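/- **Theorem (local efficiency).** Let $d\in\{2,3\}$, let $\Omega\subset\mathbb R^d$ be a bounded open polytopal set with Lipschitz boundary, and let either $\alpha=0$, $\varepsilon=1$, or $\alpha=1$, $0<\varepsilon\le 1$. Let $f\in L^2(\Omega)$, $V=H^2_0(\Omega)$, and let $u\in V$ solve $$a(u,v):=\varepsilon^2(D^2u,D^2v)_{L^2(\Omega)}+\alpha(\nabla u,\nabla v)_{L^2(\Omega)}=(f,v)_{L^2(\Omega)}\qquad\text{for all }v\in V.$$ Let $\mathcal T$ be a regular (face-to-face) simplicial triangulation of $\Omega$ with shape-regularity parameter $\sigma$ (each $T\in\mathcal T$ contains a ball of diameter $\rho$ with $h_T\le\sigma\rho$), and let $\mathcal F$ be the set of its hyperfaces; $h_T,h_F$ are the diameters of $T\in\mathcal T$, $F\in\mathcal F$. Each interior face $F$ is shared by two elements $T_+,T_-$, and $[v]_F=v|_{T_+}-v|_{T_-}$; for a boundary face, $T_+$ is the only element containing $F$, $T_-=\emptyset$ and $[v]_F=v|_{T_+}$. Let $n_F$ be a unit normal of $F$ (outward if $F\subset\partial\Omega$), and let $\omega_F$ be the interior of $T_+\cup T_-$.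 Differential operators with index $h$ act piecewise with respect to $\mathcal T$, and $\nabla_F$ is the tangential gradient on $F$. Let $\ell\ge2$, $L\ge 0$ and $c$ be given, and let $V_h$ be a linear space of piecewise polynomials of degree at most $L$ with respect to $\mathcal T$ such that every $v_h\in V_h$ satisfies, for all $F\in\mathcal F$, * $\|[v_h]_F\|_{L^2(F)}\le c\,h_F\|\nabla_F[v_h]_F\|_{L^2(F)}$; * $\int_F[\nabla_hv_h]_F\cdot Q\,dS=0$ for all $Q\in P_{\ell-2}(F)^d$; * if $\alpha=0$: $\int_F[v_h]_F\,q\,dS=0$ for all $q\in P_{\ell-3}(F)$ (with $P_{-1}(F)=\{0\}$); if $\alpha=1$: $v_h\in H^1_0(\Omega)$. Let $u_h\in V_h$ satisfy $\varepsilon^2(D_h^2u_h,D_h^2v_h)_{L^2(\Omega)}+\alpha(\nabla_hu_h,\nabla_hv_h)_{L^2(\Omega)}=(f,v_h)_{L^2(\Omega)}$ for all $v_h\in V_h$. Write $|||w|||_\omega^2=\varepsilon^2\|D_h^2w\|_{L^2(\omega)}^2+\alpha\|\nabla_hw\|_{L^2(\omega)}^2$, $\kappa_T=\min\{1,h_T/\varepsilon\}$,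 $\kappa_F=\min\{1,h_F/\varepsilon\}$, let $\Pi_\ell$ be the $L^2$-orthogonal projection onto the piecewise polynomials of degree at most $\ell$, and let $\mathrm{osc}^2(f,\ell,T)=h_T^2\kappa_T^2\|f-\Pi_\ell f\|_{L^2(T)}^2$ for $T\in\mathcal T$ and $\mathrm{osc}^2(f,\ell,\emptyset)=0$. Define $$\mu_0^2(T)=|||u_h-\Pi_\ell u_h|||_T^2,\qquad \mu_1^2(T)=\kappa_T^2h_T^2\|\varepsilon^2\Delta_h^2u_h-\alpha\Delta_hu_h-f\|_{L^2(T)}^2,$$ $$\xi^2(F)=\frac{\varepsilon}{\kappa_F}\|[\nabla_hu_h]_F\cdot n_F\|_{L^2(F)}^2+\frac1{\varepsilon\kappa_F^3}\|[u_h]_F\|_{L^2(F)}^2,$$ and, for interior faces, $$\mu_2^2(F)=\varepsilon^3\kappa_F\|[D_h^2u_h]_Fn_F\|_{L^2(F)}^2,\qquad \mu_3^2(F)=\kappa_F^2h_F\|[\alpha\nabla_hu_h-\varepsilon^2\operatorname{div}_hD_h^2u_h]_F\cdot n_F\|_{L^2(F)}^2,$$ while $\mu_2^2(F)=\mu_3^2(F)=0$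 for boundary faces. Then there is a constant $C>0$ that depends only on $d,\Omega,\sigma,\ell,L,c$ (in particular neither on the mesh size nor on $\varepsilon$) such that for all $T\in\mathcal T$ and all $F\in\mathcal F$ $$\xi^2(F)\le C\,|||u-u_h|||_{\omega_F}^2,$$ $$\mu_0^2(T)\le C\Big(|||u-u_h|||_T^2+\min_{p\in P_\ell(T)}|||u-p|||_T^2\Big),$$ $$\mu_1^2(T)\le C\Big(|||u-u_h|||_T^2+\mathrm{osc}^2(f,\ell,T)\Big),$$ $$\mu_2^2(F)+\mu_3^2(F)\le C\Big(|||u-u_h|||_{\omega_F}^2+\sum_{K\in\{T_+,T_-\}}\mathrm{osc}^2(f,\ell,K)\Big).$$ -/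

import Mathlib

open MeasureTheory Filter Topology

namespace BiharmonicFEM

noncomputable section

/-! ### Points, polynomials, functions with two weak derivatives -/

/-- Euclidean space `ℝ^d`. -/
abbrev Pt (d : ℕ) := EuclideanSpace ℝ (Fin d)

/-- Real polynomials in `d` variables. -/
abbrev PolyD (d : ℕ) := MvPolynomial (Fin d) ℝ

/-- The value of the polynomial `p` at the point `x`. -/
def pev {d : ℕ} (p : PolyD d) (x : Pt d) : ℝ := MvPolynomial.eval (fun i => x i) p

/-- A real function together with (representatives of) its first and second partial derivatives. -/
structure Jet (d : ℕ) where
  val : Pt d → ℝ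
  grad : Fin d → Pt d → ℝ
  hess : Fin d → Fin d → Pt d → ℝ

/-- The difference of two functions, together with its derivatives. -/
instance {d : ℕ} : Sub (Jet d) :=
  ⟨fun w z => ⟨fun x => w.val x - z.val x, fun i x => w.grad i x - z.grad i x,
    fun i j x => w.hess i j x - z.hess i j x⟩⟩

/-- A polynomial function together with its derivatives. -/
def Jet.ofPoly {d : ℕ} (p : PolyD d) : Jet d where
  val := pev p
  grad := fun i => pev (MvPolynomial.pderiv i p)
  hess := fun i j => pev (MvPolynomial.pderiv j (MvPolynomial.pderiv i p))

/-- The classical partial derivative `∂φ/∂x_i`. -/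
def pd {d : ℕ} (i : Fin d) (φ : Pt d → ℝ) (x : Pt d) : ℝ :=
  fderiv ℝ φ x (EuclideanSpace.single i (1 : ℝ))

/-- `φ ∈ C_c^∞(Ω)`. -/
def IsTest {d : ℕ} (Ω : Set (Pt d)) (φ : Pt d → ℝ) : Prop :=
  ContDiff ℝ ((⊤ : ℕ∞) : WithTop ℕ∞) φ ∧ HasCompactSupport φ ∧ tsupport φ ⊆ Ω

/-- `g ∈ L²(S)`. -/
def InL2 {d : ℕ} (S : Set (Pt d)) (g : Pt d → ℝ) : Prop :=
  MemLp g 2 (volume.restrict S)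

/-- `φ n → g` in `L²(S)`. -/
def TendstoL2 {d : ℕ} (S : Set (Pt d)) (φ : ℕ → Pt d → ℝ) (g : Pt d → ℝ) : Prop :=
  Tendsto (fun n => eLpNorm (fun x => φ n x - g x) 2 (volume.restrict S)) atTop (𝓝 0)

/-- `w ∈ H²_0(Ω)`, the closure of `C_c^∞(Ω)` in `H²(Ω)`, and the entries `w.grad`, `w.hess` are its
weak derivatives of order one and two. -/
def IsH20 {d : ℕ} (Ω : Set (Pt d)) (w : Jet d) : Prop :=
  InL2 Ω w.val ∧ (∀ i, InL2 Ω (w.grad i)) ∧ (∀ i j, InL2 Ω (w.hess i j)) ∧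
  ∃ φ : ℕ → Pt d → ℝ, (∀ n, IsTest Ω (φ n)) ∧
    TendstoL2 Ω φ w.val ∧
    (∀ i, TendstoL2 Ω (fun n => pd i (φ n)) (w.grad i)) ∧
    (∀ i j, TendstoL2 Ω (fun n => pd j (pd i (φ n))) (w.hess i j))

/-- `w ∈ H¹_0(Ω)`, the closure of `C_c^∞(Ω)` in `H¹(Ω)`. -/
def IsH10 {d : ℕ} (Ω : Set (Pt d)) (w : Pt d → ℝ) : Prop :=
  InL2 Ω w ∧ ∃ G : Fin d → Pt d → ℝ, (∀ i, InL2 Ω (G i)) ∧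
  ∃ φ : ℕ → Pt d → ℝ, (∀ n, IsTest Ω (φ n)) ∧
    TendstoL2 Ω φ w ∧ (∀ i, TendstoL2 Ω (fun n => pd i (φ n)) (G i))

/-- `ε² (D²w, D²z)_{0,S} + α (∇w, ∇z)_{0,S}`. -/
def energyForm {d : ℕ} (ε α : ℝ) (S : Set (Pt d)) (w z : Jet d) : ℝ :=
  ε ^ 2 * (∫ x in S, ∑ i, ∑ j, w.hess i j x * z.hess i j x)
    + α * ∫ x in S, ∑ i, w.grad i x * z.grad i x

/-- The squared energy seminorm `|||w|||²_S = ε² ‖D²w‖²_{0,S} + α ‖∇w‖²_{0,S}`. -/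
def energySq {d : ℕ} (ε α : ℝ) (S : Set (Pt d)) (w : Jet d) : ℝ := energyForm ε α S w w

/-! ### Domain and triangulation -/

/-- `Ω` is, near each of its boundary points, the strict epigraph of a Lipschitz function over the
hyperplane orthogonal to some direction `ν`. -/
def IsLipschitzDomain {d : ℕ} (Ω : Set (Pt d)) : Prop :=
  ∀ x ∈ frontier Ω, ∃ ν : Pt d, ‖ν‖ = 1 ∧ ∃ U : Set (Pt d), IsOpen U ∧ x ∈ U ∧
    ∃ (M : NNReal) (g : Pt d → ℝ), LipschitzWith M g ∧
      ∀ y ∈ U, (y ∈ Ω ↔ g (y - inner ℝ ν y • ν) < inner ℝ ν y)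

/-- The closed simplex with the given vertices. -/
def hull {d : ℕ} (s : Finset (Pt d)) : Set (Pt d) := convexHull ℝ (s : Set (Pt d))

/-- A regular (face-to-face) simplicial triangulation of `Ω`: a finite simplicial complex with
underlying space `closure Ω`, each simplex of which is a face of a `d`-dimensional simplex. -/
structure Triangulation {d : ℕ} (Ω : Set (Pt d)) where
  K : Geometry.SimplicialComplex ℝ (Pt d)
  finite : K.faces.Finite
  space_eq : K.space = closure Ω
  pure : ∀ s ∈ K.faces, ∃ T ∈ K.faces, s ⊆ T ∧ T.card = d + 1

variable {d : ℕ} {Ω : Set (Pt d)}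

/-- The elements of the triangulation: its `d`-dimensional simplices, given by their vertices. -/
def Cell (𝒯 : Triangulation Ω) : Type := {T : Finset (Pt d) // T ∈ 𝒯.K.faces ∧ T.card = d + 1}

/-- The hyperfaces of the triangulation: its `(d-1)`-dimensional simplices. -/
def Face (𝒯 : Triangulation Ω) : Type := {F : Finset (Pt d) // F ∈ 𝒯.K.faces ∧ F.card = d}

instance (𝒯 : Triangulation Ω) : Finite (Cell 𝒯) :=
  (𝒯.finite.subset (fun _ h => h.1) : {T : Finset (Pt d) | T ∈ 𝒯.K.faces ∧ T.card = d + 1}.Finite)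

instance (𝒯 : Triangulation Ω) : Fintype (Cell 𝒯) := Fintype.ofFinite _

/-- The closed simplex `T`. -/
def Cell.set {𝒯 : Triangulation Ω} (T : Cell 𝒯) : Set (Pt d) := hull T.1

/-- The closed hyperface `F`. -/
def Face.set {𝒯 : Triangulation Ω} (F : Face 𝒯) : Set (Pt d) := hull F.1

/-- The diameter `h_T`. -/
def Cell.h {𝒯 : Triangulation Ω} (T : Cell 𝒯) : ℝ := Metric.diam T.set

/-- The diameter `h_F`. -/
def Face.h {𝒯 : Triangulation Ω} (F : Face 𝒯) : ℝ := Metric.diam F.set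

/-- Shape regularity with parameter `σ`: every element `T` contains a ball of diameter `2 r` with
`h_T ≤ σ · 2 r`. -/
def ShapeRegular (𝒯 : Triangulation Ω) (σ : ℝ) : Prop :=
  ∀ T : Cell 𝒯, ∃ (x : Pt d) (r : ℝ), 0 < r ∧ Metric.closedBall x r ⊆ T.set ∧ T.h ≤ σ * (2 * r)

/-- A choice, for every hyperface `F`, of the names `T₊`, `T₋` of the elements containing `F`
(with `minus F = none` if `F` lies in one element only, that is, on the boundary) and of a unit
normal `n_F`, which points out of the domain if `F` is a boundary face. -/
structure Labelling (𝒯 : Triangulation Ω) where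
  plus : Face 𝒯 → Cell 𝒯
  minus : Face 𝒯 → Option (Cell 𝒯)
  subset_plus : ∀ F, F.1 ⊆ (plus F).1
  minus_iff : ∀ F T, minus F = some T ↔ F.1 ⊆ T.1 ∧ T ≠ plus F
  normal : Face 𝒯 → Pt d
  norm_normal : ∀ F, ‖normal F‖ = 1
  normal_orth : ∀ F, ∀ x ∈ F.1, ∀ y ∈ F.1, inner ℝ (normal F) (x - y) = 0
  outward : ∀ F, minus F = none →
    ∀ z ∈ (plus F).1, ∀ x ∈ F.1, inner ℝ (normal F) (z - x) ≤ 0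

/-! ### Piecewise polynomials

A piecewise polynomial with respect to `𝒯` is a family `v` with one polynomial `v T` per element;
broken derivatives act on each `v T`. -/

/-- The jump `[v]_F = v₊ - v₋` (`v₊` on boundary faces), given by a polynomial whose restriction
to `F` is the jump. The jump of a broken derivative of `v` is the corresponding derivative of this
polynomial. -/
def jump {𝒯 : Triangulation Ω} (o : Labelling 𝒯) (v : Cell 𝒯 → PolyD d) (F : Face 𝒯) : PolyD d :=
  v (o.plus F) - (o.minus F).elim 0 v

/-- The surface integral of `g` over `F`. -/
def Face.integral {𝒯 : Triangulation Ω} (F : Face 𝒯) (g : Pt d → ℝ) : ℝ :=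
  ∫ x in F.set, g x ∂μHE[d - 1]

/-- `∂p/∂n = ∇p · n`. -/
def normalDeriv (n : Pt d) (p : PolyD d) : PolyD d :=
  ∑ i, MvPolynomial.C (n i) * MvPolynomial.pderiv i p

/-- The `i`-th component of the part of `∇p` tangential to the hyperplane with unit normal `n`. -/
def tangGrad (n : Pt d) (p : PolyD d) (i : Fin d) : PolyD d :=
  MvPolynomial.pderiv i p - MvPolynomial.C (n i) * normalDeriv n p

/-- The `i`-th component of `(D²p) n`. -/
def hessNormal (n : Pt d) (p : PolyD d) (i : Fin d) : PolyD d :=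
  ∑ j, MvPolynomial.C (n j) * MvPolynomial.pderiv j (MvPolynomial.pderiv i p)

/-- The Laplacian. -/
def lap (p : PolyD d) : PolyD d := ∑ i, MvPolynomial.pderiv i (MvPolynomial.pderiv i p)

/-- `(div D²p) · n` with the row-wise divergence. -/
def divHessNormal (n : Pt d) (p : PolyD d) : PolyD d :=
  ∑ i, MvPolynomial.C (n i) *
    ∑ j, MvPolynomial.pderiv j (MvPolynomial.pderiv j (MvPolynomial.pderiv i p))

/-- The weak continuity condition `‖[v]_F‖_{0,F} ≤ c h_F ‖∇_F [v]_F‖_{0,F}` on `V_h`. -/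
def WeakContinuity {𝒯 : Triangulation Ω} (o : Labelling 𝒯) (c : ℝ)
    (Vh : Submodule ℝ (Cell 𝒯 → PolyD d)) : Prop :=
  ∀ v ∈ Vh, ∀ F : Face 𝒯,
    Real.sqrt (F.integral fun x => pev (jump o v F) x ^ 2) ≤
      c * F.h * Real.sqrt (F.integral fun x =>
        ∑ i, pev (tangGrad (o.normal F) (jump o v F) i) x ^ 2)

/-- `∫_F [v]_F q dS = 0` for all `q ∈ P_{ℓ-3}(F)` (where `P_{-1}(F) = {0}`). -/
def ValueJumpOrth {𝒯 : Triangulation Ω} (o : Labelling 𝒯) (ℓ : ℕ)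
    (v : Cell 𝒯 → PolyD d) (F : Face 𝒯) : Prop :=
  ∀ q : PolyD d, q.totalDegree + 3 ≤ ℓ → F.integral (fun x => pev (jump o v F) x * pev q x) = 0

/-- `∫_F [∇_h v]_F · Q dS = 0` for all `Q ∈ P_{ℓ-2}(F)^d`. -/
def GradJumpOrth {𝒯 : Triangulation Ω} (o : Labelling 𝒯) (ℓ : ℕ)
    (v : Cell 𝒯 → PolyD d) (F : Face 𝒯) : Prop :=
  ∀ Q : Fin d → PolyD d, (∀ i, (Q i).totalDegree + 2 ≤ ℓ) →
    F.integral (fun x =>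
      ∑ i, pev (MvPolynomial.pderiv i (jump o v F)) x * pev (Q i) x) = 0

/-- The piecewise polynomial `v` belongs to `H¹_0(Ω)`. -/
def PiecewiseInH10 {𝒯 : Triangulation Ω} (v : Cell 𝒯 → PolyD d) : Prop :=
  ∃ w : Pt d → ℝ, IsH10 Ω w ∧ ∀ T : Cell 𝒯, w =ᵐ[volume.restrict T.set] pev (v T)

/-- The consistency condition on the inter-element jumps of `V_h` with the degree `ℓ`. -/
def JumpConsistency {𝒯 : Triangulation Ω} (o : Labelling 𝒯) (α : ℝ) (ℓ : ℕ)
    (Vh : Submodule ℝ (Cell 𝒯 → PolyD d)) : Prop :=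
  (α = 0 → ∀ v ∈ Vh, ∀ F, ValueJumpOrth o ℓ v F ∧ GradJumpOrth o ℓ v F) ∧
  (α = 1 → ∀ v ∈ Vh, PiecewiseInH10 v ∧ ∀ F, GradJumpOrth o ℓ v F)

/-! ### Continuous and discrete problem -/

/-- `u ∈ H²_0(Ω)` and `a(u,v) = (f,v)_0` for all `v ∈ H²_0(Ω)`. -/
def IsWeakSolution (Ω : Set (Pt d)) (ε α : ℝ) (f : Pt d → ℝ) (u : Jet d) : Prop :=
  IsH20 Ω u ∧ ∀ v : Jet d, IsH20 Ω v → energyForm ε α Ω u v = ∫ x in Ω, f x * v.val x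

/-- `u_h ∈ V_h` and `a_h(u_h,v_h) = (f,v_h)_0` for all `v_h ∈ V_h`. -/
def IsDiscreteSolution {𝒯 : Triangulation Ω} (ε α : ℝ) (f : Pt d → ℝ)
    (Vh : Submodule ℝ (Cell 𝒯 → PolyD d)) (uh : Cell 𝒯 → PolyD d) : Prop :=
  uh ∈ Vh ∧ ∀ v ∈ Vh,
    ∑ T : Cell 𝒯, energyForm ε α T.set (Jet.ofPoly (uh T)) (Jet.ofPoly (v T)) =
      ∑ T : Cell 𝒯, ∫ x in T.set, f x * pev (v T) x

/-! ### The local `L²` projection -/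

/-- `p ∈ P_ℓ(S)` is the `L²(S)`-orthogonal projection of `g`. -/
def IsL2Proj (ℓ : ℕ) (S : Set (Pt d)) (g : Pt d → ℝ) (p : PolyD d) : Prop :=
  p.totalDegree ≤ ℓ ∧
    ∀ q : PolyD d, q.totalDegree ≤ ℓ → ∫ x in S, (g x - pev p x) * pev q x = 0

open Classical in
/-- The `L²(S)`-orthogonal projection `Π_ℓ g` onto `P_ℓ(S)`. -/
def l2Proj (ℓ : ℕ) (S : Set (Pt d)) (g : Pt d → ℝ) : PolyD d :=
  if h : ∃ p, IsL2Proj ℓ S g p then h.choose else 0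

theorem continuous_pev (p : PolyD d) : Continuous (pev p) :=
  (MvPolynomial.continuous_eval p).comp (by fun_prop)

theorem inL2_pev (s : Finset (Pt d)) (p : PolyD d) : InL2 (hull s) (pev p) := by
  have hc : IsCompact (hull s) := s.finite_toSet.isCompact_convexHull ℝ
  obtain ⟨B, hB⟩ := hc.exists_bound_of_continuousOn (continuous_pev p).continuousOn
  have : IsFiniteMeasure (volume.restrict (hull s)) :=
    ⟨by rw [Measure.restrict_apply_univ]; exact hc.measure_lt_top⟩
  exact MemLp.of_bound (continuous_pev p).aestronglyMeasurable B
    ((ae_restrict_iff' hc.measurableSet).2 (Eventually.of_forall hB))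

/-- On a simplex, `l2Proj` is indeed the orthogonal projection. -/
theorem l2Proj_spec (ℓ : ℕ) (s : Finset (Pt d)) (g : Pt d → ℝ) (hg : InL2 (hull s) g) :
    IsL2Proj ℓ (hull s) g (l2Proj ℓ (hull s) g) := by
  have hex : ∃ p, IsL2Proj ℓ (hull s) g p := by
    let Φ : MvPolynomial.restrictTotalDegree (Fin d) ℝ ℓ →ₗ[ℝ]
        Lp ℝ 2 (volume.restrict (hull s)) :=
      { toFun := fun p => (inL2_pev s p.1).toLp (pev p.1)
        map_add' := fun p q =>
          (MemLp.toLp_congr (inL2_pev s (p + q).1) ((inL2_pev s p.1).add (inL2_pev s q.1))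
            (Eventually.of_forall fun x => by simp [pev])).trans
            (MemLp.toLp_add (inL2_pev s p.1) (inL2_pev s q.1))
        map_smul' := fun a p =>
          (MemLp.toLp_congr (inL2_pev s (a • p).1) ((inL2_pev s p.1).const_smul a)
            (Eventually.of_forall fun x => by simp [pev])).trans
            (MemLp.toLp_const_smul a (inL2_pev s p.1)) }
    have hfd : FiniteDimensional ℝ (MvPolynomial.restrictTotalDegree (Fin d) ℝ ℓ) := inferInstance
    have : FiniteDimensional ℝ (LinearMap.range Φ) := inferInstance
    obtain ⟨p, hp⟩ : (LinearMap.range Φ).starProjection (hg.toLp g) ∈ LinearMap.range Φ :=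
      Submodule.starProjection_apply_mem _ _
    refine ⟨p.1, (MvPolynomial.mem_restrictTotalDegree _ _ _).1 p.2, fun q hq => ?_⟩
    have horth := Submodule.sub_starProjection_mem_orthogonal (K := LinearMap.range Φ) (hg.toLp g)
    have h0 := (Submodule.mem_orthogonal' _ _).1 horth
      (Φ ⟨q, (MvPolynomial.mem_restrictTotalDegree _ _ _).2 hq⟩) ⟨_, rfl⟩
    rw [← hp, L2.inner_def] at h0
    rw [← h0]
    refine integral_congr_ae ?_
    filter_upwards [Lp.coeFn_sub (hg.toLp g) (Φ p), hg.coeFn_toLp,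
      (inL2_pev s p.1).coeFn_toLp, (inL2_pev s q).coeFn_toLp] with x h1 h2 h3 h4
    have h5 : (Φ p : Pt d → ℝ) x = pev p.1 x := h3
    have h6 : (Φ ⟨q, (MvPolynomial.mem_restrictTotalDegree _ _ _).2 hq⟩ : Pt d → ℝ) x = pev q x :=
      h4
    rw [h1, h6, Pi.sub_apply, h2, h5]
    simp [mul_comm]
  unfold l2Proj
  rw [dif_pos hex]
  exact hex.choose_spec

/-! ### Error estimator contributions -/

/-- `κ = min {1, h/ε}`. -/
def kappa (ε h : ℝ) : ℝ := min 1 (h / ε)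

/-- `μ₀²(T) = |||u_h - Π_ℓ u_h|||²_T`. -/
def mu0Sq {𝒯 : Triangulation Ω} (ε α : ℝ) (ℓ : ℕ) (uh : Cell 𝒯 → PolyD d) (T : Cell 𝒯) : ℝ :=
  energySq ε α T.set (Jet.ofPoly (uh T) - Jet.ofPoly (l2Proj ℓ T.set (pev (uh T))))

/-- `μ₁²(T) = κ_T² h_T² ‖ε² Δ_h² u_h - α Δ_h u_h - f‖²_{0,T}`. -/
def mu1Sq {𝒯 : Triangulation Ω} (ε α : ℝ) (f : Pt d → ℝ) (uh : Cell 𝒯 → PolyD d)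
    (T : Cell 𝒯) : ℝ :=
  kappa ε T.h ^ 2 * T.h ^ 2 *
    ∫ x in T.set, (ε ^ 2 * pev (lap (lap (uh T))) x - α * pev (lap (uh T)) x - f x) ^ 2

open Classical in
/-- `μ₂²(F) = ε³ κ_F ‖[D_h² u_h]_F n_F‖²_{0,F}`, and `0` on boundary faces. -/
def mu2Sq {𝒯 : Triangulation Ω} (o : Labelling 𝒯) (ε : ℝ) (uh : Cell 𝒯 → PolyD d)
    (F : Face 𝒯) : ℝ :=
  if o.minus F = none then 0 else
    ε ^ 3 * kappa ε F.h *
      F.integral fun x => ∑ i, pev (hessNormal (o.normal F) (jump o uh F) i) x ^ 2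

open Classical in
/-- `μ₃²(F) = κ_F² h_F ‖[α ∇_h u_h - ε² div_h D_h² u_h]_F · n_F‖²_{0,F}`, and `0` on boundary
faces. -/
def mu3Sq {𝒯 : Triangulation Ω} (o : Labelling 𝒯) (ε α : ℝ) (uh : Cell 𝒯 → PolyD d)
    (F : Face 𝒯) : ℝ :=
  if o.minus F = none then 0 else
    kappa ε F.h ^ 2 * F.h *
      F.integral fun x => (α * pev (normalDeriv (o.normal F) (jump o uh F)) x
        - ε ^ 2 * pev (divHessNormal (o.normal F) (jump o uh F)) x) ^ 2

/-- `ξ²(F) = (ε/κ_F) ‖[∇_h u_h]_F · n_F‖²_{0,F} + (1/(ε κ_F³)) ‖[u_h]_F‖²_{0,F}`. -/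
def xiSq {𝒯 : Triangulation Ω} (o : Labelling 𝒯) (ε : ℝ) (uh : Cell 𝒯 → PolyD d)
    (F : Face 𝒯) : ℝ :=
  ε / kappa ε F.h * F.integral (fun x => pev (normalDeriv (o.normal F) (jump o uh F)) x ^ 2)
    + 1 / (ε * kappa ε F.h ^ 3) * F.integral (fun x => pev (jump o uh F) x ^ 2)

/-- The oscillation `osc²(f,ℓ,T) = h_T² κ_T² ‖f - Π_ℓ f‖²_{0,T}`. -/
def oscSq {𝒯 : Triangulation Ω} (ε : ℝ) (f : Pt d → ℝ) (ℓ : ℕ) (T : Cell 𝒯) : ℝ :=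
  T.h ^ 2 * kappa ε T.h ^ 2 * ∫ x in T.set, (f x - pev (l2Proj ℓ T.set f) x) ^ 2

/-- The squared local error `|||u - u_h|||²_T`. -/
def errSq {𝒯 : Triangulation Ω} (ε α : ℝ) (u : Jet d) (uh : Cell 𝒯 → PolyD d) (T : Cell 𝒯) : ℝ :=
  energySq ε α T.set (u - Jet.ofPoly (uh T))

/-- The sum of `g` over the elements `T₊`, `T₋` (only `T₊` for a boundary face) that contain `F`.
For `g = errSq ε α u uh` this is `|||u - u_h|||²` on the face patch of `F`. -/
def patchSum {𝒯 : Triangulation Ω} (o : Labelling 𝒯) (g : Cell 𝒯 → ℝ) (F : Face 𝒯) : ℝ :=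
  g (o.plus F) + (o.minus F).elim 0 g

/-- The squared best approximation error `min {|||u - p|||²_T : p ∈ P_ℓ(T)}`. -/
def bestApproxSq {𝒯 : Triangulation Ω} (ε α : ℝ) (ℓ : ℕ) (u : Jet d) (T : Cell 𝒯) : ℝ :=
  ⨅ p : {p : PolyD d // p.totalDegree ≤ ℓ}, energySq ε α T.set (u - Jet.ofPoly p.1)

end

end BiharmonicFEM

open BiharmonicFEM

/-!
The estimates are proved with the bubble function technique, in a form that needs no reference
element: every local argument takes place in a ball inside an element, or in a ball around the
barycentre of a hyperface `F`, whose radius is comparable to the local mesh size. By shape regularity,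
the latter ball meets `F` in a disc and the adjacent elements in half-balls (`FacePatch`,
`exists_facePatch`). Norm equivalences and inverse estimates for polynomials on these sets follow
from the finite dimension of the polynomial space, by translation and dilation (`exists_poly_bound`,
`exists_hyp_integral_bound`, `exists_normalExt_bound`). In this way all constants depend on the mesh
only through the shape-regularity parameter. They depend on the domain only through its diameter,
which enters in the jump terms for `α = 0`.

*Jump terms.* The solution `u` is a limit of test functions `φ`, so that it suffices to bound the jumps
of `u_h` by the error of `φ` (`tendsto_errSq`). Near the centre of `F`, the jump of `∇u_h` is the
difference of the errors `∇(u_h - φ)` from both sides. The trace inequality with a free parameter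
(`exists_trace_bound`), combined with the Poincaré inequality for jumps of mean value zero
(`exists_two_sided_poincare`) if `h_F ≤ ε`, bounds it with the weight `ε / κ_F`
(`exists_gradJump_bound`). For `α = 0`, the weak continuity condition bounds the jump of `u_h` by the
tangential part of the jump of its gradient; for `α = 1`, the jump of `u_h` vanishes
(`integral_jump_sq_eq_zero`). The result is `exists_xi_bound`.

*Projection error.* The local `L²`-projection onto polynomials of degree at most `ℓ`, restricted to
polynomials of bounded degree, is stable in the `H¹` and `H²` seminorms (`exists_projection_stability`);
this gives `exists_mu0_bound`.

*Element residual.* With `f` replaced by its projection, the residual is a polynomial. Tested with its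
product with a bubble function, it equals the error tested with the same function, up to the
oscillation (`integral_residual_mul`, `exists_poly_residual_bound`). This gives `exists_mu1_bound`.

*Jumps of higher order.* For an interior hyperface, integration by parts on both half-balls expresses
the jumps of `D²u_h n` and of `(α ∇u_h - ε² div D²u_h) · n`, tested with a function `v` supported in the
ball, through element residuals and errors (`integral_jump_flux_eq`, `exists_jump_flux_bound`). Three
choices are combined. The tangential components of the jump of `D²u_h n` are derivatives, along `F`,
of the jump of `∂u_h/∂n`, which is already bounded; an inverse estimate suffices
(`exists_tangGrad_bound`). For its normal component, `v` vanishes on `F` and has the normal width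
`δ ≈ ε κ_F` (`exists_second_normal_bound`); this choice makes the constant independent of `ε`. For the
flux of third order, `v` is isotropic, and the jump of `D²u_h n` that appears is already bounded
(`exists_third_normal_bound`). The powers of `ε`, `κ_F` and `h_F` are collected in
`exists_mu23_bound`.
-/


namespace BiharmonicFEM

noncomputable section



/-! ### Hyperplanes, their frames, and the divergence theorem on half-spaces -/

/-- The hyperplane through `m` orthogonal to `ν`. -/
def hyp {d : ℕ} (m ν : Pt d) : Set (Pt d) := {x | inner ℝ ν (x - m) = 0}

/-- The open half-space bounded by `hyp m ν` into which `ν` points. -/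
def upper {d : ℕ} (m ν : Pt d) : Set (Pt d) := {x | 0 < inner ℝ ν (x - m)}

theorem isClosed_hyp {d : ℕ} (m ν : Pt d) : IsClosed (hyp m ν) :=
  isClosed_eq (by fun_prop) continuous_const

theorem isOpen_upper {d : ℕ} (m ν : Pt d) : IsOpen (upper m ν) :=
  isOpen_lt continuous_const (by fun_prop)

/-- `R` identifies `ℝ^n` isometrically with the linear hyperplane orthogonal to `ν`. -/
structure IsFrame {n : ℕ} (ν : Pt (n + 1)) (R : Pt n →ₗᵢ[ℝ] Pt (n + 1)) : Prop where
  norm_eq : ‖ν‖ = 1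
  orth : ∀ y, inner ℝ ν (R y) = 0
  surj : ∀ x, inner ℝ ν x = 0 → ∃ y, R y = x

theorem exists_isFrame {n : ℕ} (ν : Pt (n + 1)) (hν : ‖ν‖ = 1) : ∃ R, IsFrame ν R := by
  have hν0 : ν ≠ 0 := by
    rintro rfl
    simp at hν
  have hf : Fact (Module.finrank ℝ (Pt (n + 1)) = n + 1) := ⟨by simp⟩
  let b := OrthonormalBasis.fromOrthogonalSpanSingleton (𝕜 := ℝ) n hν0
  let R : Pt n →ₗᵢ[ℝ] Pt (n + 1) :=
    (ℝ ∙ ν)ᗮ.subtypeₗᵢ.comp b.repr.symm.toLinearIsometry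
  refine ⟨R, hν, fun y => ?_, fun x hx => ?_⟩
  · exact (Submodule.mem_orthogonal_singleton_iff_inner_right).1 (b.repr.symm y).2
  · refine ⟨b.repr ⟨x, Submodule.mem_orthogonal_singleton_iff_inner_right.2 hx⟩, ?_⟩
    simp [R]

variable {n : ℕ} {ν : Pt (n + 1)} {R : Pt n →ₗᵢ[ℝ] Pt (n + 1)}

theorem IsFrame.inner_self (h : IsFrame ν R) : inner ℝ ν ν = (1 : ℝ) := by
  rw [real_inner_self_eq_norm_sq, h.norm_eq, one_pow]

/-- The orthonormal coordinates `(t, y) ↦ m + t ν + R y`. -/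
def frameMap (m ν : Pt (n + 1)) (R : Pt n →ₗᵢ[ℝ] Pt (n + 1)) (p : ℝ × Pt n) : Pt (n + 1) :=
  m + (p.1 • ν + R p.2)

theorem IsFrame.inner_frameMap (h : IsFrame ν R) (m : Pt (n + 1)) (p : ℝ × Pt n) :
    inner ℝ ν (frameMap m ν R p - m) = p.1 := by
  simp only [frameMap, add_sub_cancel_left, inner_add_right, inner_smul_right, h.orth,
    h.inner_self]
  ring

theorem IsFrame.norm_sq_frameMap_sub (h : IsFrame ν R) (m : Pt (n + 1)) (p : ℝ × Pt n) :
    ‖frameMap m ν R p - m‖ ^ 2 = p.1 ^ 2 + ‖p.2‖ ^ 2 := by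
  have : frameMap m ν R p - m = p.1 • ν + R p.2 := by simp [frameMap]
  rw [this, norm_add_sq_real, inner_smul_left, h.orth]
  simp [norm_smul, h.norm_eq]

theorem IsFrame.measurePreserving (h : IsFrame ν R) (m : Pt (n + 1)) :
    MeasurePreserving (frameMap m ν R) (volume : Measure (ℝ × Pt n)) volume ∧
      MeasurableEmbedding (frameMap m ν R) := by
  let f : WithLp 2 (ℝ × Pt n) →ₗᵢ[ℝ] Pt (n + 1) :=
    { toFun := fun p => p.fst • ν + R p.snd
      map_add' := fun p q => by simp [add_smul]; abel
      map_smul' := fun a p => by simp [smul_smul]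
      norm_map' := fun p => by
        have h1 := h.norm_sq_frameMap_sub m (p.fst, p.snd)
        have h2 : frameMap m ν R (p.fst, p.snd) - m = p.fst • ν + R p.snd := by simp [frameMap]
        rw [h2] at h1
        have h3 : ‖p‖ ^ 2 = ‖p.fst • ν + R p.snd‖ ^ 2 := by
          rw [h1, WithLp.prod_norm_sq_eq_of_L2, Real.norm_eq_abs, sq_abs]
        exact ((sq_eq_sq₀ (norm_nonneg _) (norm_nonneg _)).1 h3).symm }
  have hdim : Module.finrank ℝ (WithLp 2 (ℝ × Pt n)) = Module.finrank ℝ (Pt (n + 1)) := by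
    rw [(WithLp.linearEquiv 2 ℝ (ℝ × Pt n)).finrank_eq]
    simp [add_comm]
  let e := f.toLinearIsometryEquiv hdim
  have h1 := (WithLp.volume_preserving_toLp ℝ (Pt n))
  have h2 := e.measurePreserving
  have h3 := measurePreserving_add_left (volume : Measure (Pt (n + 1))) m
  refine ⟨h3.comp (h2.comp h1), ?_⟩
  exact (MeasurableEquiv.addLeft m).measurableEmbedding.comp
    (e.toHomeomorph.measurableEmbedding.comp
      (MeasurableEquiv.toLp 2 (ℝ × Pt n)).measurableEmbedding)

/-- The isometry `y ↦ m + R y` transports the Lebesgue measure to the Hausdorff measure on the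
hyperplane. -/
theorem IsFrame.map_volume (h : IsFrame ν R) (m : Pt (n + 1)) :
    (volume : Measure (Pt n)).map (fun y => m + R y) = (μHE[n]).restrict (hyp m ν) := by
  have hi : Isometry (fun y => m + R y) := (isometry_add_left m).comp R.isometry
  have h1 := hi.map_euclideanHausdorffMeasure (d := n)
  rw [EuclideanSpace.euclideanHausdorffMeasure_eq_volume] at h1
  rw [h1]
  congr 1
  ext x
  constructor
  · rintro ⟨y, rfl⟩
    simp [hyp, h.orth]
  · intro hx
    obtain ⟨y, hy⟩ := h.surj _ hx
    exact ⟨y, by simp [hy]⟩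

theorem frameEmbedding (m : Pt (n + 1)) (R : Pt n →ₗᵢ[ℝ] Pt (n + 1)) :
    MeasurableEmbedding (fun y => m + R y) :=
  ((isometry_add_left m).comp R.isometry).isClosedEmbedding.measurableEmbedding

theorem IsFrame.setIntegral_hyp (h : IsFrame ν R) (m : Pt (n + 1)) (S : Set (Pt (n + 1)))
    (hS : MeasurableSet S) (hSH : S ⊆ hyp m ν) (g : Pt (n + 1) → ℝ) :
    ∫ x in S, g x ∂μHE[n] = ∫ y in (fun y => m + R y) ⁻¹' S, g (m + R y) := by
  have h1 : (μHE[n] : Measure (Pt (n + 1))).restrict S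
      = ((μHE[n]).restrict (hyp m ν)).restrict S := by
    rw [Measure.restrict_restrict hS, Set.inter_eq_left.2 hSH]
  rw [h1, ← h.map_volume m, (frameEmbedding m R).setIntegral_map]

theorem IsFrame.integral_hyp (h : IsFrame ν R) (m : Pt (n + 1)) (g : Pt (n + 1) → ℝ) :
    ∫ x in hyp m ν, g x ∂μHE[n] = ∫ y, g (m + R y) := by
  rw [← h.map_volume m, (frameEmbedding m R).integral_map]

/-- The divergence theorem on a half-space, for one directional derivative. -/
theorem integral_upper_fderiv (m w : Pt (n + 1)) (hν : ‖ν‖ = 1) {G : Pt (n + 1) → ℝ}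
    (hG : ContDiff ℝ 1 G) (hc : HasCompactSupport G) :
    ∫ x in upper m ν, fderiv ℝ G x w = - inner ℝ ν w * ∫ x in hyp m ν, G x ∂μHE[n] := by
  obtain ⟨R, h⟩ := exists_isFrame ν hν
  obtain ⟨hmp, hme⟩ := h.measurePreserving m
  obtain ⟨y, hy⟩ := h.surj (w - inner ℝ ν w • ν) (by
    rw [inner_sub_right, inner_smul_right, h.inner_self]; ring)
  set a : ℝ := inner ℝ ν w
  have hw : w = a • ν + R y := by rw [hy]; abel
  have hpre : frameMap m ν R ⁻¹' (upper m ν) = Set.Ioi (0:ℝ) ×ˢ Set.univ := by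
    ext p
    simp [upper, h.inner_frameMap]
  rw [← hmp.setIntegral_preimage_emb hme, hpre, h.integral_hyp]
  have hsplit : ∀ p, fderiv ℝ G (frameMap m ν R p) w =
      a * fderiv ℝ G (frameMap m ν R p) ν + fderiv ℝ G (frameMap m ν R p) (R y) := by
    intro p
    conv_lhs => rw [hw]
    simp
  have hcompl : ∀ (t : ℝ), HasCompactSupport (fun z => G (frameMap m ν R (t, z))) := by
    intro t
    have : (fun z => G (frameMap m ν R (t, z))) = G ∘ (fun z => (m + t • ν) + R z) := by
      ext z; simp [frameMap, add_assoc]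
    rw [this]
    exact hc.comp_isClosedEmbedding
      ((isometry_add_left (m + t • ν)).comp R.isometry).isClosedEmbedding
  -- tangential derivatives integrate to zero on every parallel hyperplane
  have htan : ∀ t : ℝ, ∫ z, fderiv ℝ G (frameMap m ν R (t, z)) (R y) = 0 := by
    intro t
    set g : Pt n → ℝ := fun z => G (frameMap m ν R (t, z)) with hg
    have hgd : ContDiff ℝ 1 g := by
      refine hG.comp ?_
      change ContDiff ℝ 1 (fun z => m + (t • ν + R z))
      exact contDiff_const.add (contDiff_const.add R.contDiff)
    have hder : ∀ z, fderiv ℝ g z y = fderiv ℝ G (frameMap m ν R (t, z)) (R y) := by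
      intro z
      have h1 : HasFDerivAt (fun z => frameMap m ν R (t, z)) R.toContinuousLinearMap z := by
        have := (R.toContinuousLinearMap.hasFDerivAt (x := z)).const_add (m + t • ν)
        refine this.congr_of_eventuallyEq (Eventually.of_forall fun z => ?_)
        simp [frameMap, add_assoc]
      have h2 := ((hG.differentiable one_ne_zero) (frameMap m ν R (t, z))).hasFDerivAt.comp z h1
      rw [show g = G ∘ (fun z => frameMap m ν R (t, z)) from rfl, h2.fderiv]
      rfl
    simp_rw [← hder]
    have hcg := hcompl t
    have hi : Integrable (fun z => fderiv ℝ g z y) :=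
      ((hgd.continuous_fderiv one_ne_zero).clm_apply continuous_const).integrable_of_hasCompactSupport
        ((hcg.fderiv ℝ).comp_left (g := fun L : Pt n →L[ℝ] ℝ => L y) (by simp))
    have := integral_mul_fderiv_eq_neg_fderiv_mul_of_integrable (μ := (volume : Measure (Pt n)))
      (f := fun _ => (1:ℝ)) (g := g) (v := y) (by simp) (by simpa using hi)
      (by simpa using hgd.continuous.integrable_of_hasCompactSupport hcg)
      (fun x _ => by fun_prop) (fun x _ => hgd.differentiable one_ne_zero x)
    simpa using this
  -- the fundamental theorem of calculus along the normal
  have hnor : ∀ z : Pt n, ∫ t in Set.Ioi (0:ℝ), fderiv ℝ G (frameMap m ν R (t, z)) ν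
      = - G (m + R z) := by
    intro z
    set g : ℝ → ℝ := fun t => G (frameMap m ν R (t, z)) with hg
    have hgd : ContDiff ℝ 1 g := by
      refine hG.comp ?_
      unfold frameMap
      fun_prop
    have hder : ∀ t, deriv g t = fderiv ℝ G (frameMap m ν R (t, z)) ν := by
      intro t
      have h1 : HasDerivAt (fun t => frameMap m ν R (t, z)) ν t := by
        have := (((hasDerivAt_id t).smul_const ν).add_const (R z)).const_add m
        simpa [frameMap] using this
      exact (((hG.differentiable one_ne_zero)
        (frameMap m ν R (t, z))).hasFDerivAt.comp_hasDerivAt t h1).deriv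
    have hcg : HasCompactSupport g := by
      have : g = G ∘ (fun t => (m + R z) + t • ν) := by
        ext t; simp [hg, frameMap]; congr 1; abel
      rw [this]
      refine hc.comp_isClosedEmbedding (Isometry.isClosedEmbedding ?_)
      refine Isometry.of_dist_eq fun s t => ?_
      rw [dist_add_left, dist_eq_norm, ← sub_smul, norm_smul, h.norm_eq, mul_one, dist_eq_norm]
    simp_rw [← hder]
    rw [hcg.integral_Ioi_deriv_eq hgd]
    simp [hg, frameMap]
  have hsm : ∀ v : Pt (n + 1), Integrable (fun p => fderiv ℝ G (frameMap m ν R p) v)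
      ((volume.restrict (Set.Ioi (0:ℝ))).prod (volume : Measure (Pt n))) := by
    intro v
    have h1 : Integrable (fun p => fderiv ℝ G (frameMap m ν R p) v)
        ((volume : Measure ℝ).prod (volume : Measure (Pt n))) :=
      (hmp.integrable_comp_emb hme).2
        (((hG.continuous_fderiv one_ne_zero).clm_apply
          continuous_const).integrable_of_hasCompactSupport
          ((hc.fderiv ℝ).comp_left (g := fun L : Pt (n + 1) →L[ℝ] ℝ => L v) (by simp)))
    have h2 := h1.integrableOn (s := Set.Ioi (0:ℝ) ×ˢ Set.univ)
    rwa [IntegrableOn, ← Measure.prod_restrict, Measure.restrict_univ] at h2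
  rw [Measure.volume_eq_prod, ← Measure.prod_restrict, Measure.restrict_univ]
  simp_rw [hsplit]
  rw [integral_add ((hsm ν).const_mul a) (hsm (R y)), integral_const_mul,
    integral_prod _ (hsm (R y)), integral_prod_symm _ (hsm ν)]
  simp_rw [htan, hnor, integral_neg]
  simp

theorem volume_hyp (m : Pt (n + 1)) (hν : ‖ν‖ = 1) : volume (hyp m ν) = 0 := by
  obtain ⟨R, h⟩ := exists_isFrame ν hν
  obtain ⟨hmp, hme⟩ := h.measurePreserving m
  rw [← hmp.measure_preimage (isClosed_hyp m ν).measurableSet.nullMeasurableSet]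
  have hpre : frameMap m ν R ⁻¹' (hyp m ν) = {0} ×ˢ Set.univ := by
    ext p
    simp [hyp, h.inner_frameMap]
  rw [hpre, Measure.volume_eq_prod, Measure.prod_prod]
  simp



/-! ### Partial derivatives -/

section PartialDerivatives

variable {d : ℕ}

theorem fderiv_eq_sum_pd (g : Pt d → ℝ) (x w : Pt d) :
    fderiv ℝ g x w = ∑ i, w i * pd i g x := by
  conv_lhs => rw [← (EuclideanSpace.basisFun (Fin d) ℝ).sum_repr w]
  simp [pd, map_sum]

theorem contDiff_pd {g : Pt d → ℝ} (hg : ContDiff ℝ ((⊤ : ℕ∞) : WithTop ℕ∞) g) (i : Fin d) :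
    ContDiff ℝ ((⊤ : ℕ∞) : WithTop ℕ∞) (pd i g) :=
  (hg.fderiv_right (m := ((⊤ : ℕ∞) : WithTop ℕ∞)) (by simp)).clm_apply contDiff_const

theorem ContDiff.differentiable_of_top {g : Pt d → ℝ}
    (hg : ContDiff ℝ ((⊤ : ℕ∞) : WithTop ℕ∞) g) : Differentiable ℝ g :=
  hg.differentiable (by simp)

theorem tsupport_pd_subset (g : Pt d → ℝ) (i : Fin d) : tsupport (pd i g) ⊆ tsupport g :=
  tsupport_fderiv_apply_subset ℝ _

theorem pd_mul {f g : Pt d → ℝ} (hf : Differentiable ℝ f) (hg : Differentiable ℝ g) (i : Fin d) :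
    pd i (fun x => f x * g x) = fun x => pd i f x * g x + f x * pd i g x := by
  ext x
  have := ((hf x).hasFDerivAt.mul (hg x).hasFDerivAt).fderiv
  rw [pd, show (fun x => f x * g x) = f * g from rfl, this]
  simp [pd]
  ring

theorem pd_add {f g : Pt d → ℝ} (hf : Differentiable ℝ f) (hg : Differentiable ℝ g) (i : Fin d) :
    pd i (fun x => f x + g x) = fun x => pd i f x + pd i g x := by
  ext x
  have := ((hf x).hasFDerivAt.add (hg x).hasFDerivAt).fderiv
  rw [pd, show (fun x => f x + g x) = f + g from rfl, this]
  simp [pd]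

theorem pd_sub {f g : Pt d → ℝ} (hf : Differentiable ℝ f) (hg : Differentiable ℝ g) (i : Fin d) :
    pd i (fun x => f x - g x) = fun x => pd i f x - pd i g x := by
  ext x
  have := ((hf x).hasFDerivAt.sub (hg x).hasFDerivAt).fderiv
  rw [pd, show (fun x => f x - g x) = f - g from rfl, this]
  simp [pd]

theorem pd_const (a : ℝ) (i : Fin d) : pd i (fun _ : Pt d => a) = fun _ => 0 := by
  ext x
  simp [pd]

end PartialDerivatives

/-! ### Polynomial functions -/

section Polynomials

variable {d n : ℕ}

theorem pev_add (p q : PolyD d) (x : Pt d) : pev (p + q) x = pev p x + pev q x := by simp [pev]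
theorem pev_sub (p q : PolyD d) (x : Pt d) : pev (p - q) x = pev p x - pev q x := by simp [pev]
theorem pev_neg (p : PolyD d) (x : Pt d) : pev (-p) x = -pev p x := by simp [pev]
theorem pev_mul (p q : PolyD d) (x : Pt d) : pev (p * q) x = pev p x * pev q x := by simp [pev]
theorem pev_C (a : ℝ) (x : Pt d) : pev (MvPolynomial.C a) x = a := by simp [pev]
theorem pev_X (i : Fin d) (x : Pt d) : pev (MvPolynomial.X i) x = x i := by simp [pev]
theorem pev_sum {ι : Type*} (s : Finset ι) (p : ι → PolyD d) (x : Pt d) :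
    pev (∑ i ∈ s, p i) x = ∑ i ∈ s, pev (p i) x := by simp [pev]

theorem hasFDerivAt_pev (p : PolyD d) (x : Pt d) :
    HasFDerivAt (pev p) (∑ i, pev (MvPolynomial.pderiv i p) x •
      (EuclideanSpace.proj i : Pt d →L[ℝ] ℝ)) x := by
  induction p using MvPolynomial.induction_on with
  | C a =>
    have : (pev (MvPolynomial.C a) : Pt d → ℝ) = fun _ => a := by ext; simp [pev]
    rw [this]
    simpa [pev] using hasFDerivAt_const a x
  | add p q hp hq =>
    have : (pev (p + q) : Pt d → ℝ) = pev p + pev q := by ext; simp [pev]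
    rw [this]
    refine (hp.add hq).congr_fderiv ?_
    simp [pev, add_smul, Finset.sum_add_distrib]
  | mul_X p j hp =>
    have : (pev (p * MvPolynomial.X j) : Pt d → ℝ)
        = pev p * (EuclideanSpace.proj j : Pt d →L[ℝ] ℝ) := by ext; simp [pev]
    rw [this]
    refine (hp.mul (EuclideanSpace.proj j : Pt d →L[ℝ] ℝ).hasFDerivAt).congr_fderiv ?_
    ext v
    simp only [pev, Derivation.leibniz, smul_eq_mul, map_add, map_mul, MvPolynomial.eval_X,
      add_smul, Finset.sum_add_distrib, FunLike.coe_add, Pi.add_apply, FunLike.coe_smul,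
      Pi.smul_apply, sum_apply, MvPolynomial.pderiv_X, Finset.smul_sum, PiLp.proj_apply]
    congr 1
    · rw [Finset.sum_eq_single j]
      · simp
      · intro b _ hb
        simp [hb.symm]
      · simp
    · refine Finset.sum_congr rfl fun i _ => ?_
      ring

theorem pd_pev (i : Fin d) (p : PolyD d) : pd i (pev p) = pev (MvPolynomial.pderiv i p) := by
  ext x
  rw [pd, (hasFDerivAt_pev p x).fderiv]
  simp

theorem contDiff_pev (p : PolyD d) : ContDiff ℝ ((⊤ : ℕ∞) : WithTop ℕ∞) (pev p) := by
  induction p using MvPolynomial.induction_on with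
  | C a =>
    have : (pev (MvPolynomial.C a) : Pt d → ℝ) = fun _ => a := by ext; simp [pev]
    rw [this]
    exact contDiff_const
  | add p q hp hq =>
    have : (pev (p + q) : Pt d → ℝ) = fun x => pev p x + pev q x := by ext; simp [pev]
    rw [this]
    exact hp.add hq
  | mul_X p j hp =>
    have : (pev (p * MvPolynomial.X j) : Pt d → ℝ)
        = fun x => pev p x * (EuclideanSpace.proj j : Pt d →L[ℝ] ℝ) x := by ext; simp [pev]
    rw [this]
    exact hp.mul (ContinuousLinearMap.contDiff _)

theorem pderiv_comm (i j : Fin d) (p : PolyD d) :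
    MvPolynomial.pderiv i (MvPolynomial.pderiv j p)
      = MvPolynomial.pderiv j (MvPolynomial.pderiv i p) := by
  classical
  have h : ⁅(MvPolynomial.pderiv i : Derivation ℝ (PolyD d) (PolyD d)),
      (MvPolynomial.pderiv j : Derivation ℝ (PolyD d) (PolyD d))⁆ = 0 := by
    refine MvPolynomial.derivation_ext fun k => ?_
    simp [Derivation.commutator_apply, MvPolynomial.pderiv_X, Pi.single_apply, apply_ite]
  have := congrArg (fun D => D p) h
  simpa [Derivation.commutator_apply, sub_eq_zero] using this

theorem totalDegree_pderiv_le (i : Fin d) (p : PolyD d) :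
    (MvPolynomial.pderiv i p).totalDegree ≤ p.totalDegree := by
  classical
  refine Finset.sup_le fun s hs => ?_
  rw [MvPolynomial.mem_support_iff, MvPolynomial.coeff_pderiv] at hs
  have h1 : s + Finsupp.single i 1 ∈ p.support :=
    MvPolynomial.mem_support_iff.2 fun h => hs (by simp [h])
  have h2 := MvPolynomial.le_totalDegree h1
  rw [Finsupp.sum_fintype _ _ (by simp)] at h2 ⊢
  refine le_trans (Finset.sum_le_sum fun k _ => ?_) h2
  simp

/-- Substitution of the affine forms `a_i + ∑_j B i j y_j` for the variables. -/
def affineSubst (a : Fin d → ℝ) (B : Fin d → Fin n → ℝ) (p : PolyD d) : PolyD n :=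
  MvPolynomial.aeval (fun i => MvPolynomial.C (a i) +
    ∑ j, MvPolynomial.C (B i j) * MvPolynomial.X j) p

theorem pev_affineSubst (a : Fin d → ℝ) (B : Fin d → Fin n → ℝ) (p : PolyD d) (y : Pt n) (x : Pt d)
    (hx : ∀ i, x i = a i + ∑ j, B i j * y j) : pev (affineSubst a B p) y = pev p x := by
  have h := MvPolynomial.comp_aeval_apply (fun i => MvPolynomial.C (a i) +
    ∑ j, MvPolynomial.C (B i j) * MvPolynomial.X j)
    (MvPolynomial.aeval (R := ℝ) (fun i => y i) : PolyD n →ₐ[ℝ] ℝ) p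
  simp only [pev, affineSubst]
  refine h.trans ?_
  simp [MvPolynomial.aeval_eq_eval, ← hx]

theorem totalDegree_affineSubst_le (a : Fin d → ℝ) (B : Fin d → Fin n → ℝ) (p : PolyD d) :
    (affineSubst a B p).totalDegree ≤ p.totalDegree := by
  classical
  have h1 : ∀ i, (MvPolynomial.C (a i) +
      ∑ j, MvPolynomial.C (B i j) * MvPolynomial.X j : PolyD n).totalDegree ≤ 1 := by
    intro i
    refine (MvPolynomial.totalDegree_add _ _).trans (max_le (by simp) ?_)
    refine MvPolynomial.totalDegree_finsetSum_le fun j _ => ?_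
    refine (MvPolynomial.totalDegree_mul _ _).trans ?_
    simp
  rw [affineSubst, MvPolynomial.aeval_def, MvPolynomial.eval₂_eq']
  refine MvPolynomial.totalDegree_finsetSum_le fun s hs => ?_
  refine (MvPolynomial.totalDegree_mul _ _).trans ?_
  have h2 : (∏ i, (MvPolynomial.C (a i) +
      ∑ j, MvPolynomial.C (B i j) * MvPolynomial.X j : PolyD n) ^ s i).totalDegree ≤ ∑ i, s i := by
    refine (MvPolynomial.totalDegree_finsetProd _ _).trans (Finset.sum_le_sum fun i _ => ?_)
    refine (MvPolynomial.totalDegree_pow _ _).trans ?_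
    simpa using Nat.mul_le_mul_left (s i) (h1 i)
  have h3 := MvPolynomial.le_totalDegree hs
  rw [Finsupp.sum_fintype _ _ (by simp)] at h3
  have h5 := h2.trans h3
  have h4 : (algebraMap ℝ (PolyD n) (MvPolynomial.coeff s p)).totalDegree = 0 := by
    rw [MvPolynomial.algebraMap_eq]; simp
  rw [h4, zero_add]
  exact h5

end Polynomials



/-! ### Bounds for polynomials on balls -/

section PolynomialBounds

variable {d n : ℕ}

/-- The chain rule for an affine substitution. -/
theorem pev_pderiv_affineSubst (a : Fin d → ℝ) (B : Fin d → Fin n → ℝ) (p : PolyD d) (j : Fin n)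
    (y : Pt n) (x : Pt d) (hx : ∀ i, x i = a i + ∑ j, B i j * y j) :
    pev (MvPolynomial.pderiv j (affineSubst a B p)) y
      = ∑ i, B i j * pev (MvPolynomial.pderiv i p) x := by
  induction p using MvPolynomial.induction_on with
  | C r => simp [affineSubst, pev]
  | add p q hp hq =>
    have : affineSubst a B (p + q) = affineSubst a B p + affineSubst a B q := by
      simp [affineSubst]
    rw [this]
    simp only [map_add, pev_add, hp, hq, mul_add, Finset.sum_add_distrib]
  | mul_X p k hp =>
    have h1 : affineSubst a B (p * MvPolynomial.X k) = affineSubst a B p *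
        (MvPolynomial.C (a k) + ∑ j, MvPolynomial.C (B k j) * MvPolynomial.X j) := by
      simp [affineSubst]
    have h2 : MvPolynomial.pderiv j (MvPolynomial.C (a k) +
        ∑ j, MvPolynomial.C (B k j) * MvPolynomial.X j : PolyD n) = MvPolynomial.C (B k j) := by
      classical
      simp [MvPolynomial.pderiv_X, Pi.single_apply]
    have h3 : pev (MvPolynomial.C (a k) +
        ∑ j, MvPolynomial.C (B k j) * MvPolynomial.X j : PolyD n) y = x k := by
      rw [hx k]; simp [pev]
    have h4 : ∀ i, pev (MvPolynomial.pderiv i (p * MvPolynomial.X k)) x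
        = pev (MvPolynomial.pderiv i p) x * x k + if i = k then pev p x else 0 := by
      intro i
      classical
      rw [MvPolynomial.pderiv_mul, pev_add, pev_mul, pev_mul, pev_X, MvPolynomial.pderiv_X]
      congr 1
      by_cases hik : i = k
      · subst hik; simp [pev]
      · simp [hik, Ne.symm hik, pev]
    rw [h1, MvPolynomial.pderiv_mul, h2, pev_add, pev_mul, pev_mul, hp, h3, pev_C,
      pev_affineSubst a B p y x hx]
    simp_rw [h4, mul_add, Finset.sum_add_distrib, Finset.sum_mul]
    simp [mul_comm, mul_left_comm]

theorem pev_eq_zero_of_ball {p : PolyD n} {m : Pt n} {r : ℝ} (hr : 0 < r)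
    (h : ∀ x ∈ Metric.ball m r, pev p x = 0) : p = 0 := by
  -- a ball contains a product of intervals around its centre
  have h1 : {y : Fin n → ℝ | WithLp.toLp 2 y ∈ Metric.ball m r} ∈ 𝓝 (fun i => m i) := by
    have hc : Continuous (fun y : Fin n → ℝ => (WithLp.toLp 2 y : Pt n)) :=
      PiLp.continuous_toLp 2 _
    exact hc.continuousAt.preimage_mem_nhds (Metric.isOpen_ball.mem_nhds (by
      simpa using hr))
  obtain ⟨ε, hε, hb⟩ := Metric.mem_nhds_iff.1 h1
  refine MvPolynomial.funext_set (fun i => Metric.ball (m i) ε) (fun i => ?_) fun x hx => ?_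
  · rw [Real.ball_eq_Ioo]
    exact Set.Ioo_infinite (by linarith)
  · have h2 : x ∈ Metric.ball (fun i => m i) ε := by
      rw [ball_pi _ hε]
      exact hx
    have := h _ (hb h2)
    simpa [pev] using this

theorem memLp_pev_of_isBounded {S : Set (Pt n)} (hS : Bornology.IsBounded S) (p : PolyD n) :
    InL2 S (pev p) := by
  have hc : IsCompact (closure S) := hS.isCompact_closure
  obtain ⟨B, hB⟩ := hc.exists_bound_of_continuousOn (continuous_pev p).continuousOn
  have : IsFiniteMeasure (volume.restrict (closure S)) :=
    ⟨by rw [Measure.restrict_apply_univ]; exact hc.measure_lt_top⟩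
  have h1 : InL2 (closure S) (pev p) := MemLp.of_bound (continuous_pev p).aestronglyMeasurable B
    ((ae_restrict_iff' hc.measurableSet).2 (Eventually.of_forall hB))
  exact h1.mono_measure (Measure.restrict_mono subset_closure le_rfl)

/-- On the finite-dimensional space of polynomials of degree at most `N`, a linear operator
followed by point evaluation on a large ball is controlled by the `L²` norm on the unit ball. -/
theorem exists_eval_le_unitBall (n N : ℕ) (K : ℝ) (D : PolyD n →ₗ[ℝ] PolyD n) :
    ∃ C : ℝ, 0 < C ∧ ∀ p : PolyD n, p.totalDegree ≤ N → ∀ x : Pt n, ‖x‖ ≤ K →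
      pev (D p) x ^ 2 ≤ C * ∫ y in Metric.ball (0 : Pt n) 1, pev p y ^ 2 := by
  let V := MvPolynomial.restrictTotalDegree (Fin n) ℝ N
  have hfd : FiniteDimensional ℝ V := inferInstance
  have hL : ∀ p : PolyD n, InL2 (Metric.ball 0 1) (pev p) :=
    memLp_pev_of_isBounded Metric.isBounded_ball
  let S : V →ₗ[ℝ] Lp ℝ 2 (volume.restrict (Metric.ball (0 : Pt n) 1)) :=
    { toFun := fun p => (hL p.1).toLp (pev p.1)
      map_add' := fun p q =>
        (MemLp.toLp_congr (hL (p + q).1) ((hL p.1).add (hL q.1))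
          (Eventually.of_forall fun x => by simp [pev])).trans
          (MemLp.toLp_add (hL p.1) (hL q.1))
      map_smul' := fun a p =>
        (MemLp.toLp_congr (hL (a • p).1) ((hL p.1).const_smul a)
          (Eventually.of_forall fun x => by simp [pev])).trans
          (MemLp.toLp_const_smul a (hL p.1)) }
  -- a polynomial that vanishes on a ball is zero, so that the `L²` norm is a norm on `V`
  have hSinj : Function.Injective S := by
    rw [← LinearMap.ker_eq_bot, LinearMap.ker_eq_bot']
    intro p hp
    have h1 : (pev p.1) =ᵐ[volume.restrict (Metric.ball (0 : Pt n) 1)] (fun _ => (0:ℝ)) :=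
      (hL p.1).coeFn_toLp.symm.trans (by
        have : (hL p.1).toLp (pev p.1) = 0 := hp
        rw [this]
        exact Lp.coeFn_zero _ _ _)
    have h2 := Measure.eqOn_open_of_ae_eq h1 Metric.isOpen_ball
      (continuous_pev p.1).continuousOn continuousOn_const
    exact Subtype.ext (pev_eq_zero_of_ball one_pos fun x hx => h2 hx)
  let X := Metric.closedBall (0 : Pt n) K
  have : CompactSpace X := isCompact_iff_compactSpace.1 (isCompact_closedBall _ _)
  let T : V →ₗ[ℝ] C(X, ℝ) :=
    { toFun := fun p => ⟨fun x => pev (D p.1) x.1, (continuous_pev _).comp continuous_subtype_val⟩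
      map_add' := fun p q => by ext x; simp [pev]
      map_smul' := fun a p => by ext x; simp [pev] }
  let e := LinearEquiv.ofInjective S hSinj
  let A : LinearMap.range S →L[ℝ] C(X, ℝ) := (T ∘ₗ e.symm.toLinearMap).toContinuousLinearMap
  refine ⟨‖A‖ ^ 2 + 1, by positivity, fun p hp x hx => ?_⟩
  let q : V := ⟨p, (MvPolynomial.mem_restrictTotalDegree _ _ _).2 hp⟩
  have h1 : |pev (D p) x| ≤ ‖T q‖ :=
    ContinuousMap.norm_coe_le_norm (T q) ⟨x, by simpa [X] using hx⟩
  have h2 : T q = A (e q) := by simp [A]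
  have h3 : ‖T q‖ ≤ ‖A‖ * ‖S q‖ := by
    rw [h2]
    exact A.le_opNorm (e q)
  have h4 : ‖S q‖ ^ 2 = ∫ y in Metric.ball (0 : Pt n) 1, pev p y ^ 2 := by
    rw [← real_inner_self_eq_norm_sq, L2.inner_def]
    refine integral_congr_ae ?_
    filter_upwards [(hL p).coeFn_toLp] with y hy
    have : (S q : Pt n → ℝ) y = pev p y := hy
    rw [this]
    simp [sq]
  rw [← h4, ← sq_abs]
  calc |pev (D p) x| ^ 2 ≤ (‖A‖ * ‖S q‖) ^ 2 := by
        gcongr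
        exact h1.trans h3
    _ ≤ _ := by
        rw [mul_pow]
        gcongr
        linarith

theorem setIntegral_ball_affine (f : Pt n → ℝ) (m : Pt n) {ρ : ℝ} (hρ : 0 < ρ) :
    ∫ y in Metric.ball (0 : Pt n) 1, f (m + ρ • y)
      = (ρ ^ n)⁻¹ * ∫ x in Metric.ball m ρ, f x := by
  have h1 := Measure.setIntegral_comp_smul_of_pos (volume : Measure (Pt n))
    (fun z => f (m + z)) (Metric.ball (0 : Pt n) 1) hρ
  rw [h1, smul_unitBall hρ.ne', finrank_euclideanSpace_fin, smul_eq_mul, Real.norm_of_nonneg hρ.le]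
  congr 1
  have h2 := (measurePreserving_add_left (volume : Measure (Pt n)) m).setIntegral_preimage_emb
    (MeasurableEquiv.addLeft m).measurableEmbedding f (Metric.ball m ρ)
  rw [← h2]
  congr 2
  ext z
  simp [dist_eq_norm]

/-- Norm equivalence and inverse estimates for polynomials of degree at most `N` on balls. The
constant is independent of the centre and of the radius. -/
theorem exists_poly_bound (n N : ℕ) (K : ℝ) :
    ∃ C : ℝ, 0 < C ∧ ∀ p : PolyD n, p.totalDegree ≤ N → ∀ (m : Pt n) (ρ : ℝ), 0 < ρ →
      ∀ x : Pt n, ‖x - m‖ ≤ K * ρ →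
      pev p x ^ 2 ≤ C * ((ρ ^ n)⁻¹ * ∫ y in Metric.ball m ρ, pev p y ^ 2) ∧
      (∀ i, ρ ^ 2 * pev (MvPolynomial.pderiv i p) x ^ 2
        ≤ C * ((ρ ^ n)⁻¹ * ∫ y in Metric.ball m ρ, pev p y ^ 2)) ∧
      (∀ i j, ρ ^ 4 * pev (MvPolynomial.pderiv j (MvPolynomial.pderiv i p)) x ^ 2
        ≤ C * ((ρ ^ n)⁻¹ * ∫ y in Metric.ball m ρ, pev p y ^ 2)) := by
  obtain ⟨C0, hC0, h0⟩ := exists_eval_le_unitBall n N K LinearMap.id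
  choose C1 hC1 h1 using fun i : Fin n =>
    exists_eval_le_unitBall n N K (MvPolynomial.pderiv i).toLinearMap
  choose C2 hC2 h2 using fun i j : Fin n =>
    exists_eval_le_unitBall n N K
      ((MvPolynomial.pderiv j).toLinearMap ∘ₗ (MvPolynomial.pderiv i).toLinearMap)
  have hs1 : ∀ i, C1 i ≤ ∑ i, C1 i := fun i =>
    Finset.single_le_sum (fun k _ => (hC1 k).le) (Finset.mem_univ i)
  have hs2 : ∀ i j, C2 i j ≤ ∑ i, ∑ j, C2 i j := fun i j =>
    (Finset.single_le_sum (f := fun j => C2 i j) (fun k _ => (hC2 i k).le)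
      (Finset.mem_univ j)).trans
      (Finset.single_le_sum (f := fun i => ∑ j, C2 i j)
        (fun k _ => Finset.sum_nonneg fun l _ => (hC2 k l).le) (Finset.mem_univ i))
  have hn1 : 0 ≤ ∑ i, C1 i := Finset.sum_nonneg fun i _ => (hC1 i).le
  have hn2 : 0 ≤ ∑ i, ∑ j, C2 i j :=
    Finset.sum_nonneg fun i _ => Finset.sum_nonneg fun j _ => (hC2 i j).le
  refine ⟨C0 + ∑ i, C1 i + ∑ i, ∑ j, C2 i j, by positivity, fun p hp m ρ hρ x hx => ?_⟩
  -- rescale the ball to the unit ball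
  let B : Fin n → Fin n → ℝ := fun i j => if i = j then ρ else 0
  have hB : ∀ (y : Pt n) i, (m + ρ • y) i = m i + ∑ j, B i j * y j := by
    intro y i
    simp [B]
  set q := affineSubst (fun i => m i) B p with hq
  have hqd : q.totalDegree ≤ N := (totalDegree_affineSubst_le _ _ _).trans hp
  have hI : ∫ y in Metric.ball (0 : Pt n) 1, pev q y ^ 2
      = (ρ ^ n)⁻¹ * ∫ y in Metric.ball m ρ, pev p y ^ 2 := by
    rw [← setIntegral_ball_affine (fun x => pev p x ^ 2) m hρ]
    simp_rw [hq, pev_affineSubst _ B p _ _ (hB _)]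
  have hd1 : ∀ (r : PolyD n) (i : Fin n) (y : Pt n),
      pev (MvPolynomial.pderiv i (affineSubst (fun i => m i) B r)) y
        = ρ * pev (MvPolynomial.pderiv i r) (m + ρ • y) := by
    intro r i y
    rw [pev_pderiv_affineSubst _ B r i y _ (hB y)]
    simp [B]
  have hd1' : ∀ i, MvPolynomial.pderiv i q
      = MvPolynomial.C ρ * affineSubst (fun i => m i) B (MvPolynomial.pderiv i p) := by
    intro i
    refine MvPolynomial.funext fun z => ?_
    have := hd1 p i (WithLp.toLp 2 z)
    rw [← pev_affineSubst (fun i => m i) B (MvPolynomial.pderiv i p) _ _ (hB _)] at this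
    simpa [pev, hq] using this
  set y : Pt n := ρ⁻¹ • (x - m) with hy
  have hyn : ‖y‖ ≤ K := by
    rw [hy, norm_smul, norm_inv, Real.norm_of_nonneg hρ.le, inv_mul_le_iff₀ hρ, mul_comm]
    exact hx
  have hxy : m + ρ • y = x := by
    rw [hy, smul_smul, mul_inv_cancel₀ hρ.ne', one_smul]
    abel
  rw [← hI]
  have hI0 : 0 ≤ ∫ y in Metric.ball (0 : Pt n) 1, pev q y ^ 2 :=
    integral_nonneg fun _ => sq_nonneg _
  refine ⟨?_, fun i => ?_, fun i j => ?_⟩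
  · have := h0 q hqd y hyn
    rw [LinearMap.id_apply, hq, pev_affineSubst _ B p y _ (hB y), hxy] at this
    refine this.trans (mul_le_mul_of_nonneg_right ?_ hI0)
    linarith
  · have := h1 i q hqd y hyn
    have e : pev ((MvPolynomial.pderiv i).toLinearMap q) y
        = ρ * pev (MvPolynomial.pderiv i p) x := by
      rw [← hxy]; exact hd1 p i y
    rw [e, mul_pow] at this
    refine this.trans (mul_le_mul_of_nonneg_right ?_ hI0)
    linarith [hs1 i]
  · have := h2 i j q hqd y hyn
    have e : pev (((MvPolynomial.pderiv j).toLinearMap ∘ₗ (MvPolynomial.pderiv i).toLinearMap) q) y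
        = ρ * (ρ * pev (MvPolynomial.pderiv j (MvPolynomial.pderiv i p)) x) := by
      change pev (MvPolynomial.pderiv j (MvPolynomial.pderiv i q)) y = _
      rw [hd1', MvPolynomial.pderiv_C_mul, pev_mul, pev_C, hd1, hxy]
    rw [e] at this
    refine le_trans (le_of_eq ?_) (this.trans (mul_le_mul_of_nonneg_right ?_ hI0))
    · ring
    · linarith [hs2 i j]

end PolynomialBounds



/-! ### Bounds for polynomials on hyperplanes, and their normal extension -/

section HyperplaneBounds

variable {n : ℕ}

theorem IsFrame.preimage_ball {ν : Pt (n + 1)} {R : Pt n →ₗᵢ[ℝ] Pt (n + 1)} (h : IsFrame ν R)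
    (m : Pt (n + 1)) (ρ : ℝ) :
    (fun y => m + R y) ⁻¹' (Metric.ball m ρ ∩ hyp m ν) = Metric.ball 0 ρ := by
  ext y
  simp [hyp, h.orth, dist_eq_norm]

/-- The restriction of a polynomial to a hyperplane is bounded by its `L²` norm on a disc. -/
theorem exists_hyp_bound (n N : ℕ) (K : ℝ) :
    ∃ C : ℝ, 0 < C ∧ ∀ p : PolyD (n + 1), p.totalDegree ≤ N → ∀ (m ν : Pt (n + 1)) (ρ : ℝ),
      ‖ν‖ = 1 → 0 < ρ → ∀ x ∈ hyp m ν, ‖x - m‖ ≤ K * ρ →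
      pev p x ^ 2 ≤ C * ((ρ ^ n)⁻¹ * ∫ y in Metric.ball m ρ ∩ hyp m ν, pev p y ^ 2 ∂μHE[n]) := by
  obtain ⟨C, hC, hb⟩ := exists_poly_bound n N K
  refine ⟨C, hC, fun p hp m ν ρ hν hρ x hx hxm => ?_⟩
  obtain ⟨R, h⟩ := exists_isFrame ν hν
  obtain ⟨y, hy⟩ := h.surj _ hx
  -- in the coordinates of the frame, the restriction is a polynomial on `ℝ^n`
  let B : Fin (n + 1) → Fin n → ℝ := fun i j => R (EuclideanSpace.single j 1) i
  have hB : ∀ (y : Pt n) i, (m + R y) i = m i + ∑ j, B i j * y j := by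
    intro y i
    have h1 : R y = ∑ j, y j • R (EuclideanSpace.single j 1) := by
      conv_lhs => rw [← (EuclideanSpace.basisFun (Fin n) ℝ).sum_repr y]
      simp [map_sum]
    rw [PiLp.add_apply, h1]
    simp [B, WithLp.ofLp_sum, Finset.sum_apply, mul_comm]
  have h2 := (hb (affineSubst (fun i => m i) B p) ((totalDegree_affineSubst_le _ _ _).trans hp)
    0 ρ hρ y (by rw [sub_zero, ← R.norm_map, hy]; exact hxm)).1
  rw [h.setIntegral_hyp m _ (Metric.isOpen_ball.measurableSet.inter (isClosed_hyp m ν).measurableSet)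
    Set.inter_subset_right, h.preimage_ball]
  simp_rw [fun y => pev_affineSubst (fun i => m i) B p y _ (hB y)] at h2
  rwa [hy, add_sub_cancel] at h2

theorem isCompact_hyp_inter (m ν : Pt (n + 1)) (r : ℝ) :
    IsCompact (Metric.closedBall m r ∩ hyp m ν) :=
  (isCompact_closedBall _ _).inter_right (isClosed_hyp m ν)

theorem hausdorff_disc (m ν : Pt (n + 1)) (hν : ‖ν‖ = 1) {r : ℝ} (hr : 0 ≤ r) :
    (μHE[n] : Measure (Pt (n + 1))) (Metric.closedBall m r ∩ hyp m ν)
      = ENNReal.ofReal (r ^ n * volume.real (Metric.ball (0 : Pt n) 1)) := by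
  obtain ⟨R, h⟩ := exists_isFrame ν hν
  have h1 : (μHE[n] : Measure (Pt (n + 1))) (Metric.closedBall m r ∩ hyp m ν)
      = (μHE[n]).restrict (hyp m ν) (Metric.closedBall m r) := by
    rw [Measure.restrict_apply Metric.isClosed_closedBall.measurableSet]
  rw [h1, ← h.map_volume m, (frameEmbedding m R).map_apply]
  have h2 : (fun y => m + R y) ⁻¹' Metric.closedBall m r = Metric.closedBall 0 r := by
    ext y
    simp [dist_eq_norm]
  rw [h2, Measure.addHaar_closedBall _ _ hr, ENNReal.ofReal_mul (by positivity),
    measureReal_def, ENNReal.ofReal_toReal measure_ball_lt_top.ne, finrank_euclideanSpace_fin]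

theorem hausdorff_finite_of_subset {m ν : Pt (n + 1)} (hν : ‖ν‖ = 1) {r : ℝ}
    {S : Set (Pt (n + 1))} (hS : S ⊆ Metric.closedBall m r ∩ hyp m ν) :
    (μHE[n] : Measure (Pt (n + 1))) S < ⊤ := by
  rcases lt_or_ge r 0 with hr | hr
  · rw [Metric.closedBall_eq_empty.2 hr, Set.empty_inter] at hS
    simp [Set.subset_empty_iff.1 hS]
  · refine (measure_mono hS).trans_lt ?_
    rw [hausdorff_disc m ν hν hr]
    exact ENNReal.ofReal_lt_top

theorem integrableOn_hyp {m ν : Pt (n + 1)} (hν : ‖ν‖ = 1) {r : ℝ} {S : Set (Pt (n + 1))}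
    (hS : S ⊆ Metric.closedBall m r ∩ hyp m ν) {g : Pt (n + 1) → ℝ} (hg : Continuous g) :
    IntegrableOn g S (μHE[n]) := by
  have hc := isCompact_hyp_inter m ν r
  obtain ⟨B, hB⟩ := hc.exists_bound_of_continuousOn hg.continuousOn
  refine IntegrableOn.mono_set (t := Metric.closedBall m r ∩ hyp m ν) ?_ hS
  exact Measure.integrableOn_of_bounded (hausdorff_finite_of_subset hν subset_rfl).ne
    hg.aestronglyMeasurable ((ae_restrict_iff' hc.measurableSet).2 (Eventually.of_forall hB))

/-- The `L²` norm of a polynomial on a flat set of diameter comparable to `ρ` is controlled by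
its `L²` norm on a disc of radius `ρ`. -/
theorem exists_hyp_integral_bound (n N : ℕ) (K : ℝ) (hK : 0 ≤ K) :
    ∃ C : ℝ, 0 < C ∧ ∀ p : PolyD (n + 1), p.totalDegree ≤ N → ∀ (m ν : Pt (n + 1)) (ρ : ℝ),
      ‖ν‖ = 1 → 0 < ρ → ∀ S : Set (Pt (n + 1)),
      S ⊆ Metric.closedBall m (K * ρ) ∩ hyp m ν → MeasurableSet S →
      ∫ x in S, pev p x ^ 2 ∂μHE[n]
        ≤ C * ∫ y in Metric.ball m ρ ∩ hyp m ν, pev p y ^ 2 ∂μHE[n] := by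
  obtain ⟨C, hC, hb⟩ := exists_hyp_bound n N K
  set w := volume.real (Metric.ball (0 : Pt n) 1) with hw
  have hw0 : 0 ≤ w := measureReal_nonneg
  refine ⟨C * (K ^ n * w) + 1, by positivity, fun p hp m ν ρ hν hρ S hS hSm => ?_⟩
  set I := ∫ y in Metric.ball m ρ ∩ hyp m ν, pev p y ^ 2 ∂μHE[n]
  have hI0 : 0 ≤ I := integral_nonneg fun _ => sq_nonneg _
  set M := C * ((ρ ^ n)⁻¹ * I) with hM
  have hM0 : 0 ≤ M := by positivity
  have hfin := hausdorff_finite_of_subset hν hS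
  have h1 : ∫ x in S, pev p x ^ 2 ∂μHE[n] ≤ M * (μHE[n] : Measure (Pt (n + 1))).real S := by
    have h2 := norm_setIntegral_le_of_norm_le_const (μ := (μHE[n] : Measure (Pt (n + 1))))
      (f := fun x => pev p x ^ 2) (C := M) hfin (fun x hx => by
        rw [Real.norm_of_nonneg (sq_nonneg _)]
        refine hb p hp m ν ρ hν hρ x (hS hx).2 ?_
        simpa [dist_eq_norm] using (hS hx).1)
    exact (le_abs_self _).trans h2
  have h3 : (μHE[n] : Measure (Pt (n + 1))).real S ≤ (K * ρ) ^ n * w := by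
    refine ENNReal.toReal_le_of_le_ofReal (by positivity) ?_
    rw [← hausdorff_disc m ν hν (by positivity)]
    exact measure_mono hS
  refine h1.trans ((mul_le_mul_of_nonneg_left h3 hM0).trans ?_)
  have : M * ((K * ρ) ^ n * w) = C * (K ^ n * w) * I := by
    rw [hM, mul_pow]
    field_simp
  rw [this]
  linarith

/-- The polynomial `p ∘ π`, where `π` is the orthogonal projection onto `hyp m ν`: the extension,
constant in normal direction, of the restriction of `p` to the hyperplane. -/
def normalExt (m ν : Pt n) (p : PolyD n) : PolyD n :=
  affineSubst (fun i => ν i * inner ℝ ν m)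
    (fun i j => (if i = j then 1 else 0) - ν i * ν j) p

theorem normalExt_aux (m ν x : Pt n) (i : Fin n) :
    (x - (inner ℝ ν (x - m) : ℝ) • ν) i = ν i * inner ℝ ν m
      + ∑ j, ((if i = j then 1 else 0) - ν i * ν j) * x j := by
  simp only [sub_mul, Finset.sum_sub_distrib, ite_mul, one_mul, zero_mul, Finset.sum_ite_eq,
    Finset.mem_univ, if_true, PiLp.sub_apply, PiLp.smul_apply, smul_eq_mul, inner_sub_right]
  have : (inner ℝ ν x : ℝ) = ∑ j, ν j * x j := by
    simp [PiLp.inner_apply, mul_comm]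
  rw [this]
  simp_rw [mul_assoc, ← Finset.mul_sum]
  ring

theorem pev_normalExt (m ν : Pt n) (p : PolyD n) (x : Pt n) :
    pev (normalExt m ν p) x = pev p (x - (inner ℝ ν (x - m) : ℝ) • ν) :=
  pev_affineSubst _ _ _ _ _ (normalExt_aux m ν x)

theorem pev_normalExt_of_mem {m ν : Pt n} (p : PolyD n) {x : Pt n} (hx : x ∈ hyp m ν) :
    pev (normalExt m ν p) x = pev p x := by
  have : (inner ℝ ν (x - m) : ℝ) = 0 := hx
  rw [pev_normalExt, this, zero_smul, sub_zero]

theorem totalDegree_normalExt_le (m ν : Pt n) (p : PolyD n) :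
    (normalExt m ν p).totalDegree ≤ p.totalDegree := totalDegree_affineSubst_le _ _ _

theorem pev_normalDeriv (ν : Pt n) (p : PolyD n) (x : Pt n) :
    pev (normalDeriv ν p) x = ∑ i, ν i * pev (MvPolynomial.pderiv i p) x := by
  simp [normalDeriv, pev]

/-- On the hyperplane, the gradient of the normal extension is the tangential gradient. -/
theorem pev_pderiv_normalExt_of_mem {m ν : Pt n} (p : PolyD n) {x : Pt n} (hx : x ∈ hyp m ν)
    (i : Fin n) :
    pev (MvPolynomial.pderiv i (normalExt m ν p)) x = pev (tangGrad ν p i) x := by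
  rw [normalExt, pev_pderiv_affineSubst _ _ _ _ _ _ (normalExt_aux m ν x)]
  have h0 : (inner ℝ ν (x - m) : ℝ) = 0 := hx
  rw [h0, zero_smul, sub_zero, tangGrad, pev_sub, pev_mul, pev_C, pev_normalDeriv]
  simp only [sub_mul, Finset.sum_sub_distrib, ite_mul, one_mul, zero_mul, Finset.sum_ite_eq',
    Finset.mem_univ, if_true, Finset.mul_sum]
  congr 1
  exact Finset.sum_congr rfl fun j _ => by ring

/-- The normal extension of a polynomial of bounded degree and its derivatives are bounded, on
balls, by the `L²` norm of the polynomial on a disc. -/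
theorem exists_normalExt_bound (n N : ℕ) (K : ℝ) :
    ∃ C : ℝ, 0 < C ∧ ∀ p : PolyD (n + 1), p.totalDegree ≤ N → ∀ (m ν : Pt (n + 1)) (ρ : ℝ),
      ‖ν‖ = 1 → 0 < ρ → ∀ x : Pt (n + 1), ‖x - m‖ ≤ K * ρ →
      pev (normalExt m ν p) x ^ 2
        ≤ C * ((ρ ^ n)⁻¹ * ∫ y in Metric.ball m ρ ∩ hyp m ν, pev p y ^ 2 ∂μHE[n]) ∧
      (∀ i, ρ ^ 2 * pev (MvPolynomial.pderiv i (normalExt m ν p)) x ^ 2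
        ≤ C * ((ρ ^ n)⁻¹ * ∫ y in Metric.ball m ρ ∩ hyp m ν, pev p y ^ 2 ∂μHE[n])) ∧
      (∀ i j, ρ ^ 4 * pev (MvPolynomial.pderiv j (MvPolynomial.pderiv i (normalExt m ν p))) x ^ 2
        ≤ C * ((ρ ^ n)⁻¹ * ∫ y in Metric.ball m ρ ∩ hyp m ν, pev p y ^ 2 ∂μHE[n])) := by
  obtain ⟨C1, hC1, h1⟩ := exists_poly_bound (n + 1) N K
  obtain ⟨C2, hC2, h2⟩ := exists_hyp_bound n N 1
  set w := volume.real (Metric.ball (0 : Pt (n + 1)) 1) with hw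
  have hw0 : 0 < w := by
    rw [hw, measureReal_def]
    exact ENNReal.toReal_pos (Metric.measure_ball_pos _ _ one_pos).ne' measure_ball_lt_top.ne
  refine ⟨C1 * (C2 * w), by positivity, fun p hp m ν ρ hν hρ x hx => ?_⟩
  set I := ∫ y in Metric.ball m ρ ∩ hyp m ν, pev p y ^ 2 ∂μHE[n]
  have hI0 : 0 ≤ I := integral_nonneg fun _ => sq_nonneg _
  have hνν : (inner ℝ ν ν : ℝ) = 1 := by rw [real_inner_self_eq_norm_sq, hν, one_pow]
  have hsup : ∀ y ∈ Metric.ball m ρ, pev (normalExt m ν p) y ^ 2 ≤ C2 * ((ρ ^ n)⁻¹ * I) := by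
    intro y hy
    rw [pev_normalExt]
    refine h2 p hp m ν ρ hν hρ _ ?_ ?_
    · change inner ℝ ν (y - _ - m) = 0
      rw [sub_right_comm, inner_sub_right, inner_smul_right, hνν]
      ring
    · set z := y - m
      have h3 : ‖z - (inner ℝ ν z : ℝ) • ν‖ ^ 2 ≤ ‖z‖ ^ 2 := by
        rw [norm_sub_sq_real, inner_smul_right, norm_smul, hν, real_inner_comm, mul_one,
          Real.norm_eq_abs, sq_abs]
        nlinarith [sq_nonneg (inner ℝ z ν : ℝ)]
      have h4 := abs_le_of_sq_le_sq h3 (norm_nonneg _)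
      rw [abs_of_nonneg (norm_nonneg _)] at h4
      have h5 : ‖z‖ < ρ := by simpa [dist_eq_norm, z] using hy
      have h6 : y - (inner ℝ ν z : ℝ) • ν - m = z - (inner ℝ ν z : ℝ) • ν := by
        simp only [z]; abel
      rw [h6, one_mul]
      exact h4.trans h5.le
  have hint : (ρ ^ (n + 1))⁻¹ * ∫ y in Metric.ball m ρ, pev (normalExt m ν p) y ^ 2
      ≤ C2 * w * ((ρ ^ n)⁻¹ * I) := by
    rw [← setIntegral_ball_affine (fun y => pev (normalExt m ν p) y ^ 2) m hρ]
    have h3 := norm_setIntegral_le_of_norm_le_const (μ := (volume : Measure (Pt (n + 1))))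
      (s := Metric.ball 0 1) (f := fun y => pev (normalExt m ν p) (m + ρ • y) ^ 2)
      (C := C2 * ((ρ ^ n)⁻¹ * I)) measure_ball_lt_top (fun y hy => by
        rw [Real.norm_of_nonneg (sq_nonneg _)]
        refine hsup _ ?_
        rw [mem_ball_iff_norm, add_sub_cancel_left, norm_smul, Real.norm_of_nonneg hρ.le]
        have : ‖y‖ < 1 := by simpa using hy
        nlinarith)
    refine ((le_abs_self _).trans h3).trans (le_of_eq ?_)
    rw [← hw]
    ring
  have hfin : ∀ {a : ℝ}, a ≤ C1 * ((ρ ^ (n + 1))⁻¹ *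
      ∫ y in Metric.ball m ρ, pev (normalExt m ν p) y ^ 2) → a ≤ C1 * (C2 * w) * ((ρ ^ n)⁻¹ * I) := by
    intro a ha
    refine ha.trans ?_
    rw [mul_assoc]
    exact mul_le_mul_of_nonneg_left hint hC1.le
  have h3 := h1 (normalExt m ν p) ((totalDegree_normalExt_le _ _ _).trans hp) m ρ hρ x hx
  exact ⟨hfin h3.1, fun i => hfin (h3.2.1 i), fun i j => hfin (h3.2.2 i j)⟩

end HyperplaneBounds



/-! ### Integration by parts against test functions -/

section Green

variable {n : ℕ}

/-- A smooth function together with its classical derivatives. -/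
def testJet {d : ℕ} (v : Pt d → ℝ) : Jet d where
  val := v
  grad := fun i => pd i v
  hess := fun i j => pd j (pd i v)

theorem hasCompactSupport_pd {d : ℕ} {v : Pt d → ℝ} (hc : HasCompactSupport v) (i : Fin d) :
    HasCompactSupport (pd i v) :=
  hc.of_isClosed_subset (isClosed_tsupport _) (tsupport_pd_subset v i)

theorem integrable_mul_of_hasCompactSupport {d : ℕ} {g v : Pt d → ℝ} (hg : Continuous g)
    (hv : Continuous v) (hc : HasCompactSupport v) : Integrable (fun x => g x * v x) :=
  (hg.mul hv).integrable_of_hasCompactSupport (hc.mul_left)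

theorem integrableOn_hyp_of_hasCompactSupport {m ν : Pt (n + 1)} (hν : ‖ν‖ = 1)
    {G : Pt (n + 1) → ℝ} (hG : Continuous G) (hc : HasCompactSupport G) :
    IntegrableOn G (hyp m ν) (μHE[n]) := by
  obtain ⟨R, h⟩ := exists_isFrame ν hν
  rw [IntegrableOn, ← h.map_volume m, (frameEmbedding m R).integrable_map_iff]
  have hi : Isometry (fun y => m + R y) := (isometry_add_left m).comp R.isometry
  exact (hG.comp hi.continuous).integrable_of_hasCompactSupport
    (hc.comp_isClosedEmbedding hi.isClosedEmbedding)

/-- Integration by parts on a half-space; `-ν` is the outer normal. -/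
theorem integral_upper_pev_mul_pd (m ν : Pt (n + 1)) (hν : ‖ν‖ = 1) (q : PolyD (n + 1))
    {w : Pt (n + 1) → ℝ} (hw : ContDiff ℝ ((⊤ : ℕ∞) : WithTop ℕ∞) w) (hc : HasCompactSupport w)
    (i : Fin (n + 1)) :
    ∫ x in upper m ν, pev q x * pd i w x
      = - (∫ x in upper m ν, pev (MvPolynomial.pderiv i q) x * w x)
        - ν i * ∫ x in hyp m ν, pev q x * w x ∂μHE[n] := by
  have hG : ContDiff ℝ 1 (fun x => pev q x * w x) :=
    ((contDiff_pev q).mul hw).of_le (by exact_mod_cast le_top)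
  have h1 := integral_upper_fderiv m (EuclideanSpace.single i (1 : ℝ)) hν hG hc.mul_left
  have h2 : ∀ x, fderiv ℝ (fun x => pev q x * w x) x (EuclideanSpace.single i (1 : ℝ))
      = pev (MvPolynomial.pderiv i q) x * w x + pev q x * pd i w x := by
    intro x
    have := congrFun (pd_mul (contDiff_pev q).differentiable_of_top hw.differentiable_of_top i) x
    rw [pd_pev] at this
    exact this
  simp_rw [h2] at h1
  rw [integral_add
    (integrable_mul_of_hasCompactSupport (continuous_pev _) hw.continuous hc).integrableOn
    (integrable_mul_of_hasCompactSupport (continuous_pev _) (contDiff_pd hw i).continuous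
      (hasCompactSupport_pd hc i)).integrableOn] at h1
  have h3 : (inner ℝ ν (EuclideanSpace.single i (1 : ℝ)) : ℝ) = ν i := by
    rw [EuclideanSpace.inner_single_right]; simp
  rw [h3] at h1
  linarith

/-- The surface density of the boundary terms obtained from the energy form by integration by parts
on a half-space. -/
def fluxDensity {d : ℕ} (ε α : ℝ) (ν : Pt d) (p : PolyD d) (v : Pt d → ℝ) (x : Pt d) : ℝ :=
  ε ^ 2 * ∑ i, pev (hessNormal ν p i) x * pd i v x
    + (α * pev (normalDeriv ν p) x - ε ^ 2 * pev (divHessNormal ν p) x) * v x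

theorem pev_hessNormal {d : ℕ} (ν : Pt d) (p : PolyD d) (i : Fin d) (x : Pt d) :
    pev (hessNormal ν p i) x
      = ∑ j, ν j * pev (MvPolynomial.pderiv j (MvPolynomial.pderiv i p)) x := by
  simp [hessNormal, pev]

theorem pev_divHessNormal {d : ℕ} (ν : Pt d) (p : PolyD d) (x : Pt d) :
    pev (divHessNormal ν p) x = ∑ i, ν i *
      ∑ j, pev (MvPolynomial.pderiv j (MvPolynomial.pderiv j (MvPolynomial.pderiv i p))) x := by
  simp [divHessNormal, pev]

theorem integral_upper_grad (m ν : Pt (n + 1)) (hν : ‖ν‖ = 1) (p : PolyD (n + 1))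
    {v : Pt (n + 1) → ℝ} (hv : ContDiff ℝ ((⊤ : ℕ∞) : WithTop ℕ∞) v) (hc : HasCompactSupport v) :
    ∫ x in upper m ν, ∑ i, pev (MvPolynomial.pderiv i p) x * pd i v x
      = - (∫ x in upper m ν, pev (lap p) x * v x)
        - ∫ x in hyp m ν, pev (normalDeriv ν p) x * v x ∂μHE[n] := by
  have hI : ∀ (q : PolyD (n + 1)) (w : Pt (n + 1) → ℝ), ContDiff ℝ ((⊤ : ℕ∞) : WithTop ℕ∞) w →
      HasCompactSupport w → IntegrableOn (fun x => pev q x * w x) (upper m ν) := fun q w h1 h2 =>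
    (integrable_mul_of_hasCompactSupport (continuous_pev q) h1.continuous h2).integrableOn
  have hJ : ∀ (q : PolyD (n + 1)),
      IntegrableOn (fun x => pev q x * v x) (hyp m ν) (μHE[n]) := fun q =>
    integrableOn_hyp_of_hasCompactSupport hν ((continuous_pev q).mul hv.continuous) hc.mul_left
  rw [integral_finsetSum _ fun i _ => hI _ _ (contDiff_pd hv i) (hasCompactSupport_pd hc i)]
  simp_rw [integral_upper_pev_mul_pd m ν hν _ hv hc, Finset.sum_sub_distrib, Finset.sum_neg_distrib]
  rw [← integral_finsetSum _ fun i _ => hI _ _ hv hc]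
  congr 1
  · congr 2
    ext x
    rw [lap, pev_sum, Finset.sum_mul]
  · simp_rw [← integral_const_mul]
    rw [← integral_finsetSum _ fun i _ => (hJ _).const_mul _]
    congr 1
    ext x
    rw [pev_normalDeriv, Finset.sum_mul]
    exact Finset.sum_congr rfl fun i _ => by ring

theorem lap_lap {d : ℕ} (p : PolyD d) : lap (lap p) = ∑ i, ∑ j,
    MvPolynomial.pderiv i (MvPolynomial.pderiv j
      (MvPolynomial.pderiv j (MvPolynomial.pderiv i p))) := by
  simp only [lap, map_sum]
  refine Finset.sum_congr rfl fun i _ => Finset.sum_congr rfl fun j _ => ?_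
  rw [pderiv_comm i j (MvPolynomial.pderiv j p), pderiv_comm i j p]

theorem integral_upper_hess (m ν : Pt (n + 1)) (hν : ‖ν‖ = 1) (p : PolyD (n + 1))
    {v : Pt (n + 1) → ℝ} (hv : ContDiff ℝ ((⊤ : ℕ∞) : WithTop ℕ∞) v) (hc : HasCompactSupport v) :
    ∫ x in upper m ν, ∑ i, ∑ j,
        pev (MvPolynomial.pderiv j (MvPolynomial.pderiv i p)) x * pd j (pd i v) x
      = (∫ x in upper m ν, pev (lap (lap p)) x * v x)
        - (∫ x in hyp m ν, ∑ i, pev (hessNormal ν p i) x * pd i v x ∂μHE[n])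
        + ∫ x in hyp m ν, pev (divHessNormal ν p) x * v x ∂μHE[n] := by
  have hI : ∀ (q : PolyD (n + 1)) (w : Pt (n + 1) → ℝ), ContDiff ℝ ((⊤ : ℕ∞) : WithTop ℕ∞) w →
      HasCompactSupport w → IntegrableOn (fun x => pev q x * w x) (upper m ν) := fun q w h1 h2 =>
    (integrable_mul_of_hasCompactSupport (continuous_pev q) h1.continuous h2).integrableOn
  have hJ : ∀ (q : PolyD (n + 1)) (w : Pt (n + 1) → ℝ), ContDiff ℝ ((⊤ : ℕ∞) : WithTop ℕ∞) w →
      HasCompactSupport w → IntegrableOn (fun x => pev q x * w x) (hyp m ν) (μHE[n]) :=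
    fun q w h1 h2 => integrableOn_hyp_of_hasCompactSupport hν
      ((continuous_pev q).mul h1.continuous) h2.mul_left
  have hp := fun i => contDiff_pd hv i
  have hpp := fun i j => contDiff_pd (hp i) j
  have hc1 := fun i => hasCompactSupport_pd hc i
  have hc2 := fun i j => hasCompactSupport_pd (hc1 i) j
  rw [integral_finsetSum _ fun i _ => integrable_finsetSum _ fun j _ =>
    hI _ _ (hpp i j) (hc2 i j)]
  simp_rw [fun i => integral_finsetSum (μ := volume.restrict (upper m ν)) Finset.univ
    (fun j _ => hI (MvPolynomial.pderiv j (MvPolynomial.pderiv i p)) _ (hpp i j) (hc2 i j)),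
    fun i j => integral_upper_pev_mul_pd m ν hν (MvPolynomial.pderiv j (MvPolynomial.pderiv i p))
      (hp i) (hc1 i) j,
    fun i j => integral_upper_pev_mul_pd m ν hν
      (MvPolynomial.pderiv j (MvPolynomial.pderiv j (MvPolynomial.pderiv i p))) hv hc i]
  have e1 : ∫ x in upper m ν, pev (lap (lap p)) x * v x = ∑ i, ∑ j, ∫ x in upper m ν,
      pev (MvPolynomial.pderiv i (MvPolynomial.pderiv j
        (MvPolynomial.pderiv j (MvPolynomial.pderiv i p)))) x * v x := by
    simp_rw [lap_lap, pev_sum, Finset.sum_mul]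
    rw [integral_finsetSum _ fun i _ => integrable_finsetSum _ fun j _ => hI _ _ hv hc]
    exact Finset.sum_congr rfl fun i _ => integral_finsetSum _ fun j _ => hI _ _ hv hc
  have e2 : ∫ x in hyp m ν, ∑ i, pev (hessNormal ν p i) x * pd i v x ∂μHE[n]
      = ∑ i, ∑ j, ν j * ∫ x in hyp m ν,
        pev (MvPolynomial.pderiv j (MvPolynomial.pderiv i p)) x * pd i v x ∂μHE[n] := by
    simp_rw [pev_hessNormal, Finset.sum_mul, mul_assoc]
    rw [integral_finsetSum _ fun i _ => integrable_finsetSum _ fun j _ =>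
      (hJ _ _ (hp i) (hc1 i)).const_mul _]
    refine Finset.sum_congr rfl fun i _ => ?_
    rw [integral_finsetSum _ fun j _ => (hJ _ _ (hp i) (hc1 i)).const_mul _]
    exact Finset.sum_congr rfl fun j _ => integral_const_mul _ _
  have e3 : ∫ x in hyp m ν, pev (divHessNormal ν p) x * v x ∂μHE[n]
      = ∑ i, ∑ j, ν i * ∫ x in hyp m ν, pev (MvPolynomial.pderiv j
          (MvPolynomial.pderiv j (MvPolynomial.pderiv i p))) x * v x ∂μHE[n] := by
    simp_rw [pev_divHessNormal, Finset.mul_sum, Finset.sum_mul, mul_assoc]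
    rw [integral_finsetSum _ fun i _ => integrable_finsetSum _ fun j _ =>
      (hJ _ _ hv hc).const_mul _]
    refine Finset.sum_congr rfl fun i _ => ?_
    rw [integral_finsetSum _ fun j _ => (hJ _ _ hv hc).const_mul _]
    exact Finset.sum_congr rfl fun j _ => integral_const_mul _ _
  rw [e1, e2, e3, ← Finset.sum_sub_distrib, ← Finset.sum_add_distrib]
  refine Finset.sum_congr rfl fun i _ => ?_
  rw [← Finset.sum_sub_distrib, ← Finset.sum_add_distrib]
  exact Finset.sum_congr rfl fun j _ => by ring

theorem continuous_fluxDensity {d : ℕ} (ε α : ℝ) (ν : Pt d) (p : PolyD d) {v : Pt d → ℝ}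
    (hv : ContDiff ℝ ((⊤ : ℕ∞) : WithTop ℕ∞) v) : Continuous (fluxDensity ε α ν p v) := by
  unfold fluxDensity
  have h1 := fun i => (contDiff_pd hv i).continuous
  have h2 := fun q : PolyD d => continuous_pev q
  have h3 := hv.continuous
  fun_prop

theorem hasCompactSupport_fluxDensity {d : ℕ} (ε α : ℝ) (ν : Pt d) (p : PolyD d) {v : Pt d → ℝ}
    (hc : HasCompactSupport v) : HasCompactSupport (fluxDensity ε α ν p v) := by
  refine HasCompactSupport.intro hc fun x hx => ?_
  have h1 : v x = 0 := image_eq_zero_of_notMem_tsupport hx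
  have h2 : ∀ i, pd i v x = 0 := fun i =>
    image_eq_zero_of_notMem_tsupport fun h => hx (tsupport_pd_subset v i h)
  simp [fluxDensity, h1, h2]

/-- Twofold integration by parts in the energy form on a half-space. -/
theorem energyForm_upper (ε α : ℝ) (m ν : Pt (n + 1)) (hν : ‖ν‖ = 1) (p : PolyD (n + 1))
    {v : Pt (n + 1) → ℝ} (hv : ContDiff ℝ ((⊤ : ℕ∞) : WithTop ℕ∞) v) (hc : HasCompactSupport v) :
    energyForm ε α (upper m ν) (Jet.ofPoly p) (testJet v)
      = (∫ x in upper m ν, (ε ^ 2 * pev (lap (lap p)) x - α * pev (lap p) x) * v x)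
        - ∫ x in hyp m ν, fluxDensity ε α ν p v x ∂μHE[n] := by
  have hI : ∀ (q : PolyD (n + 1)), IntegrableOn (fun x => pev q x * v x) (upper m ν) := fun q =>
    (integrable_mul_of_hasCompactSupport (continuous_pev q) hv.continuous hc).integrableOn
  have hJ : ∀ (q : PolyD (n + 1)) (w : Pt (n + 1) → ℝ), ContDiff ℝ ((⊤ : ℕ∞) : WithTop ℕ∞) w →
      HasCompactSupport w → IntegrableOn (fun x => pev q x * w x) (hyp m ν) (μHE[n]) :=
    fun q w h1 h2 => integrableOn_hyp_of_hasCompactSupport hν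
      ((continuous_pev q).mul h1.continuous) h2.mul_left
  have e1 : ∫ x in upper m ν, (ε ^ 2 * pev (lap (lap p)) x - α * pev (lap p) x) * v x
      = ε ^ 2 * (∫ x in upper m ν, pev (lap (lap p)) x * v x)
        - α * ∫ x in upper m ν, pev (lap p) x * v x := by
    rw [← integral_const_mul, ← integral_const_mul,
      ← integral_sub ((hI _).const_mul _) ((hI _).const_mul _)]
    congr 1
    ext x
    ring
  have e2 : ∫ x in hyp m ν, fluxDensity ε α ν p v x ∂μHE[n]
      = ε ^ 2 * (∫ x in hyp m ν, ∑ i, pev (hessNormal ν p i) x * pd i v x ∂μHE[n])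
        + (α * (∫ x in hyp m ν, pev (normalDeriv ν p) x * v x ∂μHE[n])
        - ε ^ 2 * ∫ x in hyp m ν, pev (divHessNormal ν p) x * v x ∂μHE[n]) := by
    simp_rw [← integral_const_mul]
    have a1 : IntegrableOn (fun x => ε ^ 2 * ∑ i, pev (hessNormal ν p i) x * pd i v x)
        (hyp m ν) (μHE[n]) := (integrable_finsetSum _ fun i _ =>
          hJ _ _ (contDiff_pd hv i) (hasCompactSupport_pd hc i)).const_mul _
    have a2 := (hJ (normalDeriv ν p) v hv hc).const_mul α
    have a3 := (hJ (divHessNormal ν p) v hv hc).const_mul (ε ^ 2)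
    rw [← integral_sub a2 a3]
    refine Eq.trans ?_ (integral_add a1 (a2.sub a3))
    congr 1
    ext x
    rw [fluxDensity]
    ring
  rw [e1, e2, energyForm]
  have h1 := integral_upper_hess m ν hν p hv hc
  have h2 := integral_upper_grad m ν hν p hv hc
  simp only [Jet.ofPoly, testJet]
  rw [h1, h2]
  ring

end Green



/-! ### Anisotropic cut-off functions -/

section Cutoff

variable {d : ℕ}

/-- On `S`, the smooth function `v` and its derivatives of order `k ≤ 2` are at most `M / δ^k`. -/
structure ScaledBounds (v : Pt d → ℝ) (S : Set (Pt d)) (M δ : ℝ) : Prop where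
  smooth : ContDiff ℝ ((⊤ : ℕ∞) : WithTop ℕ∞) v
  val : ∀ x ∈ S, |v x| ≤ M
  grad : ∀ x ∈ S, ∀ i, |pd i v x| ≤ M / δ
  hess : ∀ x ∈ S, ∀ i j, |pd j (pd i v) x| ≤ M / δ ^ 2

theorem ScaledBounds.mul {f g : Pt d → ℝ} {S : Set (Pt d)} {A B δ : ℝ} (hδ : 0 < δ) (hA : 0 ≤ A)
    (hB : 0 ≤ B) (hf : ScaledBounds f S A δ) (hg : ScaledBounds g S B δ) :
    ScaledBounds (fun x => f x * g x) S (4 * A * B) δ := by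
  have sf := hf.smooth.differentiable_of_top
  have sg := hg.smooth.differentiable_of_top
  have hAB := mul_nonneg hA hB
  refine ⟨hf.smooth.mul hg.smooth, fun x hx => ?_, fun x hx i => ?_, fun x hx i j => ?_⟩
  · rw [abs_mul]
    have := mul_le_mul (hf.val x hx) (hg.val x hx) (abs_nonneg _) hA
    linarith
  · rw [pd_mul sf sg]
    have h1 : |pd i f x * g x| ≤ A / δ * B := by
      rw [abs_mul]
      exact mul_le_mul (hf.grad x hx i) (hg.val x hx) (abs_nonneg _) (by positivity)
    have h2 : |f x * pd i g x| ≤ A * (B / δ) := by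
      rw [abs_mul]
      exact mul_le_mul (hf.val x hx) (hg.grad x hx i) (abs_nonneg _) hA
    refine (abs_add_le _ _).trans ((add_le_add h1 h2).trans ?_)
    have : A / δ * B + A * (B / δ) = 2 * (A * B) / δ := by ring
    rw [this]
    refine div_le_div_of_nonneg_right ?_ hδ.le
    nlinarith
  · have d1 := fun i => (contDiff_pd hf.smooth i).differentiable_of_top
    have d2 := fun i => (contDiff_pd hg.smooth i).differentiable_of_top
    rw [pd_mul sf sg, pd_add (f := fun x => pd i f x * g x) (g := fun x => f x * pd i g x)
      ((d1 i).mul sg) (sf.mul (d2 i)), pd_mul (d1 i) sg, pd_mul sf (d2 i)]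
    have h1 : |pd j (pd i f) x * g x| ≤ A / δ ^ 2 * B := by
      rw [abs_mul]
      exact mul_le_mul (hf.hess x hx i j) (hg.val x hx) (abs_nonneg _) (by positivity)
    have h2 : |pd i f x * pd j g x| ≤ A / δ * (B / δ) := by
      rw [abs_mul]
      exact mul_le_mul (hf.grad x hx i) (hg.grad x hx j) (abs_nonneg _) (by positivity)
    have h3 : |pd j f x * pd i g x| ≤ A / δ * (B / δ) := by
      rw [abs_mul]
      exact mul_le_mul (hf.grad x hx j) (hg.grad x hx i) (abs_nonneg _) (by positivity)
    have h4 : |f x * pd j (pd i g) x| ≤ A * (B / δ ^ 2) := by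
      rw [abs_mul]
      exact mul_le_mul (hf.val x hx) (hg.hess x hx i j) (abs_nonneg _) hA
    refine (abs_add_le _ _).trans ((add_le_add (abs_add_le _ _) (abs_add_le _ _)).trans ?_)
    refine (add_le_add (add_le_add h1 h2) (add_le_add h3 h4)).trans (le_of_eq ?_)
    field_simp
    ring

theorem ScaledBounds.mono {f : Pt d → ℝ} {S T : Set (Pt d)} {A δ : ℝ} (hf : ScaledBounds f S A δ)
    (h : T ⊆ S) : ScaledBounds f T A δ :=
  ⟨hf.smooth, fun x hx => hf.val x (h hx), fun x hx => hf.grad x (h hx),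
    fun x hx => hf.hess x (h hx)⟩

/-- A fixed radial bump function: one on the ball of radius `1/2`, supported in the ball of radius
`3/4`. -/
def bump0 (d : ℕ) : ContDiffBump (0 : Pt d) := ⟨1 / 2, 3 / 4, by norm_num, by norm_num⟩

/-- The linear map that scales by `1/δ` along `ν` and by `1/ρ` orthogonally to `ν`. -/
def anisoMap (ν : Pt d) (ρ δ : ℝ) : Pt d →L[ℝ] Pt d :=
  ρ⁻¹ • (ContinuousLinearMap.id ℝ (Pt d) - (innerSL ℝ ν).smulRight ν)
    + δ⁻¹ • (innerSL ℝ ν).smulRight ν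

/-- The bump function of height one centred at `m`, of width `ρ` orthogonally to `ν` and of width
`δ` along `ν`. -/
def cut (m ν : Pt d) (ρ δ : ℝ) (x : Pt d) : ℝ := bump0 d (anisoMap ν ρ δ (x - m))

theorem anisoMap_apply (ν : Pt d) (ρ δ : ℝ) (z : Pt d) :
    anisoMap ν ρ δ z = ρ⁻¹ • (z - (inner ℝ ν z : ℝ) • ν) + (δ⁻¹ * inner ℝ ν z : ℝ) • ν := by
  simp [anisoMap, smul_smul]

theorem norm_sq_anisoMap {ν : Pt d} (hν : ‖ν‖ = 1) (ρ δ : ℝ) (z : Pt d) :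
    ‖anisoMap ν ρ δ z‖ ^ 2
      = (ρ⁻¹) ^ 2 * (‖z‖ ^ 2 - (inner ℝ ν z : ℝ) ^ 2) + (δ⁻¹) ^ 2 * (inner ℝ ν z : ℝ) ^ 2 := by
  have hνν : (inner ℝ ν ν : ℝ) = 1 := by rw [real_inner_self_eq_norm_sq, hν, one_pow]
  have h1 : ‖z - (inner ℝ ν z : ℝ) • ν‖ ^ 2 = ‖z‖ ^ 2 - (inner ℝ ν z : ℝ) ^ 2 := by
    rw [norm_sub_sq_real, inner_smul_right, norm_smul, hν, real_inner_comm, mul_one,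
      Real.norm_eq_abs, sq_abs]
    rw [real_inner_comm]
    ring
  have h2 : (inner ℝ (ρ⁻¹ • (z - (inner ℝ ν z : ℝ) • ν)) ((δ⁻¹ * inner ℝ ν z : ℝ) • ν) : ℝ) = 0 := by
    rw [inner_smul_left, inner_smul_right, inner_sub_left, inner_smul_left, hνν,
      real_inner_comm]
    simp
  rw [anisoMap_apply, norm_add_sq_real, h2, norm_smul, norm_smul, mul_pow, mul_pow, h1, hν]
  simp only [Real.norm_eq_abs, sq_abs]
  ring

theorem norm_anisoMap_le {ν : Pt d} (hν : ‖ν‖ = 1) {ρ δ : ℝ} (hδ : 0 < δ) (hδρ : δ ≤ ρ) :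
    ‖anisoMap ν ρ δ‖ ≤ δ⁻¹ := by
  refine ContinuousLinearMap.opNorm_le_bound _ (by positivity) fun z => ?_
  refine abs_le_of_sq_le_sq' ?_ (by positivity) |>.2
  rw [norm_sq_anisoMap hν, mul_pow]
  have h1 : (inner ℝ ν z : ℝ) ^ 2 ≤ ‖z‖ ^ 2 := by
    rw [← sq_abs]
    have := abs_real_inner_le_norm ν z
    rw [hν, one_mul] at this
    gcongr
  have hρ : 0 < ρ := hδ.trans_le hδρ
  have h2 : (ρ⁻¹) ^ 2 ≤ (δ⁻¹) ^ 2 := by gcongr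
  nlinarith [mul_le_mul_of_nonneg_right h2 (sub_nonneg.2 h1)]

theorem norm_le_of_anisoMap {ν : Pt d} (hν : ‖ν‖ = 1) {ρ δ : ℝ} (hδ : 0 < δ) (hδρ : δ ≤ ρ)
    (z : Pt d) : ‖z‖ ≤ ρ * ‖anisoMap ν ρ δ z‖ ∧ |inner ℝ ν z| ≤ δ * ‖anisoMap ν ρ δ z‖ := by
  have hρ : 0 < ρ := hδ.trans_le hδρ
  have h0 := norm_sq_anisoMap hν ρ δ z
  have h1 : (inner ℝ ν z : ℝ) ^ 2 ≤ ‖z‖ ^ 2 := by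
    rw [← sq_abs]
    have := abs_real_inner_le_norm ν z
    rw [hν, one_mul] at this
    gcongr
  have h2 : (ρ⁻¹) ^ 2 ≤ (δ⁻¹) ^ 2 := by gcongr
  constructor
  · refine abs_le_of_sq_le_sq' ?_ (by positivity) |>.2
    rw [mul_pow, h0]
    have h3 : (ρ⁻¹) ^ 2 * ‖z‖ ^ 2 ≤ (ρ⁻¹) ^ 2 * (‖z‖ ^ 2 - (inner ℝ ν z : ℝ) ^ 2)
        + (δ⁻¹) ^ 2 * (inner ℝ ν z : ℝ) ^ 2 := by
      nlinarith [mul_le_mul_of_nonneg_right h2 (sq_nonneg (inner ℝ ν z : ℝ))]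
    have h4 := mul_le_mul_of_nonneg_left h3 (sq_nonneg ρ)
    have h5 : ρ ^ 2 * ((ρ⁻¹) ^ 2 * ‖z‖ ^ 2) = ‖z‖ ^ 2 := by field_simp
    linarith
  · refine abs_le_of_sq_le_sq ?_ (by positivity)
    rw [mul_pow, h0]
    have h3 : (δ⁻¹) ^ 2 * (inner ℝ ν z : ℝ) ^ 2 ≤ (ρ⁻¹) ^ 2 * (‖z‖ ^ 2 - (inner ℝ ν z : ℝ) ^ 2)
        + (δ⁻¹) ^ 2 * (inner ℝ ν z : ℝ) ^ 2 := by
      have := mul_nonneg (sq_nonneg ρ⁻¹) (sub_nonneg.2 h1)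
      linarith
    have h4 := mul_le_mul_of_nonneg_left h3 (sq_nonneg δ)
    have h5 : δ ^ 2 * ((δ⁻¹) ^ 2 * (inner ℝ ν z : ℝ) ^ 2) = (inner ℝ ν z : ℝ) ^ 2 := by field_simp
    linarith

/-- The box-like set that contains the support of `cut m ν ρ δ`. -/
def slab (m ν : Pt d) (ρ δ : ℝ) : Set (Pt d) :=
  {x | ‖x - m‖ ≤ 3 / 4 * ρ ∧ |inner ℝ ν (x - m)| ≤ δ}

theorem isClosed_slab (m ν : Pt d) (ρ δ : ℝ) : IsClosed (slab m ν ρ δ) :=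
  IsClosed.inter (s₁ := {x | ‖x - m‖ ≤ 3 / 4 * ρ}) (s₂ := {x | |inner ℝ ν (x - m)| ≤ δ})
    (isClosed_le (by fun_prop) continuous_const) (isClosed_le (by fun_prop) continuous_const)

theorem isCompact_slab (m ν : Pt d) (ρ δ : ℝ) : IsCompact (slab m ν ρ δ) :=
  (isCompact_closedBall m (3 / 4 * ρ)).of_isClosed_subset (isClosed_slab m ν ρ δ)
    fun x hx => by simpa [dist_eq_norm] using hx.1

theorem slab_subset_ball {m ν : Pt d} {ρ δ : ℝ} (hρ : 0 < ρ) :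
    slab m ν ρ δ ⊆ Metric.ball m ρ := by
  intro x hx
  rw [mem_ball_iff_norm]
  linarith [hx.1]

theorem tsupport_cut_subset {m ν : Pt d} (hν : ‖ν‖ = 1) {ρ δ : ℝ} (hδ : 0 < δ) (hδρ : δ ≤ ρ) :
    tsupport (cut m ν ρ δ) ⊆ slab m ν ρ δ := by
  refine closure_minimal (fun x hx => ?_) (isClosed_slab m ν ρ δ)
  have h1 : anisoMap ν ρ δ (x - m) ∈ Function.support (bump0 d) := hx
  rw [ContDiffBump.support_eq, mem_ball_zero_iff] at h1
  have h1' : ‖anisoMap ν ρ δ (x - m)‖ < 3 / 4 := h1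
  have h2 := norm_le_of_anisoMap hν hδ hδρ (x - m)
  have hρ : 0 < ρ := hδ.trans_le hδρ
  constructor
  · nlinarith [h2.1]
  · nlinarith [h2.2]

theorem contDiff_cut (m ν : Pt d) (ρ δ : ℝ) :
    ContDiff ℝ ((⊤ : ℕ∞) : WithTop ℕ∞) (cut m ν ρ δ) :=
  (bump0 d).contDiff.comp ((anisoMap ν ρ δ).contDiff.comp (contDiff_id.sub contDiff_const))

theorem cut_nonneg (m ν : Pt d) (ρ δ : ℝ) (x : Pt d) : 0 ≤ cut m ν ρ δ x := (bump0 d).nonneg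

theorem cut_le_one (m ν : Pt d) (ρ δ : ℝ) (x : Pt d) : cut m ν ρ δ x ≤ 1 := (bump0 d).le_one

theorem cut_eq_one_of_isotropic {m ν : Pt d} (hν : ‖ν‖ = 1) {ρ : ℝ} (hρ : 0 < ρ) {x : Pt d}
    (hx : ‖x - m‖ ≤ ρ / 2) : cut m ν ρ ρ x = 1 := by
  refine (bump0 d).one_of_mem_closedBall ?_
  rw [mem_closedBall_zero_iff]
  change _ ≤ (1 / 2 : ℝ)
  refine abs_le_of_sq_le_sq' ?_ (by norm_num) |>.2
  rw [norm_sq_anisoMap hν]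
  have h1 : (ρ⁻¹) ^ 2 * (‖x - m‖ ^ 2 - (inner ℝ ν (x - m) : ℝ) ^ 2)
      + (ρ⁻¹) ^ 2 * (inner ℝ ν (x - m) : ℝ) ^ 2 = (ρ⁻¹ * ‖x - m‖) ^ 2 := by ring
  rw [h1]
  have h2 : ρ⁻¹ * ‖x - m‖ ≤ 1 / 2 := by
    rw [inv_mul_le_iff₀ hρ]; linarith
  gcongr

theorem cut_eq_one_of_mem_hyp {m ν : Pt d} (hν : ‖ν‖ = 1) {ρ δ : ℝ} (hρ : 0 < ρ) {x : Pt d}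
    (hxH : x ∈ hyp m ν) (hx : ‖x - m‖ ≤ ρ / 2) : cut m ν ρ δ x = 1 := by
  refine (bump0 d).one_of_mem_closedBall ?_
  rw [mem_closedBall_zero_iff]
  change _ ≤ (1 / 2 : ℝ)
  refine abs_le_of_sq_le_sq' ?_ (by norm_num) |>.2
  have h0 : (inner ℝ ν (x - m) : ℝ) = 0 := hxH
  rw [norm_sq_anisoMap hν, h0]
  have h1 : (ρ⁻¹) ^ 2 * (‖x - m‖ ^ 2 - (0 : ℝ) ^ 2)
      + (δ⁻¹) ^ 2 * (0 : ℝ) ^ 2 = (ρ⁻¹ * ‖x - m‖) ^ 2 := by ring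
  rw [h1]
  have h2 : ρ⁻¹ * ‖x - m‖ ≤ 1 / 2 := by
    rw [inv_mul_le_iff₀ hρ]; linarith
  gcongr

theorem pd_comp_affine {ψ : Pt d → ℝ} (hψ : ContDiff ℝ ((⊤ : ℕ∞) : WithTop ℕ∞) ψ)
    (A : Pt d →L[ℝ] Pt d) (m : Pt d) (i : Fin d) :
    pd i (fun x => ψ (A (x - m)))
      = fun x => ∑ k, A (EuclideanSpace.single i 1) k * pd k ψ (A (x - m)) := by
  ext x
  have h1 : HasFDerivAt (fun x => A (x - m)) A x :=
    A.hasFDerivAt.comp x ((hasFDerivAt_id x).sub_const m)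
  have h2 := (hψ.differentiable_of_top (A (x - m))).hasFDerivAt.comp x h1
  rw [pd, show (fun x => ψ (A (x - m))) = ψ ∘ (fun x => A (x - m)) from rfl, h2.fderiv]
  exact fderiv_eq_sum_pd ψ _ _

theorem exists_bound_of_hasCompactSupport {g : Pt d → ℝ} (hg : Continuous g) (hc : HasCompactSupport g) :
    ∃ C, 0 ≤ C ∧ ∀ x, |g x| ≤ C := by
  obtain ⟨C, hC⟩ := hc.exists_bound_of_continuous hg
  exact ⟨C, (norm_nonneg _).trans (hC 0), hC⟩

theorem abs_apply_single_le (A : Pt d →L[ℝ] Pt d) (i k : Fin d) :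
    |A (EuclideanSpace.single i 1) k| ≤ ‖A‖ := by
  have h1 : ‖(A (EuclideanSpace.single i (1:ℝ))) k‖ ≤ ‖A (EuclideanSpace.single i 1)‖ :=
    PiLp.norm_apply_le _ k
  refine h1.trans ((A.le_opNorm _).trans ?_)
  simp

/-- Each derivative of the cut-off function costs a factor `1/δ`, the larger of the two scaling
factors `1/δ` and `1/ρ`; the constant does not depend on `ρ` and `δ`. -/
theorem exists_cut_bounds (d : ℕ) : ∃ C : ℝ, 0 < C ∧ ∀ (m ν : Pt d) (ρ δ : ℝ), ‖ν‖ = 1 → 0 < δ →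
    δ ≤ ρ → ScaledBounds (cut m ν ρ δ) Set.univ C δ := by
  have hs : ContDiff ℝ ((⊤ : ℕ∞) : WithTop ℕ∞) (bump0 d) := (bump0 d).contDiff
  have hc : HasCompactSupport (bump0 d) := (bump0 d).hasCompactSupport
  choose C1 hC1 h1 using fun k => exists_bound_of_hasCompactSupport (contDiff_pd hs k).continuous
    (hasCompactSupport_pd hc k)
  choose C2 hC2 h2 using fun k l => exists_bound_of_hasCompactSupport
    (contDiff_pd (contDiff_pd hs k) l).continuous
    (hasCompactSupport_pd (hasCompactSupport_pd hc k) l)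
  have n1 : 0 ≤ ∑ k, C1 k := Finset.sum_nonneg fun k _ => hC1 k
  have n2 : 0 ≤ ∑ k, ∑ l, C2 k l := Finset.sum_nonneg fun k _ => Finset.sum_nonneg fun l _ => hC2 k l
  refine ⟨1 + ∑ k, C1 k + ∑ k, ∑ l, C2 k l, by positivity, fun m ν ρ δ hν hδ hδρ => ?_⟩
  set A := anisoMap ν ρ δ with hA
  have hAn : ‖A‖ ≤ δ⁻¹ := norm_anisoMap_le hν hδ hδρ
  have hAk : ∀ i k, |A (EuclideanSpace.single i 1) k| ≤ δ⁻¹ := fun i k =>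
    (abs_apply_single_le A i k).trans hAn
  have hδi : 0 ≤ δ⁻¹ := by positivity
  refine ⟨contDiff_cut m ν ρ δ, fun x _ => ?_, fun x _ i => ?_, fun x _ i j => ?_⟩
  · rw [abs_of_nonneg (cut_nonneg _ _ _ _ _)]
    linarith [cut_le_one m ν ρ δ x]
  · have e : pd i (cut m ν ρ δ) = _ := pd_comp_affine hs A m i
    rw [e]
    calc |∑ k, A (EuclideanSpace.single i 1) k * pd k (bump0 d) (A (x - m))|
        ≤ ∑ k, |A (EuclideanSpace.single i 1) k * pd k (bump0 d) (A (x - m))| :=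
          Finset.abs_sum_le_sum_abs _ _
      _ ≤ ∑ k, δ⁻¹ * C1 k := by
          refine Finset.sum_le_sum fun k _ => ?_
          rw [abs_mul]
          exact mul_le_mul (hAk i k) (h1 k _) (abs_nonneg _) hδi
      _ = δ⁻¹ * ∑ k, C1 k := by rw [Finset.mul_sum]
      _ ≤ _ := by
          rw [div_eq_inv_mul]
          gcongr
          linarith
  · have e : pd i (cut m ν ρ δ) = _ := pd_comp_affine hs A m i
    have e2 : pd j (pd i (cut m ν ρ δ)) x = ∑ k, A (EuclideanSpace.single i 1) k *
        ∑ l, A (EuclideanSpace.single j 1) l * pd l (pd k (bump0 d)) (A (x - m)) := by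
      have hd : ∀ k, HasFDerivAt (fun x => pd k (bump0 d) (A (x - m)))
          (fderiv ℝ (fun x => pd k (bump0 d) (A (x - m))) x) x := fun k =>
        (((contDiff_pd hs k).comp (A.contDiff.comp (contDiff_id.sub
          (contDiff_const (c := m))))).differentiable_of_top x).hasFDerivAt
      have := HasFDerivAt.fun_sum (u := Finset.univ) fun k _ =>
        (hd k).const_mul (A (EuclideanSpace.single i 1) k)
      rw [e, pd, this.fderiv]
      simp only [sum_apply, FunLike.coe_smul, Pi.smul_apply, smul_eq_mul]
      refine Finset.sum_congr rfl fun k _ => ?_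
      congr 1
      exact congrFun (pd_comp_affine (contDiff_pd hs k) A m j) x
    rw [e2]
    calc |∑ k, A (EuclideanSpace.single i 1) k *
          ∑ l, A (EuclideanSpace.single j 1) l * pd l (pd k (bump0 d)) (A (x - m))|
        ≤ ∑ k, |A (EuclideanSpace.single i 1) k *
          ∑ l, A (EuclideanSpace.single j 1) l * pd l (pd k (bump0 d)) (A (x - m))| :=
          Finset.abs_sum_le_sum_abs _ _
      _ ≤ ∑ k, δ⁻¹ * ∑ l, δ⁻¹ * C2 k l := by
          refine Finset.sum_le_sum fun k _ => ?_
          rw [abs_mul]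
          refine mul_le_mul (hAk i k) ?_ (abs_nonneg _) hδi
          refine (Finset.abs_sum_le_sum_abs _ _).trans (Finset.sum_le_sum fun l _ => ?_)
          rw [abs_mul]
          exact mul_le_mul (hAk j l) (h2 k l _) (abs_nonneg _) hδi
      _ = (δ ^ 2)⁻¹ * ∑ k, ∑ l, C2 k l := by
          simp_rw [← Finset.mul_sum, ← mul_assoc]
          congr 1
          rw [sq, mul_inv]
      _ ≤ _ := by
          rw [div_eq_inv_mul]
          gcongr
          linarith

theorem pd_linear (ν m : Pt d) (i : Fin d) (δ : ℝ) :
    pd i (fun x => (inner ℝ ν (x - m) : ℝ) / δ) = fun _ => ν i / δ := by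
  ext x
  have h1 : HasFDerivAt (fun x => δ⁻¹ * innerSL ℝ ν (x - m)) (δ⁻¹ • innerSL ℝ ν) x := by
    have := ((innerSL ℝ ν).hasFDerivAt (x := x - m)).comp x ((hasFDerivAt_id x).sub_const m)
    exact this.const_mul _
  have h2 : (fun x => (inner ℝ ν (x - m) : ℝ) / δ) = fun x => δ⁻¹ * innerSL ℝ ν (x - m) := by
    ext x; simp [div_eq_inv_mul]
  rw [pd, h2, h1.fderiv]
  simp [EuclideanSpace.inner_single_right, div_eq_inv_mul]

/-- The signed distance to the hyperplane, divided by `δ`, has the same scaling on the slab as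
the cut-off function. -/
theorem scaledBounds_linear {m ν : Pt d} (hν : ‖ν‖ = 1) {ρ δ : ℝ} (hδ : 0 < δ) :
    ScaledBounds (fun x => (inner ℝ ν (x - m) : ℝ) / δ) (slab m ν ρ δ) 1 δ := by
  have hs : ContDiff ℝ ((⊤ : ℕ∞) : WithTop ℕ∞) (fun x => (inner ℝ ν (x - m) : ℝ) / δ) :=
    ((innerSL ℝ ν).contDiff.comp (contDiff_id.sub (contDiff_const (c := m)))).div_const δ
  refine ⟨hs, fun x hx => ?_, fun x hx i => ?_, fun x hx i j => ?_⟩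
  · rw [abs_div, abs_of_pos hδ, div_le_one hδ]
    exact hx.2
  · rw [pd_linear, abs_div, abs_of_pos hδ]
    gcongr
    have : ‖ν i‖ ≤ ‖ν‖ := PiLp.norm_apply_le _ i
    rwa [hν] at this
  · rw [pd_linear, pd_const]
    simp
    positivity

theorem volume_slab_le {n : ℕ} (m : Pt (n + 1)) {ν : Pt (n + 1)} (hν : ‖ν‖ = 1) {ρ δ : ℝ}
    (hδ : 0 < δ) (hρ : 0 < ρ) :
    volume.real (slab m ν ρ δ) ≤ 2 * volume.real (Metric.ball (0 : Pt n) 1) * (δ * ρ ^ n) := by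
  obtain ⟨R, h⟩ := exists_isFrame ν hν
  obtain ⟨hmp, hme⟩ := h.measurePreserving m
  refine ENNReal.toReal_le_of_le_ofReal (by positivity) ?_
  rw [← hmp.measure_preimage (isClosed_slab m ν ρ δ).measurableSet.nullMeasurableSet]
  have h1 : frameMap m ν R ⁻¹' (slab m ν ρ δ)
      ⊆ Set.Icc (-δ) δ ×ˢ Metric.closedBall (0 : Pt n) ρ := by
    intro p hp
    have h2 : |p.1| ≤ δ := by
      have := hp.2
      rwa [h.inner_frameMap] at this
    refine ⟨abs_le.1 h2, ?_⟩
    rw [mem_closedBall_zero_iff]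
    have h3 := h.norm_sq_frameMap_sub m p
    have h4 : ‖frameMap m ν R p - m‖ ≤ ρ := by linarith [hp.1]
    refine abs_le_of_sq_le_sq' ?_ hρ.le |>.2
    nlinarith [sq_nonneg p.1, norm_nonneg (frameMap m ν R p - m)]
  refine (measure_mono h1).trans (le_of_eq ?_)
  rw [Measure.volume_eq_prod, Measure.prod_prod, Real.volume_Icc,
    Measure.addHaar_closedBall _ _ hρ.le, finrank_euclideanSpace_fin]
  conv_lhs => rw [← ENNReal.ofReal_toReal (measure_ball_lt_top (μ := volume)
    (x := (0 : Pt n)) (r := 1)).ne]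
  rw [← ENNReal.ofReal_mul (by positivity), ← ENNReal.ofReal_mul (by linarith), measureReal_def]
  congr 1
  ring

end Cutoff



/-! ### Cauchy–Schwarz bounds for localized test functions -/

section CauchySchwarz

variable {X : Type*} [MeasurableSpace X] {μ : Measure X}

theorem abs_integral_mul_le_sqrt {f g : X → ℝ} (hf : MemLp f 2 μ) (hg : MemLp g 2 μ) :
    |∫ x, f x * g x ∂μ| ≤ Real.sqrt (∫ x, f x ^ 2 ∂μ) * Real.sqrt (∫ x, g x ^ 2 ∂μ) := by
  have h1 : ∀ {f g : X → ℝ} (hf : MemLp f 2 μ) (hg : MemLp g 2 μ),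
      (inner ℝ (hf.toLp f) (hg.toLp g) : ℝ) = ∫ x, f x * g x ∂μ := by
    intro f g hf hg
    rw [L2.inner_def]
    refine integral_congr_ae ?_
    filter_upwards [hf.coeFn_toLp, hg.coeFn_toLp] with x h1 h2
    rw [h1, h2]
    simp [mul_comm]
  have h2 : ∀ {f : X → ℝ} (hf : MemLp f 2 μ), ‖hf.toLp f‖ = Real.sqrt (∫ x, f x ^ 2 ∂μ) := by
    intro f hf
    rw [← Real.sqrt_sq (norm_nonneg _), ← real_inner_self_eq_norm_sq, h1]
    simp_rw [sq]
  rw [← h1 hf hg, ← h2 hf, ← h2 hg]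
  exact abs_real_inner_le_norm _ _

end CauchySchwarz

section TestBounds

variable {d : ℕ}

theorem inL2_of_hasCompactSupport (Z : Set (Pt d)) {g : Pt d → ℝ} (hg : Continuous g)
    (hc : HasCompactSupport g) : InL2 Z g :=
  (hg.memLp_of_hasCompactSupport hc).restrict Z

theorem inL2_of_isBounded {Z : Set (Pt d)} (hZ : Bornology.IsBounded Z) {g : Pt d → ℝ}
    (hg : Continuous g) : InL2 Z g := by
  have hc : IsCompact (closure Z) := hZ.isCompact_closure
  obtain ⟨B, hB⟩ := hc.exists_bound_of_continuousOn hg.continuousOn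
  have : IsFiniteMeasure (volume.restrict (closure Z)) :=
    ⟨by rw [Measure.restrict_apply_univ]; exact hc.measure_lt_top⟩
  have h1 : InL2 (closure Z) g := MemLp.of_bound hg.aestronglyMeasurable B
    ((ae_restrict_iff' hc.measurableSet).2 (Eventually.of_forall hB))
  exact h1.mono_measure (Measure.restrict_mono subset_closure le_rfl)

theorem setIntegral_sq_le_of_bound {Z S : Set (Pt d)} (hSf : volume S < ⊤)
    {k : Pt d → ℝ} {B V : ℝ} (hk : ∀ x ∈ S, |k x| ≤ B) (hk0 : ∀ x ∉ S, k x = 0)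
    (hV : volume.real S ≤ V) (hint : Integrable (fun x => k x ^ 2)) :
    ∫ x in Z, k x ^ 2 ≤ B ^ 2 * V := by
  calc ∫ x in Z, k x ^ 2 ≤ ∫ x, k x ^ 2 :=
        setIntegral_le_integral hint (Eventually.of_forall fun x => sq_nonneg _)
    _ = ∫ x in S, k x ^ 2 := by
        rw [setIntegral_eq_integral_of_forall_compl_eq_zero]
        intro x hx
        rw [hk0 x hx]; simp
    _ ≤ B ^ 2 * volume.real S := by
        refine (Real.le_norm_self _).trans
          (norm_setIntegral_le_of_norm_le_const (μ := volume) hSf fun x hx => ?_)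
        rw [Real.norm_of_nonneg (sq_nonneg _), ← sq_abs]
        have := hk x hx
        gcongr
    _ ≤ B ^ 2 * V := by gcongr

theorem abs_setIntegral_mul_le_of_bound {Z S : Set (Pt d)}
    (hSf : volume S < ⊤) {h k : Pt d → ℝ} {B V : ℝ} (hB : 0 ≤ B) (hh : InL2 Z h)
    (hkc : Continuous k) (hkcs : HasCompactSupport k)
    (hk : ∀ x ∈ S, |k x| ≤ B) (hk0 : ∀ x ∉ S, k x = 0) (hV : volume.real S ≤ V) :
    |∫ x in Z, h x * k x| ≤ Real.sqrt (∫ x in Z, h x ^ 2) * (B * Real.sqrt V) := by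
  have h1 := abs_integral_mul_le_sqrt hh (inL2_of_hasCompactSupport Z hkc hkcs)
  refine h1.trans (mul_le_mul_of_nonneg_left ?_ (Real.sqrt_nonneg _))
  have h2 : ∫ x in Z, k x ^ 2 ≤ B ^ 2 * V := by
    refine setIntegral_sq_le_of_bound hSf hk hk0 hV ?_
    exact (hkc.memLp_of_hasCompactSupport hkcs).integrable_sq
  calc Real.sqrt (∫ x in Z, k x ^ 2) ≤ Real.sqrt (B ^ 2 * V) := Real.sqrt_le_sqrt h2
    _ = B * Real.sqrt V := by
        rw [Real.sqrt_mul (sq_nonneg _), Real.sqrt_sq hB]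

/-- The components of `w` that enter the energy form are square integrable on `Z`. -/
structure JetL2 (Z : Set (Pt d)) (w : Jet d) : Prop where
  grad : ∀ i, InL2 Z (w.grad i)
  hess : ∀ i j, InL2 Z (w.hess i j)

theorem setIntegral_sum_sq_grad {Z : Set (Pt d)} {w : Jet d} (hw : JetL2 Z w) :
    ∫ x in Z, ∑ i, w.grad i x * w.grad i x = ∑ i, ∫ x in Z, w.grad i x ^ 2 := by
  simp_rw [← sq]
  exact integral_finsetSum _ fun i _ => (hw.grad i).integrable_sq

theorem setIntegral_sum_sq_hess {Z : Set (Pt d)} {w : Jet d} (hw : JetL2 Z w) :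
    ∫ x in Z, ∑ i, ∑ j, w.hess i j x * w.hess i j x = ∑ i, ∑ j, ∫ x in Z, w.hess i j x ^ 2 := by
  simp_rw [← sq]
  rw [integral_finsetSum _ fun i _ => integrable_finsetSum _ fun j _ => (hw.hess i j).integrable_sq]
  exact Finset.sum_congr rfl fun i _ => integral_finsetSum _ fun j _ => (hw.hess i j).integrable_sq

theorem energySq_eq {ε α : ℝ} {Z : Set (Pt d)} {w : Jet d} (hw : JetL2 Z w) :
    energySq ε α Z w = ε ^ 2 * (∑ i, ∑ j, ∫ x in Z, w.hess i j x ^ 2)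
      + α * ∑ i, ∫ x in Z, w.grad i x ^ 2 := by
  rw [energySq, energyForm, setIntegral_sum_sq_grad hw, setIntegral_sum_sq_hess hw]

theorem energySq_nonneg {ε α : ℝ} (hα : 0 ≤ α) (Z : Set (Pt d)) (w : Jet d) :
    0 ≤ energySq ε α Z w := by
  unfold energySq energyForm
  refine add_nonneg (mul_nonneg (sq_nonneg _) (integral_nonneg fun x => ?_))
    (mul_nonneg hα (integral_nonneg fun x => ?_))
  · exact Finset.sum_nonneg fun i _ => Finset.sum_nonneg fun j _ => mul_self_nonneg _
  · exact Finset.sum_nonneg fun i _ => mul_self_nonneg _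

theorem hess_le_energySq {ε α : ℝ} (hα : 0 ≤ α) {Z : Set (Pt d)} {w : Jet d} (hw : JetL2 Z w)
    (i j : Fin d) : ε ^ 2 * ∫ x in Z, w.hess i j x ^ 2 ≤ energySq ε α Z w := by
  rw [energySq_eq hw]
  have h1 : ∫ x in Z, w.hess i j x ^ 2 ≤ ∑ i, ∑ j, ∫ x in Z, w.hess i j x ^ 2 :=
    (Finset.single_le_sum (f := fun j => ∫ x in Z, w.hess i j x ^ 2)
      (fun k _ => integral_nonneg fun _ => sq_nonneg _) (Finset.mem_univ j)).trans
      (Finset.single_le_sum (f := fun i => ∑ j, ∫ x in Z, w.hess i j x ^ 2)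
      (fun k _ => Finset.sum_nonneg fun l _ => integral_nonneg fun _ => sq_nonneg _)
      (Finset.mem_univ i))
  have h2 : 0 ≤ α * ∑ i, ∫ x in Z, w.grad i x ^ 2 :=
    mul_nonneg hα (Finset.sum_nonneg fun i _ => integral_nonneg fun _ => sq_nonneg _)
  have := mul_le_mul_of_nonneg_left h1 (sq_nonneg ε)
  linarith

theorem grad_le_energySq {ε α : ℝ} (hα : 0 ≤ α) {Z : Set (Pt d)} {w : Jet d} (hw : JetL2 Z w)
    (i : Fin d) : α * ∫ x in Z, w.grad i x ^ 2 ≤ energySq ε α Z w := by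
  rw [energySq_eq hw]
  have h1 : ∫ x in Z, w.grad i x ^ 2 ≤ ∑ i, ∫ x in Z, w.grad i x ^ 2 :=
    Finset.single_le_sum (f := fun i => ∫ x in Z, w.grad i x ^ 2)
      (fun k _ => integral_nonneg fun _ => sq_nonneg _) (Finset.mem_univ i)
  have h2 : 0 ≤ ε ^ 2 * ∑ i, ∑ j, ∫ x in Z, w.hess i j x ^ 2 :=
    mul_nonneg (sq_nonneg _) (Finset.sum_nonneg fun i _ =>
      Finset.sum_nonneg fun j _ => integral_nonneg fun _ => sq_nonneg _)
  have := mul_le_mul_of_nonneg_left h1 hα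
  linarith

/-- The energy form against a test function of normal width `δ` that is supported in a set of
volume `V`, by the Cauchy–Schwarz inequality. -/
theorem abs_energyForm_testJet_le {ε α δ M V : ℝ} (hε : 0 ≤ ε) (hα : α = 0 ∨ α = 1) (hδ : 0 < δ)
    (hM : 0 ≤ M) {Z S : Set (Pt d)} (hSf : volume S < ⊤)
    (hV : volume.real S ≤ V) {w : Jet d} (hw : JetL2 Z w) {v : Pt d → ℝ}
    (hv : ScaledBounds v S M δ) (hc : HasCompactSupport v) (hvS : tsupport v ⊆ S) :
    |energyForm ε α Z w (testJet v)| ≤ Real.sqrt (energySq ε α Z w) *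
      (M * Real.sqrt V * (d ^ 2 * (ε / δ ^ 2) + d * (α / δ))) := by
  have hα0 : 0 ≤ α := by rcases hα with h | h <;> rw [h]; norm_num
  have c1 := fun i => contDiff_pd hv.smooth i
  have c2 := fun i j => contDiff_pd (c1 i) j
  have s1 := fun i => hasCompactSupport_pd hc i
  have s2 := fun i j => hasCompactSupport_pd (s1 i) j
  have z1 : ∀ i, ∀ x ∉ S, pd i v x = 0 := fun i x hx =>
    image_eq_zero_of_notMem_tsupport fun h => hx (hvS (tsupport_pd_subset v i h))
  have z2 : ∀ i j, ∀ x ∉ S, pd j (pd i v) x = 0 := fun i j x hx =>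
    image_eq_zero_of_notMem_tsupport fun h => hx (hvS (tsupport_pd_subset v i
      (tsupport_pd_subset _ j h)))
  have i1 : ∀ i, IntegrableOn (fun x => w.grad i x * pd i v x) Z := fun i =>
    (hw.grad i).integrable_mul (inL2_of_hasCompactSupport Z (c1 i).continuous (s1 i))
  have i2 : ∀ i j, IntegrableOn (fun x => w.hess i j x * pd j (pd i v) x) Z := fun i j =>
    (hw.hess i j).integrable_mul (inL2_of_hasCompactSupport Z (c2 i j).continuous (s2 i j))
  set E := energySq ε α Z w with hE
  have b2 : ∀ i j, |ε ^ 2 * ∫ x in Z, w.hess i j x * pd j (pd i v) x|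
      ≤ Real.sqrt E * (M * Real.sqrt V) * (ε / δ ^ 2) := by
    intro i j
    have h1 := abs_setIntegral_mul_le_of_bound hSf (by positivity) (hw.hess i j)
      (c2 i j).continuous (s2 i j) (fun x hx => hv.hess x hx i j) (z2 i j) hV
    have h2 : ε * Real.sqrt (∫ x in Z, w.hess i j x ^ 2) ≤ Real.sqrt E := by
      refine Real.le_sqrt_of_sq_le ?_
      rw [mul_pow, Real.sq_sqrt (integral_nonneg fun _ => sq_nonneg _)]
      exact hess_le_energySq hα0 hw i j
    rw [abs_mul, abs_of_nonneg (sq_nonneg ε)]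
    calc ε ^ 2 * |∫ x in Z, w.hess i j x * pd j (pd i v) x|
        ≤ ε ^ 2 * (Real.sqrt (∫ x in Z, w.hess i j x ^ 2) * (M / δ ^ 2 * Real.sqrt V)) := by gcongr
      _ = ε * Real.sqrt (∫ x in Z, w.hess i j x ^ 2) * (M * Real.sqrt V * (ε / δ ^ 2)) := by ring
      _ ≤ Real.sqrt E * (M * Real.sqrt V * (ε / δ ^ 2)) := by gcongr
      _ = _ := by ring
  have b1 : ∀ i, |α * ∫ x in Z, w.grad i x * pd i v x|
      ≤ Real.sqrt E * (M * Real.sqrt V) * (α / δ) := by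
    intro i
    have h1 := abs_setIntegral_mul_le_of_bound hSf (by positivity) (hw.grad i)
      (c1 i).continuous (s1 i) (fun x hx => hv.grad x hx i) (z1 i) hV
    have h2 : α * Real.sqrt (∫ x in Z, w.grad i x ^ 2) ≤ α * Real.sqrt E := by
      rcases hα with h | h
      · rw [h]; simp
      · rw [h, one_mul, one_mul]
        refine Real.sqrt_le_sqrt ?_
        have := grad_le_energySq (ε := ε) hα0 hw i
        rw [h, one_mul] at this
        rwa [hE, h]
    rw [abs_mul, abs_of_nonneg hα0]
    calc α * |∫ x in Z, w.grad i x * pd i v x|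
        ≤ α * (Real.sqrt (∫ x in Z, w.grad i x ^ 2) * (M / δ * Real.sqrt V)) := by gcongr
      _ = α * Real.sqrt (∫ x in Z, w.grad i x ^ 2) * (M / δ * Real.sqrt V) := by ring
      _ ≤ α * Real.sqrt E * (M / δ * Real.sqrt V) := by gcongr
      _ = _ := by ring
  have e : energyForm ε α Z w (testJet v)
      = ∑ i, ∑ j, ε ^ 2 * (∫ x in Z, w.hess i j x * pd j (pd i v) x)
        + ∑ i, α * ∫ x in Z, w.grad i x * pd i v x := by
    simp only [energyForm, testJet]
    rw [integral_finsetSum _ fun i _ => integrable_finsetSum _ fun j _ => i2 i j,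
      integral_finsetSum _ fun i _ => i1 i, Finset.mul_sum, Finset.mul_sum]
    congr 1
    refine Finset.sum_congr rfl fun i _ => ?_
    rw [integral_finsetSum _ fun j _ => i2 i j, Finset.mul_sum]
  rw [e]
  refine (abs_add_le _ _).trans ?_
  have t2 : |∑ i, ∑ j, ε ^ 2 * (∫ x in Z, w.hess i j x * pd j (pd i v) x)|
      ≤ ∑ _i : Fin d, ∑ _j : Fin d, Real.sqrt E * (M * Real.sqrt V) * (ε / δ ^ 2) :=
    (Finset.abs_sum_le_sum_abs _ _).trans (Finset.sum_le_sum fun i _ =>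
      (Finset.abs_sum_le_sum_abs _ _).trans (Finset.sum_le_sum fun j _ => b2 i j))
  have t1 : |∑ i, α * ∫ x in Z, w.grad i x * pd i v x|
      ≤ ∑ _i : Fin d, Real.sqrt E * (M * Real.sqrt V) * (α / δ) :=
    (Finset.abs_sum_le_sum_abs _ _).trans (Finset.sum_le_sum fun i _ => b1 i)
  refine (add_le_add t2 t1).trans (le_of_eq ?_)
  simp
  ring

end TestBounds



/-! ### Trace inequality and Poincaré inequality -/

section TracePoincare

variable {n : ℕ}

theorem sum_sq_eq_one_of_norm {d : ℕ} {ν : Pt d} (hν : ‖ν‖ = 1) : ∑ i, ν i ^ 2 = 1 := by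
  have := EuclideanSpace.norm_sq_eq ν
  rw [hν] at this
  simpa using this.symm

theorem sq_sum_mul_le {d : ℕ} {ν : Pt d} (hν : ‖ν‖ = 1) (a : Fin d → ℝ) :
    (∑ i, ν i * a i) ^ 2 ≤ ∑ i, a i ^ 2 := by
  have := Finset.sum_mul_sq_le_sq_mul_sq Finset.univ (fun i => ν i) a
  rwa [sum_sq_eq_one_of_norm hν, one_mul] at this

/-- A multiplicative trace inequality on a half-ball; the free parameter `η` balances the two
norms. It follows from the divergence theorem applied to the field `χ g² ν`. -/
theorem exists_trace_bound (n : ℕ) : ∃ C : ℝ, 0 < C ∧ ∀ (m ν : Pt (n + 1)) (ρ η : ℝ), ‖ν‖ = 1 →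
    0 < ρ → 0 < η → ∀ g : Pt (n + 1) → ℝ, ContDiff ℝ ((⊤ : ℕ∞) : WithTop ℕ∞) g →
    ∫ x in hyp m ν, cut m ν ρ ρ x * g x ^ 2 ∂μHE[n]
      ≤ η * (∫ x in Metric.ball m ρ ∩ upper m ν, ∑ i, pd i g x ^ 2)
        + (1 / η + C / ρ) * ∫ x in Metric.ball m ρ ∩ upper m ν, g x ^ 2 := by
  obtain ⟨C, hC, hcut⟩ := exists_cut_bounds (n + 1)
  refine ⟨(n + 1) * C, by positivity, fun m ν ρ η hν hρ hη g hg => ?_⟩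
  have hb := hcut m ν ρ ρ hν hρ le_rfl
  have hts : tsupport (cut m ν ρ ρ) ⊆ slab m ν ρ ρ := tsupport_cut_subset hν hρ le_rfl
  have hcs : HasCompactSupport (cut m ν ρ ρ) :=
    (isCompact_slab m ν ρ ρ).of_isClosed_subset (isClosed_tsupport _) hts
  have hg2 : ContDiff ℝ ((⊤ : ℕ∞) : WithTop ℕ∞) (fun x => g x ^ 2) := hg.pow 2
  have hG : ContDiff ℝ ((⊤ : ℕ∞) : WithTop ℕ∞) (fun x => cut m ν ρ ρ x * g x ^ 2) :=
    hb.smooth.mul hg2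
  have hGc : HasCompactSupport (fun x => cut m ν ρ ρ x * g x ^ 2) := hcs.mul_right
  have h1 := integral_upper_fderiv m ν hν (hG.of_le (by exact_mod_cast le_top)) hGc
  rw [real_inner_self_eq_norm_sq, hν] at h1
  have hd : ∀ x, fderiv ℝ (fun x => cut m ν ρ ρ x * g x ^ 2) x ν
      = (∑ i, ν i * pd i (cut m ν ρ ρ) x) * g x ^ 2
        + 2 * cut m ν ρ ρ x * g x * ∑ i, ν i * pd i g x := by
    intro x
    have e : ∀ i, pd i (fun x => cut m ν ρ ρ x * g x ^ 2) x
        = pd i (cut m ν ρ ρ) x * g x ^ 2 + cut m ν ρ ρ x * (2 * g x * pd i g x) := by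
      intro i
      have h2 : pd i (fun x => g x ^ 2) x = 2 * g x * pd i g x := by
        simp_rw [sq]
        rw [pd_mul hg.differentiable_of_top hg.differentiable_of_top]
        ring
      rw [pd_mul hb.smooth.differentiable_of_top hg2.differentiable_of_top, ← h2]
    rw [fderiv_eq_sum_pd, Finset.sum_mul, Finset.mul_sum, ← Finset.sum_add_distrib]
    exact Finset.sum_congr rfl fun i _ => by rw [e]; ring
  set Z := Metric.ball m ρ ∩ upper m ν with hZ
  have hZm : MeasurableSet Z :=
    (Metric.isOpen_ball.inter (isOpen_upper m ν)).measurableSet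
  have hZb : Bornology.IsBounded Z := Metric.isBounded_ball.subset Set.inter_subset_left
  have hpc := fun i => (contDiff_pd hg i).continuous
  have i1 : IntegrableOn (fun x => ∑ i, pd i g x ^ 2) Z :=
    integrable_finsetSum _ fun i _ => (inL2_of_isBounded hZb (hpc i)).integrable_sq
  have i2 : IntegrableOn (fun x => g x ^ 2) Z :=
    (inL2_of_isBounded hZb hg.continuous).integrable_sq
  have hoff : ∀ x ∉ Metric.ball m ρ, fderiv ℝ (fun x => cut m ν ρ ρ x * g x ^ 2) x ν = 0 := by
    intro x hx
    refine image_eq_zero_of_notMem_tsupport (f := fun x =>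
      fderiv ℝ (fun x => cut m ν ρ ρ x * g x ^ 2) x ν) fun h => hx ?_
    refine slab_subset_ball hρ (hts ?_)
    exact tsupport_mul_subset_left (tsupport_fderiv_apply_subset ℝ ν h)
  have h3 : ∫ x in upper m ν, fderiv ℝ (fun x => cut m ν ρ ρ x * g x ^ 2) x ν
      = ∫ x in Z, fderiv ℝ (fun x => cut m ν ρ ρ x * g x ^ 2) x ν := by
    refine setIntegral_eq_of_subset_of_forall_sdiff_eq_zero (isOpen_upper m ν).measurableSet
      Set.inter_subset_right fun x hx => hoff x fun h => hx.2 ⟨h, hx.1⟩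
  -- the integrand of the divergence theorem is bounded from below pointwise
  have hpt : ∀ x, -(η * (∑ i, pd i g x ^ 2) + (1 / η + (n + 1) * C / ρ) * g x ^ 2)
      ≤ fderiv ℝ (fun x => cut m ν ρ ρ x * g x ^ 2) x ν := by
    intro x
    rw [hd]
    have a1 : |∑ i, ν i * pd i (cut m ν ρ ρ) x| ≤ (n + 1) * C / ρ := by
      refine (Finset.abs_sum_le_sum_abs _ _).trans ?_
      have : ∀ i ∈ Finset.univ, |ν i * pd i (cut m ν ρ ρ) x| ≤ C / ρ := by
        intro i _
        rw [abs_mul]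
        have h4 : |ν i| ≤ 1 := by
          have : ‖ν i‖ ≤ ‖ν‖ := PiLp.norm_apply_le _ i
          rwa [hν] at this
        have h5 := hb.grad x (Set.mem_univ x) i
        calc |ν i| * |pd i (cut m ν ρ ρ) x| ≤ 1 * (C / ρ) := by gcongr
          _ = _ := one_mul _
      refine (Finset.sum_le_sum this).trans (le_of_eq ?_)
      simp
      ring
    have a2 := neg_abs_le (∑ i, ν i * pd i (cut m ν ρ ρ) x)
    have a3 : -((n + 1) * C / ρ) * g x ^ 2 ≤ (∑ i, ν i * pd i (cut m ν ρ ρ) x) * g x ^ 2 := by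
      refine mul_le_mul_of_nonneg_right ?_ (sq_nonneg _)
      linarith
    have a4 := sq_sum_mul_le hν (fun i => pd i g x)
    set s := ∑ i, ν i * pd i g x
    have c0 := cut_nonneg m ν ρ ρ x
    have c1 := cut_le_one m ν ρ ρ x
    -- Young's inequality with weight `η`
    have a5 : -(1 / η * g x ^ 2 + η * s ^ 2) ≤ 2 * cut m ν ρ ρ x * g x * s := by
      have y1 : 2 * |g x * s| ≤ 1 / η * g x ^ 2 + η * s ^ 2 := by
        have := sq_nonneg (|g x| - η * |s|)
        have h6 : 1 / η * (|g x| - η * |s|) ^ 2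
            = 1 / η * g x ^ 2 + η * s ^ 2 - 2 * (|g x| * |s|) := by
          rw [sub_sq, mul_pow, sq_abs, sq_abs]
          field_simp
          ring
        rw [abs_mul]
        have h7 : 0 ≤ 1 / η * (|g x| - η * |s|) ^ 2 := by positivity
        linarith
      have y2 : -|g x * s| ≤ cut m ν ρ ρ x * (g x * s) := by
        have := neg_abs_le (g x * s)
        nlinarith [abs_nonneg (g x * s)]
      nlinarith
    have a6 : η * s ^ 2 ≤ η * ∑ i, pd i g x ^ 2 := mul_le_mul_of_nonneg_left a4 hη.le
    linarith
  have hint : IntegrableOn (fun x => fderiv ℝ (fun x => cut m ν ρ ρ x * g x ^ 2) x ν) Z :=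
    (((hG.continuous_fderiv (by simp)).clm_apply continuous_const).integrable_of_hasCompactSupport
      ((hGc.fderiv ℝ).comp_left (g := fun L : Pt (n + 1) →L[ℝ] ℝ => L ν) (by simp))).integrableOn
  have h5 : -∫ x in Z, (η * (∑ i, pd i g x ^ 2) + (1 / η + (n + 1) * C / ρ) * g x ^ 2)
      ≤ ∫ x in Z, fderiv ℝ (fun x => cut m ν ρ ρ x * g x ^ 2) x ν := by
    rw [← integral_neg]
    exact integral_mono
      (((i1.const_mul η).add (i2.const_mul (1 / η + (n + 1) * C / ρ))).neg) hint (fun x => hpt x)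
  rw [integral_add (i1.const_mul η) (i2.const_mul (1 / η + (n + 1) * C / ρ)),
    integral_const_mul, integral_const_mul] at h5
  rw [h3] at h1
  linarith

/-- For a fixed parameter `t`, the average of `f` at the intermediate points `y + t (x - y)` of the
segments in `Z` is bounded by the integral of `f`. For `t ≥ 1/2` the substitution is made in `x`,
otherwise in `y`, so that its Jacobian is at most `2 ^ d`. -/
theorem lintegral_segment_le {d : ℕ} {Z : Set (Pt d)} (hZ : Convex ℝ Z) (hZm : MeasurableSet Z)
    {f : Pt d → ENNReal} (hf : Measurable f) {t : ℝ} (ht0 : 0 ≤ t) (ht1 : t ≤ 1) :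
    ∫⁻ y in Z, ∫⁻ x in Z, f (y + t • (x - y)) ≤ 2 ^ d * volume Z * ∫⁻ x in Z, f x := by
  have key : ∀ s : ℝ, 1 / 2 ≤ s → s ≤ 1 → ∀ y ∈ Z,
      ∫⁻ x in Z, f (y + s • (x - y)) ≤ 2 ^ d * ∫⁻ x in Z, f x := by
    intro s hs0 hs1 y hy
    have hs : 0 < s := by linarith
    have h1 : ∫⁻ x in Z, f (y + s • (x - y))
        ≤ ∫⁻ x, Z.indicator f ((1 - s) • y + s • x) := by
      rw [← lintegral_indicator hZm]
      refine lintegral_mono fun x => ?_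
      by_cases hx : x ∈ Z
      · have h2 : y + s • (x - y) = (1 - s) • y + s • x := by
          rw [smul_sub, sub_smul, one_smul]; abel
        have h3 : (1 - s) • y + s • x ∈ Z := hZ hy hx (by linarith) hs.le (by ring)
        rw [Set.indicator_of_mem hx, h2, Set.indicator_of_mem h3]
      · rw [Set.indicator_of_notMem hx]
        exact zero_le
    refine h1.trans ?_
    have hfi : Measurable (Z.indicator f) := hf.indicator hZm
    have h4 : ∫⁻ x, Z.indicator f ((1 - s) • y + s • x)
        = ENNReal.ofReal |(s ^ d)⁻¹| * ∫⁻ x, Z.indicator f ((1 - s) • y + x) := by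
      have h5 := Measure.map_addHaar_smul (volume : Measure (Pt d)) hs.ne'
      rw [finrank_euclideanSpace_fin] at h5
      rw [← smul_eq_mul, ← lintegral_smul_measure, ← h5,
        lintegral_map (f := fun x => Z.indicator f ((1 - s) • y + x))
          (hfi.comp (measurable_const_add _)) (measurable_const_smul s)]
    rw [h4, lintegral_add_left_eq_self (fun x => Z.indicator f x), lintegral_indicator hZm]
    gcongr
    rw [abs_of_pos (by positivity)]
    calc ENNReal.ofReal (s ^ d)⁻¹ ≤ ENNReal.ofReal (2 ^ d) := by
          refine ENNReal.ofReal_le_ofReal ?_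
          rw [← inv_pow]
          gcongr
          rw [inv_le_comm₀ hs (by norm_num)]
          linarith
      _ = 2 ^ d := by
          rw [ENNReal.ofReal_pow (by norm_num)]
          simp
  have hmeas : Measurable (Function.uncurry fun y x : Pt d => f (y + t • (x - y))) := by
    refine hf.comp ?_
    fun_prop
  have hconst : ∫⁻ _y in Z, (2 ^ d * ∫⁻ x in Z, f x) = 2 ^ d * volume Z * ∫⁻ x in Z, f x := by
    rw [setLIntegral_const]
    ring
  rw [← hconst]
  rcases le_total (1 / 2) t with h | h
  · exact setLIntegral_mono measurable_const fun y hy => key t h ht1 y hy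
  · rw [lintegral_lintegral_swap hmeas.aemeasurable]
    refine setLIntegral_mono measurable_const fun x hx => ?_
    refine le_trans (le_of_eq ?_) (key (1 - t) (by linarith) (by linarith) x hx)
    refine lintegral_congr fun y => ?_
    congr 1
    rw [smul_sub, smul_sub, sub_smul, sub_smul, one_smul, one_smul]
    abel

/-- The Poincaré inequality on a bounded convex set, as an `L²` bound for the deviation from a
suitable constant. The increments of `g` are integrated along segments. -/
theorem exists_poincare {d : ℕ} {Z : Set (Pt d)} (hZ : Convex ℝ Z) (hZm : MeasurableSet Z)
    (hZb : Bornology.IsBounded Z) (hZ0 : volume Z ≠ 0) {D : ℝ} (hD : ∀ x ∈ Z, ∀ y ∈ Z, ‖x - y‖ ≤ D)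
    {g : Pt d → ℝ} (hg : ContDiff ℝ ((⊤ : ℕ∞) : WithTop ℕ∞) g) :
    ∃ c : ℝ, ∫ x in Z, (g x - c) ^ 2 ≤ 2 ^ d * D ^ 2 * ∫ x in Z, ∑ i, pd i g x ^ 2 := by
  have hfin : volume Z ≠ ⊤ := hZb.measure_lt_top.ne
  have hpc := fun i => (contDiff_pd hg i).continuous
  set S : Pt d → ℝ := fun x => ∑ i, pd i g x ^ 2 with hS
  have hSc : Continuous S := by fun_prop
  have hS0 : ∀ x, 0 ≤ S x := fun x => Finset.sum_nonneg fun i _ => sq_nonneg _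
  have hgc := hg.continuous
  -- fundamental theorem of calculus along a segment
  have hseg : ∀ y ∈ Z, ∀ x ∈ Z, ENNReal.ofReal ((g x - g y) ^ 2)
      ≤ ENNReal.ofReal (D ^ 2) * ∫⁻ t in Set.Ioc (0:ℝ) 1, ENNReal.ofReal (S (y + t • (x - y))) := by
    intro y hy x hx
    set a : ℝ → ℝ := fun t => fderiv ℝ g (y + t • (x - y)) (x - y) with ha
    have hac : Continuous a :=
      ((hg.continuous_fderiv (by simp)).comp (by fun_prop)).clm_apply continuous_const
    have h1 : ∫ t in (0:ℝ)..1, a t = g x - g y := by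
      have hder : ∀ t ∈ Set.uIcc (0:ℝ) 1, HasDerivAt (fun t => g (y + t • (x - y))) (a t) t := by
        intro t _
        have h2 : HasDerivAt (fun t : ℝ => y + t • (x - y)) (x - y) t := by
          simpa using ((hasDerivAt_id t).smul_const (x - y)).const_add y
        exact (hg.differentiable_of_top _).hasFDerivAt.comp_hasDerivAt t h2
      rw [intervalIntegral.integral_eq_sub_of_hasDerivAt hder (hac.intervalIntegrable _ _)]
      simp
    rw [intervalIntegral.integral_of_le zero_le_one] at h1
    have hL2 : ∀ {b : ℝ → ℝ}, Continuous b → MemLp b 2 (volume.restrict (Set.Ioc (0:ℝ) 1)) := by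
      intro b hb
      obtain ⟨B, hB⟩ := (isCompact_Icc (a := (0:ℝ)) (b := 1)).exists_bound_of_continuousOn
        hb.continuousOn
      exact MemLp.of_bound hb.aestronglyMeasurable B ((ae_restrict_iff' measurableSet_Ioc).2
        (Eventually.of_forall fun t ht => hB t ⟨ht.1.le, ht.2⟩))
    have h2 := abs_integral_mul_le_sqrt (hL2 (continuous_const (y := (1:ℝ)))) (hL2 hac)
    simp only [one_mul, one_pow, integral_const, smul_eq_mul, mul_one] at h2
    rw [h1] at h2
    have h2' : |g x - g y| ≤ Real.sqrt (∫ t in Set.Ioc (0:ℝ) 1, a t ^ 2) := by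
      simpa using h2
    have h3 : (g x - g y) ^ 2 ≤ ∫ t in Set.Ioc (0:ℝ) 1, a t ^ 2 := by
      have h4 : 0 ≤ ∫ t in Set.Ioc (0:ℝ) 1, a t ^ 2 := integral_nonneg fun _ => sq_nonneg _
      rw [← sq_abs, ← Real.sq_sqrt h4]
      gcongr
    have h5 : ∀ t, a t ^ 2 ≤ D ^ 2 * S (y + t • (x - y)) := by
      intro t
      simp only [ha]
      rw [fderiv_eq_sum_pd]
      refine (Finset.sum_mul_sq_le_sq_mul_sq _ _ _).trans ?_
      refine mul_le_mul_of_nonneg_right ?_ (hS0 _)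
      have h6 := EuclideanSpace.norm_sq_eq (x - y)
      simp only [Real.norm_eq_abs, sq_abs] at h6
      rw [← h6]
      have := hD x hx y hy
      gcongr
    have hcS : Continuous fun t : ℝ => S (y + t • (x - y)) := by fun_prop
    have hiS : IntegrableOn (fun t : ℝ => S (y + t • (x - y))) (Set.Ioc 0 1) :=
      (hcS.integrableOn_Icc).mono_set Set.Ioc_subset_Icc_self
    have h7 : (g x - g y) ^ 2 ≤ D ^ 2 * ∫ t in Set.Ioc (0:ℝ) 1, S (y + t • (x - y)) := by
      rw [← integral_const_mul]
      exact h3.trans (integral_mono (hL2 hac).integrable_sq (hiS.const_mul _) h5)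
    calc ENNReal.ofReal ((g x - g y) ^ 2)
        ≤ ENNReal.ofReal (D ^ 2 * ∫ t in Set.Ioc (0:ℝ) 1, S (y + t • (x - y))) :=
          ENNReal.ofReal_le_ofReal h7
      _ = _ := by
          rw [ENNReal.ofReal_mul (sq_nonneg _), ofReal_integral_eq_lintegral_ofReal hiS
            (Eventually.of_forall fun t => hS0 _)]
  have hfm : Measurable fun x => ENNReal.ofReal (S x) := hSc.measurable.ennreal_ofReal
  set I := ∫⁻ x in Z, ENNReal.ofReal (S x) with hI
  have htot : ∫⁻ y in Z, ∫⁻ x in Z, ENNReal.ofReal ((g x - g y) ^ 2)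
      ≤ ENNReal.ofReal (D ^ 2) * (2 ^ d * volume Z * I) := by
    have m3 : Measurable fun q : (Pt d × Pt d) × ℝ =>
        ENNReal.ofReal (S (q.1.1 + q.2 • (q.1.2 - q.1.1))) := hfm.comp (by fun_prop)
    calc ∫⁻ y in Z, ∫⁻ x in Z, ENNReal.ofReal ((g x - g y) ^ 2)
        ≤ ∫⁻ y in Z, ∫⁻ x in Z, ENNReal.ofReal (D ^ 2) *
          ∫⁻ t in Set.Ioc (0:ℝ) 1, ENNReal.ofReal (S (y + t • (x - y))) := by
          refine setLIntegral_mono' hZm fun y hy => setLIntegral_mono' hZm fun x hx => ?_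
          exact hseg y hy x hx
      _ = ENNReal.ofReal (D ^ 2) * ∫⁻ t in Set.Ioc (0:ℝ) 1, ∫⁻ y in Z, ∫⁻ x in Z,
          ENNReal.ofReal (S (y + t • (x - y))) := by
          have e1 : ∀ y : Pt d, ∫⁻ x in Z, ENNReal.ofReal (D ^ 2) *
              ∫⁻ t in Set.Ioc (0:ℝ) 1, ENNReal.ofReal (S (y + t • (x - y)))
              = ENNReal.ofReal (D ^ 2) * ∫⁻ t in Set.Ioc (0:ℝ) 1, ∫⁻ x in Z,
                ENNReal.ofReal (S (y + t • (x - y))) := by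
            intro y
            rw [lintegral_const_mul' _ _ ENNReal.ofReal_ne_top]
            congr 1
            refine lintegral_lintegral_swap ?_
            exact (m3.comp (show Measurable fun q : Pt d × ℝ => ((y, q.1), q.2) by
              fun_prop)).aemeasurable
          simp_rw [e1]
          rw [lintegral_const_mul' _ _ ENNReal.ofReal_ne_top]
          congr 1
          refine lintegral_lintegral_swap ?_
          refine Measurable.aemeasurable ?_
          refine Measurable.lintegral_prod_right' (f := fun q : (Pt d × ℝ) × Pt d =>
            ENNReal.ofReal (S (q.1.1 + q.1.2 • (q.2 - q.1.1)))) (hfm.comp (by fun_prop))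
      _ ≤ ENNReal.ofReal (D ^ 2) * ∫⁻ _t in Set.Ioc (0:ℝ) 1, 2 ^ d * volume Z * I := by
          refine mul_le_mul_right ?_ _
          refine setLIntegral_mono measurable_const fun t ht => ?_
          exact lintegral_segment_le hZ hZm hfm ht.1.le ht.2
      _ = _ := by
          rw [setLIntegral_const]
          simp
  have hmy : Measurable fun y => ∫⁻ x in Z, ENNReal.ofReal ((g x - g y) ^ 2) := by
    refine Measurable.lintegral_prod_right' (f := fun q : Pt d × Pt d =>
      ENNReal.ofReal ((g q.2 - g q.1) ^ 2)) ?_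
    exact (Continuous.measurable (by fun_prop)).ennreal_ofReal
  -- the constant is the value of `g` at a point where the inner integral is below its average
  obtain ⟨y, hy, hle⟩ := exists_le_setLAverage hZ0 hfin hmy.aemeasurable.restrict
  refine ⟨g y, ?_⟩
  have hib : ∀ {b : Pt d → ℝ}, Continuous b → IntegrableOn b Z := by
    intro b hb
    exact (hb.continuousOn.integrableOn_compact hZb.isCompact_closure).mono_set subset_closure
  have h8 : ∫⁻ x in Z, ENNReal.ofReal ((g x - g y) ^ 2) ≤ ENNReal.ofReal (D ^ 2) * (2 ^ d * I) := by
    refine hle.trans ?_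
    rw [setLAverage_eq]
    refine ENNReal.div_le_of_le_mul (htot.trans (le_of_eq ?_))
    ring
  have h9 : ENNReal.ofReal (∫ x in Z, (g x - g y) ^ 2)
      ≤ ENNReal.ofReal (2 ^ d * D ^ 2 * ∫ x in Z, S x) := by
    rw [ofReal_integral_eq_lintegral_ofReal (hib (by fun_prop))
      (Eventually.of_forall fun x => sq_nonneg _)]
    refine h8.trans (le_of_eq ?_)
    rw [hI, ← ofReal_integral_eq_lintegral_ofReal (hib hSc) (Eventually.of_forall hS0),
      ENNReal.ofReal_mul (by positivity), ENNReal.ofReal_mul (by positivity)]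
    have h10 : ENNReal.ofReal (2 ^ d) = 2 ^ d := by
      rw [ENNReal.ofReal_pow (by norm_num)]
      simp
    rw [h10]
    ring
  exact (ENNReal.ofReal_le_ofReal_iff (mul_nonneg (by positivity)
    (integral_nonneg hS0))).1 h9

end TracePoincare



/-! ### Geometry of simplices and their hyperfaces -/

section Simplex

variable {n : ℕ}

/-- The barycentre of a finite set of points. -/
def bary {d : ℕ} (F : Finset (Pt d)) : Pt d := (F.card : ℝ)⁻¹ • ∑ a ∈ F, a

theorem affineMap_eq_linear_add {d : ℕ} (φ : Pt d →ᵃ[ℝ] ℝ) (x : Pt d) :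
    φ x = φ.linear x + φ 0 := by
  have := φ.linearMap_vsub x 0
  simp only [vsub_eq_sub, sub_zero] at this
  linarith

theorem affineMap_bary {d : ℕ} (φ : Pt d →ᵃ[ℝ] ℝ) {F : Finset (Pt d)} (hF : F.Nonempty) :
    φ (bary F) = (F.card : ℝ)⁻¹ * ∑ a ∈ F, φ a := by
  have hc : (F.card : ℝ) ≠ 0 := by exact_mod_cast hF.card_pos.ne'
  rw [affineMap_eq_linear_add, Finset.sum_congr rfl fun a _ => affineMap_eq_linear_add φ a,
    bary, map_smul, map_sum, Finset.sum_add_distrib]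
  simp only [smul_eq_mul, Finset.sum_const, nsmul_eq_mul]
  field_simp

theorem bary_mem_hull {d : ℕ} {F : Finset (Pt d)} (hF : F.Nonempty) : bary F ∈ hull F := by
  have hc : (F.card : ℝ) ≠ 0 := by exact_mod_cast hF.card_pos.ne'
  refine Finset.mem_convexHull'.2 ⟨fun _ => (F.card : ℝ)⁻¹, fun _ _ => by positivity, ?_, ?_⟩
  · simp [hc]
  · rw [bary, Finset.smul_sum]

/-- The barycentric coordinates of a simplex, as affine functions on the whole space. -/
theorem exists_barycentric {T : Finset (Pt (n + 1))}
    (hT : AffineIndependent ℝ ((↑) : T → Pt (n + 1))) (hc : T.card = n + 2) :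
    ∃ lam : Pt (n + 1) → (Pt (n + 1) →ᵃ[ℝ] ℝ),
      (∀ v ∈ T, ∀ w ∈ T, v ≠ w → lam v w = 0) ∧ (∀ v ∈ T, lam v v = 1) ∧
      (∀ x, ∑ v ∈ T, lam v x = 1) ∧ (∀ x, ∑ v ∈ T, lam v x • v = x) ∧
      (∀ x, x ∈ hull T ↔ ∀ v ∈ T, 0 ≤ lam v x) := by
  classical
  have htop : affineSpan ℝ (Set.range ((↑) : T → Pt (n + 1))) = ⊤ := by
    rw [hT.affineSpan_eq_top_iff_card_eq_finrank_add_one]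
    simp [hc]
  let b : AffineBasis T ℝ (Pt (n + 1)) := ⟨(↑), hT, htop⟩
  have hb : ∀ i, b i = i := fun i => rfl
  let lam : Pt (n + 1) → (Pt (n + 1) →ᵃ[ℝ] ℝ) := fun v =>
    if h : v ∈ T then b.coord ⟨v, h⟩ else 0
  have hl : ∀ v (h : v ∈ T), lam v = b.coord ⟨v, h⟩ := fun v h => by simp [lam, h]
  have hsum : ∀ x, ∑ v ∈ T, lam v x = 1 := by
    intro x
    rw [← b.sum_coord_apply_eq_one x, ← Finset.sum_coe_sort]
    exact Finset.sum_congr rfl fun i _ => by rw [hl i.1 i.2]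
  have hcomb : ∀ x, ∑ v ∈ T, lam v x • v = x := by
    intro x
    conv_rhs => rw [← b.linear_combination_coord_eq_self x]
    rw [← Finset.sum_coe_sort]
    exact Finset.sum_congr rfl fun i _ => by rw [hl i.1 i.2, hb]
  refine ⟨lam, fun v hv w hw hvw => ?_, fun v hv => ?_, hsum, hcomb, fun x => ?_⟩
  · rw [hl v hv]
    have := b.coord_apply_ne (i := ⟨v, hv⟩) (j := ⟨w, hw⟩) (fun h => hvw (congrArg Subtype.val h))
    exact this
  · rw [hl v hv]
    exact b.coord_apply_eq ⟨v, hv⟩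
  · have h1 : hull T = {x | ∀ i, 0 ≤ b.coord i x} := by
      rw [← b.convexHull_eq_nonneg_coord]
      change convexHull ℝ (T : Set (Pt (n + 1))) =
        convexHull ℝ (Set.range ((↑) : T → Pt (n + 1)))
      rw [Subtype.range_coe]
    rw [h1]
    constructor
    · intro h v hv
      rw [hl v hv]
      exact h _
    · intro h i
      have := h i.1 i.2
      rwa [hl i.1 i.2] at this

/-- An affine function with values in `[0, 1]` on a ball has a small gradient. -/
theorem abs_linear_le_of_ball {d : ℕ} (φ : Pt d →ᵃ[ℝ] ℝ) {x : Pt d} {r : ℝ} (hr : 0 < r)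
    (h : ∀ y ∈ Metric.closedBall x r, 0 ≤ φ y ∧ φ y ≤ 1) (v : Pt d) :
    |φ.linear v| ≤ ‖v‖ / (2 * r) := by
  rcases eq_or_ne v 0 with rfl | hv
  · simp
  have hv' : 0 < ‖v‖ := norm_pos_iff.2 hv
  have hn : ‖(r / ‖v‖) • v‖ = r := by
    rw [norm_smul, norm_div, norm_norm, Real.norm_of_nonneg hr.le]
    field_simp
  have h1 := h (x + (r / ‖v‖) • v) (by simp [hn])
  have h2 := h (x - (r / ‖v‖) • v) (by simp [hn])
  have e1 : φ (x + (r / ‖v‖) • v) = φ x + r / ‖v‖ * φ.linear v := by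
    rw [affineMap_eq_linear_add, affineMap_eq_linear_add φ x, map_add, map_smul, smul_eq_mul]
    ring
  have e2 : φ (x - (r / ‖v‖) • v) = φ x - r / ‖v‖ * φ.linear v := by
    rw [affineMap_eq_linear_add, affineMap_eq_linear_add φ x, map_sub, map_smul, smul_eq_mul]
    ring
  rw [e1] at h1
  rw [e2] at h2
  have h3 : |2 * (r / ‖v‖) * φ.linear v| ≤ 1 := by
    rw [abs_le]
    constructor <;> linarith [h1.1, h1.2, h2.1, h2.2]
  rw [abs_mul, abs_of_pos (by positivity)] at h3
  rw [le_div_iff₀ (by positivity)]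
  have h4 : 2 * (r / ‖v‖) * |φ.linear v| * ‖v‖ = |φ.linear v| * (2 * r) := by field_simp
  nlinarith

/-- The position of a simplex relative to one of its hyperfaces: up to the sign of `c`, the simplex
lies on the side `{inner ν (· - m) ≥ 0}`, and contains a half-ball around the barycentre `m` of the
hyperface. The last clause says that no proper face of the hyperface comes near its barycentre. -/
theorem exists_face_geometry {T F : Finset (Pt (n + 1))}
    (hT : AffineIndependent ℝ ((↑) : T → Pt (n + 1))) (hTc : T.card = n + 2)
    (hFT : F ⊆ T) (hFc : F.card = n + 1) {ν : Pt (n + 1)} (hν : ‖ν‖ = 1)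
    (horth : ∀ a ∈ F, ∀ b ∈ F, inner ℝ ν (a - b) = (0 : ℝ))
    {x : Pt (n + 1)} {r : ℝ} (hr : 0 < r) (hball : Metric.closedBall x r ⊆ hull T) :
    ∃ c : ℝ, c ≠ 0 ∧
      (∀ y ∈ hull T, 0 ≤ c * inner ℝ ν (y - bary F)) ∧
      (∀ y, ‖y - bary F‖ < 2 * r / (n + 1) → 0 ≤ c * inner ℝ ν (y - bary F) → y ∈ hull T) ∧
      (∀ y ∈ hyp (bary F) ν, ‖y - bary F‖ < 2 * r / (n + 1) → y ∈ hull F) ∧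
      (∀ y ∈ hyp (bary F) ν, ‖y - bary F‖ < 2 * r / (n + 1) → ∀ S ⊆ F, y ∈ hull S → S = F) := by
  classical
  obtain ⟨lam, hl0, hl1, hsum, hcomb, hhull⟩ := exists_barycentric hT hTc
  have hFne : F.Nonempty := Finset.card_pos.1 (by omega)
  obtain ⟨z, hz⟩ : ∃ z, T \ F = {z} := by
    rw [← Finset.card_eq_one, Finset.card_sdiff_of_subset hFT]
    omega
  have hzT : z ∈ T ∧ z ∉ F := by
    have : z ∈ T \ F := by rw [hz]; simp
    simpa using this
  have hTi : T = insert z F := by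
    rw [← Finset.sdiff_union_of_subset hFT, hz]
    rfl
  set m := bary F with hm
  have hle1 : ∀ y ∈ hull T, ∀ v ∈ T, lam v y ≤ 1 := by
    intro y hy v hv
    rw [← hsum y]
    exact Finset.single_le_sum (f := fun v => lam v y) (fun w hw => (hhull y).1 hy w hw) hv
  have hlin : ∀ v ∈ T, ∀ w, |(lam v).linear w| ≤ ‖w‖ / (2 * r) := fun v hv w =>
    abs_linear_le_of_ball (lam v) hr
      (fun y hy => ⟨(hhull y).1 (hball hy) v hv, hle1 y (hball hy) v hv⟩) w
  have hlm : ∀ v ∈ F, lam v m = 1 / (n + 1) := by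
    intro v hv
    rw [hm, affineMap_bary _ hFne, Finset.sum_eq_single v, hl1 v (hFT hv), hFc]
    · push_cast; ring
    · intro w hw hwv
      exact hl0 v (hFT hv) w (hFT hw) hwv.symm
    · exact fun h => absurd hv h
  -- the barycentric coordinates of the vertices of `F` are positive near the barycentre of `F`
  have hpos : ∀ y, ‖y - m‖ < 2 * r / (n + 1) → ∀ v ∈ F, 0 < lam v y := by
    intro y hy v hv
    have h1 : lam v y = lam v m + (lam v).linear (y - m) := by
      rw [affineMap_eq_linear_add, affineMap_eq_linear_add (lam v) m, map_sub]
      ring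
    have h2 := neg_abs_le ((lam v).linear (y - m))
    have h3 := hlin v (hFT hv) (y - m)
    have h4 : ‖y - m‖ / (2 * r) < 1 / (n + 1) := by
      rw [div_lt_iff₀ (by positivity)]
      calc ‖y - m‖ < 2 * r / (n + 1) := hy
        _ = _ := by ring
    rw [h1, hlm v hv]
    linarith
  have hνF : ∀ v ∈ F, (inner ℝ ν (v - m) : ℝ) = 0 := by
    intro v hv
    have hc : (F.card : ℝ) ≠ 0 := by exact_mod_cast hFne.card_pos.ne'
    have h1 : v - m = (F.card : ℝ)⁻¹ • ∑ a ∈ F, (v - a) := by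
      rw [hm, bary, Finset.sum_sub_distrib, smul_sub, Finset.sum_const, ← Nat.cast_smul_eq_nsmul ℝ,
        smul_smul, inv_mul_cancel₀ hc, one_smul]
    rw [h1, inner_smul_right, inner_sum, Finset.sum_eq_zero fun a ha => horth v hv a ha, mul_zero]
  -- the signed distance to the hyperplane is a multiple of the remaining barycentric coordinate
  have hdist : ∀ y, (inner ℝ ν (y - m) : ℝ) = lam z y * inner ℝ ν (z - m) := by
    intro y
    have h1 : y - m = ∑ v ∈ T, lam v y • (v - m) := by
      simp_rw [smul_sub]
      rw [Finset.sum_sub_distrib, hcomb, ← Finset.sum_smul, hsum, one_smul]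
    rw [h1, inner_sum, hTi, Finset.sum_insert hzT.2]
    simp_rw [inner_smul_right]
    rw [Finset.sum_eq_zero fun v hv => by rw [hνF v hv, mul_zero], add_zero]
  set c : ℝ := inner ℝ ν (z - m) with hc
  have hc0 : c ≠ 0 := by
    intro h0
    have h1 := hdist (m + ν)
    rw [h0, mul_zero, add_sub_cancel_left, real_inner_self_eq_norm_sq, hν] at h1
    norm_num at h1
  have hsub : ∀ S ⊆ F, ∀ y ∈ hull S, ∀ v ∈ F, v ∉ S → lam v y = 0 := by
    intro S hS y hy v hv hvS
    obtain ⟨w, hw0, hw1, hwy⟩ := Finset.mem_convexHull'.1 hy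
    have h1 : lam v y = ∑ a ∈ S, w a * lam v a := by
      rw [affineMap_eq_linear_add, ← hwy, map_sum,
        Finset.sum_congr rfl fun a _ => congrArg (w a * ·) (affineMap_eq_linear_add (lam v) a)]
      simp_rw [map_smul, mul_add, smul_eq_mul, Finset.sum_add_distrib, ← Finset.sum_mul]
      rw [hw1, one_mul]
    rw [h1]
    refine Finset.sum_eq_zero fun a ha => ?_
    rw [hl0 v (hFT hv) a (hFT (hS ha)) (fun h => hvS (h ▸ ha)), mul_zero]
  refine ⟨c, hc0, fun y hy => ?_, fun y hy hcy => ?_, fun y hyH hy => ?_,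
    fun y hyH hy S hS hyS => ?_⟩
  · rw [hdist]
    have := (hhull y).1 hy z hzT.1
    nlinarith [mul_nonneg this (mul_self_nonneg c)]
  · rw [hhull, hTi]
    intro v hv
    rcases Finset.mem_insert.1 hv with rfl | hv
    · rw [hdist] at hcy
      have h2 : 0 < c * c := mul_self_pos.2 hc0
      by_contra hneg
      push Not at hneg
      nlinarith
    · exact (hpos y hy v hv).le
  · have h0 : lam z y = 0 := by
      have h1 : (inner ℝ ν (y - m) : ℝ) = 0 := hyH
      rw [hdist] at h1
      exact (mul_eq_zero.1 h1).resolve_right hc0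
    refine Finset.mem_convexHull'.2 ⟨fun v => lam v y, fun v hv => (hpos y hy v hv).le, ?_, ?_⟩
    · have := hsum y
      rw [hTi, Finset.sum_insert hzT.2, h0, zero_add] at this
      exact this
    · have := hcomb y
      rw [hTi, Finset.sum_insert hzT.2, h0, zero_smul, zero_add] at this
      exact this
  · refine Finset.Subset.antisymm hS fun v hv => ?_
    by_contra hvS
    exact (hpos y hy v hv).ne' (hsub S hS y hyS v hv hvS)

theorem hull_subset_hyp {d : ℕ} {F : Finset (Pt d)} {ν : Pt d}
    (horth : ∀ a ∈ F, ∀ b ∈ F, inner ℝ ν (a - b) = (0 : ℝ)) (hF : F.Nonempty) :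
    hull F ⊆ hyp (bary F) ν := by
  have hc : (F.card : ℝ) ≠ 0 := by exact_mod_cast hF.card_pos.ne'
  have hconv : Convex ℝ (hyp (bary F) ν) := by
    intro x hx y hy a b _ _ hab
    have hx' : (inner ℝ ν (x - bary F) : ℝ) = 0 := hx
    have hy' : (inner ℝ ν (y - bary F) : ℝ) = 0 := hy
    change (inner ℝ ν (a • x + b • y - bary F) : ℝ) = 0
    have : a • x + b • y - bary F = a • (x - bary F) + b • (y - bary F) := by
      rw [smul_sub, smul_sub]
      nth_rewrite 1 [← one_smul ℝ (bary F)]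
      rw [← hab, add_smul]
      abel
    rw [this, inner_add_right, inner_smul_right, inner_smul_right, hx', hy']
    simp
  refine convexHull_min (fun v hv => ?_) hconv
  have h1 : v - bary F = (F.card : ℝ)⁻¹ • ∑ a ∈ F, (v - a) := by
    rw [bary, Finset.sum_sub_distrib, smul_sub, Finset.sum_const, ← Nat.cast_smul_eq_nsmul ℝ,
      smul_smul, inv_mul_cancel₀ hc, one_smul]
  change (inner ℝ ν (v - bary F) : ℝ) = 0
  rw [h1, inner_smul_right, inner_sum, Finset.sum_eq_zero fun a ha => horth v hv a ha, mul_zero]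

theorem isCompact_hull {d : ℕ} (s : Finset (Pt d)) : IsCompact (hull s) :=
  s.finite_toSet.isCompact_convexHull ℝ

theorem convex_hull {d : ℕ} (s : Finset (Pt d)) : Convex ℝ (hull s) := convex_convexHull ℝ _

theorem hull_mono {d : ℕ} {s t : Finset (Pt d)} (h : s ⊆ t) : hull s ⊆ hull t :=
  convexHull_mono (by exact_mod_cast h)

theorem norm_sub_le_diam {d : ℕ} (s : Finset (Pt d)) {x y : Pt d} (hx : x ∈ hull s)
    (hy : y ∈ hull s) : ‖x - y‖ ≤ Metric.diam (hull s) := by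
  rw [← dist_eq_norm]
  exact Metric.dist_le_diam_of_mem (isCompact_hull s).isBounded hx hy

end Simplex

/-! ### Elements and hyperfaces of a triangulation of a Lipschitz domain -/

section Mesh

/-- A Lipschitz domain lies on one side of its boundary. Hence a ball that is covered by elements
lies in the domain, and test functions supported there are admissible. -/
theorem interior_closure_subset {d : ℕ} {Ω : Set (Pt d)} (ho : IsOpen Ω)
    (hL : IsLipschitzDomain Ω) : interior (closure Ω) ⊆ Ω := by
  intro x hx
  by_contra hxΩ
  have hfr : x ∈ frontier Ω := by
    rw [ho.frontier_eq]
    exact ⟨interior_subset hx, hxΩ⟩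
  obtain ⟨ν, hν, U, hU, hxU, M, g, hg, hiff⟩ := hL x hfr
  have hνν : (inner ℝ ν ν : ℝ) = 1 := by rw [real_inner_self_eq_norm_sq, hν, one_pow]
  have hxg : (inner ℝ ν x : ℝ) ≤ g (x - inner ℝ ν x • ν) := by
    have := (hiff x hxU).not.1 hxΩ
    linarith
  have hcont : Continuous fun t : ℝ => x - t • ν := by fun_prop
  have hnhds : ∀ᶠ t in 𝓝 (0:ℝ), x - t • ν ∈ U ∩ interior (closure Ω) :=
    hcont.continuousAt.eventually (((hU.inter isOpen_interior).mem_nhds (by simpa using ⟨hxU, hx⟩)))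
  obtain ⟨t, ht, ht0⟩ := ((hnhds.filter_mono nhdsWithin_le_nhds).and
    (self_mem_nhdsWithin (a := (0:ℝ)) (s := Set.Ioi 0))).exists
  have ht0' : 0 < t := ht0
  -- slightly below a boundary point there are only points of the complement of `Ω`
  set y := x - t • ν with hy
  have hyi : (inner ℝ ν y : ℝ) = inner ℝ ν x - t := by
    rw [hy, inner_sub_right, inner_smul_right, hνν, mul_one]
  have hyP : y - (inner ℝ ν y : ℝ) • ν = x - (inner ℝ ν x : ℝ) • ν := by
    rw [hyi, hy, sub_smul]
    abel
  have hopen : IsOpen (U ∩ {w | (inner ℝ ν w : ℝ) < g (w - (inner ℝ ν w : ℝ) • ν)}) := by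
    refine hU.inter (isOpen_lt (by fun_prop) (hg.continuous.comp (by fun_prop)))
  have hyin : y ∈ U ∩ {w | (inner ℝ ν w : ℝ) < g (w - (inner ℝ ν w : ℝ) • ν)} := by
    refine ⟨ht.1, ?_⟩
    change (inner ℝ ν y : ℝ) < g (y - (inner ℝ ν y : ℝ) • ν)
    rw [hyP, hyi]
    linarith
  have hycl : y ∈ closure Ω := interior_subset ht.2
  obtain ⟨w, hw, hwΩ⟩ := mem_closure_iff.1 hycl _ hopen hyin
  have h1 := (hiff w hw.1).1 hwΩ
  have h2 : (inner ℝ ν w : ℝ) < g (w - (inner ℝ ν w : ℝ) • ν) := hw.2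
  linarith

variable {n : ℕ} {Ω : Set (Pt (n + 1))} (𝒯 : Triangulation Ω)

theorem Cell.set_subset_closure {𝒯 : Triangulation Ω} (T : Cell 𝒯) : T.set ⊆ closure Ω := by
  rw [← 𝒯.space_eq]
  exact 𝒯.K.convexHull_subset_space T.2.1

theorem Cell.measurableSet {𝒯 : Triangulation Ω} (T : Cell 𝒯) : MeasurableSet T.set :=
  (isCompact_hull T.1).measurableSet

theorem Cell.ball_subset (ho : IsOpen Ω) (hL : IsLipschitzDomain Ω) {𝒯 : Triangulation Ω}
    (T : Cell 𝒯) {x : Pt (n + 1)} {r : ℝ} (h : Metric.ball x r ⊆ T.set) : Metric.ball x r ⊆ Ω := by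
  refine Set.Subset.trans ?_ (interior_closure_subset ho hL)
  exact interior_maximal (h.trans T.set_subset_closure) Metric.isOpen_ball

theorem Cell.volume_diff (ho : IsOpen Ω) (hL : IsLipschitzDomain Ω) {𝒯 : Triangulation Ω}
    (T : Cell 𝒯) : volume (T.set \ Ω) = 0 := by
  have h1 : T.set \ Ω ⊆ frontier T.set := by
    intro x hx
    have hcl : closure T.set = T.set := (isCompact_hull T.1).isClosed.closure_eq
    rw [frontier, hcl]
    refine ⟨hx.1, fun h => hx.2 (interior_closure_subset ho hL ?_)⟩
    exact interior_mono T.set_subset_closure h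
  exact measure_mono_null h1 ((convex_hull T.1).addHaar_frontier volume)

theorem restrict_cell_le (ho : IsOpen Ω) (hL : IsLipschitzDomain Ω)
    {𝒯 : Triangulation Ω} (T : Cell 𝒯) : volume.restrict T.set ≤ volume.restrict Ω := by
  rw [Measure.restrict_congr_set (s := T.set) (t := T.set ∩ Ω)]
  · exact Measure.restrict_mono Set.inter_subset_right le_rfl
  · have h0 := T.volume_diff ho hL
    filter_upwards [measure_eq_zero_iff_ae_notMem.1 h0] with x hx
    refine propext ⟨fun h => ⟨h, ?_⟩, fun h => h.1⟩
    by_contra hxΩ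
    exact hx ⟨h, hxΩ⟩

theorem Cell.inL2 (ho : IsOpen Ω) (hL : IsLipschitzDomain Ω) {𝒯 : Triangulation Ω}
    (T : Cell 𝒯) {g : Pt (n + 1) → ℝ} (hg : InL2 Ω g) : InL2 T.set g :=
  MemLp.mono_measure (restrict_cell_le ho hL T) hg

theorem exists_cell_of_mem_closure {x : Pt (n + 1)} (hx : x ∈ closure Ω) :
    ∃ T : Cell 𝒯, x ∈ T.set := by
  rw [← 𝒯.space_eq] at hx
  obtain ⟨s, hs, hxs⟩ := Geometry.SimplicialComplex.mem_space_iff.1 hx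
  obtain ⟨T, hT, hsT, hc⟩ := 𝒯.pure s hs
  exact ⟨⟨T, hT, hc⟩, hull_mono hsT hxs⟩

/-- The local geometry at a hyperface `F`: `m` is a point of `F`, `ν` a unit normal that points into
`plus F`, and the ball of radius `ρ` around `m` consists of a disc contained in `F`, a half-ball in
`plus F` and a half-ball in `minus F`; if `F` is a boundary face, the disc lies outside of `Ω`. -/
structure FacePatch {𝒯 : Triangulation Ω} (o : Labelling 𝒯) (F : Face 𝒯) (m ν : Pt (n + 1))
    (ρ : ℝ) : Prop where
  norm_eq : ‖ν‖ = 1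
  normal_eq : ν = o.normal F ∨ ν = -o.normal F
  pos : 0 < ρ
  subset : F.set ⊆ Metric.closedBall m F.h ∩ hyp m ν
  disc_subset : Metric.ball m ρ ∩ hyp m ν ⊆ F.set
  plus_subset : Metric.ball m ρ ∩ upper m ν ⊆ (o.plus F).set
  minus_subset : ∀ T, o.minus F = some T → Metric.ball m ρ ∩ upper m (-ν) ⊆ T.set
  ball_subset : ∀ T, o.minus F = some T → Metric.ball m ρ ⊆ Ω
  boundary : o.minus F = none → ∀ x ∈ Metric.ball m ρ ∩ hyp m ν, x ∉ Ω

theorem Face.h_pos (hn : 1 ≤ n) {𝒯 : Triangulation Ω} (F : Face 𝒯) : 0 < F.h := by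
  have hc : 1 < F.1.card := by rw [F.2.2]; omega
  obtain ⟨a, ha, b, hb, hab⟩ := Finset.one_lt_card.1 hc
  have h1 := norm_sub_le_diam F.1 (subset_convexHull ℝ _ (Finset.mem_coe.2 ha))
    (subset_convexHull ℝ _ (Finset.mem_coe.2 hb))
  exact (norm_pos_iff.2 (sub_ne_zero.2 hab)).trans_le h1

theorem Face.h_le {𝒯 : Triangulation Ω} {F : Face 𝒯} {T : Cell 𝒯} (h : F.1 ⊆ T.1) :
    F.h ≤ T.h :=
  Metric.diam_mono (hull_mono h) (isCompact_hull T.1).isBounded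

/-- A lower bound for the ratio between the radius of the ball around the barycentre of a hyperface
in `FacePatch` and the diameter of the hyperface. -/
def patchRatio (n : ℕ) (σ : ℝ) : ℝ := min 1 (1 / (σ * (n + 1)))

/-- The hyperfaces of a shape-regular triangulation of a Lipschitz domain have patches of comparable
size around their barycentres. A hyperface has a positive diameter for `n ≥ 1`, which forces the
shape-regularity parameter to be positive. -/
theorem exists_facePatch (hn : 1 ≤ n) (ho : IsOpen Ω) (hL : IsLipschitzDomain Ω)
    {𝒯 : Triangulation Ω} {σ : ℝ} (hσ : ShapeRegular 𝒯 σ) (o : Labelling 𝒯) (F : Face 𝒯) :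
    0 < σ ∧ ∃ m ν, FacePatch o F m ν (patchRatio n σ * F.h) := by
  classical
  have hh := F.h_pos hn
  have hFne : F.1.Nonempty := Finset.card_pos.1 (by rw [F.2.2]; omega)
  have hσ0 : 0 < σ := by
    obtain ⟨x, r, hr, -, h2⟩ := hσ (o.plus F)
    have h3 := Face.h_le (o.subset_plus F)
    by_contra hneg
    push Not at hneg
    nlinarith
  refine ⟨hσ0, ?_⟩
  set N := o.normal F
  set m := bary F.1 with hm
  set ρ := patchRatio n σ * F.h with hρ
  have hθ : 0 < patchRatio n σ := lt_min one_pos (by positivity)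
  have hρ0 : 0 < ρ := mul_pos hθ hh
  have geo : ∀ T : Cell 𝒯, F.1 ⊆ T.1 → ∃ c : ℝ, c ≠ 0 ∧
      (∀ y ∈ T.set, 0 ≤ c * inner ℝ N (y - m)) ∧
      (∀ y, ‖y - m‖ < ρ → 0 ≤ c * inner ℝ N (y - m) → y ∈ T.set) ∧
      (∀ y ∈ hyp m N, ‖y - m‖ < ρ → y ∈ F.set) ∧
      (∀ y ∈ hyp m N, ‖y - m‖ < ρ → ∀ S ⊆ F.1, y ∈ hull S → S = F.1) := by
    intro T hFT
    obtain ⟨x, r, hr, h1, h2⟩ := hσ T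
    have h3 := Face.h_le hFT
    have hle : ρ ≤ 2 * r / (n + 1) := by
      calc ρ ≤ 1 / (σ * (n + 1)) * F.h := by
            rw [hρ]; gcongr; exact min_le_right _ _
        _ ≤ 1 / (σ * (n + 1)) * (σ * (2 * r)) := by gcongr; exact h3.trans h2
        _ = _ := by field_simp
    obtain ⟨c, hc, g1, g2, g3, g4⟩ := exists_face_geometry (𝒯.K.indep T.2.1) T.2.2 hFT F.2.2
      (o.norm_normal F) (o.normal_orth F) hr h1
    exact ⟨c, hc, g1, fun y hy => g2 y (hy.trans_le hle), fun y hyH hy => g3 y hyH (hy.trans_le hle),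
      fun y hyH hy => g4 y hyH (hy.trans_le hle)⟩
  obtain ⟨c, hc, g1, g2, g3, g4⟩ := geo (o.plus F) (o.subset_plus F)
  -- choose the sign of the normal such that it points into `plus F`
  obtain ⟨s, hs1, hsc⟩ : ∃ s : ℝ, (s = 1 ∨ s = -1) ∧ 0 < c * s := by
    rcases lt_or_gt_of_ne hc with h | h
    · exact ⟨-1, Or.inr rfl, by linarith⟩
    · exact ⟨1, Or.inl rfl, by linarith⟩
  have hss : s * s = 1 := by rcases hs1 with h | h <;> rw [h] <;> norm_num
  set ν := s • N with hν
  have hin : ∀ w : Pt (n + 1), (inner ℝ ν w : ℝ) = s * inner ℝ N w := fun w => by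
    rw [hν, inner_smul_left]; rfl
  have hinN : ∀ w : Pt (n + 1), (inner ℝ N w : ℝ) = s * inner ℝ ν w := fun w => by
    rw [hin, ← mul_assoc, hss, one_mul]
  have hνn : ‖ν‖ = 1 := by
    rw [hν, norm_smul, o.norm_normal F, mul_one]
    rcases hs1 with h | h <;> rw [h] <;> norm_num
  have hhyp : hyp m ν = hyp m N := by
    ext x
    constructor
    · intro h
      have h' : (inner ℝ ν (x - m) : ℝ) = 0 := h
      change (inner ℝ N (x - m) : ℝ) = 0
      rw [hinN, h', mul_zero]
    · intro h
      have h' : (inner ℝ N (x - m) : ℝ) = 0 := h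
      change (inner ℝ ν (x - m) : ℝ) = 0
      rw [hin, h', mul_zero]
  have hmF : m ∈ F.set := bary_mem_hull hFne
  have hball : ∀ {y}, y ∈ Metric.ball m ρ → ‖y - m‖ < ρ := fun hy => by
    simpa [dist_eq_norm] using hy
  have hνν : (inner ℝ ν ν : ℝ) = 1 := by rw [real_inner_self_eq_norm_sq, hνn, one_pow]
  have hplus : Metric.ball m ρ ∩ upper m ν ⊆ (o.plus F).set := by
    intro y hy
    refine g2 y (hball hy.1) ?_
    have h1 : 0 < (inner ℝ ν (y - m) : ℝ) := hy.2
    rw [hinN, ← mul_assoc]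
    positivity
  have hFsub : F.set ⊆ Metric.closedBall m F.h ∩ hyp m ν := by
    intro y hy
    refine ⟨?_, ?_⟩
    · rw [mem_closedBall_iff_norm]
      exact norm_sub_le_diam F.1 hy hmF
    · rw [hhyp]
      exact hull_subset_hyp (o.normal_orth F) hFne hy
  have hdisc : Metric.ball m ρ ∩ hyp m ν ⊆ F.set := fun y hy =>
    g3 y (by rw [← hhyp]; exact hy.2) (hball hy.1)
  have hminus : ∀ T, o.minus F = some T → Metric.ball m ρ ∩ upper m (-ν) ⊆ T.set := by
    intro T hT
    obtain ⟨hFT, hne⟩ := (o.minus_iff F T).1 hT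
    obtain ⟨c', hc', k1, k2, k3, k4⟩ := geo T hFT
    -- two elements on the same side of `F` would overlap
    have hsign : c' * s < 0 := by
      by_contra hnn
      push Not at hnn
      have hpos : 0 < c' * s := lt_of_le_of_ne hnn (by
        rcases hs1 with h | h <;> rw [h] <;> simpa [eq_comm] using hc')
      set y := m + (ρ / 2) • ν with hy
      have hyν : (inner ℝ ν (y - m) : ℝ) = ρ / 2 := by
        rw [hy, add_sub_cancel_left, inner_smul_right, hνν, mul_one]
      have hyn : ‖y - m‖ < ρ := by
        rw [hy, add_sub_cancel_left, norm_smul, hνn, mul_one, Real.norm_of_nonneg (by positivity)]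
        linarith
      have y1 : y ∈ (o.plus F).set := g2 y hyn (by rw [hinN, hyν, ← mul_assoc]; positivity)
      have y2 : y ∈ T.set := k2 y hyn (by rw [hinN, hyν, ← mul_assoc]; positivity)
      have y3 := 𝒯.K.inter_subset_convexHull (o.plus F).2.1 T.2.1 ⟨y1, y2⟩
      have hint : (o.plus F).1 ∩ T.1 = F.1 := by
        symm
        refine Finset.eq_of_subset_of_card_le (Finset.subset_inter (o.subset_plus F) hFT) ?_
        rw [F.2.2]
        by_contra hlt
        push Not at hlt
        have e1 : (o.plus F).1 ∩ T.1 = (o.plus F).1 :=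
          Finset.eq_of_subset_of_card_le Finset.inter_subset_left (by
            rw [(o.plus F).2.2]; omega)
        have e2 : (o.plus F).1 ∩ T.1 = T.1 :=
          Finset.eq_of_subset_of_card_le Finset.inter_subset_right (by
            rw [T.2.2]; omega)
        exact hne (Subtype.ext (e2.symm.trans e1))
      rw [← Finset.coe_inter, hint] at y3
      have h4 : (inner ℝ ν (y - m) : ℝ) = 0 := (hFsub y3).2
      linarith
    intro y hy
    refine k2 y (hball hy.1) ?_
    have h1 : 0 < (inner ℝ (-ν) (y - m) : ℝ) := hy.2
    rw [inner_neg_left] at h1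
    rw [hinN, ← mul_assoc]
    nlinarith
  refine ⟨m, ν, hνn, ?_, hρ0, hFsub, hdisc, hplus, hminus, fun T hT => ?_, fun hnone x hx hxΩ => ?_⟩
  · rcases hs1 with h | h
    · left; rw [hν, h, one_smul]
    · right; rw [hν, h, neg_one_smul]
  · refine Set.Subset.trans ?_ (interior_closure_subset ho hL)
    refine interior_maximal (fun y hy => ?_) Metric.isOpen_ball
    rcases lt_trichotomy (inner ℝ ν (y - m) : ℝ) 0 with h | h | h
    · refine T.set_subset_closure (hminus T hT ⟨hy, ?_⟩)
      change 0 < (inner ℝ (-ν) (y - m) : ℝ)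
      rw [inner_neg_left]
      linarith
    · exact (o.plus F).set_subset_closure
        (hull_mono (o.subset_plus F) (hdisc ⟨hy, h⟩))
    · exact (o.plus F).set_subset_closure (hplus ⟨hy, h⟩)
  · -- points of `Ω` just across `F` belong to another element, which then contains `F`
    let A : Set (Pt (n + 1)) := ⋃ T : {T : Cell 𝒯 // T ≠ o.plus F}, T.1.set
    have hA : IsClosed A := isClosed_iUnion_of_finite fun T => (isCompact_hull T.1.1).isClosed
    have hxA : x ∈ A := by
      have hcont : Continuous fun t : ℝ => x - t • ν := by fun_prop
      have h1 : ∀ᶠ t in 𝓝[>] (0:ℝ), x - t • ν ∈ A := by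
        have h2 : ∀ᶠ t in 𝓝 (0:ℝ), x - t • ν ∈ Ω :=
          hcont.continuousAt.eventually (ho.mem_nhds (by simpa using hxΩ))
        filter_upwards [h2.filter_mono nhdsWithin_le_nhds, self_mem_nhdsWithin] with t ht ht0
        obtain ⟨T, hT⟩ := exists_cell_of_mem_closure 𝒯 (subset_closure ht)
        refine Set.mem_iUnion.2 ⟨⟨T, fun hTe => ?_⟩, hT⟩
        have h3 := g1 _ (hTe ▸ hT)
        have hxν : (inner ℝ ν (x - m) : ℝ) = 0 := hx.2
        rw [hinN, sub_right_comm, inner_sub_right, hxν, inner_smul_right, hνν, ← mul_assoc] at h3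
        have ht0' : 0 < t := ht0
        nlinarith [mul_pos hsc ht0']
      have h2 : Tendsto (fun t : ℝ => x - t • ν) (𝓝[>] 0) (𝓝 x) := by
        have := (hcont.tendsto 0).mono_left (nhdsWithin_le_nhds (s := Set.Ioi 0))
        simpa using this
      exact hA.mem_of_tendsto h2 h1
    obtain ⟨⟨T, hTne⟩, hxT⟩ := Set.mem_iUnion.1 hxA
    have h3 := 𝒯.K.inter_subset_convexHull F.2.1 T.2.1 ⟨hdisc hx, hxT⟩
    rw [← Finset.coe_inter] at h3
    have h4 := g4 x (by rw [← hhyp]; exact hx.2) (hball hx.1) _ Finset.inter_subset_left h3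
    have h5 : o.minus F = some T :=
      (o.minus_iff F T).2 ⟨by rw [← h4]; exact Finset.inter_subset_right, hTne⟩
    rw [hnone] at h5
    exact Option.some_ne_none _ h5.symm

end Mesh



/-! ### Two-sided trace estimates for jumps -/

section Traces

variable {n : ℕ}

theorem hyp_neg {d : ℕ} (m ν : Pt d) : hyp m (-ν) = hyp m ν := by
  ext x
  simp [hyp, inner_neg_left]

theorem cut_neg {d : ℕ} (m ν : Pt d) (ρ δ : ℝ) : cut m (-ν) ρ δ = cut m ν ρ δ := by
  have h : anisoMap (-ν) ρ δ = anisoMap ν ρ δ := by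
    ext1 z
    rw [anisoMap_apply, anisoMap_apply]
    simp only [inner_neg_left, smul_neg, neg_smul, mul_neg, neg_neg]
  funext x
  simp only [cut, h]

theorem volume_halfBall_ne_zero {m ν : Pt (n + 1)} (hν : ‖ν‖ = 1) {ρ : ℝ} (hρ : 0 < ρ) :
    volume (Metric.ball m ρ ∩ upper m ν) ≠ 0 := by
  refine ((Metric.isOpen_ball.inter (isOpen_upper m ν)).measure_pos volume ?_).ne'
  refine ⟨m + (ρ / 2) • ν, ?_, ?_⟩
  · rw [mem_ball_iff_norm, add_sub_cancel_left, norm_smul, hν, Real.norm_of_nonneg (by positivity)]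
    linarith
  · change 0 < (inner ℝ ν (m + (ρ / 2) • ν - m) : ℝ)
    rw [add_sub_cancel_left, inner_smul_right, real_inner_self_eq_norm_sq, hν]
    positivity

theorem convex_upper {d : ℕ} (m ν : Pt d) : Convex ℝ (upper m ν) := by
  intro x hx y hy a b ha hb hab
  have hx' : 0 < (inner ℝ ν (x - m) : ℝ) := hx
  have hy' : 0 < (inner ℝ ν (y - m) : ℝ) := hy
  change 0 < (inner ℝ ν (a • x + b • y - m) : ℝ)
  have h : a • x + b • y - m = a • (x - m) + b • (y - m) := by
    rw [smul_sub, smul_sub]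
    nth_rewrite 1 [← one_smul ℝ m]
    rw [← hab, add_smul]
    abel
  rw [h, inner_add_right, inner_smul_right, inner_smul_right]
  rcases ha.eq_or_lt with rfl | ha'
  · have : b = 1 := by linarith
    rw [this]; linarith
  · have := mul_nonneg hb hy'.le
    have := mul_pos ha' hx'
    linarith

theorem integrableOn_of_isBounded {d : ℕ} {Z : Set (Pt d)} (hZ : Bornology.IsBounded Z)
    {g : Pt d → ℝ} (hg : Continuous g) : IntegrableOn g Z := by
  obtain ⟨r, hr⟩ := hZ.subset_closedBall 0
  exact (hg.continuousOn.integrableOn_compact (isCompact_closedBall 0 r)).mono_set hr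

/-- A trace estimate for a polynomial that is, on the hyperplane, the difference of two functions
which are controlled on opposite half-balls. -/
theorem exists_two_sided_bound (n N : ℕ) (K : ℝ) (hK : 0 ≤ K) : ∃ C : ℝ, 0 < C ∧
    ∀ P : PolyD (n + 1), P.totalDegree ≤ N → ∀ (m ν : Pt (n + 1)) (ρ η : ℝ), ‖ν‖ = 1 →
    0 < ρ → 0 < η → ∀ g₁ g₂ : Pt (n + 1) → ℝ, ContDiff ℝ ((⊤ : ℕ∞) : WithTop ℕ∞) g₁ →
    ContDiff ℝ ((⊤ : ℕ∞) : WithTop ℕ∞) g₂ →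
    (∀ x ∈ Metric.ball m ρ ∩ hyp m ν, pev P x = g₁ x - g₂ x) →
    ∀ S ⊆ Metric.closedBall m (K * ρ) ∩ hyp m ν, MeasurableSet S →
    ∫ x in S, pev P x ^ 2 ∂μHE[n] ≤
      C * (η * ((∫ x in Metric.ball m ρ ∩ upper m ν, ∑ i, pd i g₁ x ^ 2)
          + ∫ x in Metric.ball m ρ ∩ upper m (-ν), ∑ i, pd i g₂ x ^ 2)
        + (1 / η + 1 / ρ) * ((∫ x in Metric.ball m ρ ∩ upper m ν, g₁ x ^ 2)
          + ∫ x in Metric.ball m ρ ∩ upper m (-ν), g₂ x ^ 2)) := by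
  obtain ⟨C1, hC1, h1⟩ := exists_hyp_integral_bound n N (2 * K) (by positivity)
  obtain ⟨C2, hC2, h2⟩ := exists_trace_bound n
  refine ⟨2 * C1 * (1 + C2), by positivity, fun P hP m ν ρ η hν hρ hη g₁ g₂ hg₁ hg₂ hPg S hS hSm => ?_⟩
  have hcut := contDiff_cut m ν ρ ρ
  have hts := (tsupport_cut_subset (m := m) hν hρ le_rfl).trans (slab_subset_ball (ν := ν) (δ := ρ) hρ)
  have hcs : HasCompactSupport (cut m ν ρ ρ) :=
    HasCompactSupport.of_support_subset_isCompact (isCompact_slab m ν ρ ρ)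
      ((subset_tsupport _).trans (tsupport_cut_subset hν hρ le_rfl))
  have hint : ∀ g : Pt (n + 1) → ℝ, Continuous g →
      IntegrableOn (fun x => cut m ν ρ ρ x * g x ^ 2) (hyp m ν) (μHE[n]) := fun g hg =>
    integrableOn_hyp_of_hasCompactSupport hν (hcut.continuous.mul (hg.pow 2)) hcs.mul_right
  have hnn : ∀ g : Pt (n + 1) → ℝ, ∀ x, 0 ≤ cut m ν ρ ρ x * g x ^ 2 := fun g x =>
    mul_nonneg (cut_nonneg _ _ _ _ _) (sq_nonneg _)
  -- the cut-off function is one on the ball of half the radius, which suffices for polynomials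
  have e1 := h1 P hP m ν (ρ / 2) hν (by positivity) S (by
    rw [show 2 * K * (ρ / 2) = K * ρ by ring]; exact hS) hSm
  have hmH : MeasurableSet (Metric.ball m (ρ / 2) ∩ hyp m ν) :=
    Metric.isOpen_ball.measurableSet.inter (isClosed_hyp m ν).measurableSet
  have e2 : ∫ y in Metric.ball m (ρ / 2) ∩ hyp m ν, pev P y ^ 2 ∂μHE[n]
      ≤ ∫ x in hyp m ν, cut m ν ρ ρ x * pev P x ^ 2 ∂μHE[n] := by
    rw [setIntegral_congr_fun (g := fun x => cut m ν ρ ρ x * pev P x ^ 2) hmH]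
    · exact setIntegral_mono_set (hint _ (continuous_pev P))
        (Eventually.of_forall (hnn _)) (Set.inter_subset_right.eventuallyLE)
    · intro x hx
      have hx' : ‖x - m‖ ≤ ρ / 2 := by
        have := hx.1
        rw [mem_ball_iff_norm] at this
        exact this.le
      change pev P x ^ 2 = cut m ν ρ ρ x * pev P x ^ 2
      rw [cut_eq_one_of_isotropic hν hρ hx', one_mul]
  have e3 : ∫ x in hyp m ν, cut m ν ρ ρ x * pev P x ^ 2 ∂μHE[n]
      ≤ 2 * (∫ x in hyp m ν, cut m ν ρ ρ x * g₁ x ^ 2 ∂μHE[n])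
        + 2 * ∫ x in hyp m ν, cut m ν ρ ρ x * g₂ x ^ 2 ∂μHE[n] := by
    rw [← integral_const_mul, ← integral_const_mul,
      ← integral_add ((hint _ hg₁.continuous).const_mul 2) ((hint _ hg₂.continuous).const_mul 2)]
    refine setIntegral_mono_on (hint _ (continuous_pev P))
      (((hint _ hg₁.continuous).const_mul 2).add ((hint _ hg₂.continuous).const_mul 2))
      (isClosed_hyp m ν).measurableSet fun x hx => ?_
    by_cases hxb : x ∈ Metric.ball m ρ
    · rw [hPg x ⟨hxb, hx⟩]
      have h0 := cut_nonneg m ν ρ ρ x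
      have : (g₁ x - g₂ x) ^ 2 ≤ 2 * g₁ x ^ 2 + 2 * g₂ x ^ 2 := by
        nlinarith [sq_nonneg (g₁ x + g₂ x)]
      calc _ ≤ cut m ν ρ ρ x * (2 * g₁ x ^ 2 + 2 * g₂ x ^ 2) := by gcongr
        _ = _ := by ring
    · have : cut m ν ρ ρ x = 0 := image_eq_zero_of_notMem_tsupport fun h => hxb (hts h)
      rw [this]
      simp
  have e4 := h2 m ν ρ η hν hρ hη g₁ hg₁
  have e5 := h2 m (-ν) ρ η (by rwa [norm_neg]) hρ hη g₂ hg₂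
  rw [cut_neg, hyp_neg] at e5
  set A₁ := ∫ x in Metric.ball m ρ ∩ upper m ν, ∑ i, pd i g₁ x ^ 2
  set A₂ := ∫ x in Metric.ball m ρ ∩ upper m (-ν), ∑ i, pd i g₂ x ^ 2
  set B₁ := ∫ x in Metric.ball m ρ ∩ upper m ν, g₁ x ^ 2 with hB₁
  set B₂ := ∫ x in Metric.ball m ρ ∩ upper m (-ν), g₂ x ^ 2 with hB₂
  have hA₁ : 0 ≤ A₁ := integral_nonneg fun x => Finset.sum_nonneg fun i _ => sq_nonneg _
  have hA₂ : 0 ≤ A₂ := integral_nonneg fun x => Finset.sum_nonneg fun i _ => sq_nonneg _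
  have hB₁0 : 0 ≤ B₁ := integral_nonneg fun x => sq_nonneg _
  have hB₂0 : 0 ≤ B₂ := integral_nonneg fun x => sq_nonneg _
  have e6 : (1 / η + C2 / ρ) * (B₁ + B₂) ≤ (1 + C2) * ((1 / η + 1 / ρ) * (B₁ + B₂)) := by
    rw [← mul_assoc]
    gcongr
    have : (1 + C2) * (1 / η + 1 / ρ) = 1 / η + C2 / ρ + (C2 / η + 1 / ρ) := by ring
    rw [this]
    have : 0 ≤ C2 / η + 1 / ρ := by positivity
    linarith
  have e7 : η * (A₁ + A₂) ≤ (1 + C2) * (η * (A₁ + A₂)) :=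
    le_mul_of_one_le_left (by positivity) (by linarith)
  calc ∫ x in S, pev P x ^ 2 ∂μHE[n]
      ≤ C1 * (2 * (η * A₁ + (1 / η + C2 / ρ) * B₁) + 2 * (η * A₂ + (1 / η + C2 / ρ) * B₂)) := by
        refine e1.trans (mul_le_mul_of_nonneg_left (e2.trans (e3.trans ?_)) hC1.le)
        linarith
    _ = 2 * C1 * (η * (A₁ + A₂) + (1 / η + C2 / ρ) * (B₁ + B₂)) := by ring
    _ ≤ 2 * C1 * ((1 + C2) * (η * (A₁ + A₂)) + (1 + C2) * ((1 / η + 1 / ρ) * (B₁ + B₂))) := by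
        gcongr
    _ = _ := by ring

/-- Up to an additive constant, a jump is controlled by the gradients on both sides alone. -/
theorem exists_two_sided_poincare (n N : ℕ) (K : ℝ) (hK : 0 ≤ K) : ∃ C : ℝ, 0 < C ∧
    ∀ P : PolyD (n + 1), P.totalDegree ≤ N → ∀ (m ν : Pt (n + 1)) (ρ : ℝ), ‖ν‖ = 1 →
    0 < ρ → ∀ g₁ g₂ : Pt (n + 1) → ℝ, ContDiff ℝ ((⊤ : ℕ∞) : WithTop ℕ∞) g₁ →
    ContDiff ℝ ((⊤ : ℕ∞) : WithTop ℕ∞) g₂ →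
    (∀ x ∈ Metric.ball m ρ ∩ hyp m ν, pev P x = g₁ x - g₂ x) →
    ∀ S ⊆ Metric.closedBall m (K * ρ) ∩ hyp m ν, MeasurableSet S →
    ∃ k : ℝ, ∫ x in S, (pev P x - k) ^ 2 ∂μHE[n] ≤
      C * (ρ * ((∫ x in Metric.ball m ρ ∩ upper m ν, ∑ i, pd i g₁ x ^ 2)
          + ∫ x in Metric.ball m ρ ∩ upper m (-ν), ∑ i, pd i g₂ x ^ 2)) := by
  obtain ⟨C, hC, h⟩ := exists_two_sided_bound n N K hK
  refine ⟨C * (1 + 2 * (2 ^ (n + 1) * 4)), by positivity,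
    fun P hP m ν ρ hν hρ g₁ g₂ hg₁ hg₂ hPg S hS hSm => ?_⟩
  -- the Poincaré inequality on each of the half-balls, followed by the trace estimate with `η = ρ`
  have poin : ∀ w : Pt (n + 1), ‖w‖ = 1 → ∀ g : Pt (n + 1) → ℝ,
      ContDiff ℝ ((⊤ : ℕ∞) : WithTop ℕ∞) g → ∃ c : ℝ,
      ∫ x in Metric.ball m ρ ∩ upper m w, (g x - c) ^ 2
        ≤ 2 ^ (n + 1) * (2 * ρ) ^ 2 * ∫ x in Metric.ball m ρ ∩ upper m w, ∑ i, pd i g x ^ 2 := by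
    intro w hw g hg
    refine exists_poincare ((convex_ball m ρ).inter (convex_upper m w))
      (Metric.isOpen_ball.inter (isOpen_upper m w)).measurableSet
      (Metric.isBounded_ball.subset Set.inter_subset_left)
      (volume_halfBall_ne_zero hw hρ) (fun x hx y hy => ?_) hg
    have h1 := hx.1
    have h2 := hy.1
    rw [Metric.mem_ball] at h1 h2
    rw [← dist_eq_norm]
    linarith [dist_triangle_right x y m]
  obtain ⟨c₁, hc₁⟩ := poin ν hν g₁ hg₁
  obtain ⟨c₂, hc₂⟩ := poin (-ν) (by rwa [norm_neg]) g₂ hg₂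
  refine ⟨c₁ - c₂, ?_⟩
  have hdeg : (P - MvPolynomial.C (c₁ - c₂)).totalDegree ≤ N := by
    refine (MvPolynomial.totalDegree_sub _ _).trans ?_
    rw [MvPolynomial.totalDegree_C]
    exact max_le hP (Nat.zero_le _)
  have h0 := h (P - MvPolynomial.C (c₁ - c₂)) hdeg m ν ρ ρ hν hρ hρ
    (fun x => g₁ x - c₁) (fun x => g₂ x - c₂) (hg₁.sub contDiff_const) (hg₂.sub contDiff_const)
    (fun x hx => by rw [pev_sub, pev_C, hPg x hx]; ring) S hS hSm
  have pdc : ∀ (g : Pt (n + 1) → ℝ), ContDiff ℝ ((⊤ : ℕ∞) : WithTop ℕ∞) g → ∀ (c : ℝ) i,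
      pd i (fun x => g x - c) = pd i g := by
    intro g hg c i
    rw [pd_sub hg.differentiable_of_top (differentiable_const c), pd_const]
    simp
  simp only [pev_sub, pev_C, pdc g₁ hg₁, pdc g₂ hg₂] at h0
  refine h0.trans ?_
  set A₁ := ∫ x in Metric.ball m ρ ∩ upper m ν, ∑ i, pd i g₁ x ^ 2
  set A₂ := ∫ x in Metric.ball m ρ ∩ upper m (-ν), ∑ i, pd i g₂ x ^ 2
  calc _ ≤ C * (ρ * (A₁ + A₂) + (1 / ρ + 1 / ρ) *
        (2 ^ (n + 1) * (2 * ρ) ^ 2 * A₁ + 2 ^ (n + 1) * (2 * ρ) ^ 2 * A₂)) := by gcongr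
    _ = _ := by field_simp; ring

end Traces

/-! ### Passage to the limit in local errors -/

section Limits

theorem setIntegral_sq_eq_eLpNorm {d : ℕ} {S : Set (Pt d)} {g : Pt d → ℝ} (hg : InL2 S g) :
    ∫ x in S, g x ^ 2 = (eLpNorm g 2 (volume.restrict S)).toReal ^ 2 := by
  replace hg : MemLp g 2 (volume.restrict S) := hg
  have h1 : (eLpNorm g 2 (volume.restrict S)).toReal = ‖hg.toLp g‖ := by
    rw [Lp.norm_toLp]
  rw [h1, ← real_inner_self_eq_norm_sq, L2.inner_def]
  refine integral_congr_ae ?_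
  filter_upwards [hg.coeFn_toLp] with x hx
  rw [hx]
  simp [sq]

theorem TendstoL2.integral_sub_sq {d : ℕ} {S Z : Set (Pt d)} {φ : ℕ → Pt d → ℝ} {g q : Pt d → ℝ}
    (hZS : volume.restrict Z ≤ volume.restrict S) (h : TendstoL2 S φ g)
    (hφ : ∀ k, InL2 Z (φ k)) (hg : InL2 Z g) (hq : InL2 Z q) :
    Tendsto (fun k => ∫ x in Z, (φ k x - q x) ^ 2) atTop (𝓝 (∫ x in Z, (g x - q x) ^ 2)) := by
  have hZ : TendstoL2 Z φ g :=
    tendsto_of_tendsto_of_tendsto_of_le_of_le tendsto_const_nhds h (fun _ => zero_le)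
      fun k => eLpNorm_mono_measure _ hZS
  have h1 : Tendsto (fun k => ((hφ k).sub hq).toLp (φ k - q)) atTop (𝓝 ((hg.sub hq).toLp (g - q))) := by
    rw [Lp.tendsto_Lp_iff_tendsto_eLpNorm'']
    refine hZ.congr fun k => ?_
    congr 1
    ext x
    simp
  have h2 := (h1.norm).pow 2
  simp only [Lp.norm_toLp] at h2
  have e : ∀ w : Pt d → ℝ, InL2 Z w → ∫ x in Z, (w x - q x) ^ 2
      = (eLpNorm (w - q) 2 (volume.restrict Z)).toReal ^ 2 := fun w hw =>
    setIntegral_sq_eq_eLpNorm (hw.sub hq)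
  rw [e g hg]
  exact h2.congr fun k => (e _ (hφ k)).symm

theorem jetL2_sub {d : ℕ} {Z : Set (Pt d)} {w z : Jet d} (hw : JetL2 Z w) (hz : JetL2 Z z) :
    JetL2 Z (w - z) :=
  ⟨fun i => (hw.grad i).sub (hz.grad i), fun i j => (hw.hess i j).sub (hz.hess i j)⟩

theorem jetL2_ofPoly {d : ℕ} {Z : Set (Pt d)} (hZ : Bornology.IsBounded Z) (p : PolyD d) :
    JetL2 Z (Jet.ofPoly p) :=
  ⟨fun _ => memLp_pev_of_isBounded hZ _, fun _ _ => memLp_pev_of_isBounded hZ _⟩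

theorem jetL2_testJet {d : ℕ} (Z : Set (Pt d)) {v : Pt d → ℝ}
    (hv : ContDiff ℝ ((⊤ : ℕ∞) : WithTop ℕ∞) v) (hc : HasCompactSupport v) :
    JetL2 Z (testJet v) :=
  ⟨fun i => inL2_of_hasCompactSupport Z (contDiff_pd hv i).continuous (hasCompactSupport_pd hc i),
    fun i j => inL2_of_hasCompactSupport Z (contDiff_pd (contDiff_pd hv i) j).continuous
      (hasCompactSupport_pd (hasCompactSupport_pd hc i) j)⟩

variable {n : ℕ} {Ω : Set (Pt (n + 1))}

theorem IsH20.jetL2 (ho : IsOpen Ω) (hL : IsLipschitzDomain Ω) {u : Jet (n + 1)}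
    (hu : IsH20 Ω u) {𝒯 : Triangulation Ω} (T : Cell 𝒯) : JetL2 T.set u :=
  ⟨fun i => T.inL2 ho hL (hu.2.1 i), fun i j => T.inL2 ho hL (hu.2.2.1 i j)⟩

theorem Cell.isBounded {𝒯 : Triangulation Ω} (T : Cell 𝒯) : Bornology.IsBounded T.set :=
  (isCompact_hull T.1).isBounded

/-- The local errors of the approximating test functions tend to that of `u`. It therefore suffices
to prove estimates of polynomial jumps by the error for test functions, which have classical traces. -/
theorem tendsto_errSq (ho : IsOpen Ω) (hL : IsLipschitzDomain Ω) {u : Jet (n + 1)}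
    (hu : IsH20 Ω u) {φ : ℕ → Pt (n + 1) → ℝ} (hφ : ∀ k, IsTest Ω (φ k))
    (h1 : ∀ i, TendstoL2 Ω (fun k => pd i (φ k)) (u.grad i))
    (h2 : ∀ i j, TendstoL2 Ω (fun k => pd j (pd i (φ k))) (u.hess i j))
    {𝒯 : Triangulation Ω} (ε α : ℝ) (uh : Cell 𝒯 → PolyD (n + 1)) (T : Cell 𝒯) :
    Tendsto (fun k => errSq ε α (testJet (φ k)) uh T) atTop (𝓝 (errSq ε α u uh T)) := by
  have hp := jetL2_ofPoly T.isBounded (uh T)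
  have ht : ∀ k, JetL2 T.set (testJet (φ k)) := fun k => jetL2_testJet _ (hφ k).1 (hφ k).2.1
  have hu' := hu.jetL2 ho hL T
  unfold errSq
  rw [energySq_eq (jetL2_sub hu' hp)]
  simp_rw [fun k => energySq_eq (ε := ε) (α := α) (jetL2_sub (ht k) hp)]
  refine (Tendsto.const_mul _ (tendsto_finsetSum _ fun i _ => tendsto_finsetSum _ fun j _ => ?_)).add
    (Tendsto.const_mul _ (tendsto_finsetSum _ fun i _ => ?_))
  · exact TendstoL2.integral_sub_sq (restrict_cell_le ho hL T) (h2 i j)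
      (fun k => (ht k).hess i j) (hu'.hess i j) (hp.hess i j)
  · exact TendstoL2.integral_sub_sq (restrict_cell_le ho hL T) (h1 i)
      (fun k => (ht k).grad i) (hu'.grad i) (hp.grad i)

theorem tendsto_patchSum {𝒯 : Triangulation Ω} (o : Labelling 𝒯) (F : Face 𝒯)
    {g : ℕ → Cell 𝒯 → ℝ} {g' : Cell 𝒯 → ℝ} (h : ∀ T, Tendsto (fun k => g k T) atTop (𝓝 (g' T))) :
    Tendsto (fun k => patchSum o (g k) F) atTop (𝓝 (patchSum o g' F)) := by
  unfold patchSum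
  refine (h _).add ?_
  cases o.minus F with
  | none => exact tendsto_const_nhds
  | some T => exact h T

theorem patchSum_mono {𝒯 : Triangulation Ω} (o : Labelling 𝒯) (F : Face 𝒯)
    {g g' : Cell 𝒯 → ℝ} (h : ∀ T, g T ≤ g' T) : patchSum o g F ≤ patchSum o g' F := by
  unfold patchSum
  refine add_le_add (h _) ?_
  cases o.minus F with
  | none => exact le_rfl
  | some T => exact h T

theorem patchSum_nonneg {𝒯 : Triangulation Ω} (o : Labelling 𝒯) (F : Face 𝒯)
    {g : Cell 𝒯 → ℝ} (h : ∀ T, 0 ≤ g T) : 0 ≤ patchSum o g F := by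
  refine add_nonneg (h _) ?_
  cases o.minus F with
  | none => exact le_rfl
  | some T => exact h T

theorem patchSum_const_mul {𝒯 : Triangulation Ω} (o : Labelling 𝒯) (F : Face 𝒯) (a : ℝ)
    (g : Cell 𝒯 → ℝ) : patchSum o (fun T => a * g T) F = a * patchSum o g F := by
  unfold patchSum
  cases o.minus F with
  | none => simp
  | some T => simp [mul_add]

/-- A test function is an element of `H²_0(Ω)`. -/
theorem isH20_testJet {d : ℕ} {Ω : Set (Pt d)} {v : Pt d → ℝ} (hv : IsTest Ω v) :
    IsH20 Ω (testJet v) := by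
  have h := jetL2_testJet Ω hv.1 hv.2.1
  refine ⟨inL2_of_hasCompactSupport Ω hv.1.continuous hv.2.1, h.grad, h.hess,
    fun _ => v, fun _ => hv, ?_, fun i => ?_, fun i j => ?_⟩ <;>
  · simp [TendstoL2, testJet]

end Limits



/-! ### Jumps across a hyperface are bounded by the error -/

section JumpBounds

variable {n : ℕ} {Ω : Set (Pt (n + 1))} {𝒯 : Triangulation Ω}

theorem errSq_eq {d : ℕ} {Ω : Set (Pt d)} {𝒯 : Triangulation Ω} (ε α : ℝ) (u : Jet d)
    (uh : Cell 𝒯 → PolyD d) (T : Cell 𝒯) :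
    errSq ε α u uh T = ε ^ 2 * errSq 1 0 u uh T + α * errSq 0 1 u uh T := by
  simp [errSq, energySq, energyForm]

theorem patchSum_errSq_eq {d : ℕ} {Ω : Set (Pt d)} {𝒯 : Triangulation Ω} (o : Labelling 𝒯)
    (F : Face 𝒯) (ε α : ℝ) (u : Jet d) (uh : Cell 𝒯 → PolyD d) :
    patchSum o (errSq ε α u uh) F
      = ε ^ 2 * patchSum o (errSq 1 0 u uh) F + α * patchSum o (errSq 0 1 u uh) F := by
  unfold patchSum
  rw [errSq_eq ε α]
  cases o.minus F with
  | none => simp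
  | some T =>
    simp only [Option.elim]
    rw [errSq_eq ε α]
    ring

theorem errSq_nonneg {d : ℕ} {Ω : Set (Pt d)} {𝒯 : Triangulation Ω} {ε α : ℝ} (hα : 0 ≤ α)
    (u : Jet d) (uh : Cell 𝒯 → PolyD d) (T : Cell 𝒯) : 0 ≤ errSq ε α u uh T :=
  energySq_nonneg hα _ _

theorem pd_pev_sub {d : ℕ} (p : PolyD d) {φ : Pt d → ℝ}
    (hφ : ContDiff ℝ ((⊤ : ℕ∞) : WithTop ℕ∞) φ) (i : Fin d) :
    pd i (fun x => pev p x - φ x)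
      = fun x => pev (MvPolynomial.pderiv i p) x - pd i φ x := by
  rw [pd_sub (contDiff_pev p).differentiable_of_top hφ.differentiable_of_top, pd_pev]

/-- Squared `L²` norms of the error of a test function and its derivatives on a part of an element. -/
theorem side_bounds {φ : Pt (n + 1) → ℝ} (hφ : IsTest Ω φ) (uh : Cell 𝒯 → PolyD (n + 1))
    (T : Cell 𝒯) {Z : Set (Pt (n + 1))} (hZ : Z ⊆ T.set) :
    (∑ i, ∫ x in Z, ∑ j, pd j (pd i fun x => pev (uh T) x - φ x) x ^ 2)
        ≤ errSq 1 0 (testJet φ) uh T ∧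
    (∫ x in Z, ∑ i, pd i (fun x => pev (uh T) x - φ x) x ^ 2) ≤ errSq 0 1 (testJet φ) uh T ∧
    (∫ x in Z, (pev (uh T) x - φ x) ^ 2) ≤ ∫ x in T.set, (φ x - pev (uh T) x) ^ 2 := by
  have hq : ContDiff ℝ ((⊤ : ℕ∞) : WithTop ℕ∞) fun x => pev (uh T) x - φ x :=
    (contDiff_pev _).sub hφ.1
  have mono : ∀ g : Pt (n + 1) → ℝ, Continuous g → (∀ x, 0 ≤ g x) →
      ∫ x in Z, g x ≤ ∫ x in T.set, g x := fun g hg h0 =>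
    setIntegral_mono_set (integrableOn_of_isBounded T.isBounded hg) (Eventually.of_forall h0)
      hZ.eventuallyLE
  have hJ := jetL2_sub (jetL2_testJet T.set hφ.1 hφ.2.1) (jetL2_ofPoly T.isBounded (uh T))
  have c1 : ∀ i, Continuous (pd i fun x => pev (uh T) x - φ x) := fun i => (contDiff_pd hq i).continuous
  have c2 : ∀ i j, Continuous (pd j (pd i fun x => pev (uh T) x - φ x)) := fun i j =>
    (contDiff_pd (contDiff_pd hq i) j).continuous
  refine ⟨?_, ?_, ?_⟩
  · rw [errSq, energySq_eq hJ, one_pow, one_mul, zero_mul, add_zero]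
    refine Finset.sum_le_sum fun i _ => ?_
    rw [← integral_finsetSum _ fun j _ => (hJ.hess i j).integrable_sq]
    refine (mono _ (by have := c2; fun_prop) fun x => Finset.sum_nonneg fun j _ => sq_nonneg _).trans
      (le_of_eq ?_)
    refine integral_congr_ae (Eventually.of_forall fun x => Finset.sum_congr rfl fun j _ => ?_)
    rw [pd_pev_sub _ hφ.1, pd_pev_sub _ (contDiff_pd hφ.1 i)]
    exact sub_sq_comm _ _
  · rw [errSq, energySq_eq hJ, zero_pow two_ne_zero, zero_mul, zero_add, one_mul,
      ← integral_finsetSum _ fun j _ => (hJ.grad j).integrable_sq]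
    refine (mono _ (by have := c1; fun_prop) fun x => Finset.sum_nonneg fun j _ => sq_nonneg _).trans
      (le_of_eq ?_)
    refine integral_congr_ae (Eventually.of_forall fun x => Finset.sum_congr rfl fun j _ => ?_)
    rw [pd_pev_sub _ hφ.1]
    exact sub_sq_comm _ _
  · refine (mono _ (hq.continuous.pow 2) fun x => sq_nonneg _).trans (le_of_eq ?_)
    exact integral_congr_ae (Eventually.of_forall fun x => sub_sq_comm _ _)

/-- Near the centre of a hyperface, the jump is the difference of the errors of a test function on
both sides; on the boundary the test function vanishes. -/
theorem exists_jump_split (o : Labelling 𝒯) (F : Face 𝒯) {m ν : Pt (n + 1)} {ρ : ℝ}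
    (hp : FacePatch o F m ν ρ) {φ : Pt (n + 1) → ℝ} (hφ : IsTest Ω φ)
    (uh : Cell 𝒯 → PolyD (n + 1)) : ∃ q₁ q₂ : Pt (n + 1) → ℝ,
    ContDiff ℝ ((⊤ : ℕ∞) : WithTop ℕ∞) q₁ ∧ ContDiff ℝ ((⊤ : ℕ∞) : WithTop ℕ∞) q₂ ∧
    (∀ x ∈ Metric.ball m ρ ∩ hyp m ν, pev (jump o uh F) x = q₁ x - q₂ x) ∧
    (∀ i, ∀ x ∈ Metric.ball m ρ ∩ hyp m ν,
      pev (MvPolynomial.pderiv i (jump o uh F)) x = pd i q₁ x - pd i q₂ x) ∧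
    (∑ i, ((∫ x in Metric.ball m ρ ∩ upper m ν, ∑ j, pd j (pd i q₁) x ^ 2)
      + ∫ x in Metric.ball m ρ ∩ upper m (-ν), ∑ j, pd j (pd i q₂) x ^ 2)
        ≤ patchSum o (errSq 1 0 (testJet φ) uh) F) ∧
    ((∫ x in Metric.ball m ρ ∩ upper m ν, ∑ i, pd i q₁ x ^ 2)
      + (∫ x in Metric.ball m ρ ∩ upper m (-ν), ∑ i, pd i q₂ x ^ 2)
        ≤ patchSum o (errSq 0 1 (testJet φ) uh) F) ∧
    ((∫ x in Metric.ball m ρ ∩ upper m ν, q₁ x ^ 2)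
      + (∫ x in Metric.ball m ρ ∩ upper m (-ν), q₂ x ^ 2)
        ≤ patchSum o (fun T => ∫ x in T.set, (φ x - pev (uh T) x) ^ 2) F) := by
  have hq : ∀ T, ContDiff ℝ ((⊤ : ℕ∞) : WithTop ℕ∞) fun x => pev (uh T) x - φ x := fun T =>
    (contDiff_pev _).sub hφ.1
  obtain ⟨s1, s2, s3⟩ := side_bounds hφ uh (o.plus F) hp.plus_subset
  rcases hm : o.minus F with _ | T
  -- on the boundary, the jump is compared with the zero function on the outer half-ball
  · have hJ : jump o uh F = uh (o.plus F) := by simp [jump, hm]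
    have hz : ∀ x ∈ Metric.ball m ρ ∩ hyp m ν, x ∉ tsupport φ := fun x hx h =>
      hp.boundary hm x hx (hφ.2.2 h)
    have pd0 : ∀ i, pd i (fun _ : Pt (n + 1) => (0:ℝ)) = fun _ => 0 := pd_const 0
    refine ⟨_, fun _ => 0, hq (o.plus F), contDiff_const, fun x hx => ?_, fun i x hx => ?_,
      ?_, ?_, ?_⟩
    · rw [hJ, image_eq_zero_of_notMem_tsupport (hz x hx), sub_zero, sub_zero]
    · have hz' : pd i φ x = 0 := image_eq_zero_of_notMem_tsupport
        fun h => hz x hx (tsupport_pd_subset φ i h)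
      rw [hJ, pd0, pd_pev_sub _ hφ.1]
      simp only [hz', sub_zero]
    · simpa [patchSum, hm, pd0] using s1
    · simpa [patchSum, hm, pd0] using s2
    · simpa [patchSum, hm] using s3
  · have hJ : jump o uh F = uh (o.plus F) - uh T := by simp [jump, hm]
    obtain ⟨t1, t2, t3⟩ := side_bounds hφ uh T (hp.minus_subset T hm)
    refine ⟨_, _, hq (o.plus F), hq T, fun x hx => ?_, fun i x hx => ?_, ?_, ?_, ?_⟩
    · rw [hJ, pev_sub]; ring
    · rw [hJ, pd_pev_sub _ hφ.1, pd_pev_sub _ hφ.1, map_sub, pev_sub]; ring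
    · simp only [patchSum, hm, Option.elim]
      rw [Finset.sum_add_distrib]
      exact add_le_add s1 t1
    · simp only [patchSum, hm, Option.elim]
      exact add_le_add s2 t2
    · simp only [patchSum, hm, Option.elim]
      exact add_le_add s3 t3

theorem jump_totalDegree_le {d : ℕ} {Ω : Set (Pt d)} {𝒯 : Triangulation Ω} (o : Labelling 𝒯)
    {uh : Cell 𝒯 → PolyD d} {N : ℕ} (h : ∀ T, (uh T).totalDegree ≤ N) (F : Face 𝒯) :
    (jump o uh F).totalDegree ≤ N := by
  refine (MvPolynomial.totalDegree_sub _ _).trans (max_le (h _) ?_)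
  cases o.minus F with
  | none => simp
  | some T => exact h T

theorem Face.measurableSet {d : ℕ} {Ω : Set (Pt d)} {𝒯 : Triangulation Ω} (F : Face 𝒯) :
    MeasurableSet F.set := (isCompact_hull F.1).measurableSet

theorem FacePatch.integrableOn {o : Labelling 𝒯} {F : Face 𝒯} {m ν : Pt (n + 1)} {ρ : ℝ}
    (hp : FacePatch o F m ν ρ) {g : Pt (n + 1) → ℝ} (hg : Continuous g) :
    IntegrableOn g F.set (μHE[n]) :=
  integrableOn_hyp hp.norm_eq hp.subset hg

/-- Among all constants, the mean value zero is the best approximation of a function with mean value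
zero. -/
theorem FacePatch.integral_sq_le {o : Labelling 𝒯} {F : Face 𝒯} {m ν : Pt (n + 1)} {ρ : ℝ}
    (hp : FacePatch o F m ν ρ) {g : Pt (n + 1) → ℝ} (hg : Continuous g)
    (h0 : F.integral g = 0) (k : ℝ) :
    F.integral (fun x => g x ^ 2) ≤ F.integral fun x => (g x - k) ^ 2 := by
  have h0' : ∫ x in F.set, g x ∂μHE[n] = 0 := h0
  have i1 := hp.integrableOn hg
  have i2 : IntegrableOn (fun x => g x ^ 2) F.set (μHE[n]) := hp.integrableOn (hg.pow 2)
  have i3 : IntegrableOn (fun _ => k ^ 2) F.set (μHE[n]) := hp.integrableOn continuous_const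
  change ∫ x in F.set, g x ^ 2 ∂μHE[n] ≤ ∫ x in F.set, (g x - k) ^ 2 ∂μHE[n]
  have h1 : ∀ x, (g x - k) ^ 2 = g x ^ 2 - 2 * k * g x + k ^ 2 := fun x => by ring
  simp_rw [h1]
  have i4 : IntegrableOn (fun x => 2 * k * g x) F.set (μHE[n]) := i1.const_mul _
  have i5 : IntegrableOn (fun x => g x ^ 2 - 2 * k * g x) F.set (μHE[n]) := i2.sub i4
  rw [integral_add i5 i3, integral_sub i2 i4, integral_const_mul, h0', mul_zero, sub_zero]
  have : 0 ≤ ∫ _ in F.set, k ^ 2 ∂(μHE[n] : Measure (Pt (n + 1))) :=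
    integral_nonneg fun _ => sq_nonneg _
  linarith

/-- The square of the `L²`-norm of the jump of the gradient. -/
def gradJumpSq {d : ℕ} {Ω : Set (Pt d)} {𝒯 : Triangulation Ω} (o : Labelling 𝒯)
    (uh : Cell 𝒯 → PolyD d) (F : Face 𝒯) : ℝ :=
  ∑ i, F.integral fun x => pev (MvPolynomial.pderiv i (jump o uh F)) x ^ 2

variable {θ : ℝ}

theorem FacePatch.subset_closedBall {o : Labelling 𝒯} {F : Face 𝒯} {m ν : Pt (n + 1)}
    (hθ : 0 < θ) (hp : FacePatch o F m ν (θ * F.h)) :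
    F.set ⊆ Metric.closedBall m (1 / θ * (θ * F.h)) ∩ hyp m ν := by
  have : 1 / θ * (θ * F.h) = F.h := by field_simp
  rw [this]
  exact hp.subset

/-- If the jump of the gradient has mean value zero, it is bounded by the second derivatives of the
error: the trace inequality is combined with the Poincaré inequality. -/
theorem exists_gradJump_hess_bound (n N : ℕ) (hθ : 0 < θ) (hθ1 : θ ≤ 1) : ∃ C : ℝ, 0 < C ∧
    ∀ Ω : Set (Pt (n + 1)), IsOpen Ω → IsLipschitzDomain Ω → ∀ 𝒯 : Triangulation Ω,
    ∀ (o : Labelling 𝒯) (F : Face 𝒯) (m ν : Pt (n + 1)), FacePatch o F m ν (θ * F.h) →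
    ∀ uh : Cell 𝒯 → PolyD (n + 1), (∀ T, (uh T).totalDegree ≤ N) →
    (∀ i, F.integral (pev (MvPolynomial.pderiv i (jump o uh F))) = 0) →
    ∀ u, IsH20 Ω u → gradJumpSq o uh F ≤ C * (F.h * patchSum o (errSq 1 0 u uh) F) := by
  obtain ⟨C, hC, h⟩ := exists_two_sided_poincare n N (1 / θ) (by positivity)
  refine ⟨C, hC, fun Ω ho hL 𝒯 o F m ν hp uh hdeg hmean u hu => ?_⟩
  obtain ⟨φ, hφ, -, hφ1, hφ2⟩ := hu.2.2.2
  have hlim := tendsto_patchSum o F fun T => tendsto_errSq ho hL hu hφ hφ1 hφ2 1 0 uh T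
  refine ge_of_tendsto' ((hlim.const_mul F.h).const_mul C) fun k => ?_
  obtain ⟨q₁, q₂, hq₁, hq₂, -, hd, b1, -, -⟩ := exists_jump_split o F hp (hφ k) uh
  have hh : 0 < F.h := pos_of_mul_pos_right hp.pos hθ.le
  have hi : ∀ i, F.integral (fun x => pev (MvPolynomial.pderiv i (jump o uh F)) x ^ 2) ≤
      C * (θ * F.h * ((∫ x in Metric.ball m (θ * F.h) ∩ upper m ν, ∑ j, pd j (pd i q₁) x ^ 2)
      + ∫ x in Metric.ball m (θ * F.h) ∩ upper m (-ν), ∑ j, pd j (pd i q₂) x ^ 2)) := by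
    intro i
    obtain ⟨c, hc⟩ := h (MvPolynomial.pderiv i (jump o uh F))
      ((totalDegree_pderiv_le _ _).trans (jump_totalDegree_le o hdeg F)) m ν (θ * F.h) hp.norm_eq
      hp.pos (pd i q₁) (pd i q₂) (contDiff_pd hq₁ i) (contDiff_pd hq₂ i) (hd i) F.set
      (hp.subset_closedBall hθ) F.measurableSet
    exact (hp.integral_sq_le (continuous_pev _) (hmean i) c).trans hc
  refine (Finset.sum_le_sum fun i _ => hi i).trans ?_
  rw [← Finset.mul_sum, ← Finset.mul_sum]
  have : θ * F.h ≤ F.h := mul_le_of_le_one_left hh.le hθ1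
  have h0 : 0 ≤ patchSum o (errSq 1 0 (testJet (φ k)) uh) F :=
    patchSum_nonneg o F fun T => errSq_nonneg le_rfl _ _ T
  gcongr

theorem one_div_add_le {θ h η : ℝ} (hθ : 0 < θ) (hθ1 : θ ≤ 1) (hh : 0 < h) (hη : 0 < η) :
    1 / η + 1 / (θ * h) ≤ 1 / θ * (1 / η + 1 / h) := by
  have h1 : 1 / θ * (1 / η + 1 / h) = 1 / θ * (1 / η) + 1 / (θ * h) := by field_simp
  have h2 : 1 ≤ 1 / θ := by rw [le_div_iff₀ hθ]; linarith
  have h3 : 1 * (1 / η) ≤ 1 / θ * (1 / η) := by gcongr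
  linarith

/-- The jump of the gradient is bounded by the derivatives of the error of order one and two, with
a free weight `η`. -/
theorem exists_gradJump_energy_bound (n N : ℕ) (hθ : 0 < θ) (hθ1 : θ ≤ 1) : ∃ C : ℝ, 0 < C ∧
    ∀ Ω : Set (Pt (n + 1)), IsOpen Ω → IsLipschitzDomain Ω → ∀ 𝒯 : Triangulation Ω,
    ∀ (o : Labelling 𝒯) (F : Face 𝒯) (m ν : Pt (n + 1)), FacePatch o F m ν (θ * F.h) →
    ∀ uh : Cell 𝒯 → PolyD (n + 1), (∀ T, (uh T).totalDegree ≤ N) → ∀ η, 0 < η →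
    ∀ u, IsH20 Ω u → gradJumpSq o uh F ≤ C * (η * patchSum o (errSq 1 0 u uh) F
      + (1 / η + 1 / F.h) * patchSum o (errSq 0 1 u uh) F) := by
  obtain ⟨C, hC, h⟩ := exists_two_sided_bound n N (1 / θ) (by positivity)
  refine ⟨C * (1 / θ), by positivity, fun Ω ho hL 𝒯 o F m ν hp uh hdeg η hη u hu => ?_⟩
  obtain ⟨φ, hφ, -, hφ1, hφ2⟩ := hu.2.2.2
  have hlim1 := tendsto_patchSum o F fun T => tendsto_errSq ho hL hu hφ hφ1 hφ2 1 0 uh T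
  have hlim2 := tendsto_patchSum o F fun T => tendsto_errSq ho hL hu hφ hφ1 hφ2 0 1 uh T
  refine ge_of_tendsto' (((hlim1.const_mul _).add (hlim2.const_mul _)).const_mul _) fun k => ?_
  obtain ⟨q₁, q₂, hq₁, hq₂, -, hd, b1, b2, -⟩ := exists_jump_split o F hp (hφ k) uh
  have hh : 0 < F.h := pos_of_mul_pos_right hp.pos hθ.le
  have hmb : ∀ w : Pt (n + 1), Bornology.IsBounded (Metric.ball m (θ * F.h) ∩ upper m w) :=
    fun w => Metric.isBounded_ball.subset Set.inter_subset_left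
  have hsum : ∀ (w : Pt (n + 1)) (q : Pt (n + 1) → ℝ), ContDiff ℝ ((⊤ : ℕ∞) : WithTop ℕ∞) q →
      ∫ x in Metric.ball m (θ * F.h) ∩ upper m w, ∑ i, pd i q x ^ 2
        = ∑ i, ∫ x in Metric.ball m (θ * F.h) ∩ upper m w, pd i q x ^ 2 := fun w q hq =>
    integral_finsetSum _ fun i _ =>
      integrableOn_of_isBounded (hmb w) ((contDiff_pd hq i).continuous.pow 2)
  rw [hsum _ _ hq₁, hsum _ _ hq₂, ← Finset.sum_add_distrib] at b2
  have hi : ∀ i, F.integral (fun x => pev (MvPolynomial.pderiv i (jump o uh F)) x ^ 2) ≤ _ :=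
    fun i => h (MvPolynomial.pderiv i (jump o uh F))
      ((totalDegree_pderiv_le _ _).trans (jump_totalDegree_le o hdeg F)) m ν (θ * F.h) η hp.norm_eq
      hp.pos hη (pd i q₁) (pd i q₂) (contDiff_pd hq₁ i) (contDiff_pd hq₂ i) (hd i) F.set
      (hp.subset_closedBall hθ) F.measurableSet
  refine (Finset.sum_le_sum fun i _ => hi i).trans ?_
  rw [← Finset.mul_sum, Finset.sum_add_distrib, ← Finset.mul_sum, ← Finset.mul_sum]
  have h0 : 0 ≤ patchSum o (errSq 1 0 (testJet (φ k)) uh) F :=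
    patchSum_nonneg o F fun T => errSq_nonneg le_rfl _ _ T
  have h1 : 0 ≤ patchSum o (errSq 0 1 (testJet (φ k)) uh) F :=
    patchSum_nonneg o F fun T => errSq_nonneg zero_le_one _ _ T
  have h2 : 1 ≤ 1 / θ := by rw [le_div_iff₀ hθ]; linarith
  rw [mul_assoc]
  refine mul_le_mul_of_nonneg_left ?_ hC.le
  rw [mul_add]
  refine add_le_add ?_ ?_
  · calc _ ≤ η * patchSum o (errSq 1 0 (testJet (φ k)) uh) F := by gcongr
      _ ≤ _ := le_mul_of_one_le_left (by positivity) h2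
  · rw [← mul_assoc]
    have := one_div_add_le hθ hθ1 hh hη
    gcongr

theorem le_zero_of_forall_le {a B : ℝ} (h : ∀ η > 0, a ≤ η * B) : a ≤ 0 := by
  have h1 : Tendsto (fun η : ℝ => η * B) (𝓝 0) (𝓝 (0 * B)) := tendsto_id.mul_const B
  rw [zero_mul] at h1
  exact ge_of_tendsto (h1.mono_left (nhdsWithin_le_nhds (s := Set.Ioi 0)))
    (eventually_nhdsWithin_of_forall fun η hη => h η hη)

/-- Piecewise polynomials in `H¹_0(Ω)` have no jumps: in the trace estimate, the value errors of the
approximating test functions tend to zero, and the remaining gradient errors carry the factor `η`,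
which is arbitrary. -/
theorem integral_jump_sq_eq_zero (hθ : 0 < θ) (ho : IsOpen Ω)
    (hL : IsLipschitzDomain Ω) {o : Labelling 𝒯} {F : Face 𝒯} {m ν : Pt (n + 1)}
    (hp : FacePatch o F m ν (θ * F.h)) {uh : Cell 𝒯 → PolyD (n + 1)}
    (hH : PiecewiseInH10 uh) : F.integral (fun x => pev (jump o uh F) x ^ 2) = 0 := by
  obtain ⟨w, ⟨hw, G, hG, φ, hφ, hφ0, hφ1⟩, hwT⟩ := hH
  obtain ⟨N, hN⟩ : ∃ N, ∀ T, (uh T).totalDegree ≤ N :=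
    ⟨∑ T, (uh T).totalDegree, fun T =>
      Finset.single_le_sum (f := fun T => (uh T).totalDegree) (fun _ _ => Nat.zero_le _)
        (Finset.mem_univ T)⟩
  obtain ⟨C, hC, h⟩ := exists_two_sided_bound n N (1 / θ) (by positivity)
  have hh : 0 < F.h := pos_of_mul_pos_right hp.pos hθ.le
  have hnn : 0 ≤ F.integral (fun x => pev (jump o uh F) x ^ 2) :=
    integral_nonneg fun x => sq_nonneg _
  refine le_antisymm ?_ hnn
  -- the limits of the gradient and value errors of the approximating test functions
  set B : Cell 𝒯 → ℝ := fun T =>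
    ∑ i, ∫ x in T.set, (G i x - pev (MvPolynomial.pderiv i (uh T)) x) ^ 2 with hB
  have ht : ∀ k, ∀ T : Cell 𝒯, JetL2 T.set (testJet (φ k)) := fun k T => jetL2_testJet _ (hφ k).1 (hφ k).2.1
  have hpoly : ∀ T : Cell 𝒯, JetL2 T.set (Jet.ofPoly (uh T)) := fun T => jetL2_ofPoly T.isBounded _
  have l1 : ∀ T, Tendsto (fun k => errSq 0 1 (testJet (φ k)) uh T) atTop (𝓝 (B T)) := by
    intro T
    unfold errSq
    simp_rw [fun k => energySq_eq (ε := 0) (α := 1) (jetL2_sub (ht k T) (hpoly T))]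
    simp only [zero_pow two_ne_zero, zero_mul, zero_add, one_mul]
    exact tendsto_finsetSum _ fun i _ => TendstoL2.integral_sub_sq (restrict_cell_le ho hL T)
      (hφ1 i) (fun k => (ht k T).grad i) (T.inL2 ho hL (hG i)) ((hpoly T).grad i)
  have l0 : ∀ T : Cell 𝒯, Tendsto (fun k => ∫ x in T.set, (φ k x - pev (uh T) x) ^ 2) atTop
      (𝓝 0) := by
    intro T
    have h1 := TendstoL2.integral_sub_sq (restrict_cell_le ho hL T) hφ0
      (fun k => inL2_of_hasCompactSupport T.set (hφ k).1.continuous (hφ k).2.1)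
      (T.inL2 ho hL hw) (memLp_pev_of_isBounded T.isBounded (uh T))
    rwa [integral_congr_ae (g := fun _ => (0:ℝ)), integral_zero] at h1
    filter_upwards [hwT T] with x hx
    rw [hx, sub_self, zero_pow two_ne_zero]
  refine le_zero_of_forall_le (B := C * patchSum o B F) fun η hη => ?_
  have lim := (((tendsto_patchSum o F l1).const_mul η).add ((tendsto_patchSum o F l0).const_mul
    (1 / η + 1 / (θ * F.h)))).const_mul C
  have hz : patchSum o (fun _ => (0:ℝ)) F = 0 := by
    unfold patchSum
    cases o.minus F <;> simp
  rw [hz, mul_zero, add_zero] at lim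
  rw [mul_left_comm]
  refine ge_of_tendsto' lim fun k => ?_
  obtain ⟨q₁, q₂, hq₁, hq₂, hv, -, -, b2, b3⟩ := exists_jump_split o F hp (hφ k) uh
  have hi : F.integral (fun x => pev (jump o uh F) x ^ 2) ≤ _ :=
    h (jump o uh F) (jump_totalDegree_le o hN F) m ν (θ * F.h) η hp.norm_eq
      hp.pos hη q₁ q₂ hq₁ hq₂ hv F.set (hp.subset_closedBall hθ) F.measurableSet
  refine hi.trans (mul_le_mul_of_nonneg_left (add_le_add ?_ ?_) hC.le)
  · exact mul_le_mul_of_nonneg_left b2 hη.le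
  · refine mul_le_mul_of_nonneg_left b3 ?_
    have := hp.pos
    positivity

end JumpBounds



/-! ### Efficiency of the jump terms -/

section Xi

variable {n : ℕ} {Ω : Set (Pt (n + 1))} {𝒯 : Triangulation Ω} {θ : ℝ}

/-- For `ℓ ≥ 2`, the jump condition is tested with constant vector fields. -/
theorem GradJumpOrth.integral_eq_zero {o : Labelling 𝒯} {ℓ : ℕ} (hℓ : 2 ≤ ℓ)
    {v : Cell 𝒯 → PolyD (n + 1)} {F : Face 𝒯} (h : GradJumpOrth o ℓ v F) (i : Fin (n + 1)) :
    F.integral (pev (MvPolynomial.pderiv i (jump o v F))) = 0 := by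
  classical
  have h1 := h (fun j => MvPolynomial.C (if i = j then 1 else 0)) fun j => by
    rw [MvPolynomial.totalDegree_C]; omega
  simp only [pev_C] at h1
  rw [← h1]
  congr 1
  funext x
  simp

theorem kappa_pos {ε h : ℝ} (hε : 0 < ε) (hh : 0 < h) : 0 < kappa ε h :=
  lt_min one_pos (div_pos hh hε)

/-- The jump of the gradient, weighted as in the estimator, is bounded by the error in the energy
norm. For `F.h ≤ ε` the bound by second derivatives has the right scaling; otherwise the bound with
both orders of derivatives is used with `η = ε`. -/
theorem exists_gradJump_bound (n N : ℕ) (D : ℝ) (hθ : 0 < θ) (hθ1 : θ ≤ 1) : ∃ C : ℝ, 0 < C ∧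
    ∀ Ω : Set (Pt (n + 1)), IsOpen Ω → IsLipschitzDomain Ω → ∀ 𝒯 : Triangulation Ω,
    ∀ (o : Labelling 𝒯) (F : Face 𝒯) (m ν : Pt (n + 1)), FacePatch o F m ν (θ * F.h) → F.h ≤ D →
    ∀ ε α : ℝ, (ε = 1 ∧ α = 0) ∨ (0 < ε ∧ ε ≤ 1 ∧ α = 1) →
    ∀ uh : Cell 𝒯 → PolyD (n + 1), (∀ T, (uh T).totalDegree ≤ N) →
    (∀ i, F.integral (pev (MvPolynomial.pderiv i (jump o uh F))) = 0) →
    ∀ u, IsH20 Ω u →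
      ε / kappa ε F.h * gradJumpSq o uh F ≤ C * patchSum o (errSq ε α u uh) F := by
  obtain ⟨C1, hC1, h1⟩ := exists_gradJump_hess_bound n N hθ hθ1
  obtain ⟨C2, hC2, h2⟩ := exists_gradJump_energy_bound n N hθ hθ1
  refine ⟨C1 * (1 + |D|) + 2 * C2, by positivity,
    fun Ω ho hL 𝒯 o F m ν hp hD ε α hreg uh hdeg hmean u hu => ?_⟩
  have hh : 0 < F.h := pos_of_mul_pos_right hp.pos hθ.le
  have hε : 0 < ε := by rcases hreg with h | h <;> linarith [h.1]
  have hα : 0 ≤ α := by rcases hreg with h | h <;> linarith [h.2]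
  have b1 := h1 Ω ho hL 𝒯 o F m ν hp uh hdeg hmean u hu
  rw [patchSum_errSq_eq]
  set H := patchSum o (errSq 1 0 u uh) F
  set G := patchSum o (errSq 0 1 u uh) F
  have hH : 0 ≤ H := patchSum_nonneg o F fun T => errSq_nonneg le_rfl _ _ T
  have hG : 0 ≤ G := patchSum_nonneg o F fun T => errSq_nonneg zero_le_one _ _ T
  have hD' : F.h ≤ |D| := hD.trans (le_abs_self D)
  rcases le_or_gt F.h ε with hle | hlt
  · have hκ : kappa ε F.h = F.h / ε := min_eq_right (by rwa [div_le_one hε])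
    have hw : ε / kappa ε F.h = ε ^ 2 / F.h := by rw [hκ]; field_simp
    rw [hw]
    calc ε ^ 2 / F.h * gradJumpSq o uh F ≤ ε ^ 2 / F.h * (C1 * (F.h * H)) := by gcongr
      _ = C1 * (ε ^ 2 * H) := by field_simp
      _ ≤ (C1 * (1 + |D|) + 2 * C2) * (ε ^ 2 * H + α * G) := by
          have e1 : C1 ≤ C1 * (1 + |D|) + 2 * C2 := by nlinarith [abs_nonneg D]
          have e2 : 0 ≤ α * G := mul_nonneg hα hG
          have e3 : ε ^ 2 * H ≤ ε ^ 2 * H + α * G := by linarith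
          gcongr
  -- for `α = 0`, the case `ε = 1 < F.h ≤ D` only changes the constant
  · have hκ : kappa ε F.h = 1 := min_eq_left (by rw [one_le_div hε]; exact hlt.le)
    rw [hκ, div_one]
    rcases hreg with ⟨rfl, rfl⟩ | ⟨-, -, rfl⟩
    · rw [one_mul, one_pow, one_mul, zero_mul, add_zero]
      calc gradJumpSq o uh F ≤ C1 * (F.h * H) := b1
        _ ≤ C1 * ((1 + |D|) * H) := by gcongr; linarith
        _ ≤ (C1 * (1 + |D|) + 2 * C2) * H := by nlinarith [mul_nonneg hC2.le hH]
    · have b2 := h2 Ω ho hL 𝒯 o F m ν hp uh hdeg ε hε u hu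
      have e1 : ε / F.h ≤ 1 := by rw [div_le_one hh]; exact hlt.le
      calc ε * gradJumpSq o uh F ≤ ε * (C2 * (ε * H + (1 / ε + 1 / F.h) * G)) := by gcongr
        _ = C2 * (ε ^ 2 * H + (1 + ε / F.h) * G) := by field_simp
        _ ≤ C2 * (2 * (ε ^ 2 * H) + 2 * G) := by
            have e2 : 0 ≤ ε ^ 2 * H := by positivity
            have e3 : (1 + ε / F.h) * G ≤ 2 * G :=
              mul_le_mul_of_nonneg_right (by linarith) hG
            refine mul_le_mul_of_nonneg_left ?_ hC2.le
            linarith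
        _ ≤ (C1 * (1 + |D|) + 2 * C2) * (ε ^ 2 * H + 1 * G) := by
            have : 0 ≤ C1 * (1 + |D|) * (ε ^ 2 * H + 1 * G) := by positivity
            linarith

theorem continuous_sum_sq_pev {d : ℕ} (p : Fin d → PolyD d) :
    Continuous fun x => ∑ i, pev (p i) x ^ 2 := by
  have := fun i => continuous_pev (p i)
  fun_prop

theorem FacePatch.gradJumpSq_eq {o : Labelling 𝒯} {F : Face 𝒯} {m ν : Pt (n + 1)} {ρ : ℝ}
    (hp : FacePatch o F m ν ρ) (uh : Cell 𝒯 → PolyD (n + 1)) :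
    gradJumpSq o uh F
      = F.integral fun x => ∑ i, pev (MvPolynomial.pderiv i (jump o uh F)) x ^ 2 :=
  (integral_finsetSum _ fun _ _ => hp.integrableOn ((continuous_pev _).pow 2)).symm

theorem FacePatch.integral_mono {o : Labelling 𝒯} {F : Face 𝒯} {m ν : Pt (n + 1)} {ρ : ℝ}
    (hp : FacePatch o F m ν ρ) {f g : Pt (n + 1) → ℝ} (hf : Continuous f) (hg : Continuous g)
    (h : ∀ x, f x ≤ g x) : F.integral f ≤ F.integral g :=
  MeasureTheory.integral_mono (hp.integrableOn hf) (hp.integrableOn hg) h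

theorem sq_normalDeriv_le {d : ℕ} {ν : Pt d} (hν : ‖ν‖ = 1) (p : PolyD d) (x : Pt d) :
    pev (normalDeriv ν p) x ^ 2 ≤ ∑ i, pev (MvPolynomial.pderiv i p) x ^ 2 := by
  rw [pev_normalDeriv]
  exact sq_sum_mul_le hν _

theorem sum_sq_tangGrad {d : ℕ} {ν : Pt d} (hν : ‖ν‖ = 1) (p : PolyD d) (x : Pt d) :
    ∑ i, pev (tangGrad ν p i) x ^ 2
      = ∑ i, pev (MvPolynomial.pderiv i p) x ^ 2 - pev (normalDeriv ν p) x ^ 2 := by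
  have h1 : ∀ i, pev (tangGrad ν p i) x ^ 2 = pev (MvPolynomial.pderiv i p) x ^ 2
      - 2 * pev (normalDeriv ν p) x * (ν i * pev (MvPolynomial.pderiv i p) x)
      + pev (normalDeriv ν p) x ^ 2 * ν i ^ 2 := by
    intro i
    rw [tangGrad, pev_sub, pev_mul, pev_C]
    ring
  simp_rw [h1, Finset.sum_add_distrib, Finset.sum_sub_distrib, ← Finset.mul_sum]
  rw [sum_sq_eq_one_of_norm hν, ← pev_normalDeriv]
  ring

/-- The jump terms are bounded by the error. For `α = 0`, the value jumps are controlled by the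
tangential part of the gradient jumps; for `α = 1`, they vanish. -/
theorem exists_xi_bound (n N : ℕ) (D c : ℝ) (hθ : 0 < θ) (hθ1 : θ ≤ 1) : ∃ C : ℝ, 0 < C ∧
    ∀ Ω : Set (Pt (n + 1)), IsOpen Ω → IsLipschitzDomain Ω → ∀ 𝒯 : Triangulation Ω,
    ∀ (o : Labelling 𝒯) (F : Face 𝒯) (m ν : Pt (n + 1)), FacePatch o F m ν (θ * F.h) → F.h ≤ D →
    ∀ ε α : ℝ, (ε = 1 ∧ α = 0) ∨ (0 < ε ∧ ε ≤ 1 ∧ α = 1) →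
    ∀ uh : Cell 𝒯 → PolyD (n + 1), (∀ T, (uh T).totalDegree ≤ N) →
    (∀ i, F.integral (pev (MvPolynomial.pderiv i (jump o uh F))) = 0) →
    Real.sqrt (F.integral fun x => pev (jump o uh F) x ^ 2) ≤ c * F.h * Real.sqrt (F.integral
      fun x => ∑ i, pev (tangGrad (o.normal F) (jump o uh F) i) x ^ 2) →
    (α = 1 → PiecewiseInH10 uh) →
    ∀ u, IsH20 Ω u → xiSq o ε uh F ≤ C * patchSum o (errSq ε α u uh) F := by
  obtain ⟨C1, hC1, h1⟩ := exists_gradJump_bound n N D hθ hθ1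
  refine ⟨C1 * (1 + c ^ 2 * (1 + |D|) ^ 2), by positivity,
    fun Ω ho hL 𝒯 o F m ν hp hD ε α hreg uh hdeg hmean hweak hH u hu => ?_⟩
  have b1 := h1 Ω ho hL 𝒯 o F m ν hp hD ε α hreg uh hdeg hmean u hu
  have hh : 0 < F.h := pos_of_mul_pos_right hp.pos hθ.le
  have hε : 0 < ε := by rcases hreg with h | h <;> linarith [h.1]
  have hα : 0 ≤ α := by rcases hreg with h | h <;> linarith [h.2]
  have hκ := kappa_pos hε hh
  set E := patchSum o (errSq ε α u uh) F
  have hE : 0 ≤ E := patchSum_nonneg o F fun T => errSq_nonneg hα _ _ T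
  have hX := hp.gradJumpSq_eq uh
  have hN := o.norm_normal F
  have b2 : F.integral (fun x => pev (normalDeriv (o.normal F) (jump o uh F)) x ^ 2)
      ≤ gradJumpSq o uh F := by
    rw [hX]
    exact hp.integral_mono ((continuous_pev _).pow 2) (continuous_sum_sq_pev _)
      fun x => sq_normalDeriv_le hN _ x
  have b3 : (F.integral fun x => ∑ i, pev (tangGrad (o.normal F) (jump o uh F) i) x ^ 2)
      ≤ gradJumpSq o uh F := by
    rw [hX]
    refine hp.integral_mono (continuous_sum_sq_pev _) (continuous_sum_sq_pev _) fun x => ?_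
    rw [sum_sq_tangGrad hN]
    linarith [sq_nonneg (pev (normalDeriv (o.normal F) (jump o uh F)) x)]
  have b4 : 1 / (ε * kappa ε F.h ^ 3) * F.integral (fun x => pev (jump o uh F) x ^ 2)
      ≤ C1 * (c ^ 2 * (1 + |D|) ^ 2) * E := by
    rcases hreg with ⟨rfl, rfl⟩ | ⟨-, -, hα1⟩
    · have hJ0 : 0 ≤ F.integral (fun x => pev (jump o uh F) x ^ 2) :=
        integral_nonneg fun x => sq_nonneg _
      have ht0 : 0 ≤ F.integral fun x => ∑ i, pev (tangGrad (o.normal F) (jump o uh F) i) x ^ 2 :=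
        integral_nonneg fun x => Finset.sum_nonneg fun i _ => sq_nonneg _
      have hsq := pow_le_pow_left₀ (Real.sqrt_nonneg _) hweak 2
      rw [mul_pow, Real.sq_sqrt hJ0, Real.sq_sqrt ht0] at hsq
      have hr : F.h / kappa 1 F.h ≤ 1 + |D| := by
        rw [div_le_iff₀ hκ, kappa, div_one]
        have hD' : F.h ≤ |D| := hD.trans (le_abs_self D)
        rcases min_choice 1 F.h with h | h <;> rw [h] <;> nlinarith [abs_nonneg D]
      rw [one_mul]
      calc 1 / kappa 1 F.h ^ 3 * F.integral (fun x => pev (jump o uh F) x ^ 2)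
          ≤ 1 / kappa 1 F.h ^ 3 * ((c * F.h) ^ 2 * gradJumpSq o uh F) := by
            gcongr
            exact hsq.trans (by gcongr)
        _ = c ^ 2 * (F.h / kappa 1 F.h) ^ 2 * (1 / kappa 1 F.h * gradJumpSq o uh F) := by
            field_simp
        _ ≤ c ^ 2 * (1 + |D|) ^ 2 * (C1 * E) := by
            refine mul_le_mul (by gcongr) b1 (mul_nonneg (by positivity) ?_) (by positivity)
            exact Finset.sum_nonneg fun i _ => integral_nonneg fun x => sq_nonneg _
        _ = _ := by ring
    · rw [integral_jump_sq_eq_zero hθ ho hL hp (hH hα1), mul_zero]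
      positivity
  have b5 : ε / kappa ε F.h * F.integral
      (fun x => pev (normalDeriv (o.normal F) (jump o uh F)) x ^ 2) ≤ C1 * E :=
    (mul_le_mul_of_nonneg_left b2 (by positivity)).trans b1
  calc xiSq o ε uh F ≤ C1 * E + C1 * (c ^ 2 * (1 + |D|) ^ 2) * E := add_le_add b5 b4
    _ = _ := by ring

end Xi



/-! ### Stability of the local projection -/

section Projection

variable {d : ℕ}

theorem ofPoly_sub (p q : PolyD d) : Jet.ofPoly (p - q) = Jet.ofPoly p - Jet.ofPoly q := by
  have h : ∀ a b : PolyD d, pev (a - b) = fun x => pev a x - pev b x := fun a b =>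
    funext fun x => pev_sub a b x
  change (⟨_, _, _⟩ : Jet d) = ⟨_, _, _⟩
  simp only [map_sub, h]
  rfl

theorem setIntegral_sub_sq_le {Z : Set (Pt d)} {f g : Pt d → ℝ} (hf : InL2 Z f) (hg : InL2 Z g) :
    ∫ x in Z, (f x - g x) ^ 2 ≤ 2 * (∫ x in Z, f x ^ 2) + 2 * ∫ x in Z, g x ^ 2 := by
  rw [← integral_const_mul, ← integral_const_mul,
    ← integral_add (hf.integrable_sq.const_mul 2) (hg.integrable_sq.const_mul 2)]
  refine integral_mono (hf.sub hg).integrable_sq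
    ((hf.integrable_sq.const_mul 2).add (hg.integrable_sq.const_mul 2)) fun x => ?_
  change (f x - g x) ^ 2 ≤ 2 * f x ^ 2 + 2 * g x ^ 2
  nlinarith [sq_nonneg (f x + g x)]

theorem energySq_sub_le {ε α : ℝ} (hα : 0 ≤ α) {Z : Set (Pt d)} {w z : Jet d} (hw : JetL2 Z w)
    (hz : JetL2 Z z) :
    energySq ε α Z (w - z) ≤ 2 * energySq ε α Z w + 2 * energySq ε α Z z := by
  rw [energySq_eq (jetL2_sub hw hz), energySq_eq hw, energySq_eq hz]
  have h1 : ∑ i, ∑ j, ∫ x in Z, (w - z).hess i j x ^ 2 ≤ 2 * (∑ i, ∑ j, ∫ x in Z, w.hess i j x ^ 2)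
      + 2 * ∑ i, ∑ j, ∫ x in Z, z.hess i j x ^ 2 := by
    simp only [Finset.mul_sum, ← Finset.sum_add_distrib]
    exact Finset.sum_le_sum fun i _ => Finset.sum_le_sum fun j _ =>
      setIntegral_sub_sq_le (hw.hess i j) (hz.hess i j)
  have h2 : ∑ i, ∫ x in Z, (w - z).grad i x ^ 2 ≤ 2 * (∑ i, ∫ x in Z, w.grad i x ^ 2)
      + 2 * ∑ i, ∫ x in Z, z.grad i x ^ 2 := by
    simp only [Finset.mul_sum, ← Finset.sum_add_distrib]
    exact Finset.sum_le_sum fun i _ => setIntegral_sub_sq_le (hw.grad i) (hz.grad i)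
  have := mul_le_mul_of_nonneg_left h1 (sq_nonneg ε)
  have := mul_le_mul_of_nonneg_left h2 hα
  linarith

/-- A convex set `S` that contains the closed ball of radius `r` around `x` and has diameter at most
`σ` times that of the ball. -/
structure FatConvex (S : Set (Pt d)) (x : Pt d) (r σ : ℝ) : Prop where
  pos : 0 < r
  convex : Convex ℝ S
  measurable : MeasurableSet S
  ball_subset : Metric.closedBall x r ⊆ S
  diam_le : ∀ y ∈ S, ∀ z ∈ S, ‖y - z‖ ≤ σ * (2 * r)

variable {S : Set (Pt d)} {x : Pt d} {r σ : ℝ}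

theorem FatConvex.subset (h : FatConvex S x r σ) : S ⊆ Metric.closedBall x (2 * σ * r) := by
  intro y hy
  rw [mem_closedBall_iff_norm]
  have := h.diam_le y hy x (h.ball_subset (Metric.mem_closedBall_self h.pos.le))
  linarith

theorem FatConvex.isBounded (h : FatConvex S x r σ) : Bornology.IsBounded S :=
  Metric.isBounded_closedBall.subset h.subset

theorem FatConvex.volume_ne_zero (h : FatConvex S x r σ) : volume S ≠ 0 := by
  have h1 : 0 < volume (Metric.ball x r) := Metric.measure_ball_pos volume x h.pos
  exact (h1.trans_le (measure_mono (Metric.ball_subset_closedBall.trans h.ball_subset))).ne'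

theorem FatConvex.param_pos (hd : 0 < d) (h : FatConvex S x r σ) : 0 < σ := by
  have hr := h.pos
  have hν : ‖(EuclideanSpace.single (⟨0, hd⟩ : Fin d) (1 : ℝ) : Pt d)‖ = 1 := by simp
  have h1 := h.diam_le _ (h.ball_subset (Metric.mem_closedBall_self h.pos.le)) _ (h.ball_subset
    (show x - r • (EuclideanSpace.single (⟨0, hd⟩ : Fin d) (1 : ℝ) : Pt d) ∈ _ by
      rw [mem_closedBall_iff_norm, sub_sub_cancel_left, norm_neg, norm_smul, hν,
        Real.norm_of_nonneg hr.le, mul_one]))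
  rw [sub_sub_cancel, norm_smul, hν, Real.norm_of_nonneg hr.le, mul_one] at h1
  by_contra hneg
  push Not at hneg
  nlinarith

theorem FatConvex.volume_le (hσ : 0 ≤ σ) (h : FatConvex S x r σ) :
    volume.real S ≤ (2 * σ) ^ d * volume.real (Metric.ball (0 : Pt d) 1) * r ^ d := by
  have h1 : volume.real S ≤ volume.real (Metric.closedBall x (2 * σ * r)) :=
    measureReal_mono h.subset measure_closedBall_lt_top.ne
  refine h1.trans (le_of_eq ?_)
  have hr := h.pos
  rw [measureReal_def, Measure.addHaar_closedBall _ _ (by positivity), ENNReal.toReal_mul,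
    ENNReal.toReal_ofReal (by positivity), finrank_euclideanSpace_fin, mul_pow, measureReal_def]
  ring

theorem setIntegral_pev_sq_mono {Z : Set (Pt d)} (hS : Bornology.IsBounded S) (hZS : Z ⊆ S)
    (p : PolyD d) : ∫ y in Z, pev p y ^ 2 ≤ ∫ y in S, pev p y ^ 2 :=
  setIntegral_mono_set (memLp_pev_of_isBounded hS p).integrable_sq
    (Eventually.of_forall fun _ => sq_nonneg _) hZS.eventuallyLE

/-- Inverse estimates on convex sets that contain a ball of comparable size. -/
theorem exists_inverse_bound (d N : ℕ) (σ : ℝ) : ∃ C : ℝ, 0 < C ∧ ∀ (S : Set (Pt d)) (x : Pt d)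
    (r : ℝ), 0 ≤ σ → FatConvex S x r σ → ∀ p : PolyD d, p.totalDegree ≤ N →
    (∀ i, r ^ 2 * ∫ y in S, pev (MvPolynomial.pderiv i p) y ^ 2 ≤ C * ∫ y in S, pev p y ^ 2) ∧
    (∀ i j, r ^ 4 * ∫ y in S, pev (MvPolynomial.pderiv j (MvPolynomial.pderiv i p)) y ^ 2
      ≤ C * ∫ y in S, pev p y ^ 2) := by
  obtain ⟨C, hC, h⟩ := exists_poly_bound d N (2 * σ)
  set V := volume.real (Metric.ball (0 : Pt d) 1)
  refine ⟨C * ((2 * |σ|) ^ d * V) + 1, by positivity, fun S x r hσ hS p hp => ?_⟩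
  have hr := hS.pos
  set I := ∫ y in Metric.ball x r, pev p y ^ 2
  have hI : I ≤ ∫ y in S, pev p y ^ 2 :=
    setIntegral_pev_sq_mono hS.isBounded (Metric.ball_subset_closedBall.trans hS.ball_subset) p
  have hI0 : 0 ≤ I := integral_nonneg fun _ => sq_nonneg _
  have hSlt : volume S < ⊤ := hS.isBounded.measure_lt_top
  have key : ∀ (q : PolyD d) (k : ℕ), (∀ y ∈ S, r ^ k * pev q y ^ 2 ≤ C * ((r ^ d)⁻¹ * I)) →
      r ^ k * ∫ y in S, pev q y ^ 2 ≤ (C * ((2 * |σ|) ^ d * V) + 1) * ∫ y in S, pev p y ^ 2 := by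
    intro q k hq
    rw [← integral_const_mul]
    calc ∫ y in S, r ^ k * pev q y ^ 2 ≤ ∫ _ in S, C * ((r ^ d)⁻¹ * I) :=
          setIntegral_mono_on ((memLp_pev_of_isBounded hS.isBounded q).integrable_sq.const_mul _)
            (integrableOn_const hSlt.ne) hS.measurable hq
      _ = volume.real S * (C * ((r ^ d)⁻¹ * I)) := by
          rw [setIntegral_const, smul_eq_mul]
      _ ≤ (2 * σ) ^ d * V * r ^ d * (C * ((r ^ d)⁻¹ * I)) := by
          gcongr
          exact hS.volume_le hσ
      _ = C * ((2 * |σ|) ^ d * V) * I := by rw [abs_of_nonneg hσ]; field_simp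
      _ ≤ C * ((2 * |σ|) ^ d * V) * ∫ y in S, pev p y ^ 2 := by gcongr
      _ ≤ _ := by rw [add_mul]; linarith
  have hb : ∀ y ∈ S, ‖y - x‖ ≤ 2 * σ * r := fun y hy => by
    have := hS.subset hy
    rwa [mem_closedBall_iff_norm] at this
  exact ⟨fun i => key _ 2 fun y hy => (h p hp x r hr y (hb y hy)).2.1 i,
    fun i j => key _ 4 fun y hy => (h p hp x r hr y (hb y hy)).2.2 i j⟩

/-- The Bramble–Hilbert estimates of first and second order for polynomials, by iteration of the
Poincaré inequality. -/
theorem FatConvex.exists_affine_approx (h : FatConvex S x r σ) (p : PolyD d) :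
    (∃ a : PolyD d, a.totalDegree ≤ 0 ∧ (∫ y in S, pev (p - a) y ^ 2)
      ≤ 2 ^ d * (σ * (2 * r)) ^ 2 * ∑ i, ∫ y in S, pev (MvPolynomial.pderiv i p) y ^ 2) ∧
    (∃ a : PolyD d, a.totalDegree ≤ 1 ∧
      (∀ i j, MvPolynomial.pderiv j (MvPolynomial.pderiv i a) = 0) ∧
      (∫ y in S, pev (p - a) y ^ 2) ≤ (2 ^ d * (σ * (2 * r)) ^ 2) ^ 2 *
        ∑ i, ∑ j, ∫ y in S, pev (MvPolynomial.pderiv j (MvPolynomial.pderiv i p)) y ^ 2) := by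
  have poin : ∀ q : PolyD d, ∃ c : ℝ, (∫ y in S, pev (q - MvPolynomial.C c) y ^ 2)
      ≤ 2 ^ d * (σ * (2 * r)) ^ 2 * ∑ i, ∫ y in S, pev (MvPolynomial.pderiv i q) y ^ 2 := by
    intro q
    obtain ⟨c, hc⟩ := exists_poincare h.convex h.measurable h.isBounded h.volume_ne_zero h.diam_le
      (contDiff_pev q)
    refine ⟨c, ?_⟩
    simp only [pev_sub, pev_C]
    refine hc.trans (le_of_eq ?_)
    rw [← integral_finsetSum _ fun i _ =>
      (memLp_pev_of_isBounded h.isBounded (MvPolynomial.pderiv i q)).integrable_sq]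
    simp only [pd_pev]
  refine ⟨?_, ?_⟩
  · obtain ⟨c, hc⟩ := poin p
    exact ⟨_, (MvPolynomial.totalDegree_C c).le, hc⟩
  · choose b hb using fun i => poin (MvPolynomial.pderiv i p)
    set ℓ : PolyD d := ∑ i, MvPolynomial.C (b i) * MvPolynomial.X i with hℓ
    have hℓd : ∀ i, MvPolynomial.pderiv i ℓ = MvPolynomial.C (b i) := by
      classical
      intro i
      rw [hℓ, map_sum, Finset.sum_eq_single i]
      · rw [Derivation.leibniz, MvPolynomial.pderiv_X_self, MvPolynomial.pderiv_C]
        simp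
      · intro j _ hj
        rw [Derivation.leibniz, MvPolynomial.pderiv_X_of_ne hj, MvPolynomial.pderiv_C]
        simp
      · simp
    obtain ⟨c, hc⟩ := poin (p - ℓ)
    refine ⟨ℓ + MvPolynomial.C c, ?_, fun i j => ?_, ?_⟩
    · refine (MvPolynomial.totalDegree_add _ _).trans (max_le ?_ (by
        rw [MvPolynomial.totalDegree_C]; omega))
      refine MvPolynomial.totalDegree_finsetSum_le fun i _ => ?_
      refine (MvPolynomial.totalDegree_mul _ _).trans ?_
      rw [MvPolynomial.totalDegree_C, MvPolynomial.totalDegree_X]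
    · rw [map_add, hℓd, MvPolynomial.pderiv_C, add_zero, MvPolynomial.pderiv_C]
    · rw [← sub_sub]
      refine hc.trans ?_
      have hA : 0 ≤ 2 ^ d * (σ * (2 * r)) ^ 2 := by positivity
      generalize 2 ^ d * (σ * (2 * r)) ^ 2 = A at *
      rw [sq A, mul_assoc]
      refine mul_le_mul_of_nonneg_left ?_ hA
      rw [Finset.mul_sum]
      refine Finset.sum_le_sum fun i _ => ?_
      have := hb i
      rwa [map_sub, hℓd]

/-- The projection minus an element `a` of its range is the projection of `z - a`, and projections are
contractions. -/
theorem IsL2Proj.integral_sq_le {ℓ : ℕ} {z π a : PolyD d} (hS : Bornology.IsBounded S)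
    (h : IsL2Proj ℓ S (pev z) π) (ha : a.totalDegree ≤ ℓ) :
    ∫ y in S, pev (π - a) y ^ 2 ≤ ∫ y in S, pev (z - a) y ^ 2 := by
  have h1 := h.2 (π - a) ((MvPolynomial.totalDegree_sub _ _).trans (max_le h.1 ha))
  have e : ∀ y, pev (z - a) y ^ 2 = pev (z - π) y ^ 2 + 2 * ((pev z y - pev π y) * pev (π - a) y)
      + pev (π - a) y ^ 2 := fun y => by simp only [pev_sub]; ring
  have i1 : IntegrableOn (fun y => pev (z - π) y ^ 2) S :=
    (memLp_pev_of_isBounded hS (z - π)).integrable_sq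
  have i2 : IntegrableOn (fun y => 2 * ((pev z y - pev π y) * pev (π - a) y)) S :=
    integrableOn_of_isBounded hS (by
      have := continuous_pev z
      have := continuous_pev π
      have := continuous_pev (π - a)
      fun_prop)
  have i3 : IntegrableOn (fun y => pev (π - a) y ^ 2) S :=
    (memLp_pev_of_isBounded hS (π - a)).integrable_sq
  have i4 : IntegrableOn (fun y => pev (z - π) y ^ 2
    + 2 * ((pev z y - pev π y) * pev (π - a) y)) S := i1.add i2
  simp_rw [e]
  rw [integral_add i4 i3, integral_add i1 i2, integral_const_mul, h1, mul_zero, add_zero]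
  have : 0 ≤ ∫ y in S, pev (z - π) y ^ 2 := integral_nonneg fun _ => sq_nonneg _
  linarith

theorem projection_const_le {d C A : ℝ} (hd : 0 ≤ d) (hC : 0 ≤ C) (hA : 0 ≤ A) :
    d ^ 2 * (C * A ^ 2) ≤ (d ^ 2 + d) * (C * (A + A ^ 2)) + 1 ∧
      d * (C * A) ≤ (d ^ 2 + d) * (C * (A + A ^ 2)) + 1 := by
  have h1 : 0 ≤ d ^ 2 * (C * A) := by positivity
  have h2 : 0 ≤ d ^ 2 * (C * A ^ 2) := by positivity
  have h3 : 0 ≤ d * (C * A) := by positivity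
  have h4 : 0 ≤ d * (C * A ^ 2) := by positivity
  constructor <;> linarith

/-- The `L²`-projection of polynomials is stable in the `H¹` and `H²` seminorms: it fixes the
affine approximations, and the difference is treated with an inverse estimate. -/
theorem exists_projection_stability (d N : ℕ) (σ : ℝ) : ∃ C : ℝ, 0 < C ∧ ∀ (S : Set (Pt d))
    (x : Pt d) (r : ℝ), 0 ≤ σ → FatConvex S x r σ → ∀ ℓ : ℕ, 1 ≤ ℓ → ℓ ≤ N →
    ∀ z π : PolyD d, IsL2Proj ℓ S (pev z) π → ∀ ε α : ℝ, 0 ≤ α →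
    energySq ε α S (Jet.ofPoly π) ≤ C * energySq ε α S (Jet.ofPoly z) := by
  obtain ⟨C, hC, h⟩ := exists_inverse_bound d N σ
  refine ⟨(d ^ 2 + d) * (C * (2 ^ d * (2 * σ) ^ 2 + (2 ^ d * (2 * σ) ^ 2) ^ 2)) + 1, by positivity,
    fun S x r hσ hS ℓ hℓ hℓN z π hπ ε α hα => ?_⟩
  have hr := hS.pos
  obtain ⟨⟨a, ha0, ha⟩, ⟨b, hb1, hbz, hb⟩⟩ := hS.exists_affine_approx z
  set G := ∑ i, ∫ y in S, pev (MvPolynomial.pderiv i z) y ^ 2 with hG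
  set H := ∑ i, ∑ j, ∫ y in S, pev (MvPolynomial.pderiv j (MvPolynomial.pderiv i z)) y ^ 2 with hH
  have hG0 : 0 ≤ G := Finset.sum_nonneg fun i _ => integral_nonneg fun _ => sq_nonneg _
  have hH0 : 0 ≤ H := Finset.sum_nonneg fun i _ => Finset.sum_nonneg fun j _ =>
    integral_nonneg fun _ => sq_nonneg _
  have da : (π - a).totalDegree ≤ N :=
    (MvPolynomial.totalDegree_sub _ _).trans (max_le (hπ.1.trans hℓN) (by omega))
  have db : (π - b).totalDegree ≤ N :=
    (MvPolynomial.totalDegree_sub _ _).trans (max_le (hπ.1.trans hℓN) (by omega))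
  have pa : ∀ i, MvPolynomial.pderiv i (π - a) = MvPolynomial.pderiv i π := by
    intro i
    rw [map_sub, MvPolynomial.totalDegree_eq_zero_iff_eq_C.1 (Nat.le_zero.1 ha0),
      MvPolynomial.pderiv_C, sub_zero]
  have pb : ∀ i j, MvPolynomial.pderiv j (MvPolynomial.pderiv i (π - b))
      = MvPolynomial.pderiv j (MvPolynomial.pderiv i π) := by
    intro i j
    rw [map_sub, map_sub, hbz, sub_zero]
  have g1 : ∀ i, ∫ y in S, pev (MvPolynomial.pderiv i π) y ^ 2
      ≤ C * (2 ^ d * (2 * σ) ^ 2) * G := by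
    intro i
    have e1 := (h S x r hσ hS (π - a) da).1 i
    rw [pa] at e1
    have e2 := hπ.integral_sq_le hS.isBounded (a := a) (by omega)
    refine le_of_mul_le_mul_left ?_ (by positivity : 0 < r ^ 2)
    calc _ ≤ C * ∫ y in S, pev (π - a) y ^ 2 := e1
      _ ≤ C * (2 ^ d * (σ * (2 * r)) ^ 2 * G) := by gcongr; exact e2.trans ha
      _ = _ := by ring
  have g2 : ∀ i j, ∫ y in S, pev (MvPolynomial.pderiv j (MvPolynomial.pderiv i π)) y ^ 2
      ≤ C * (2 ^ d * (2 * σ) ^ 2) ^ 2 * H := by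
    intro i j
    have e1 := (h S x r hσ hS (π - b) db).2 i j
    rw [pb] at e1
    have e2 := hπ.integral_sq_le hS.isBounded (a := b) (by omega)
    refine le_of_mul_le_mul_left ?_ (by positivity : 0 < r ^ 4)
    calc _ ≤ C * ∫ y in S, pev (π - b) y ^ 2 := e1
      _ ≤ C * ((2 ^ d * (σ * (2 * r)) ^ 2) ^ 2 * H) := by gcongr; exact e2.trans hb
      _ = _ := by ring
  rw [energySq_eq (jetL2_ofPoly hS.isBounded π), energySq_eq (jetL2_ofPoly hS.isBounded z)]
  change ε ^ 2 * (∑ i, ∑ j, ∫ y in S, pev (MvPolynomial.pderiv j (MvPolynomial.pderiv i π)) y ^ 2)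
    + α * (∑ i, ∫ y in S, pev (MvPolynomial.pderiv i π) y ^ 2) ≤ _ * (ε ^ 2 * H + α * G)
  have s1 := Finset.sum_le_sum fun (i : Fin d) (_ : i ∈ Finset.univ) => g1 i
  have s2 := Finset.sum_le_sum fun (i : Fin d) (_ : i ∈ Finset.univ) =>
    Finset.sum_le_sum fun (j : Fin d) (_ : j ∈ Finset.univ) => g2 i j
  simp only [Finset.sum_const, Finset.card_univ, Fintype.card_fin, nsmul_eq_mul] at s1 s2
  have hA : 0 ≤ 2 ^ d * (2 * σ) ^ 2 := by positivity
  clear g1 g2 hb ha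
  generalize 2 ^ d * (2 * σ) ^ 2 = A at *
  obtain ⟨c2, c1⟩ := projection_const_le (Nat.cast_nonneg (α := ℝ) d) hC.le hA
  have t1 := mul_le_mul_of_nonneg_left s1 hα
  have t2 := mul_le_mul_of_nonneg_left s2 (sq_nonneg ε)
  have t3 := mul_le_mul_of_nonneg_right c1 (mul_nonneg hα hG0)
  have t4 := mul_le_mul_of_nonneg_right c2 (mul_nonneg (sq_nonneg ε) hH0)
  refine (add_le_add t2 t1).trans ?_
  rw [mul_add]
  refine add_le_add (le_trans (le_of_eq ?_) t4) (le_trans (le_of_eq ?_) t3) <;> ring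

theorem Cell.exists_fatConvex {n : ℕ} {Ω : Set (Pt (n + 1))} {𝒯 : Triangulation Ω} {σ : ℝ}
    (hσ : ShapeRegular 𝒯 σ) (T : Cell 𝒯) : ∃ x r, FatConvex T.set x r σ := by
  obtain ⟨x, r, hr, h1, h2⟩ := hσ T
  exact ⟨x, r, hr, convex_hull T.1, T.measurableSet, h1, fun y hy z hz =>
    (norm_sub_le_diam T.1 hy hz).trans h2⟩

/-- For every `p` in the range of the projection, `u_h - Π u_h = (u_h - p) - Π (u_h - p)`, and the
projection is stable. -/
theorem exists_mu0_bound (n N ℓ : ℕ) (hℓ : 1 ≤ ℓ) (σ : ℝ) : ∃ C : ℝ, 0 < C ∧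
    ∀ Ω : Set (Pt (n + 1)), IsOpen Ω → IsLipschitzDomain Ω → ∀ 𝒯 : Triangulation Ω,
    ShapeRegular 𝒯 σ → ∀ ε α : ℝ, 0 ≤ α → ∀ uh : Cell 𝒯 → PolyD (n + 1),
    (∀ T, (uh T).totalDegree ≤ N) → ∀ u, IsH20 Ω u → ∀ T : Cell 𝒯,
    mu0Sq ε α ℓ uh T ≤ C * (errSq ε α u uh T + bestApproxSq ε α ℓ u T) := by
  obtain ⟨C, hC, h⟩ := exists_projection_stability (n + 1) (N + ℓ) σ
  refine ⟨4 * (1 + C), by positivity, fun Ω ho hL 𝒯 hreg ε α hα uh hN u hu T => ?_⟩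
  obtain ⟨x, r, hS⟩ := T.exists_fatConvex hreg
  have hσ := (hS.param_pos (Nat.succ_pos n)).le
  have hu' := hu.jetL2 ho hL T
  have hJ : ∀ p, JetL2 T.set (Jet.ofPoly p) := jetL2_ofPoly T.isBounded
  set π := l2Proj ℓ T.set (pev (uh T)) with hπ
  have hproj : IsL2Proj ℓ T.set (pev (uh T)) π :=
    l2Proj_spec ℓ T.1 _ (memLp_pev_of_isBounded T.isBounded (uh T))
  have key : ∀ p : {p : PolyD (n + 1) // p.totalDegree ≤ ℓ},
      mu0Sq ε α ℓ uh T / (4 * (1 + C)) - errSq ε α u uh T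
        ≤ energySq ε α T.set (u - Jet.ofPoly p.1) := by
    intro p
    have hproj' : IsL2Proj ℓ T.set (pev (uh T - p.1)) (π - p.1) := by
      refine ⟨(MvPolynomial.totalDegree_sub _ _).trans (max_le hproj.1 p.2), fun q hq => ?_⟩
      rw [← hproj.2 q hq]
      congr 1
      funext y
      rw [pev_sub, pev_sub, sub_sub_sub_cancel_right]
    have e1 := h T.set x r hσ hS ℓ hℓ (by omega) _ _ hproj' ε α hα
    have e2 : mu0Sq ε α ℓ uh T ≤ 2 * energySq ε α T.set (Jet.ofPoly (uh T - p.1))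
        + 2 * energySq ε α T.set (Jet.ofPoly (π - p.1)) := by
      have : Jet.ofPoly (uh T) - Jet.ofPoly π
          = Jet.ofPoly (uh T - p.1) - Jet.ofPoly (π - p.1) := by
        rw [← ofPoly_sub, ← ofPoly_sub, sub_sub_sub_cancel_right]
      rw [mu0Sq, ← hπ, this]
      exact energySq_sub_le hα (hJ _) (hJ _)
    have e3 : energySq ε α T.set (Jet.ofPoly (uh T - p.1))
        ≤ 2 * energySq ε α T.set (u - Jet.ofPoly p.1) + 2 * errSq ε α u uh T := by
      have : Jet.ofPoly (uh T - p.1) = (u - Jet.ofPoly p.1) - (u - Jet.ofPoly (uh T)) := by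
        rw [ofPoly_sub]
        change (⟨_, _, _⟩ : Jet (n + 1)) = ⟨_, _, _⟩
        congr 1
        · funext y; exact (sub_sub_sub_cancel_left _ _ _).symm
        · funext i y; exact (sub_sub_sub_cancel_left _ _ _).symm
        · funext i j y; exact (sub_sub_sub_cancel_left _ _ _).symm
      rw [this]
      exact energySq_sub_le hα (jetL2_sub hu' (hJ _)) (jetL2_sub hu' (hJ _))
    rw [sub_le_iff_le_add, div_le_iff₀ (by positivity)]
    calc mu0Sq ε α ℓ uh T ≤ 2 * (1 + C) * energySq ε α T.set (Jet.ofPoly (uh T - p.1)) := by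
          linarith
      _ ≤ 2 * (1 + C) * (2 * energySq ε α T.set (u - Jet.ofPoly p.1) + 2 * errSq ε α u uh T) := by
          gcongr
      _ = _ := by ring
  have hne : Nonempty {p : PolyD (n + 1) // p.totalDegree ≤ ℓ} := ⟨⟨0, by simp⟩⟩
  have hfin := le_ciInf key
  rw [sub_le_iff_le_add, div_le_iff₀ (by positivity)] at hfin
  rw [bestApproxSq]
  linarith

end Projection



/-! ### The residual on an element -/

section Residual

theorem setIntegral_congr_of_support {d : ℕ} {Z Z' K : Set (Pt d)} (hZ : MeasurableSet Z)
    (hZ' : MeasurableSet Z') {g : Pt d → ℝ} (h0 : ∀ x ∉ K, g x = 0) (hK : Z ∩ K = Z' ∩ K) :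
    ∫ x in Z, g x = ∫ x in Z', g x := by
  classical
  rw [← integral_indicator hZ, ← integral_indicator hZ']
  congr 1
  funext x
  by_cases hx : x ∈ K
  · have : x ∈ Z ↔ x ∈ Z' := by
      constructor
      · intro h; have : x ∈ Z ∩ K := ⟨h, hx⟩; rw [hK] at this; exact this.1
      · intro h; have : x ∈ Z' ∩ K := ⟨h, hx⟩; rw [← hK] at this; exact this.1
    simp only [Set.indicator, this]
  · simp [Set.indicator, h0 x hx]

theorem testJet_eq_zero {d : ℕ} {v : Pt d → ℝ} {x : Pt d} (hx : x ∉ tsupport v) :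
    v x = 0 ∧ (∀ i, pd i v x = 0) ∧ ∀ i j, pd j (pd i v) x = 0 :=
  ⟨image_eq_zero_of_notMem_tsupport hx,
    fun i => image_eq_zero_of_notMem_tsupport fun h => hx (tsupport_pd_subset v i h),
    fun i j => image_eq_zero_of_notMem_tsupport fun h =>
      hx (tsupport_pd_subset v i (tsupport_pd_subset _ j h))⟩

theorem energyForm_congr_of_support {d : ℕ} {Z Z' : Set (Pt d)} (hZ : MeasurableSet Z)
    (hZ' : MeasurableSet Z') (ε α : ℝ) (w : Jet d) {v : Pt d → ℝ}
    (hK : Z ∩ tsupport v = Z' ∩ tsupport v) :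
    energyForm ε α Z w (testJet v) = energyForm ε α Z' w (testJet v) := by
  unfold energyForm
  rw [setIntegral_congr_of_support hZ hZ' (K := tsupport v) _ hK,
    setIntegral_congr_of_support hZ hZ' (K := tsupport v) _ hK]
  · intro x hx
    exact Finset.sum_eq_zero fun i _ => by
      rw [show (testJet v).grad i x = 0 from (testJet_eq_zero hx).2.1 i, mul_zero]
  · intro x hx
    exact Finset.sum_eq_zero fun i _ => Finset.sum_eq_zero fun j _ => by
      rw [show (testJet v).hess i j x = 0 from (testJet_eq_zero hx).2.2 i j, mul_zero]

theorem energyForm_sub {d : ℕ} {Z : Set (Pt d)} (ε α : ℝ) {w z v : Jet d} (hw : JetL2 Z w)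
    (hz : JetL2 Z z) (hv : JetL2 Z v) :
    energyForm ε α Z (w - z) v = energyForm ε α Z w v - energyForm ε α Z z v := by
  have e1 : ∀ x, ∑ i, ∑ j, (w - z).hess i j x * v.hess i j x
      = ∑ i, ∑ j, w.hess i j x * v.hess i j x - ∑ i, ∑ j, z.hess i j x * v.hess i j x := by
    intro x
    simp only [← Finset.sum_sub_distrib, ← sub_mul]
    rfl
  have e2 : ∀ x, ∑ i, (w - z).grad i x * v.grad i x
      = ∑ i, w.grad i x * v.grad i x - ∑ i, z.grad i x * v.grad i x := by
    intro x
    simp only [← Finset.sum_sub_distrib, ← sub_mul]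
    rfl
  have ih : ∀ y : Jet d, JetL2 Z y → IntegrableOn (fun x => ∑ i, ∑ j, y.hess i j x * v.hess i j x) Z :=
    fun y hy => integrable_finsetSum _ fun i _ => integrable_finsetSum _ fun j _ =>
      (hy.hess i j).integrable_mul (hv.hess i j)
  have ig : ∀ y : Jet d, JetL2 Z y → IntegrableOn (fun x => ∑ i, y.grad i x * v.grad i x) Z :=
    fun y hy => integrable_finsetSum _ fun i _ => (hy.grad i).integrable_mul (hv.grad i)
  unfold energyForm
  simp_rw [e1, e2]
  rw [integral_sub (ih w hw) (ih z hz), integral_sub (ig w hw) (ig z hz)]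
  ring

/-- The residual `ε² Δ² p - α Δ p - f`. -/
def residual {d : ℕ} (ε α : ℝ) (f : Pt d → ℝ) (p : PolyD d) (x : Pt d) : ℝ :=
  ε ^ 2 * pev (lap (lap p)) x - α * pev (lap p) x - f x

variable {n : ℕ} {Ω : Set (Pt (n + 1))}

theorem measurableSet_upper {d : ℕ} (m ν : Pt d) : MeasurableSet (upper m ν) :=
  (isOpen_upper m ν).measurableSet

/-- Integration by parts for functions supported in the interior of an element. -/
theorem energyForm_ofPoly_testJet (ε α : ℝ) (p : PolyD (n + 1)) {Z : Set (Pt (n + 1))}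
    (hZ : MeasurableSet Z) {v : Pt (n + 1) → ℝ} (hv : ContDiff ℝ ((⊤ : ℕ∞) : WithTop ℕ∞) v)
    {x : Pt (n + 1)} {r : ℝ} (hr : 0 < r) (hvs : tsupport v ⊆ Metric.closedBall x r)
    (hvZ : tsupport v ⊆ Z) :
    energyForm ε α Z (Jet.ofPoly p) (testJet v)
      = ∫ y in Z, (ε ^ 2 * pev (lap (lap p)) y - α * pev (lap p) y) * v y := by
  have hc : HasCompactSupport v :=
    HasCompactSupport.of_support_subset_isCompact (isCompact_closedBall x r)
      ((subset_tsupport v).trans hvs)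
  set ν : Pt (n + 1) := EuclideanSpace.single 0 1 with hν
  have hν1 : ‖ν‖ = 1 := by simp [hν]
  -- a half-space that contains the support
  set m := x - (2 * r) • ν with hm
  have hpos : ∀ y ∈ tsupport v, 0 < (inner ℝ ν (y - m) : ℝ) := by
    intro y hy
    have h1 : y - m = (y - x) + (2 * r) • ν := by rw [hm]; abel
    have h2 : |(inner ℝ ν (y - x) : ℝ)| ≤ r := by
      refine (abs_real_inner_le_norm _ _).trans ?_
      rw [hν1, one_mul]
      exact mem_closedBall_iff_norm.1 (hvs hy)
    rw [h1, inner_add_right, inner_smul_right, real_inner_self_eq_norm_sq, hν1]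
    linarith [neg_le_of_abs_le h2]
  have hsup : Z ∩ tsupport v = upper m ν ∩ tsupport v := by
    have hup : tsupport v ⊆ upper m ν := hpos
    rw [Set.inter_eq_right.2 hvZ, Set.inter_eq_right.2 hup]
  have hflux : ∫ y in hyp m ν, fluxDensity ε α ν p v y ∂μHE[n] = 0 := by
    refine setIntegral_eq_zero_of_forall_eq_zero fun y hy => ?_
    have hy' : y ∉ tsupport v := fun h => (hpos y h).ne' hy
    obtain ⟨h1, h2, -⟩ := testJet_eq_zero hy'
    simp [fluxDensity, h1, h2]
  rw [energyForm_congr_of_support hZ (measurableSet_upper m ν) ε α _ hsup,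
    energyForm_upper ε α m ν hν1 p hv hc, hflux, sub_zero]
  exact setIntegral_congr_of_support (measurableSet_upper m ν) hZ (K := tsupport v)
    (fun y hy => by rw [(testJet_eq_zero hy).1, mul_zero]) hsup.symm

/-- The residual tested with a bubble function on an element is the error tested with it. -/
theorem integral_residual_mul (ho : IsOpen Ω) (hL : IsLipschitzDomain Ω) {𝒯 : Triangulation Ω}
    {ε α : ℝ} {f : Pt (n + 1) → ℝ} (hf : InL2 Ω f) {u : Jet (n + 1)}
    (hu : IsWeakSolution Ω ε α f u) (p : PolyD (n + 1)) (T : Cell 𝒯) {x : Pt (n + 1)} {r : ℝ}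
    (hr : 0 < r) (hxT : Metric.ball x r ⊆ T.set) {v : Pt (n + 1) → ℝ}
    (hv : ContDiff ℝ ((⊤ : ℕ∞) : WithTop ℕ∞) v) (hvs : tsupport v ⊆ Metric.ball x r) :
    ∫ y in T.set, residual ε α f p y * v y
      = - energyForm ε α T.set (u - Jet.ofPoly p) (testJet v) := by
  have hball : Metric.ball x r ⊆ Ω := T.ball_subset ho hL hxT
  have hvs' : tsupport v ⊆ Metric.closedBall x r := hvs.trans Metric.ball_subset_closedBall
  have hc : HasCompactSupport v :=
    HasCompactSupport.of_support_subset_isCompact (isCompact_closedBall x r)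
      ((subset_tsupport v).trans hvs')
  have htest : IsTest Ω v := ⟨hv, hc, hvs.trans hball⟩
  have hsup : T.set ∩ tsupport v = Ω ∩ tsupport v := by
    rw [Set.inter_eq_right.2 (hvs.trans hxT), Set.inter_eq_right.2 (hvs.trans hball)]
  have h1 := hu.2 _ (isH20_testJet htest)
  have h2 : energyForm ε α T.set u (testJet v) = ∫ y in T.set, f y * v y := by
    rw [energyForm_congr_of_support T.measurableSet ho.measurableSet ε α _ hsup, h1]
    exact setIntegral_congr_of_support ho.measurableSet T.measurableSet (K := tsupport v)
      (fun y hy => by rw [show (testJet v).val y = 0 from (testJet_eq_zero hy).1, mul_zero]) hsup.symm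
  rw [energyForm_sub ε α (hu.1.jetL2 ho hL T) (jetL2_ofPoly T.isBounded p) (jetL2_testJet _ hv hc),
    h2, energyForm_ofPoly_testJet ε α p T.measurableSet hv hr hvs' (hvs.trans hxT), neg_sub,
    ← integral_sub]
  · refine integral_congr_ae (Eventually.of_forall fun y => ?_)
    simp only [residual]
    ring
  · have := continuous_pev (lap (lap p))
    have := continuous_pev (lap p)
    exact (integrable_mul_of_hasCompactSupport (by fun_prop) hv.continuous hc).integrableOn
  · exact (T.inL2 ho hL hf).integrable_mul (inL2_of_hasCompactSupport _ hv.continuous hc)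

theorem ScaledBounds.of_sq {d : ℕ} {v : Pt d → ℝ} (hv : ContDiff ℝ ((⊤ : ℕ∞) : WithTop ℕ∞) v)
    {S : Set (Pt d)} {A ρ : ℝ} (hρ : 0 < ρ) (h0 : ∀ x ∈ S, v x ^ 2 ≤ A)
    (h1 : ∀ x ∈ S, ∀ i, ρ ^ 2 * pd i v x ^ 2 ≤ A)
    (h2 : ∀ x ∈ S, ∀ i j, ρ ^ 4 * pd j (pd i v) x ^ 2 ≤ A) : ScaledBounds v S (Real.sqrt A) ρ := by
  refine ⟨hv, fun x hx => Real.abs_le_sqrt (h0 x hx), fun x hx i => ?_, fun x hx i j => ?_⟩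
  · rw [le_div_iff₀ hρ, ← abs_of_pos hρ, ← abs_mul]
    refine Real.abs_le_sqrt (le_trans (le_of_eq ?_) (h1 x hx i))
    ring
  · rw [le_div_iff₀ (by positivity), ← abs_of_pos (show 0 < ρ ^ 2 by positivity), ← abs_mul]
    refine Real.abs_le_sqrt (le_trans (le_of_eq ?_) (h2 x hx i j))
    ring

theorem ScaledBounds.mono_scale {d : ℕ} {v : Pt d → ℝ} {S : Set (Pt d)} {M δ ρ : ℝ}
    (h : ScaledBounds v S M ρ) (hM : 0 ≤ M) (hδ : 0 < δ) (hδρ : δ ≤ ρ) : ScaledBounds v S M δ :=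
  ⟨h.smooth, h.val, fun x hx i => (h.grad x hx i).trans (by gcongr),
    fun x hx i j => (h.hess x hx i j).trans (by gcongr)⟩

/-- If `c y ≤ √y a` then `y ≤ (a / c)²`. -/
theorem le_sq_of_mul_le_sqrt_mul {c y a : ℝ} (hc : 0 < c) (hy : 0 ≤ y)
    (h : c * y ≤ Real.sqrt y * a) : y ≤ (a / c) ^ 2 := by
  rcases hy.eq_or_lt with rfl | hy'
  · positivity
  have hs := Real.sqrt_pos.2 hy'
  have h1 : c * Real.sqrt y ≤ a := by
    refine le_of_mul_le_mul_left ?_ hs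
    calc Real.sqrt y * (c * Real.sqrt y) = c * (Real.sqrt y * Real.sqrt y) := by ring
      _ = c * y := by rw [Real.mul_self_sqrt hy]
      _ ≤ _ := h
  have h2 : Real.sqrt y ≤ a / c := by rw [le_div_iff₀ hc]; linarith
  calc y = Real.sqrt y ^ 2 := (Real.sq_sqrt hy).symm
    _ ≤ _ := by gcongr

theorem totalDegree_lap_le {d : ℕ} (p : PolyD d) : (lap p).totalDegree ≤ p.totalDegree :=
  MvPolynomial.totalDegree_finsetSum_le fun _ _ =>
    (totalDegree_pderiv_le _ _).trans (totalDegree_pderiv_le _ _)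

theorem totalDegree_C_mul_le {d : ℕ} (a : ℝ) (p : PolyD d) :
    (MvPolynomial.C a * p).totalDegree ≤ p.totalDegree := by
  refine (MvPolynomial.totalDegree_mul _ _).trans ?_
  rw [MvPolynomial.totalDegree_C, zero_add]

end Residual



/-! ### Efficiency of the element residual -/

section ElementResidual

theorem exists_ball_bound (d N : ℕ) (σ : ℝ) : ∃ C : ℝ, 0 < C ∧ ∀ (S : Set (Pt d)) (x : Pt d)
    (r : ℝ), 0 ≤ σ → FatConvex S x r σ → ∀ p : PolyD d, p.totalDegree ≤ N →
    ∫ y in S, pev p y ^ 2 ≤ C * ∫ y in Metric.ball x (r / 2), pev p y ^ 2 := by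
  obtain ⟨C, hC, h⟩ := exists_poly_bound d N (4 * σ)
  set V := volume.real (Metric.ball (0 : Pt d) 1)
  refine ⟨(2 * |σ|) ^ d * V * 2 ^ d * C + 1, by positivity, fun S x r hσ hS p hp => ?_⟩
  have hr := hS.pos
  set I := ∫ y in Metric.ball x (r / 2), pev p y ^ 2
  have hI0 : 0 ≤ I := integral_nonneg fun _ => sq_nonneg _
  have hSlt : volume S < ⊤ := hS.isBounded.measure_lt_top
  calc ∫ y in S, pev p y ^ 2 ≤ ∫ _ in S, C * (((r / 2) ^ d)⁻¹ * I) :=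
        setIntegral_mono_on (memLp_pev_of_isBounded hS.isBounded p).integrable_sq
          (integrableOn_const hSlt.ne) hS.measurable fun y hy => by
            have h1 := mem_closedBall_iff_norm.1 (hS.subset hy)
            exact (h p hp x (r / 2) (by positivity) y (by linarith)).1
    _ = volume.real S * (C * (((r / 2) ^ d)⁻¹ * I)) := by rw [setIntegral_const, smul_eq_mul]
    _ ≤ (2 * σ) ^ d * V * r ^ d * (C * (((r / 2) ^ d)⁻¹ * I)) := by
        gcongr
        exact hS.volume_le hσ
    _ = (2 * |σ|) ^ d * V * 2 ^ d * C * I := by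
        rw [abs_of_nonneg hσ, div_pow]
        field_simp
    _ ≤ _ := by rw [add_mul]; linarith

variable {n : ℕ} {Ω : Set (Pt (n + 1))}

/-- The polynomial part of the residual is bounded by testing with its product with a bubble
function. -/
theorem exists_poly_residual_bound (n N : ℕ) (σ : ℝ) : ∃ C : ℝ, 0 < C ∧
    ∀ Ω : Set (Pt (n + 1)), IsOpen Ω → IsLipschitzDomain Ω → ∀ 𝒯 : Triangulation Ω,
    ∀ ε α : ℝ, 0 ≤ ε → (α = 0 ∨ α = 1) → ∀ f, InL2 Ω f → ∀ u, IsWeakSolution Ω ε α f u →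
    ∀ (uh : Cell 𝒯 → PolyD (n + 1)) (T : Cell 𝒯) (x : Pt (n + 1)) (r : ℝ), FatConvex T.set x r σ →
    ∀ π R : PolyD (n + 1), R.totalDegree ≤ N →
    (∀ y, pev R y = residual ε α f (uh T) y + (f y - pev π y)) →
    ∫ y in T.set, pev R y ^ 2 ≤ C * ((∫ y in T.set, (f y - pev π y) ^ 2)
      + errSq ε α u uh T * ((n + 1) ^ 2 * (ε / r ^ 2) + (n + 1) * (α / r)) ^ 2) := by
  obtain ⟨C2, hC2, h2⟩ := exists_ball_bound (n + 1) N σ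
  obtain ⟨C3, hC3, h3⟩ := exists_poly_bound (n + 1) N 1
  obtain ⟨Cc, hCc, hcut⟩ := exists_cut_bounds (n + 1)
  set W := volume.real (Metric.ball (0 : Pt n) 1)
  set C4 := 4 * Cc * Real.sqrt (C3 * (2 * W)) with hC4
  refine ⟨2 * (C4 * C2) ^ 2 + 1, by positivity,
    fun Ω ho hL 𝒯 ε α hε hα f hf u hu uh T x r hS π R hR hRe => ?_⟩
  have hr := hS.pos
  have hσ := (hS.param_pos (Nat.succ_pos n)).le
  have hα0 : 0 ≤ α := by rcases hα with rfl | rfl <;> norm_num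
  -- for equal widths, the direction in the cut-off function is immaterial
  set ν : Pt (n + 1) := EuclideanSpace.single 0 1 with hν
  have hν1 : ‖ν‖ = 1 := by simp [hν]
  set Y := ∫ y in T.set, pev R y ^ 2 with hY
  have hY0 : 0 ≤ Y := integral_nonneg fun _ => sq_nonneg _
  have hballT : Metric.ball x r ⊆ T.set := Metric.ball_subset_closedBall.trans hS.ball_subset
  set S := slab x ν r r
  have hSb : S ⊆ Metric.ball x r := slab_subset_ball hr
  have hSlt : volume S < ⊤ := (isCompact_slab x ν r r).measure_lt_top
  have hV := volume_slab_le x hν1 hr hr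
  set A := C3 * ((r ^ (n + 1))⁻¹ * Y) with hA
  have hIY : ∫ y in Metric.ball x r, pev R y ^ 2 ≤ Y := setIntegral_pev_sq_mono T.isBounded hballT R
  have hAle : C3 * ((r ^ (n + 1))⁻¹ * ∫ y in Metric.ball x r, pev R y ^ 2) ≤ A := by
    rw [hA]; gcongr
  have hR1 : ScaledBounds (pev R) S (Real.sqrt A) r := by
    have hb : ∀ y ∈ S, ‖y - x‖ ≤ 1 * r := fun y hy => by
      rw [one_mul]; exact (mem_ball_iff_norm.1 (hSb hy)).le
    refine ScaledBounds.of_sq (contDiff_pev R) hr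
      (fun y hy => (h3 R hR x r hr y (hb y hy)).1.trans hAle) (fun y hy i => ?_) fun y hy i j => ?_
    · rw [pd_pev]
      exact ((h3 R hR x r hr y (hb y hy)).2.1 i).trans hAle
    · rw [pd_pev, pd_pev]
      exact ((h3 R hR x r hr y (hb y hy)).2.2 i j).trans hAle
  set v : Pt (n + 1) → ℝ := fun y => cut x ν r r y * pev R y with hv
  have hvb : ScaledBounds v S (4 * Cc * Real.sqrt A) r :=
    ScaledBounds.mul hr hCc.le (Real.sqrt_nonneg _)
      ((hcut x ν r r hν1 hr le_rfl).mono (Set.subset_univ S)) hR1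
  have hvS : tsupport v ⊆ S := (tsupport_mul_subset_left).trans (tsupport_cut_subset hν1 hr le_rfl)
  have hc : HasCompactSupport v := HasCompactSupport.of_support_subset_isCompact
    (isCompact_slab x ν r r) ((subset_tsupport v).trans hvS)
  have hMV : 4 * Cc * Real.sqrt A * Real.sqrt (2 * W * (r * r ^ n)) = C4 * Real.sqrt Y := by
    rw [mul_assoc, ← Real.sqrt_mul (by positivity), hC4, mul_assoc (4 * Cc),
      ← Real.sqrt_mul (by positivity)]
    congr 2
    rw [hA, pow_succ]
    field_simp
  have hfT := T.inL2 ho hL hf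
  have hg : InL2 T.set fun y => f y - pev π y := hfT.sub (memLp_pev_of_isBounded T.isBounded π)
  have hvL2 : InL2 T.set v := inL2_of_hasCompactSupport _ hvb.smooth.continuous hc
  have b1 := abs_setIntegral_mul_le_of_bound (Z := T.set) hSlt (B := 4 * Cc * Real.sqrt A)
    (by positivity) hg hvb.smooth.continuous hc hvb.val
    (fun y hy => image_eq_zero_of_notMem_tsupport fun h => hy (hvS h)) hV
  have hw := jetL2_sub (hu.1.jetL2 ho hL T) (jetL2_ofPoly T.isBounded (uh T))
  have b2 := abs_energyForm_testJet_le (ε := ε) (α := α) hε hα hr (by positivity) hSlt hV hw hvb hc hvS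
  rw [hMV] at b1 b2
  have e1 := integral_residual_mul ho hL hf hu (uh T) T hr hballT hvb.smooth (hvS.trans hSb)
  have e2 : ∫ y in T.set, pev R y * v y = (∫ y in T.set, residual ε α f (uh T) y * v y)
      + ∫ y in T.set, (f y - pev π y) * v y := by
    rw [← integral_add]
    · exact integral_congr_ae (Eventually.of_forall fun y => by simp only [hRe y, add_mul])
    · refine MemLp.integrable_mul (p := 2) (q := 2) ?_ hvL2
      have c1 := continuous_pev (lap (lap (uh T)))
      have c2 := continuous_pev (lap (uh T))
      exact (inL2_of_isBounded T.isBounded (g := fun y => ε ^ 2 * pev (lap (lap (uh T))) y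
        - α * pev (lap (uh T)) y) (by fun_prop)).sub hfT
    · exact hg.integrable_mul hvL2
  have e3 : ∫ y in Metric.ball x (r / 2), pev R y ^ 2 ≤ ∫ y in T.set, pev R y * v y := by
    have hsub : Metric.ball x (r / 2) ⊆ T.set :=
      (Metric.ball_subset_ball (by linarith)).trans hballT
    have c1 := continuous_pev R
    have c2 := (contDiff_cut x ν r r).continuous
    rw [setIntegral_congr_fun (g := fun y => pev R y * v y) Metric.isOpen_ball.measurableSet]
    · refine setIntegral_mono_set (integrableOn_of_isBounded T.isBounded (by
        rw [hv]; fun_prop)) (Eventually.of_forall fun y => ?_) hsub.eventuallyLE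
      change 0 ≤ pev R y * (cut x ν r r y * pev R y)
      have := mul_nonneg (cut_nonneg x ν r r y) (sq_nonneg (pev R y))
      linarith
    · intro y hy
      change pev R y ^ 2 = pev R y * (cut x ν r r y * pev R y)
      rw [cut_eq_one_of_isotropic hν1 hr (mem_ball_iff_norm.1 hy).le]
      ring
  set s := (n + 1) ^ 2 * (ε / r ^ 2) + (n + 1) * (α / r) with hs
  have hs0 : 0 ≤ s := by positivity
  set O := ∫ y in T.set, (f y - pev π y) ^ 2
  have hO : 0 ≤ O := integral_nonneg fun _ => sq_nonneg _
  have hE : 0 ≤ errSq ε α u uh T := errSq_nonneg hα0 _ _ _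
  have e4 : C2⁻¹ * Y ≤ Real.sqrt Y * (C4 * (Real.sqrt O + Real.sqrt (errSq ε α u uh T) * s)) := by
    have h5 : C2⁻¹ * Y ≤ ∫ y in Metric.ball x (r / 2), pev R y ^ 2 := by
      rw [inv_mul_le_iff₀ hC2]
      exact h2 T.set x r hσ hS R hR
    have h6 := le_of_abs_le b1
    have h7 := neg_le_of_abs_le b2
    push_cast at h7
    refine h5.trans (e3.trans ?_)
    rw [e2, e1]
    change - energyForm ε α T.set (u - Jet.ofPoly (uh T)) (testJet v) + _ ≤ _
    calc _ ≤ Real.sqrt (energySq ε α T.set (u - Jet.ofPoly (uh T))) * (C4 * Real.sqrt Y * s)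
          + Real.sqrt O * (C4 * Real.sqrt Y) := add_le_add (by linarith) h6
      _ = Real.sqrt Y * (C4 * (Real.sqrt O
          + Real.sqrt (energySq ε α T.set (u - Jet.ofPoly (uh T))) * s)) := by ring
  have e5 := le_sq_of_mul_le_sqrt_mul (inv_pos.2 hC2) hY0 e4
  refine e5.trans ?_
  have e6 : (Real.sqrt O + Real.sqrt (errSq ε α u uh T) * s) ^ 2
      ≤ 2 * (O + errSq ε α u uh T * s ^ 2) := by
    refine add_sq_le.trans (le_of_eq ?_)
    rw [mul_pow, Real.sq_sqrt hO, Real.sq_sqrt hE]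
  calc _ = (C4 * C2) ^ 2 * (Real.sqrt O + Real.sqrt (errSq ε α u uh T) * s) ^ 2 := by
        field_simp
    _ ≤ (C4 * C2) ^ 2 * (2 * (O + errSq ε α u uh T * s ^ 2)) := by gcongr
    _ ≤ _ := by
        have : 0 ≤ O + errSq ε α u uh T * s ^ 2 := by positivity
        linarith

theorem kappa_nonneg {ε h : ℝ} (hε : 0 < ε) (hh : 0 ≤ h) : 0 ≤ kappa ε h :=
  le_min zero_le_one (by positivity)

theorem kappa_le_one (ε h : ℝ) : kappa ε h ≤ 1 := min_le_left _ _

theorem mul_kappa_le {ε : ℝ} (hε : 0 < ε) (h : ℝ) : ε * kappa ε h ≤ h := by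
  have : kappa ε h ≤ h / ε := min_le_right _ _
  calc ε * kappa ε h ≤ ε * (h / ε) := by gcongr
    _ = h := by field_simp

theorem FatConvex.diam_set_le {d : ℕ} {S : Set (Pt d)} {x : Pt d} {r σ : ℝ} (hσ : 0 ≤ σ)
    (h : FatConvex S x r σ) : Metric.diam S ≤ 2 * σ * r := by
  have hr := h.pos
  refine Metric.diam_le_of_forall_dist_le (by positivity) fun y hy z hz => ?_
  rw [dist_eq_norm]
  linarith [h.diam_le y hy z hz]

/-- The weights `κ h` of the residual compensate for the factors `ε / r²` and `α / r` of the bubble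
function, since `ε κ ≤ h`. -/
theorem exists_mu1_bound (n N ℓ : ℕ) (σ : ℝ) : ∃ C : ℝ, 0 < C ∧
    ∀ Ω : Set (Pt (n + 1)), IsOpen Ω → IsLipschitzDomain Ω → ∀ 𝒯 : Triangulation Ω,
    ShapeRegular 𝒯 σ → ∀ ε α : ℝ, 0 < ε → (α = 0 ∨ α = 1) → ∀ f, InL2 Ω f →
    ∀ u, IsWeakSolution Ω ε α f u → ∀ uh : Cell 𝒯 → PolyD (n + 1),
    (∀ T, (uh T).totalDegree ≤ N) → ∀ T : Cell 𝒯,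
    mu1Sq ε α f uh T ≤ C * (errSq ε α u uh T + oscSq ε f ℓ T) := by
  obtain ⟨C, hC, h⟩ := exists_poly_residual_bound n (N + ℓ) σ
  set s₀ := ((n : ℝ) + 1) ^ 2 * (2 * σ) ^ 2 + (n + 1) * (2 * σ) with hs₀
  refine ⟨2 * C * (1 + s₀ ^ 2) + 2, by positivity,
    fun Ω ho hL 𝒯 hreg ε α hε hα f hf u hu uh hN T => ?_⟩
  obtain ⟨x, r, hS⟩ := T.exists_fatConvex hreg
  have hr := hS.pos
  have hσ := (hS.param_pos (Nat.succ_pos n)).le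
  have hα0 : 0 ≤ α := by rcases hα with rfl | rfl <;> norm_num
  have hα1 : α ≤ 1 := by rcases hα with rfl | rfl <;> norm_num
  set π := l2Proj ℓ T.set f with hπ
  have hfT := T.inL2 ho hL hf
  have hproj : IsL2Proj ℓ T.set f π := l2Proj_spec ℓ T.1 f hfT
  set R : PolyD (n + 1) := MvPolynomial.C (ε ^ 2) * lap (lap (uh T))
    - MvPolynomial.C α * lap (uh T) - π with hR
  have hRe : ∀ y, pev R y = residual ε α f (uh T) y + (f y - pev π y) := by
    intro y
    simp only [hR, pev_sub, pev_mul, pev_C, residual]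
    ring
  have hl := (totalDegree_lap_le (uh T)).trans (hN T)
  have hRd : R.totalDegree ≤ N + ℓ := by
    refine (MvPolynomial.totalDegree_sub _ _).trans (max_le ?_ (hproj.1.trans (by omega)))
    refine (MvPolynomial.totalDegree_sub _ _).trans (max_le ?_ ?_)
    · exact (totalDegree_C_mul_le _ _).trans (((totalDegree_lap_le _).trans hl).trans (by omega))
    · exact (totalDegree_C_mul_le _ _).trans (hl.trans (by omega))
  have b1 := h Ω ho hL 𝒯 ε α hε.le hα f hf u hu uh T x r hS π R hRd hRe
  have hh : 0 ≤ T.h := Metric.diam_nonneg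
  have hhr : T.h ≤ 2 * σ * r := hS.diam_set_le hσ
  have hκ := kappa_nonneg hε hh
  set κ := kappa ε T.h
  set E := errSq ε α u uh T
  have hE : 0 ≤ E := errSq_nonneg hα0 _ _ _
  set O := ∫ y in T.set, (f y - pev π y) ^ 2 with hO
  have hO0 : 0 ≤ O := integral_nonneg fun _ => sq_nonneg _
  have hosc : oscSq ε f ℓ T = T.h ^ 2 * κ ^ 2 * O := rfl
  set s := ((n : ℝ) + 1) ^ 2 * (ε / r ^ 2) + (n + 1) * (α / r) with hs
  have hs0 : 0 ≤ s := by positivity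
  have hκs : κ * T.h * s ≤ s₀ := by
    have t1 : κ * T.h * (ε / r ^ 2) ≤ (2 * σ) ^ 2 := by
      calc κ * T.h * (ε / r ^ 2) = ε * κ * T.h / r ^ 2 := by ring
        _ ≤ T.h * T.h / r ^ 2 := by
            gcongr
            exact mul_kappa_le hε _
        _ ≤ (2 * σ * r) * (2 * σ * r) / r ^ 2 := by gcongr
        _ = _ := by field_simp
    have t2 : κ * T.h * (α / r) ≤ 2 * σ := by
      calc κ * T.h * (α / r) ≤ 1 * (2 * σ * r) * (1 / r) := by
            gcongr
            exact kappa_le_one _ _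
        _ = _ := by field_simp
    calc κ * T.h * s = ((n : ℝ) + 1) ^ 2 * (κ * T.h * (ε / r ^ 2))
          + (n + 1) * (κ * T.h * (α / r)) := by rw [hs]; ring
      _ ≤ _ := by rw [hs₀]; gcongr
  have b2 : ∫ y in T.set, residual ε α f (uh T) y ^ 2
      ≤ 2 * (∫ y in T.set, pev R y ^ 2) + 2 * O := by
    have : ∀ y, residual ε α f (uh T) y = pev R y - (f y - pev π y) := fun y => by
      rw [hRe]; ring
    simp_rw [this]
    exact setIntegral_sub_sq_le (memLp_pev_of_isBounded T.isBounded R)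
      (hfT.sub (memLp_pev_of_isBounded T.isBounded π))
  change κ ^ 2 * T.h ^ 2 * ∫ y in T.set, residual ε α f (uh T) y ^ 2 ≤ _
  calc κ ^ 2 * T.h ^ 2 * ∫ y in T.set, residual ε α f (uh T) y ^ 2
      ≤ κ ^ 2 * T.h ^ 2 * (2 * (C * (O + E * s ^ 2)) + 2 * O) := by
        gcongr
        linarith
    _ = (2 * C + 2) * (T.h ^ 2 * κ ^ 2 * O) + 2 * C * (κ * T.h * s) ^ 2 * E := by ring
    _ ≤ (2 * C + 2) * (T.h ^ 2 * κ ^ 2 * O) + 2 * C * s₀ ^ 2 * E := by gcongr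
    _ ≤ _ := by
        rw [hosc]
        have t1 : 0 ≤ T.h ^ 2 * κ ^ 2 * O := by positivity
        have t2 : 0 ≤ C * s₀ ^ 2 * (T.h ^ 2 * κ ^ 2 * O) := by positivity
        have t3 : 0 ≤ C * E := by positivity
        linarith

end ElementResidual



/-! ### Testing the jumps across an interior hyperface -/

section FaceIdentity

variable {n : ℕ} {Ω : Set (Pt (n + 1))}

theorem normalDeriv_sub {d : ℕ} (ν : Pt d) (p q : PolyD d) :
    normalDeriv ν (p - q) = normalDeriv ν p - normalDeriv ν q := by
  simp only [normalDeriv, map_sub, mul_sub, Finset.sum_sub_distrib]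

theorem hessNormal_sub {d : ℕ} (ν : Pt d) (p q : PolyD d) (i : Fin d) :
    hessNormal ν (p - q) i = hessNormal ν p i - hessNormal ν q i := by
  simp only [hessNormal, map_sub, mul_sub, Finset.sum_sub_distrib]

theorem divHessNormal_sub {d : ℕ} (ν : Pt d) (p q : PolyD d) :
    divHessNormal ν (p - q) = divHessNormal ν p - divHessNormal ν q := by
  simp only [divHessNormal, map_sub, mul_sub, Finset.sum_sub_distrib]

theorem normalDeriv_neg {d : ℕ} (ν : Pt d) (p : PolyD d) :
    normalDeriv (-ν) p = -normalDeriv ν p := by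
  simp [normalDeriv]

theorem hessNormal_neg {d : ℕ} (ν : Pt d) (p : PolyD d) (i : Fin d) :
    hessNormal (-ν) p i = -hessNormal ν p i := by
  simp [hessNormal]

theorem divHessNormal_neg {d : ℕ} (ν : Pt d) (p : PolyD d) :
    divHessNormal (-ν) p = -divHessNormal ν p := by
  simp [divHessNormal]

theorem fluxDensity_sub {d : ℕ} (ε α : ℝ) (ν : Pt d) (p q : PolyD d) (v : Pt d → ℝ) (x : Pt d) :
    fluxDensity ε α ν (p - q) v x = fluxDensity ε α ν p v x + fluxDensity ε α (-ν) q v x := by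
  simp only [fluxDensity, normalDeriv_sub, hessNormal_sub, divHessNormal_sub, normalDeriv_neg,
    hessNormal_neg, divHessNormal_neg, pev_sub, pev_neg, sub_mul, neg_mul, Finset.sum_sub_distrib,
    Finset.sum_neg_distrib]
  ring

theorem setIntegral_eq_halves {Z : Set (Pt (n + 1))} (hZ : MeasurableSet Z) {m ν : Pt (n + 1)}
    (hν : ‖ν‖ = 1) {ρ : ℝ} (hb : Metric.ball m ρ ⊆ Z) {K : Set (Pt (n + 1))}
    (hK : K ⊆ Metric.ball m ρ) {g : Pt (n + 1) → ℝ} (h0 : ∀ x ∉ K, g x = 0)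
    (hg : IntegrableOn g (Metric.ball m ρ)) :
    ∫ x in Z, g x = (∫ x in Metric.ball m ρ ∩ upper m ν, g x)
      + ∫ x in Metric.ball m ρ ∩ upper m (-ν), g x := by
  rw [setIntegral_congr_of_support hZ Metric.isOpen_ball.measurableSet h0
    (by rw [Set.inter_eq_right.2 (hK.trans hb), Set.inter_eq_right.2 hK] :
      Z ∩ K = Metric.ball m ρ ∩ K)]
  have hdis : Disjoint (Metric.ball m ρ ∩ upper m ν) (Metric.ball m ρ ∩ upper m (-ν)) := by
    rw [Set.disjoint_left]
    intro x hx hx'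
    have h1 : 0 < (inner ℝ ν (x - m) : ℝ) := hx.2
    have h2 : 0 < (inner ℝ (-ν) (x - m) : ℝ) := hx'.2
    rw [inner_neg_left] at h2
    linarith
  rw [← setIntegral_union hdis
    (Metric.isOpen_ball.measurableSet.inter (measurableSet_upper m (-ν)))
    (hg.mono_set Set.inter_subset_left) (hg.mono_set Set.inter_subset_left)]
  refine setIntegral_congr_set ?_
  filter_upwards [measure_eq_zero_iff_ae_notMem.1 (volume_hyp m hν)] with x hx
  refine propext ⟨fun h => ?_, fun h => ?_⟩
  · rcases lt_trichotomy (inner ℝ ν (x - m) : ℝ) 0 with h1 | h1 | h1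
    · refine Or.inr ⟨h, ?_⟩
      change 0 < (inner ℝ (-ν) (x - m) : ℝ)
      rw [inner_neg_left]
      linarith
    · exact absurd h1 hx
    · exact Or.inl ⟨h, h1⟩
  · rcases h with h | h <;> exact h.1

/-- Integration by parts on the part of an element in a half-ball. -/
theorem integral_flux_eq (ho : IsOpen Ω) (hL : IsLipschitzDomain Ω) {𝒯 : Triangulation Ω}
    (ε α : ℝ) {f : Pt (n + 1) → ℝ} (hf : InL2 Ω f) {u : Jet (n + 1)} (hu : IsH20 Ω u)
    (p : PolyD (n + 1)) (T : Cell 𝒯) {m ν : Pt (n + 1)} (hν : ‖ν‖ = 1) {ρ : ℝ}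
    (hT : Metric.ball m ρ ∩ upper m ν ⊆ T.set) {v : Pt (n + 1) → ℝ}
    (hv : ContDiff ℝ ((⊤ : ℕ∞) : WithTop ℕ∞) v) (hc : HasCompactSupport v)
    (hvs : tsupport v ⊆ Metric.ball m ρ) :
    ∫ x in hyp m ν, fluxDensity ε α ν p v x ∂μHE[n]
      = (∫ x in Metric.ball m ρ ∩ upper m ν, residual ε α f p x * v x)
        + energyForm ε α (Metric.ball m ρ ∩ upper m ν) (u - Jet.ofPoly p) (testJet v)
        + ((∫ x in Metric.ball m ρ ∩ upper m ν, f x * v x)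
          - energyForm ε α (Metric.ball m ρ ∩ upper m ν) u (testJet v)) := by
  set Z := Metric.ball m ρ ∩ upper m ν with hZ
  have hZm : MeasurableSet Z := Metric.isOpen_ball.measurableSet.inter (measurableSet_upper m ν)
  have hZb : Bornology.IsBounded Z := Metric.isBounded_ball.subset Set.inter_subset_left
  have hsup : upper m ν ∩ tsupport v = Z ∩ tsupport v := by
    rw [hZ, Set.inter_comm (Metric.ball m ρ), Set.inter_assoc, Set.inter_eq_right.2 hvs]
  have hle : volume.restrict Z ≤ volume.restrict T.set := Measure.restrict_mono hT le_rfl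
  have hJ : JetL2 Z u := ⟨fun i => ((hu.jetL2 ho hL T).grad i).mono_measure hle,
    fun i j => ((hu.jetL2 ho hL T).hess i j).mono_measure hle⟩
  have hfZ : InL2 Z f := (T.inL2 ho hL hf).mono_measure hle
  have h1 := energyForm_upper ε α m ν hν p hv hc
  rw [energyForm_congr_of_support (measurableSet_upper m ν) hZm ε α _ hsup,
    setIntegral_congr_of_support (measurableSet_upper m ν) hZm (K := tsupport v)
      (fun y hy => by rw [(testJet_eq_zero hy).1, mul_zero]) hsup] at h1
  have hvZ : InL2 Z v := inL2_of_hasCompactSupport _ hv.continuous hc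
  have c1 := continuous_pev (lap (lap p))
  have c2 := continuous_pev (lap p)
  have h2 : ∫ x in Z, residual ε α f p x * v x
      = (∫ x in Z, (ε ^ 2 * pev (lap (lap p)) x - α * pev (lap p) x) * v x)
        - ∫ x in Z, f x * v x := by
    rw [← integral_sub]
    · exact integral_congr_ae (Eventually.of_forall fun x => by simp only [residual, sub_mul])
    · exact (integrable_mul_of_hasCompactSupport (by fun_prop) hv.continuous hc).integrableOn
    · exact hfZ.integrable_mul hvZ
  rw [energyForm_sub ε α hJ (jetL2_ofPoly hZb p) (jetL2_testJet Z hv hc), h2]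
  linarith

/-- The jumps across an interior hyperface, tested with a function supported near its centre, are
given by the residuals and the errors on both sides. -/
theorem integral_jump_flux_eq (ho : IsOpen Ω) (hL : IsLipschitzDomain Ω) {𝒯 : Triangulation Ω}
    {ε α : ℝ} {f : Pt (n + 1) → ℝ} (hf : InL2 Ω f) {u : Jet (n + 1)}
    (hu : IsWeakSolution Ω ε α f u) (uh : Cell 𝒯 → PolyD (n + 1)) {o : Labelling 𝒯} {F : Face 𝒯}
    {m ν : Pt (n + 1)} {ρ : ℝ} (hp : FacePatch o F m ν ρ) {T : Cell 𝒯} (hT : o.minus F = some T)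
    {v : Pt (n + 1) → ℝ} (hv : ContDiff ℝ ((⊤ : ℕ∞) : WithTop ℕ∞) v) (hc : HasCompactSupport v)
    (hvs : tsupport v ⊆ Metric.ball m ρ) :
    ∫ x in hyp m ν, fluxDensity ε α ν (jump o uh F) v x ∂μHE[n]
      = ((∫ x in Metric.ball m ρ ∩ upper m ν, residual ε α f (uh (o.plus F)) x * v x)
        + energyForm ε α (Metric.ball m ρ ∩ upper m ν) (u - Jet.ofPoly (uh (o.plus F))) (testJet v))
        + ((∫ x in Metric.ball m ρ ∩ upper m (-ν), residual ε α f (uh T) x * v x)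
        + energyForm ε α (Metric.ball m ρ ∩ upper m (-ν)) (u - Jet.ofPoly (uh T)) (testJet v)) := by
  have hJ : jump o uh F = uh (o.plus F) - uh T := by simp [jump, hT]
  have hν' : ‖-ν‖ = 1 := by rw [norm_neg]; exact hp.norm_eq
  have hb := hp.ball_subset T hT
  have htest : IsTest Ω v := ⟨hv, hc, hvs.trans hb⟩
  have h1 := integral_flux_eq ho hL ε α hf hu.1 (uh (o.plus F)) (o.plus F) hp.norm_eq
    hp.plus_subset hv hc hvs
  have h2 := integral_flux_eq ho hL ε α hf hu.1 (uh T) T hν' (hp.minus_subset T hT) hv hc hvs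
  rw [hyp_neg] at h2
  have hle : volume.restrict (Metric.ball m ρ) ≤ volume.restrict Ω :=
    Measure.restrict_mono hb le_rfl
  have hvb := jetL2_testJet (Metric.ball m ρ) hv hc
  have hvL : InL2 (Metric.ball m ρ) v := inL2_of_hasCompactSupport _ hv.continuous hc
  have e0 : ∀ i j, InL2 (Metric.ball m ρ) (u.hess i j) := fun i j =>
    (hu.1.2.2.1 i j).mono_measure hle
  have e1 : ∀ i, InL2 (Metric.ball m ρ) (u.grad i) := fun i => (hu.1.2.1 i).mono_measure hle
  have h3 : energyForm ε α Ω u (testJet v)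
      = energyForm ε α (Metric.ball m ρ ∩ upper m ν) u (testJet v)
        + energyForm ε α (Metric.ball m ρ ∩ upper m (-ν)) u (testJet v) := by
    unfold energyForm
    rw [setIntegral_eq_halves ho.measurableSet hp.norm_eq hb hvs _ _,
      setIntegral_eq_halves ho.measurableSet hp.norm_eq hb hvs _ _]
    · ring
    · intro x hx
      exact Finset.sum_eq_zero fun i _ => by
        rw [show (testJet v).grad i x = 0 from (testJet_eq_zero hx).2.1 i, mul_zero]
    · exact integrable_finsetSum _ fun i _ => (e1 i).integrable_mul (hvb.grad i)
    · intro x hx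
      exact Finset.sum_eq_zero fun i _ => Finset.sum_eq_zero fun j _ => by
        rw [show (testJet v).hess i j x = 0 from (testJet_eq_zero hx).2.2 i j, mul_zero]
    · exact integrable_finsetSum _ fun i _ => integrable_finsetSum _ fun j _ =>
        (e0 i j).integrable_mul (hvb.hess i j)
  have h4 : ∫ x in Ω, f x * v x = (∫ x in Metric.ball m ρ ∩ upper m ν, f x * v x)
      + ∫ x in Metric.ball m ρ ∩ upper m (-ν), f x * v x :=
    setIntegral_eq_halves ho.measurableSet hp.norm_eq hb hvs
      (fun x hx => by rw [(testJet_eq_zero hx).1, mul_zero])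
      (MemLp.integrable_mul (p := 2) (q := 2) (hf.mono_measure hle) hvL)
  have h5 : energyForm ε α Ω u (testJet v) = ∫ x in Ω, f x * v x := hu.2 _ (isH20_testJet htest)
  have hint : ∀ (w : Pt (n + 1)) (q : PolyD (n + 1)),
      IntegrableOn (fluxDensity ε α w q v) (hyp m ν) (μHE[n]) := fun w q =>
    integrableOn_hyp_of_hasCompactSupport hp.norm_eq (continuous_fluxDensity ε α w q hv)
      (hasCompactSupport_fluxDensity ε α w q hc)
  rw [hJ]
  simp_rw [fluxDensity_sub]
  rw [integral_add (hint _ _) (hint _ _)]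
  linarith

theorem energySq_mono_set {d : ℕ} {ε α : ℝ} (hα : 0 ≤ α) {Z Z' : Set (Pt d)} (hZ : Z ⊆ Z')
    {w : Jet d} (hw : JetL2 Z' w) : energySq ε α Z w ≤ energySq ε α Z' w := by
  have hle : volume.restrict Z ≤ volume.restrict Z' := Measure.restrict_mono hZ le_rfl
  have hw' : JetL2 Z w := ⟨fun i => (hw.grad i).mono_measure hle,
    fun i j => (hw.hess i j).mono_measure hle⟩
  have mono : ∀ g : Pt d → ℝ, InL2 Z' g → ∫ x in Z, g x ^ 2 ≤ ∫ x in Z', g x ^ 2 := fun g hg =>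
    setIntegral_mono_set hg.integrable_sq (Eventually.of_forall fun _ => sq_nonneg _) hZ.eventuallyLE
  rw [energySq_eq hw, energySq_eq hw']
  refine add_le_add (mul_le_mul_of_nonneg_left ?_ (sq_nonneg ε)) (mul_le_mul_of_nonneg_left ?_ hα)
  · exact Finset.sum_le_sum fun i _ => Finset.sum_le_sum fun j _ => mono _ (hw.hess i j)
  · exact Finset.sum_le_sum fun i _ => mono _ (hw.grad i)

/-- The residual on a half-ball tested with a function supported in a slab. -/
theorem abs_side_le (ho : IsOpen Ω) (hL : IsLipschitzDomain Ω) {𝒯 : Triangulation Ω}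
    {ε α : ℝ} (hε : 0 ≤ ε) (hα : α = 0 ∨ α = 1) {f : Pt (n + 1) → ℝ} (hf : InL2 Ω f)
    {u : Jet (n + 1)} (hu : IsH20 Ω u) (uh : Cell 𝒯 → PolyD (n + 1)) (T : Cell 𝒯)
    {Z S : Set (Pt (n + 1))} (hZ : Z ⊆ T.set) {δ M V : ℝ} (hδ : 0 < δ) (hM : 0 ≤ M)
    (hS : volume S < ⊤) (hV : volume.real S ≤ V) {v : Pt (n + 1) → ℝ} (hv : ScaledBounds v S M δ)
    (hc : HasCompactSupport v) (hvS : tsupport v ⊆ S) :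
    |(∫ x in Z, residual ε α f (uh T) x * v x)
        + energyForm ε α Z (u - Jet.ofPoly (uh T)) (testJet v)|
      ≤ M * Real.sqrt V * (Real.sqrt (∫ x in T.set, residual ε α f (uh T) x ^ 2)
        + Real.sqrt (errSq ε α u uh T) * ((n + 1) ^ 2 * (ε / δ ^ 2) + (n + 1) * (α / δ))) := by
  have hα0 : 0 ≤ α := by rcases hα with rfl | rfl <;> norm_num
  have hle : volume.restrict Z ≤ volume.restrict T.set := Measure.restrict_mono hZ le_rfl
  have hw := jetL2_sub (hu.jetL2 ho hL T) (jetL2_ofPoly T.isBounded (uh T))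
  have hw' : JetL2 Z (u - Jet.ofPoly (uh T)) := ⟨fun i => (hw.grad i).mono_measure hle,
    fun i j => (hw.hess i j).mono_measure hle⟩
  have hres : InL2 T.set (residual ε α f (uh T)) := by
    have c1 := continuous_pev (lap (lap (uh T)))
    have c2 := continuous_pev (lap (uh T))
    exact (inL2_of_isBounded T.isBounded (g := fun y => ε ^ 2 * pev (lap (lap (uh T))) y
      - α * pev (lap (uh T)) y) (by fun_prop)).sub (T.inL2 ho hL hf)
  have b1 := abs_setIntegral_mul_le_of_bound (Z := Z) hS hM (hres.mono_measure hle)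
    hv.smooth.continuous hc hv.val
    (fun y hy => image_eq_zero_of_notMem_tsupport fun h => hy (hvS h)) hV
  have b2 := abs_energyForm_testJet_le (ε := ε) (α := α) hε hα hδ hM hS hV hw' hv hc hvS
  have m1 : ∫ x in Z, residual ε α f (uh T) x ^ 2 ≤ ∫ x in T.set, residual ε α f (uh T) x ^ 2 :=
    setIntegral_mono_set hres.integrable_sq (Eventually.of_forall fun _ => sq_nonneg _)
      hZ.eventuallyLE
  have m2 : energySq ε α Z (u - Jet.ofPoly (uh T)) ≤ errSq ε α u uh T := energySq_mono_set hα0 hZ hw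
  push_cast at b2
  calc _ ≤ _ := abs_add_le _ _
    _ ≤ Real.sqrt (∫ x in Z, residual ε α f (uh T) x ^ 2) * (M * Real.sqrt V)
        + Real.sqrt (energySq ε α Z (u - Jet.ofPoly (uh T))) *
          (M * Real.sqrt V * ((n + 1) ^ 2 * (ε / δ ^ 2) + (n + 1) * (α / δ))) := add_le_add b1 b2
    _ ≤ Real.sqrt (∫ x in T.set, residual ε α f (uh T) x ^ 2) * (M * Real.sqrt V)
        + Real.sqrt (errSq ε α u uh T) *
          (M * Real.sqrt V * ((n + 1) ^ 2 * (ε / δ ^ 2) + (n + 1) * (α / δ))) := by gcongr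
    _ = _ := by ring

/-- The sum of the squared residuals over the elements that contain `F`. -/
def patchResidual {d : ℕ} {Ω : Set (Pt d)} {𝒯 : Triangulation Ω} (o : Labelling 𝒯) (ε α : ℝ)
    (f : Pt d → ℝ) (uh : Cell 𝒯 → PolyD d) (F : Face 𝒯) : ℝ :=
  patchSum o (fun T => ∫ x in T.set, residual ε α f (uh T) x ^ 2) F

/-- Testing the jumps across a hyperface with a function of width `δ` in normal direction and width
`ρ` in tangential direction; the volume of its support is of the order `δ ρ ^ n`. -/
theorem exists_jump_flux_bound (n : ℕ) : ∃ C : ℝ, 0 < C ∧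
    ∀ Ω : Set (Pt (n + 1)), IsOpen Ω → IsLipschitzDomain Ω → ∀ 𝒯 : Triangulation Ω,
    ∀ ε α : ℝ, 0 ≤ ε → (α = 0 ∨ α = 1) → ∀ f, InL2 Ω f → ∀ u, IsWeakSolution Ω ε α f u →
    ∀ (uh : Cell 𝒯 → PolyD (n + 1)) (o : Labelling 𝒯) (F : Face 𝒯) (m ν : Pt (n + 1)) (ρ : ℝ),
    FacePatch o F m ν ρ → o.minus F ≠ none → ∀ δ M, 0 < δ → δ ≤ ρ → 0 ≤ M →
    ∀ v, ScaledBounds v (slab m ν ρ δ) M δ → tsupport v ⊆ slab m ν ρ δ →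
    |∫ x in hyp m ν, fluxDensity ε α ν (jump o uh F) v x ∂μHE[n]|
      ≤ C * (M * Real.sqrt (δ * ρ ^ n) * (Real.sqrt (patchResidual o ε α f uh F)
        + Real.sqrt (patchSum o (errSq ε α u uh) F) * (ε / δ ^ 2 + α / δ))) := by
  set W := volume.real (Metric.ball (0 : Pt n) 1)
  refine ⟨2 * Real.sqrt (2 * W) * (n + 1) ^ 2 + 1, by positivity,
    fun Ω ho hL 𝒯 ε α hε hα f hf u hu uh o F m ν ρ hp hne δ M hδ hδρ hM v hv hvS => ?_⟩
  obtain ⟨T, hT⟩ := Option.ne_none_iff_exists'.1 hne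
  have hα0 : 0 ≤ α := by rcases hα with rfl | rfl <;> norm_num
  have hc : HasCompactSupport v := HasCompactSupport.of_support_subset_isCompact
    (isCompact_slab m ν ρ δ) ((subset_tsupport v).trans hvS)
  have hSlt : volume (slab m ν ρ δ) < ⊤ := (isCompact_slab m ν ρ δ).measure_lt_top
  have hV := volume_slab_le m hp.norm_eq hδ hp.pos
  have hρ := hp.pos
  rw [integral_jump_flux_eq ho hL hf hu uh hp hT hv.smooth hc
    (hvS.trans (slab_subset_ball hp.pos))]
  have b1 := abs_side_le ho hL hε hα hf hu.1 uh (o.plus F) hp.plus_subset hδ hM hSlt hV hv hc hvS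
  have b2 := abs_side_le ho hL hε hα hf hu.1 uh T (hp.minus_subset T hT) hδ hM hSlt hV hv hc hvS
  have r0 : ∀ T : Cell 𝒯, 0 ≤ ∫ x in T.set, residual ε α f (uh T) x ^ 2 := fun T =>
    integral_nonneg fun _ => sq_nonneg _
  have e0 := errSq_nonneg (ε := ε) hα0 u uh
  have eP : patchResidual o ε α f uh F = (∫ x in (o.plus F).set,
      residual ε α f (uh (o.plus F)) x ^ 2) + ∫ x in T.set, residual ε α f (uh T) x ^ 2 := by
    simp [patchResidual, patchSum, hT]
  have eE : patchSum o (errSq ε α u uh) F = errSq ε α u uh (o.plus F) + errSq ε α u uh T := by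
    simp [patchSum, hT]
  set P := patchResidual o ε α f uh F
  set E := patchSum o (errSq ε α u uh) F
  set s := ((n : ℝ) + 1) ^ 2 * (ε / δ ^ 2) + (n + 1) * (α / δ) with hs
  have hs0 : 0 ≤ s := by positivity
  have hsle : s ≤ (n + 1) ^ 2 * (ε / δ ^ 2 + α / δ) := by
    rw [hs, mul_add]
    have : ((n : ℝ) + 1) * (α / δ) ≤ (n + 1) ^ 2 * (α / δ) := by
      refine mul_le_mul_of_nonneg_right ?_ (by positivity)
      have : (0:ℝ) ≤ n := by positivity
      nlinarith
    linarith
  have hq : Real.sqrt (2 * W * (δ * ρ ^ n)) = Real.sqrt (2 * W) * Real.sqrt (δ * ρ ^ n) :=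
    Real.sqrt_mul (by positivity) _
  have side : ∀ K : Cell 𝒯, (∫ x in K.set, residual ε α f (uh K) x ^ 2) ≤ P →
      errSq ε α u uh K ≤ E → M * Real.sqrt (2 * W * (δ * ρ ^ n)) *
        (Real.sqrt (∫ x in K.set, residual ε α f (uh K) x ^ 2) + Real.sqrt (errSq ε α u uh K) * s)
      ≤ Real.sqrt (2 * W) * (n + 1) ^ 2 * (M * Real.sqrt (δ * ρ ^ n) * (Real.sqrt P
        + Real.sqrt E * (ε / δ ^ 2 + α / δ))) := by
    intro K h1 h2
    have h3 : Real.sqrt P ≤ (n + 1) ^ 2 * Real.sqrt P := by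
      refine le_mul_of_one_le_left (Real.sqrt_nonneg _) ?_
      have : (0:ℝ) ≤ n := by positivity
      nlinarith
    calc _ ≤ M * Real.sqrt (2 * W * (δ * ρ ^ n)) * ((n + 1) ^ 2 * Real.sqrt P
          + Real.sqrt E * ((n + 1) ^ 2 * (ε / δ ^ 2 + α / δ))) := by
          refine mul_le_mul_of_nonneg_left (add_le_add ((Real.sqrt_le_sqrt h1).trans h3) ?_)
            (by positivity)
          exact mul_le_mul (Real.sqrt_le_sqrt h2) hsle hs0 (Real.sqrt_nonneg _)
      _ = _ := by rw [hq]; ring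
  have hX : 0 ≤ M * Real.sqrt (δ * ρ ^ n) * (Real.sqrt P
        + Real.sqrt E * (ε / δ ^ 2 + α / δ)) := by positivity
  calc _ ≤ _ := abs_add_le _ _
    _ ≤ _ := add_le_add (b1.trans (side _ (by rw [eP]; linarith [r0 T])
        (by rw [eE]; linarith [e0 T]))) (b2.trans (side _ (by rw [eP]; linarith [r0 (o.plus F)])
        (by rw [eE]; linarith [e0 (o.plus F)])))
    _ ≤ _ := by rw [add_mul _ (1:ℝ), one_mul]; linarith

end FaceIdentity



/-! ### Bounds for the normal jumps of second and third order -/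

section NormalJumps

variable {n : ℕ}

theorem hasCompactSupport_cut {d : ℕ} {m ν : Pt d} (hν : ‖ν‖ = 1) {ρ δ : ℝ} (hδ : 0 < δ)
    (hδρ : δ ≤ ρ) : HasCompactSupport (cut m ν ρ δ) :=
  HasCompactSupport.of_support_subset_isCompact (isCompact_slab m ν ρ δ)
    ((subset_tsupport _).trans (tsupport_cut_subset hν hδ hδρ))

/-- Polynomials on a disc are controlled in the `L²` norm weighted with the cut-off function, which
equals one on the concentric disc of half the radius. -/
theorem exists_disc_le_cut (n N : ℕ) : ∃ C : ℝ, 0 < C ∧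
    ∀ q : PolyD (n + 1), q.totalDegree ≤ N → ∀ (m ν : Pt (n + 1)) (ρ δ : ℝ), ‖ν‖ = 1 → 0 < δ →
    δ ≤ ρ → ∫ x in Metric.ball m ρ ∩ hyp m ν, pev q x ^ 2 ∂μHE[n]
      ≤ C * ∫ x in hyp m ν, cut m ν ρ δ x * pev q x ^ 2 ∂μHE[n] := by
  obtain ⟨C, hC, h⟩ := exists_hyp_integral_bound n N 2 (by norm_num)
  refine ⟨C, hC, fun q hq m ν ρ δ hν hδ hδρ => ?_⟩
  have hρ : 0 < ρ := hδ.trans_le hδρ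
  refine (h q hq m ν (ρ / 2) hν (by positivity) _ ?_ (Metric.isOpen_ball.measurableSet.inter
    (isClosed_hyp m ν).measurableSet)).trans (mul_le_mul_of_nonneg_left ?_ hC.le)
  · rw [mul_div_cancel₀ _ two_ne_zero]
    exact Set.inter_subset_inter_left _ Metric.ball_subset_closedBall
  rw [setIntegral_congr_fun (g := fun x => cut m ν ρ δ x * pev q x ^ 2)
    (Metric.isOpen_ball.measurableSet.inter (isClosed_hyp m ν).measurableSet)]
  · refine setIntegral_mono_set (integrableOn_hyp_of_hasCompactSupport hν
      ((contDiff_cut m ν ρ δ).continuous.mul ((continuous_pev q).pow 2))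
      (hasCompactSupport_cut hν hδ hδρ).mul_right) (Eventually.of_forall fun x =>
        mul_nonneg (cut_nonneg _ _ _ _ _) (sq_nonneg _)) Set.inter_subset_right.eventuallyLE
  · intro x hx
    change pev q x ^ 2 = cut m ν ρ δ x * pev q x ^ 2
    rw [cut_eq_one_of_mem_hyp hν hρ hx.2 (mem_ball_iff_norm.1 hx.1).le, one_mul]

/-- The constant extension of a polynomial on the hyperplane in normal direction, multiplied by a
cut-off function. -/
theorem exists_cut_normalExt_bounds (n N : ℕ) : ∃ C : ℝ, 0 < C ∧
    ∀ q : PolyD (n + 1), q.totalDegree ≤ N → ∀ (m ν : Pt (n + 1)) (ρ δ : ℝ), ‖ν‖ = 1 → 0 < δ →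
    δ ≤ ρ → ScaledBounds (fun x => cut m ν ρ δ x * pev (normalExt m ν q) x) (slab m ν ρ δ)
      (C * Real.sqrt ((ρ ^ n)⁻¹ * ∫ y in Metric.ball m ρ ∩ hyp m ν, pev q y ^ 2 ∂μHE[n])) δ := by
  obtain ⟨C, hC, h⟩ := exists_normalExt_bound n N 1
  obtain ⟨Cc, hCc, hcut⟩ := exists_cut_bounds (n + 1)
  refine ⟨4 * Cc * Real.sqrt C, by positivity, fun q hq m ν ρ δ hν hδ hδρ => ?_⟩
  have hρ : 0 < ρ := hδ.trans_le hδρ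
  have hb : ∀ x ∈ slab m ν ρ δ, ‖x - m‖ ≤ 1 * ρ := fun x hx => by
    rw [one_mul]
    exact (mem_ball_iff_norm.1 (slab_subset_ball hρ hx)).le
  have h1 : ScaledBounds (pev (normalExt m ν q)) (slab m ν ρ δ) (Real.sqrt (C * ((ρ ^ n)⁻¹ *
      ∫ y in Metric.ball m ρ ∩ hyp m ν, pev q y ^ 2 ∂μHE[n]))) ρ := by
    refine ScaledBounds.of_sq (contDiff_pev _) hρ (fun x hx => (h q hq m ν ρ hν hρ x (hb x hx)).1)
      (fun x hx i => ?_) fun x hx i j => ?_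
    · rw [pd_pev]
      exact (h q hq m ν ρ hν hρ x (hb x hx)).2.1 i
    · rw [pd_pev, pd_pev]
      exact (h q hq m ν ρ hν hρ x (hb x hx)).2.2 i j
  have h2 := ScaledBounds.mul hδ hCc.le (Real.sqrt_nonneg _)
    ((hcut m ν ρ δ hν hδ hδρ).mono (Set.subset_univ (slab m ν ρ δ)))
    (h1.mono_scale (Real.sqrt_nonneg _) hδ hδρ)
  rw [Real.sqrt_mul hC.le, ← mul_assoc] at h2
  exact h2

theorem pderiv_normalDeriv (ν : Pt n) (p : PolyD n) (i : Fin n) :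
    MvPolynomial.pderiv i (normalDeriv ν p) = hessNormal ν p i := by
  simp only [normalDeriv, hessNormal, map_sum]
  refine Finset.sum_congr rfl fun j _ => ?_
  rw [Derivation.leibniz, MvPolynomial.pderiv_C, pderiv_comm i j]
  simp

theorem pev_normalDeriv_normalDeriv (ν : Pt n) (p : PolyD n) (x : Pt n) :
    pev (normalDeriv ν (normalDeriv ν p)) x = ∑ i, ν i * pev (hessNormal ν p i) x := by
  simp_rw [pev_normalDeriv, pderiv_normalDeriv]

theorem totalDegree_normalDeriv_le (ν : Pt n) (p : PolyD n) :
    (normalDeriv ν p).totalDegree ≤ p.totalDegree :=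
  MvPolynomial.totalDegree_finsetSum_le fun _ _ =>
    (totalDegree_C_mul_le _ _).trans (totalDegree_pderiv_le _ _)

theorem totalDegree_divHessNormal_le (ν : Pt n) (p : PolyD n) :
    (divHessNormal ν p).totalDegree ≤ p.totalDegree :=
  MvPolynomial.totalDegree_finsetSum_le fun _ _ =>
    (totalDegree_C_mul_le _ _).trans (MvPolynomial.totalDegree_finsetSum_le fun _ _ =>
      (totalDegree_pderiv_le _ _).trans
        ((totalDegree_pderiv_le _ _).trans (totalDegree_pderiv_le _ _)))

theorem sqrt_add_mul_sq_le {P E s : ℝ} (hP : 0 ≤ P) (hE : 0 ≤ E) :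
    (Real.sqrt P + Real.sqrt E * s) ^ 2 ≤ 2 * (P + E * s ^ 2) := by
  refine add_sq_le.trans (le_of_eq ?_)
  rw [mul_pow, Real.sq_sqrt hP, Real.sq_sqrt hE]

/-- The jump of the second normal derivative is tested with a function that vanishes on the
hyperface and whose normal derivative is a multiple of this jump. The width `δ` of its support in
normal direction is at our disposal. -/
theorem exists_second_normal_bound (n N : ℕ) : ∃ C : ℝ, 0 < C ∧
    ∀ Ω : Set (Pt (n + 1)), IsOpen Ω → IsLipschitzDomain Ω → ∀ 𝒯 : Triangulation Ω,
    ∀ ε α : ℝ, 0 < ε → (α = 0 ∨ α = 1) → ∀ f, InL2 Ω f → ∀ u, IsWeakSolution Ω ε α f u →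
    ∀ uh : Cell 𝒯 → PolyD (n + 1), (∀ T, (uh T).totalDegree ≤ N) →
    ∀ (o : Labelling 𝒯) (F : Face 𝒯) (m ν : Pt (n + 1)) (ρ : ℝ),
    FacePatch o F m ν ρ → o.minus F ≠ none → ∀ δ, 0 < δ → δ ≤ ρ →
    ε ^ 4 * ∫ x in Metric.ball m ρ ∩ hyp m ν,
        pev (normalDeriv ν (normalDeriv ν (jump o uh F))) x ^ 2 ∂μHE[n]
      ≤ C * (δ ^ 3 * (patchResidual o ε α f uh F
        + patchSum o (errSq ε α u uh) F * (ε / δ ^ 2 + α / δ) ^ 2)) := by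
  obtain ⟨C1, hC1, h1⟩ := exists_disc_le_cut n N
  obtain ⟨C2, hC2, h2⟩ := exists_cut_normalExt_bounds n N
  obtain ⟨C3, hC3, h3⟩ := exists_jump_flux_bound n
  refine ⟨2 * (4 * C1 * C2 * C3) ^ 2, by positivity,
    fun Ω ho hL 𝒯 ε α hε hα f hf u hu uh hN o F m ν ρ hp hne δ hδ hδρ => ?_⟩
  have hν := hp.norm_eq
  have hρ := hp.pos
  have hα0 : 0 ≤ α := by rcases hα with rfl | rfl <;> norm_num
  set J := jump o uh F
  set q := normalDeriv ν (normalDeriv ν J) with hq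
  have hqN : q.totalDegree ≤ N := (totalDegree_normalDeriv_le _ _).trans
    ((totalDegree_normalDeriv_le _ _).trans (jump_totalDegree_le o hN F))
  set Y := ∫ x in Metric.ball m ρ ∩ hyp m ν, pev q x ^ 2 ∂μHE[n] with hY
  have hY0 : 0 ≤ Y := integral_nonneg fun _ => sq_nonneg _
  have hw := h2 q hqN m ν ρ δ hν hδ hδρ
  set w : Pt (n + 1) → ℝ := fun x => cut m ν ρ δ x * pev (normalExt m ν q) x with hwdef
  -- the test function is `t w`; on the hyperplane, `t = 0` and the normal derivative of `t` is `1/δ`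
  set t : Pt (n + 1) → ℝ := fun x => (inner ℝ ν (x - m) : ℝ) / δ with ht
  set M := C2 * Real.sqrt ((ρ ^ n)⁻¹ * Y) with hM
  have htb : ScaledBounds t (slab m ν ρ δ) 1 δ := scaledBounds_linear hν hδ
  have hvb := ScaledBounds.mul hδ zero_le_one (by positivity) htb hw
  set v : Pt (n + 1) → ℝ := fun x => t x * w x with hv
  have hvS : tsupport v ⊆ slab m ν ρ δ := (tsupport_mul_subset_right).trans
    ((tsupport_mul_subset_left).trans (tsupport_cut_subset hν hδ hδρ))
  have b := h3 Ω ho hL 𝒯 ε α hε.le hα f hf u hu uh o F m ν ρ hp hne δ (4 * 1 * M) hδ hδρ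
    (by positivity) v hvb hvS
  have hflux : ∫ x in hyp m ν, fluxDensity ε α ν J v x ∂μHE[n]
      = ε ^ 2 / δ * ∫ x in hyp m ν, cut m ν ρ δ x * pev q x ^ 2 ∂μHE[n] := by
    rw [← integral_const_mul]
    refine setIntegral_congr_fun (isClosed_hyp m ν).measurableSet fun x hx => ?_
    have ht0 : t x = 0 := by
      have : (inner ℝ ν (x - m) : ℝ) = 0 := hx
      simp [ht, this]
    have hpd : ∀ i, pd i v x = ν i / δ * (cut m ν ρ δ x * pev q x) := by
      intro i
      rw [hv, pd_mul htb.smooth.differentiable_of_top hw.smooth.differentiable_of_top]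
      simp only [ht0, zero_mul, add_zero]
      rw [ht, pd_linear, hwdef]
      simp only [pev_normalExt_of_mem q hx]
    have hqx : pev q x = ∑ i, ν i * pev (hessNormal ν J i) x := pev_normalDeriv_normalDeriv ν J x
    change fluxDensity ε α ν J v x = ε ^ 2 / δ * (cut m ν ρ δ x * pev q x ^ 2)
    unfold fluxDensity
    simp_rw [hpd]
    have hv0 : v x = 0 := by simp [hv, ht0]
    rw [hv0, mul_zero, add_zero]
    have : ∑ i, pev (hessNormal ν J i) x * (ν i / δ * (cut m ν ρ δ x * pev q x))
        = (∑ i, ν i * pev (hessNormal ν J i) x) * (cut m ν ρ δ x * pev q x / δ) := by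
      rw [Finset.sum_mul]
      exact Finset.sum_congr rfl fun i _ => by ring
    rw [this, ← hqx]
    ring
  set P := patchResidual o ε α f uh F
  set E := patchSum o (errSq ε α u uh) F
  have hP : 0 ≤ P := patchSum_nonneg o F fun T => integral_nonneg fun _ => sq_nonneg _
  have hE : 0 ≤ E := patchSum_nonneg o F fun T => errSq_nonneg hα0 _ _ T
  set s := ε / δ ^ 2 + α / δ
  have hMV : M * Real.sqrt (δ * ρ ^ n) = Real.sqrt Y * (C2 * Real.sqrt δ) := by
    rw [hM, mul_assoc, ← Real.sqrt_mul (by positivity), mul_left_comm (Real.sqrt Y),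
      ← Real.sqrt_mul hY0]
    congr 2
    field_simp
  have key : ε ^ 2 / (δ * C1) * Y
      ≤ Real.sqrt Y * (4 * C2 * C3 * Real.sqrt δ * (Real.sqrt P + Real.sqrt E * s)) := by
    have e1 := h1 q hqN m ν ρ δ hν hδ hδρ
    have e2 := le_of_abs_le b
    rw [hflux] at e2
    calc ε ^ 2 / (δ * C1) * Y ≤ ε ^ 2 / (δ * C1) *
          (C1 * ∫ x in hyp m ν, cut m ν ρ δ x * pev q x ^ 2 ∂μHE[n]) := by gcongr
      _ = ε ^ 2 / δ * ∫ x in hyp m ν, cut m ν ρ δ x * pev q x ^ 2 ∂μHE[n] := by field_simp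
      _ ≤ _ := e2
      _ = 4 * C3 * (M * Real.sqrt (δ * ρ ^ n)) * (Real.sqrt P + Real.sqrt E * s) := by ring
      _ = _ := by rw [hMV]; ring
  have e3 := le_sq_of_mul_le_sqrt_mul (by positivity) hY0 key
  calc ε ^ 4 * Y ≤ ε ^ 4 * (4 * C2 * C3 * Real.sqrt δ * (Real.sqrt P + Real.sqrt E * s)
        / (ε ^ 2 / (δ * C1))) ^ 2 := by gcongr
    _ = (4 * C1 * C2 * C3) ^ 2 * (δ ^ 2 * Real.sqrt δ ^ 2)
        * (Real.sqrt P + Real.sqrt E * s) ^ 2 := by field_simp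
    _ = (4 * C1 * C2 * C3) ^ 2 * δ ^ 3 * (Real.sqrt P + Real.sqrt E * s) ^ 2 := by
        rw [Real.sq_sqrt hδ.le]; ring
    _ ≤ (4 * C1 * C2 * C3) ^ 2 * δ ^ 3 * (2 * (P + E * s ^ 2)) := by
        gcongr
        exact sqrt_add_mul_sq_le hP hE
    _ = _ := by ring

/-- The integral over the hyperplane of a product with a derivative of a function supported in a
slab. -/
theorem abs_integral_hyp_mul_pd_le {m ν : Pt (n + 1)} (hν : ‖ν‖ = 1) {ρ M : ℝ} (hρ : 0 < ρ)
    (hM : 0 ≤ M) {v : Pt (n + 1) → ℝ} (hv : ScaledBounds v (slab m ν ρ ρ) M ρ)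
    (hvS : tsupport v ⊆ slab m ν ρ ρ) (p : PolyD (n + 1)) (i : Fin (n + 1)) :
    |∫ x in hyp m ν, pev p x * pd i v x ∂μHE[n]|
      ≤ Real.sqrt (∫ x in Metric.ball m ρ ∩ hyp m ν, pev p x ^ 2 ∂μHE[n])
        * (M / ρ * Real.sqrt (ρ ^ n * volume.real (Metric.ball (0 : Pt n) 1))) := by
  set D := Metric.ball m ρ ∩ hyp m ν with hD
  have hDm : MeasurableSet D :=
    Metric.isOpen_ball.measurableSet.inter (isClosed_hyp m ν).measurableSet
  have hDsub : D ⊆ Metric.closedBall m ρ ∩ hyp m ν :=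
    Set.inter_subset_inter_left _ Metric.ball_subset_closedBall
  have hS : slab m ν ρ ρ ⊆ Metric.ball m ρ := slab_subset_ball hρ
  have h0 : ∀ x ∉ slab m ν ρ ρ, pd i v x = 0 := fun x hx =>
    (testJet_eq_zero fun h => hx (hvS h)).2.1 i
  have hpd : Continuous (pd i v) := (contDiff_pd hv.smooth i).continuous
  rw [setIntegral_eq_of_subset_of_forall_sdiff_eq_zero (s := D) (isClosed_hyp m ν).measurableSet
    Set.inter_subset_right fun x hx => by
      rw [h0 x fun h => hx.2 ⟨hS h, hx.1⟩, mul_zero]]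
  have hmem : ∀ g : Pt (n + 1) → ℝ, Continuous g → MemLp g 2 ((μHE[n]).restrict D) := fun g hg =>
    (memLp_two_iff_integrable_sq hg.aestronglyMeasurable).2 (integrableOn_hyp hν hDsub (hg.pow 2))
  refine (abs_integral_mul_le_sqrt (hmem _ (continuous_pev p)) (hmem _ hpd)).trans
    (mul_le_mul_of_nonneg_left ?_ (Real.sqrt_nonneg _))
  have hμ := hausdorff_finite_of_subset hν hDsub
  have hreal : (μHE[n] : Measure (Pt (n + 1))).real D
      ≤ ρ ^ n * volume.real (Metric.ball (0 : Pt n) 1) := by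
    rw [measureReal_def]
    refine ENNReal.toReal_le_of_le_ofReal (by positivity) ?_
    rw [← hausdorff_disc m ν hν hρ.le]
    exact measure_mono hDsub
  have hle : ∫ x in D, pd i v x ^ 2 ∂μHE[n]
      ≤ (M / ρ) ^ 2 * (ρ ^ n * volume.real (Metric.ball (0 : Pt n) 1)) := by
    calc ∫ x in D, pd i v x ^ 2 ∂μHE[n] ≤ ∫ _ in D, (M / ρ) ^ 2 ∂(μHE[n] : Measure (Pt (n + 1))) := by
          refine setIntegral_mono_on (integrableOn_hyp hν hDsub (hpd.pow 2))
            (integrableOn_const hμ.ne) hDm fun x _ => ?_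
          by_cases hx : x ∈ slab m ν ρ ρ
          · exact sq_le_sq' (neg_le_of_abs_le (hv.grad x hx i)) (le_of_abs_le (hv.grad x hx i))
          · rw [h0 x hx, zero_pow two_ne_zero]
            exact sq_nonneg _
      _ = (μHE[n] : Measure (Pt (n + 1))).real D * (M / ρ) ^ 2 := by
          rw [setIntegral_const, smul_eq_mul]
      _ ≤ _ := by rw [mul_comm]; gcongr
  calc Real.sqrt (∫ x in D, pd i v x ^ 2 ∂μHE[n]) ≤ Real.sqrt ((M / ρ) ^ 2 *
        (ρ ^ n * volume.real (Metric.ball (0 : Pt n) 1))) := Real.sqrt_le_sqrt hle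
    _ = _ := by rw [Real.sqrt_mul (sq_nonneg _), Real.sqrt_sq (by positivity)]

end NormalJumps



/-! ### Bounds for the third-order flux jump and for tangential derivatives -/

section ThirdOrder

variable {n : ℕ}

/-- The polynomial `α ∂p/∂n - ε² (div D²p) · n`. -/
def thirdNormal {d : ℕ} (ε α : ℝ) (ν : Pt d) (p : PolyD d) : PolyD d :=
  MvPolynomial.C α * normalDeriv ν p - MvPolynomial.C (ε ^ 2) * divHessNormal ν p

theorem pev_thirdNormal {d : ℕ} (ε α : ℝ) (ν : Pt d) (p : PolyD d) (x : Pt d) :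
    pev (thirdNormal ε α ν p) x
      = α * pev (normalDeriv ν p) x - ε ^ 2 * pev (divHessNormal ν p) x := by
  simp only [thirdNormal, pev_sub, pev_mul, pev_C]

/-- The jump of the third-order flux is tested with its own normal extension, cut off isotropically.
The normal jumps of the Hessian also enter the tested identity, and remain on the right-hand side. -/
theorem exists_third_normal_bound (n N : ℕ) : ∃ C : ℝ, 0 < C ∧
    ∀ Ω : Set (Pt (n + 1)), IsOpen Ω → IsLipschitzDomain Ω → ∀ 𝒯 : Triangulation Ω,
    ∀ ε α : ℝ, 0 < ε → (α = 0 ∨ α = 1) → ∀ f, InL2 Ω f → ∀ u, IsWeakSolution Ω ε α f u →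
    ∀ uh : Cell 𝒯 → PolyD (n + 1), (∀ T, (uh T).totalDegree ≤ N) →
    ∀ (o : Labelling 𝒯) (F : Face 𝒯) (m ν : Pt (n + 1)) (ρ : ℝ),
    FacePatch o F m ν ρ → o.minus F ≠ none →
    ∫ x in Metric.ball m ρ ∩ hyp m ν, pev (thirdNormal ε α ν (jump o uh F)) x ^ 2 ∂μHE[n]
      ≤ C * (ρ * (patchResidual o ε α f uh F
        + patchSum o (errSq ε α u uh) F * (ε / ρ ^ 2 + α / ρ) ^ 2)
        + ε ^ 4 / ρ ^ 2 * ∫ x in Metric.ball m ρ ∩ hyp m ν,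
          ∑ i, pev (hessNormal ν (jump o uh F) i) x ^ 2 ∂μHE[n]) := by
  obtain ⟨C1, hC1, h1⟩ := exists_disc_le_cut n N
  obtain ⟨C2, hC2, h2⟩ := exists_cut_normalExt_bounds n N
  obtain ⟨C3, hC3, h3⟩ := exists_jump_flux_bound n
  set W := volume.real (Metric.ball (0 : Pt n) 1)
  refine ⟨4 * (C1 * C2) ^ 2 * (C3 ^ 2 + (n + 1) ^ 2 * W) + 1, by positivity,
    fun Ω ho hL 𝒯 ε α hε hα f hf u hu uh hN o F m ν ρ hp hne => ?_⟩
  have hν := hp.norm_eq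
  have hρ := hp.pos
  have hα0 : 0 ≤ α := by rcases hα with rfl | rfl <;> norm_num
  set J := jump o uh F
  set q := thirdNormal ε α ν J with hq
  have hJN := jump_totalDegree_le o hN F
  have hqN : q.totalDegree ≤ N := (MvPolynomial.totalDegree_sub _ _).trans (max_le
    ((totalDegree_C_mul_le _ _).trans ((totalDegree_normalDeriv_le _ _).trans hJN))
    ((totalDegree_C_mul_le _ _).trans ((totalDegree_divHessNormal_le _ _).trans hJN)))
  set Y := ∫ x in Metric.ball m ρ ∩ hyp m ν, pev q x ^ 2 ∂μHE[n] with hY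
  have hY0 : 0 ≤ Y := integral_nonneg fun _ => sq_nonneg _
  have hv := h2 q hqN m ν ρ ρ hν hρ le_rfl
  set v : Pt (n + 1) → ℝ := fun x => cut m ν ρ ρ x * pev (normalExt m ν q) x with hvdef
  set M := C2 * Real.sqrt ((ρ ^ n)⁻¹ * Y) with hM
  have hM0 : 0 ≤ M := by positivity
  have hvS : tsupport v ⊆ slab m ν ρ ρ :=
    (tsupport_mul_subset_left).trans (tsupport_cut_subset hν hρ le_rfl)
  have hc : HasCompactSupport v := HasCompactSupport.of_support_subset_isCompact
    (isCompact_slab m ν ρ ρ) ((subset_tsupport v).trans hvS)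
  have b := h3 Ω ho hL 𝒯 ε α hε.le hα f hf u hu uh o F m ν ρ hp hne ρ M hρ le_rfl hM0 v hv hvS
  have hci : ∀ i, IntegrableOn (fun x => pev (hessNormal ν J i) x * pd i v x) (hyp m ν) (μHE[n]) :=
    fun i => integrableOn_hyp_of_hasCompactSupport hν
      ((continuous_pev _).mul (contDiff_pd hv.smooth i).continuous)
      (hasCompactSupport_pd hc i).mul_left
  have hcq : IntegrableOn (fun x => cut m ν ρ ρ x * pev q x ^ 2) (hyp m ν) (μHE[n]) :=
    integrableOn_hyp_of_hasCompactSupport hν ((contDiff_cut _ _ _ _).continuous.mul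
      ((continuous_pev q).pow 2)) (hasCompactSupport_cut hν hρ le_rfl).mul_right
  have hflux : ∫ x in hyp m ν, fluxDensity ε α ν J v x ∂μHE[n]
      = ε ^ 2 * (∑ i, ∫ x in hyp m ν, pev (hessNormal ν J i) x * pd i v x ∂μHE[n])
        + ∫ x in hyp m ν, cut m ν ρ ρ x * pev q x ^ 2 ∂μHE[n] := by
    rw [← integral_finsetSum _ fun i _ => hci i, ← integral_const_mul, ← integral_add
      ((integrable_finsetSum _ fun i _ => hci i).const_mul _) hcq]
    refine setIntegral_congr_fun (isClosed_hyp m ν).measurableSet fun x hx => ?_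
    change fluxDensity ε α ν J v x = ε ^ 2 * (∑ i, pev (hessNormal ν J i) x * pd i v x)
      + cut m ν ρ ρ x * pev q x ^ 2
    have hvx : v x = cut m ν ρ ρ x * pev q x := by
      rw [hvdef]
      simp only [pev_normalExt_of_mem q hx]
    rw [fluxDensity, ← pev_thirdNormal, hvx]
    ring
  set P := patchResidual o ε α f uh F
  set E := patchSum o (errSq ε α u uh) F
  have hP : 0 ≤ P := patchSum_nonneg o F fun T => integral_nonneg fun _ => sq_nonneg _
  have hE : 0 ≤ E := patchSum_nonneg o F fun T => errSq_nonneg hα0 _ _ T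
  set s := ε / ρ ^ 2 + α / ρ
  set Yh := ∫ x in Metric.ball m ρ ∩ hyp m ν, ∑ i, pev (hessNormal ν J i) x ^ 2 ∂μHE[n]
  have hDsub : Metric.ball m ρ ∩ hyp m ν ⊆ Metric.closedBall m ρ ∩ hyp m ν :=
    Set.inter_subset_inter_left _ Metric.ball_subset_closedBall
  have hYi : ∀ i, ∫ x in Metric.ball m ρ ∩ hyp m ν, pev (hessNormal ν J i) x ^ 2 ∂μHE[n] ≤ Yh :=
    fun i => setIntegral_mono (integrableOn_hyp hν hDsub ((continuous_pev _).pow 2))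
      (integrableOn_hyp hν hDsub (continuous_sum_sq_pev _)) fun x =>
        Finset.single_le_sum (f := fun i => pev (hessNormal ν J i) x ^ 2)
          (fun i _ => sq_nonneg _) (Finset.mem_univ i)
  have hYh : 0 ≤ Yh := integral_nonneg fun _ => Finset.sum_nonneg fun _ _ => sq_nonneg _
  have hsplit : Real.sqrt ((ρ ^ n)⁻¹ * Y) = Real.sqrt Y / Real.sqrt (ρ ^ n) := by
    rw [mul_comm, Real.sqrt_mul hY0, Real.sqrt_inv, div_eq_mul_inv]
  have hρn : 0 < Real.sqrt (ρ ^ n) := Real.sqrt_pos.2 (by positivity)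
  have hMV : M * Real.sqrt (ρ * ρ ^ n) = Real.sqrt Y * (C2 * Real.sqrt ρ) := by
    rw [hM, hsplit, Real.sqrt_mul hρ.le]
    field_simp
  have hMW : M / ρ * Real.sqrt (ρ ^ n * W) = Real.sqrt Y * (C2 * Real.sqrt W / ρ) := by
    rw [hM, hsplit, Real.sqrt_mul (by positivity)]
    field_simp
  have hsum : |∑ i, ∫ x in hyp m ν, pev (hessNormal ν J i) x * pd i v x ∂μHE[n]|
      ≤ (n + 1) * (Real.sqrt Yh * (Real.sqrt Y * (C2 * Real.sqrt W / ρ))) := by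
    refine (Finset.abs_sum_le_sum_abs _ _).trans ?_
    calc _ ≤ ∑ _i : Fin (n + 1), Real.sqrt Yh * (Real.sqrt Y * (C2 * Real.sqrt W / ρ)) := by
          refine Finset.sum_le_sum fun i _ => ?_
          rw [← hMW]
          refine (abs_integral_hyp_mul_pd_le hν hρ hM0 hv hvS (hessNormal ν J i) i).trans ?_
          have := Real.sqrt_le_sqrt (hYi i)
          gcongr
      _ = _ := by simp
  have key : C1⁻¹ * Y ≤ Real.sqrt Y * (C2 * C3 * Real.sqrt ρ * (Real.sqrt P + Real.sqrt E * s)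
      + ε ^ 2 * ((n + 1) * (C2 * Real.sqrt W / ρ * Real.sqrt Yh))) := by
    have e1 := h1 q hqN m ν ρ ρ hν hρ le_rfl
    have e2 := le_of_abs_le b
    rw [hflux] at e2
    have e3 := neg_le_of_abs_le hsum
    have e4 := mul_le_mul_of_nonneg_left e3 (sq_nonneg ε)
    rw [inv_mul_le_iff₀ hC1]
    refine e1.trans (mul_le_mul_of_nonneg_left ?_ hC1.le)
    have e5 : C3 * (M * Real.sqrt (ρ * ρ ^ n) * (Real.sqrt P + Real.sqrt E * s))
        = Real.sqrt Y * (C2 * C3 * Real.sqrt ρ * (Real.sqrt P + Real.sqrt E * s)) := by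
      rw [hMV]; ring
    rw [e5] at e2
    linarith
  have e3 := le_sq_of_mul_le_sqrt_mul (inv_pos.2 hC1) hY0 key
  set A := C2 * C3 * Real.sqrt ρ * (Real.sqrt P + Real.sqrt E * s) with hA
  set B := ε ^ 2 * ((n + 1) * (C2 * Real.sqrt W / ρ * Real.sqrt Yh)) with hB
  have hA2 : A ^ 2 ≤ 2 * (C2 * C3) ^ 2 * (ρ * (P + E * s ^ 2)) := by
    calc A ^ 2 = (C2 * C3) ^ 2 * Real.sqrt ρ ^ 2 * (Real.sqrt P + Real.sqrt E * s) ^ 2 := by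
          rw [hA]; ring
      _ ≤ (C2 * C3) ^ 2 * Real.sqrt ρ ^ 2 * (2 * (P + E * s ^ 2)) := by
          gcongr
          exact sqrt_add_mul_sq_le hP hE
      _ = _ := by rw [Real.sq_sqrt hρ.le]; ring
  have hB2 : B ^ 2 = C2 ^ 2 * ((n + 1) ^ 2 * W) * (ε ^ 4 / ρ ^ 2 * Yh) := by
    calc B ^ 2 = C2 ^ 2 * ((n + 1) ^ 2 * Real.sqrt W ^ 2) * (ε ^ 4 / ρ ^ 2 * Real.sqrt Yh ^ 2) := by
          rw [hB]; ring
      _ = _ := by rw [Real.sq_sqrt hYh, Real.sq_sqrt measureReal_nonneg]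
  have hX1 : 0 ≤ ρ * (P + E * s ^ 2) := by positivity
  have hX2 : 0 ≤ ε ^ 4 / ρ ^ 2 * Yh := by positivity
  have hW : 0 ≤ W := measureReal_nonneg
  calc Y ≤ ((A + B) / C1⁻¹) ^ 2 := e3
    _ = C1 ^ 2 * (A + B) ^ 2 := by field_simp
    _ ≤ C1 ^ 2 * (2 * (A ^ 2 + B ^ 2)) := by gcongr; exact add_sq_le
    _ ≤ C1 ^ 2 * (2 * (2 * (C2 * C3) ^ 2 * (ρ * (P + E * s ^ 2))
        + C2 ^ 2 * ((n + 1) ^ 2 * W) * (ε ^ 4 / ρ ^ 2 * Yh))) := by rw [hB2]; gcongr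
    _ ≤ _ := by
        generalize ρ * (P + E * s ^ 2) = X1 at *
        generalize ε ^ 4 / ρ ^ 2 * Yh = X2 at *
        have t1 : 0 ≤ (C1 * C2) ^ 2 * (((n : ℝ) + 1) ^ 2 * W) * X1 := by positivity
        have t2 : 0 ≤ (C1 * C2) ^ 2 * C3 ^ 2 * X2 := by positivity
        have t3 : 0 ≤ (C1 * C2) ^ 2 * (((n : ℝ) + 1) ^ 2 * W) * X2 := by positivity
        linarith

/-- An inverse estimate for the tangential gradient, which only depends on the values on the
hyperface and is the gradient of the normal extension. -/
theorem exists_tangGrad_bound (n N : ℕ) {θ : ℝ} (hθ : 0 < θ) : ∃ C : ℝ, 0 < C ∧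
    ∀ Ω : Set (Pt (n + 1)), ∀ 𝒯 : Triangulation Ω, ∀ (o : Labelling 𝒯) (F : Face 𝒯)
    (m ν : Pt (n + 1)), FacePatch o F m ν (θ * F.h) → ∀ g : PolyD (n + 1), g.totalDegree ≤ N →
    (θ * F.h) ^ 2 * F.integral (fun x => ∑ i, pev (tangGrad ν g i) x ^ 2)
      ≤ C * F.integral fun x => pev g x ^ 2 := by
  obtain ⟨C, hC, h⟩ := exists_normalExt_bound n N (1 / θ)
  set W := volume.real (Metric.ball (0 : Pt n) 1)
  refine ⟨(1 / θ) ^ n * W * ((n + 1) * C) + 1, by positivity, fun Ω 𝒯 o F m ν hp g hg => ?_⟩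
  have hν := hp.norm_eq
  set ρ := θ * F.h with hρdef
  have hρ : 0 < ρ := hp.pos
  have hsub := hp.subset_closedBall hθ
  rw [← hρdef] at hsub
  have hh : 0 ≤ 1 / θ * ρ := by positivity
  have hreal : (μHE[n] : Measure (Pt (n + 1))).real F.set ≤ (1 / θ * ρ) ^ n * W := by
    rw [measureReal_def]
    refine ENNReal.toReal_le_of_le_ofReal (by positivity) ?_
    rw [← hausdorff_disc m ν hν hh]
    exact measure_mono hsub
  have hμ := hausdorff_finite_of_subset hν hsub
  set I := ∫ y in Metric.ball m ρ ∩ hyp m ν, pev g y ^ 2 ∂μHE[n]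
  have hI0 : 0 ≤ I := integral_nonneg fun _ => sq_nonneg _
  have hI : I ≤ F.integral fun x => pev g x ^ 2 :=
    setIntegral_mono_set (hp.integrableOn ((continuous_pev g).pow 2))
      (Eventually.of_forall fun _ => sq_nonneg _) hp.disc_subset.eventuallyLE
  have hpt : ∀ x ∈ F.set, ρ ^ 2 * ∑ i, pev (tangGrad ν g i) x ^ 2
      ≤ (n + 1) * (C * ((ρ ^ n)⁻¹ * I)) := by
    intro x hx
    have hx' := hsub hx
    rw [Finset.mul_sum]
    calc _ ≤ ∑ _i : Fin (n + 1), C * ((ρ ^ n)⁻¹ * I) := by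
          refine Finset.sum_le_sum fun i _ => ?_
          rw [← pev_pderiv_normalExt_of_mem g hx'.2 i]
          exact (h g hg m ν ρ hν hρ x (mem_closedBall_iff_norm.1 hx'.1)).2.1 i
      _ = _ := by simp
  change ρ ^ 2 * ∫ x in F.set, ∑ i, pev (tangGrad ν g i) x ^ 2 ∂μHE[n] ≤ _
  rw [← integral_const_mul]
  calc ∫ x in F.set, ρ ^ 2 * ∑ i, pev (tangGrad ν g i) x ^ 2 ∂μHE[n]
      ≤ ∫ _ in F.set, (n + 1) * (C * ((ρ ^ n)⁻¹ * I)) ∂(μHE[n] : Measure (Pt (n + 1))) :=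
        setIntegral_mono_on ((hp.integrableOn (continuous_sum_sq_pev _)).const_mul _)
          (integrableOn_const hμ.ne) F.measurableSet hpt
    _ = (μHE[n] : Measure (Pt (n + 1))).real F.set * ((n + 1) * (C * ((ρ ^ n)⁻¹ * I))) := by
        rw [setIntegral_const, smul_eq_mul]
    _ ≤ (1 / θ * ρ) ^ n * W * ((n + 1) * (C * ((ρ ^ n)⁻¹ * I))) := by gcongr
    _ = (1 / θ) ^ n * W * ((n + 1) * C) * I := by rw [mul_pow]; field_simp
    _ ≤ (1 / θ) ^ n * W * ((n + 1) * C) * F.integral fun x => pev g x ^ 2 := by gcongr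
    _ ≤ _ := by
        have : 0 ≤ F.integral fun x => pev g x ^ 2 := hI0.trans hI
        linarith

end ThirdOrder



/-! ### The estimator contributions of interior hyperfaces -/

section InteriorFaces

/-- The powers of `ε`, `κ` and `h` in the estimate of the second-order jumps, with `t` and `N` for the
tangential and the normal part. The normal part is tested with a function of width `δ = θ ε κ`. -/
theorem second_order_weights {ε κ h θ α X t N Y P E O C₀ C₁ Ct CF C₂ : ℝ} (hε : 0 < ε) (hκ : 0 < κ)
    (hκ1 : κ ≤ 1) (hεκ : ε * κ ≤ h) (hθ : 0 < θ) (hθ1 : θ ≤ 1) (hα0 : 0 ≤ α) (hα1 : α ≤ 1)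
    (hh : 0 < h) (hP0 : 0 ≤ P) (hE : 0 ≤ E) (hO : 0 ≤ O) (hC₀ : 0 < C₀)
    (hCt : 0 < Ct) (hCF : 0 < CF) (hC₂ : 0 < C₂) (hX : ε / κ * X ≤ C₀ * E)
    (ht : (θ * h) ^ 2 * t ≤ Ct * X) (hN : N ≤ CF * Y)
    (hY : ε ^ 4 * Y ≤ C₂ * ((θ * (ε * κ)) ^ 3 * (P + E * (ε / (θ * (ε * κ)) ^ 2
      + α / (θ * (ε * κ))) ^ 2)))
    (hP : κ ^ 2 * h ^ 2 * P ≤ C₁ * (E + O)) :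
    ε ^ 3 * κ * (t + N) ≤ (Ct * C₀ / θ ^ 2 + CF * C₂ * (C₁ + 4 / θ)) * (E + O) := by
  have hEO : E ≤ E + O := by linarith
  have e1 : ε ^ 3 * κ * t ≤ Ct * C₀ / θ ^ 2 * (E + O) := by
    calc ε ^ 3 * κ * t = ε ^ 3 * κ / (θ * h) ^ 2 * ((θ * h) ^ 2 * t) := by field_simp
      _ ≤ ε ^ 3 * κ / (θ * h) ^ 2 * (Ct * X) := by gcongr
      _ = Ct / θ ^ 2 * ((ε * κ) ^ 2 / h ^ 2 * (ε / κ * X)) := by field_simp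
      _ ≤ Ct / θ ^ 2 * ((ε * κ) ^ 2 / h ^ 2 * (C₀ * E)) := by gcongr
      _ ≤ Ct / θ ^ 2 * (1 * (C₀ * (E + O))) := by
          have : (ε * κ) ^ 2 / h ^ 2 ≤ 1 := by
            rw [div_le_one (by positivity)]
            gcongr
          gcongr
      _ = _ := by ring
  set δ := θ * (ε * κ) with hδ
  have hδ0 : 0 < δ := by positivity
  have e2 : κ / ε * δ ^ 3 * P ≤ C₁ * (E + O) := by
    refine le_trans (mul_le_mul_of_nonneg_right ?_ hP0) hP
    calc κ / ε * δ ^ 3 = θ ^ 3 * κ ^ 2 * (ε * κ) ^ 2 := by rw [hδ]; field_simp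
      _ ≤ 1 * κ ^ 2 * h ^ 2 := by
          have : θ ^ 3 ≤ 1 := pow_le_one₀ hθ.le hθ1
          gcongr
      _ = _ := by ring
  have e3 : κ / ε * δ ^ 3 * (ε / δ ^ 2 + α / δ) ^ 2 ≤ 4 / θ := by
    have h1 : 1 ≤ 1 / θ := by rw [le_div_iff₀ hθ]; linarith
    calc κ / ε * δ ^ 3 * (ε / δ ^ 2 + α / δ) ^ 2
        ≤ κ / ε * δ ^ 3 * (2 * ((ε / δ ^ 2) ^ 2 + (α / δ) ^ 2)) := by gcongr; exact add_sq_le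
      _ = 2 * (1 / θ + α ^ 2 * θ * κ ^ 2) := by rw [hδ]; field_simp
      _ ≤ 2 * (1 / θ + 1 ^ 2 * 1 * 1 ^ 2) := by gcongr
      _ ≤ 4 / θ := by
          rw [show 4 / θ = 2 * (1 / θ + 1 / θ) by ring]
          linarith
  have e4 : ε ^ 3 * κ * N ≤ CF * C₂ * (C₁ + 4 / θ) * (E + O) := by
    calc ε ^ 3 * κ * N ≤ ε ^ 3 * κ * (CF * Y) := by gcongr
      _ = CF * (κ / ε * (ε ^ 4 * Y)) := by field_simp
      _ ≤ CF * (κ / ε * (C₂ * (δ ^ 3 * (P + E * (ε / δ ^ 2 + α / δ) ^ 2)))) := by gcongr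
      _ = CF * C₂ * (κ / ε * δ ^ 3 * P + κ / ε * δ ^ 3 * (ε / δ ^ 2 + α / δ) ^ 2 * E) := by ring
      _ ≤ CF * C₂ * (C₁ * (E + O) + 4 / θ * (E + O)) := by gcongr
      _ = _ := by ring
  calc ε ^ 3 * κ * (t + N) = ε ^ 3 * κ * t + ε ^ 3 * κ * N := by ring
    _ ≤ _ := add_le_add e1 e4
    _ = _ := by ring

/-- The powers of `ε`, `κ` and `h` in the estimate of the third-order jumps, which are tested with a
function of width `θ h`; the Hessian jumps `Yh` have been estimated before. -/
theorem third_order_weights {ε κ h θ α N Y Yd Yh P E O C₁ CF C₃ C₄ : ℝ} (hε : 0 < ε) (hκ : 0 < κ)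
    (hκ1 : κ ≤ 1) (hεκ : ε * κ ≤ h) (hθ : 0 < θ) (hθ1 : θ ≤ 1) (hα0 : 0 ≤ α) (hα1 : α ≤ 1)
    (hh : 0 < h) (hP0 : 0 ≤ P) (hE : 0 ≤ E) (hO : 0 ≤ O) (hC₄ : 0 < C₄)
    (hCF : 0 < CF) (hC₃ : 0 < C₃) (hN : N ≤ CF * Y) (hYd : Yd ≤ Yh)
    (hY : Y ≤ C₃ * (θ * h * (P + E * (ε / (θ * h) ^ 2 + α / (θ * h)) ^ 2)
      + ε ^ 4 / (θ * h) ^ 2 * Yd))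
    (hYh : ε ^ 3 * κ * Yh ≤ C₄ * (E + O)) (hP : κ ^ 2 * h ^ 2 * P ≤ C₁ * (E + O)) :
    κ ^ 2 * h * N ≤ CF * C₃ * (C₁ + 4 / θ ^ 3 + C₄ / θ ^ 2) * (E + O) := by
  have hEO : E ≤ E + O := by linarith
  set ρ := θ * h with hρ
  have hρ0 : 0 < ρ := by positivity
  have e1 : κ ^ 2 * h * ρ * P ≤ C₁ * (E + O) := by
    refine le_trans (mul_le_mul_of_nonneg_right ?_ hP0) hP
    calc κ ^ 2 * h * ρ = θ * (κ ^ 2 * h ^ 2) := by rw [hρ]; ring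
      _ ≤ 1 * (κ ^ 2 * h ^ 2) := by gcongr
      _ = _ := one_mul _
  have e2 : κ ^ 2 * h * ρ * (ε / ρ ^ 2 + α / ρ) ^ 2 ≤ 4 / θ ^ 3 := by
    have h1 : 1 / θ ≤ 1 / θ ^ 3 := one_div_le_one_div_of_le (by positivity)
      (pow_le_of_le_one hθ.le hθ1 (by norm_num))
    calc κ ^ 2 * h * ρ * (ε / ρ ^ 2 + α / ρ) ^ 2
        ≤ κ ^ 2 * h * ρ * (2 * ((ε / ρ ^ 2) ^ 2 + (α / ρ) ^ 2)) := by gcongr; exact add_sq_le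
      _ = 2 * ((ε * κ) ^ 2 * h / ρ ^ 3 + κ ^ 2 * α ^ 2 * (h / ρ)) := by field_simp
      _ ≤ 2 * (h ^ 2 * h / ρ ^ 3 + 1 ^ 2 * 1 ^ 2 * (h / ρ)) := by gcongr
      _ = 2 * (1 / θ ^ 3 + 1 / θ) := by rw [hρ]; field_simp
      _ ≤ 2 * (1 / θ ^ 3 + 1 / θ ^ 3) := by gcongr
      _ = _ := by ring
  have e3 : κ ^ 2 * h * (ε ^ 4 / ρ ^ 2 * Yd) ≤ C₄ / θ ^ 2 * (E + O) := by
    calc κ ^ 2 * h * (ε ^ 4 / ρ ^ 2 * Yd) ≤ κ ^ 2 * h * (ε ^ 4 / ρ ^ 2 * Yh) := by gcongr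
      _ = (ε * κ) * h / ρ ^ 2 * (ε ^ 3 * κ * Yh) := by ring
      _ ≤ (ε * κ) * h / ρ ^ 2 * (C₄ * (E + O)) := by gcongr
      _ ≤ h * h / ρ ^ 2 * (C₄ * (E + O)) := by gcongr
      _ = _ := by rw [hρ]; field_simp
  calc κ ^ 2 * h * N ≤ κ ^ 2 * h * (CF * (C₃ * (ρ * (P + E * (ε / ρ ^ 2 + α / ρ) ^ 2)
        + ε ^ 4 / ρ ^ 2 * Yd))) := by
        have := hN.trans (mul_le_mul_of_nonneg_left hY hCF.le)
        gcongr
    _ = CF * C₃ * (κ ^ 2 * h * ρ * P + κ ^ 2 * h * ρ * (ε / ρ ^ 2 + α / ρ) ^ 2 * E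
        + κ ^ 2 * h * (ε ^ 4 / ρ ^ 2 * Yd)) := by ring
    _ ≤ CF * C₃ * (C₁ * (E + O) + 4 / θ ^ 3 * (E + O) + C₄ / θ ^ 2 * (E + O)) := by gcongr
    _ = _ := by ring

theorem kappa_mono {ε h h' : ℝ} (hε : 0 < ε) (h1 : h ≤ h') : kappa ε h ≤ kappa ε h' :=
  min_le_min le_rfl (by gcongr)

variable {n : ℕ}

theorem weighted_patchResidual_le {Ω : Set (Pt (n + 1))} {𝒯 : Triangulation Ω} (o : Labelling 𝒯)
    (F : Face 𝒯) {ε α : ℝ} (hε : 0 < ε) (f : Pt (n + 1) → ℝ) (uh : Cell 𝒯 → PolyD (n + 1)) :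
    kappa ε F.h ^ 2 * F.h ^ 2 * patchResidual o ε α f uh F ≤ patchSum o (mu1Sq ε α f uh) F := by
  have hF : 0 ≤ F.h := Metric.diam_nonneg
  have hle : ∀ T : Cell 𝒯, F.1 ⊆ T.1 → kappa ε F.h ^ 2 * F.h ^ 2 *
      (∫ x in T.set, residual ε α f (uh T) x ^ 2) ≤ mu1Sq ε α f uh T := by
    intro T hT
    have h1 := Face.h_le hT
    have h2 := kappa_mono hε h1
    have h3 := kappa_nonneg hε hF
    refine mul_le_mul_of_nonneg_right (by gcongr) (integral_nonneg fun _ => sq_nonneg _)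
  unfold patchResidual patchSum
  rw [mul_add]
  refine add_le_add (hle _ (o.subset_plus F)) ?_
  rcases hm : o.minus F with _ | T
  · simp
  · exact hle T ((o.minus_iff F T).1 hm).1

theorem patchSum_add {d : ℕ} {Ω : Set (Pt d)} {𝒯 : Triangulation Ω} (o : Labelling 𝒯) (F : Face 𝒯)
    (g g' : Cell 𝒯 → ℝ) : patchSum o (fun T => g T + g' T) F = patchSum o g F + patchSum o g' F := by
  unfold patchSum
  cases o.minus F with
  | none => simp
  | some T => simp only [Option.elim]; ring

/-- The jumps across a hyperface of the second- and third-order derivatives are bounded by the error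
and the oscillation. The tangential derivatives of the gradient jump are reduced to the gradient jump
by an inverse estimate; the remaining normal jumps are tested across the hyperface. -/
theorem exists_mu23_bound (n N ℓ : ℕ) (σ D : ℝ) {θ : ℝ} (hθ : 0 < θ) (hθ1 : θ ≤ 1) :
    ∃ C : ℝ, 0 < C ∧
    ∀ Ω : Set (Pt (n + 1)), IsOpen Ω → IsLipschitzDomain Ω → ∀ 𝒯 : Triangulation Ω,
    ShapeRegular 𝒯 σ → ∀ (o : Labelling 𝒯) (F : Face 𝒯) (m ν : Pt (n + 1)),
    FacePatch o F m ν (θ * F.h) → F.h ≤ D →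
    ∀ ε α : ℝ, (ε = 1 ∧ α = 0) ∨ (0 < ε ∧ ε ≤ 1 ∧ α = 1) → ∀ f, InL2 Ω f →
    ∀ uh : Cell 𝒯 → PolyD (n + 1), (∀ T, (uh T).totalDegree ≤ N) →
    (∀ i, F.integral (pev (MvPolynomial.pderiv i (jump o uh F))) = 0) →
    ∀ u, IsWeakSolution Ω ε α f u → mu2Sq o ε uh F + mu3Sq o ε α uh F
      ≤ C * (patchSum o (errSq ε α u uh) F + patchSum o (oscSq ε f ℓ) F) := by
  obtain ⟨C₀, hC₀, h₀⟩ := exists_gradJump_bound n N D hθ hθ1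
  obtain ⟨C₁, hC₁, h₁⟩ := exists_mu1_bound n N ℓ σ
  obtain ⟨Ct, hCt, ht⟩ := exists_tangGrad_bound n N hθ
  obtain ⟨CF, hCF, hF⟩ := exists_hyp_integral_bound n N (1 / θ) (by positivity)
  obtain ⟨C₂, hC₂, h₂⟩ := exists_second_normal_bound n N
  obtain ⟨C₃, hC₃, h₃⟩ := exists_third_normal_bound n N
  set C₄ := Ct * C₀ / θ ^ 2 + CF * C₂ * (C₁ + 4 / θ) with hC₄
  have hC₄0 : 0 < C₄ := by positivity
  refine ⟨C₄ + CF * C₃ * (C₁ + 4 / θ ^ 3 + C₄ / θ ^ 2), by positivity,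
    fun Ω ho hL 𝒯 hσ o F m ν hp hD ε α hreg f hf uh hN hmean u hu => ?_⟩
  have hh : 0 < F.h := pos_of_mul_pos_right hp.pos hθ.le
  have hε : 0 < ε := by rcases hreg with h | h <;> linarith [h.1]
  have hα : α = 0 ∨ α = 1 := hreg.imp (fun h => h.2) fun h => h.2.2
  have hα0 : 0 ≤ α := by rcases hα with rfl | rfl <;> norm_num
  have hα1 : α ≤ 1 := by rcases hα with rfl | rfl <;> norm_num
  have hosc : ∀ T : Cell 𝒯, 0 ≤ oscSq ε f ℓ T := fun T =>
    mul_nonneg (by positivity) (integral_nonneg fun _ => sq_nonneg _)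
  have hE : 0 ≤ patchSum o (errSq ε α u uh) F :=
    patchSum_nonneg o F fun T => errSq_nonneg hα0 _ _ T
  have hO : 0 ≤ patchSum o (oscSq ε f ℓ) F := patchSum_nonneg o F hosc
  by_cases hne : o.minus F = none
  · rw [mu2Sq, mu3Sq, if_pos hne, if_pos hne, add_zero]
    positivity
  have hP0 : 0 ≤ patchResidual o ε α f uh F :=
    patchSum_nonneg o F fun T => integral_nonneg fun _ => sq_nonneg _
  have hκ := kappa_pos hε hh
  have hκ1 := kappa_le_one ε F.h
  have hεκ := mul_kappa_le hε F.h
  have hδρ : θ * (ε * kappa ε F.h) ≤ θ * F.h := by gcongr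
  have hJN := jump_totalDegree_le o hN F
  -- the squares do not depend on the orientation of the normal
  have hsq2 : ∀ x, ∑ i, pev (hessNormal (o.normal F) (jump o uh F) i) x ^ 2
      = ∑ i, pev (hessNormal ν (jump o uh F) i) x ^ 2 := by
    intro x
    rcases hp.normal_eq with h | h
    · rw [h]
    · rw [h]
      simp only [hessNormal_neg, pev_neg, neg_sq]
  have hsq3 : ∀ x, (α * pev (normalDeriv (o.normal F) (jump o uh F)) x
        - ε ^ 2 * pev (divHessNormal (o.normal F) (jump o uh F)) x) ^ 2
      = pev (thirdNormal ε α ν (jump o uh F)) x ^ 2 := by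
    intro x
    rw [pev_thirdNormal]
    rcases hp.normal_eq with h | h
    · rw [h]
    · rw [h]
      simp only [normalDeriv_neg, divHessNormal_neg, pev_neg]
      ring
  rw [mu2Sq, mu3Sq, if_neg hne, if_neg hne]
  simp_rw [hsq2, hsq3]
  have hfull : ∀ q : PolyD (n + 1), q.totalDegree ≤ N → F.integral (fun x => pev q x ^ 2)
      ≤ CF * ∫ x in Metric.ball m (θ * F.h) ∩ hyp m ν, pev q x ^ 2 ∂μHE[n] := fun q hq =>
    hF q hq m ν (θ * F.h) hp.norm_eq hp.pos F.set (hp.subset_closedBall hθ) F.measurableSet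
  set J := jump o uh F
  set g := normalDeriv ν J with hg
  have hgN : g.totalDegree ≤ N := (totalDegree_normalDeriv_le _ _).trans hJN
  have hP := (weighted_patchResidual_le o F hε (α := α) f uh).trans
    (patchSum_mono o F fun T => h₁ Ω ho hL 𝒯 hσ ε α hε hα f hf u hu uh hN T)
  rw [patchSum_const_mul, patchSum_add] at hP
  have hX := h₀ Ω ho hL 𝒯 o F m ν hp hD ε α hreg uh hN hmean u hu.1
  have hgX : F.integral (fun x => pev g x ^ 2) ≤ gradJumpSq o uh F := by
    rw [hp.gradJumpSq_eq uh]
    exact hp.integral_mono ((continuous_pev _).pow 2) (continuous_sum_sq_pev _)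
      fun x => sq_normalDeriv_le hp.norm_eq _ x
  have htang := (ht Ω 𝒯 o F m ν hp g hgN).trans (mul_le_mul_of_nonneg_left hgX hCt.le)
  -- the Hessian jump times the normal is the full gradient of the normal derivative of the jump
  have hYh : F.integral (fun x => ∑ i, pev (hessNormal ν J i) x ^ 2)
      = F.integral (fun x => ∑ i, pev (tangGrad ν g i) x ^ 2)
        + F.integral (fun x => pev (normalDeriv ν g) x ^ 2) := by
    have : F.integral (fun x => ∑ i, pev (tangGrad ν g i) x ^ 2 + pev (normalDeriv ν g) x ^ 2)
        = F.integral (fun x => ∑ i, pev (tangGrad ν g i) x ^ 2)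
          + F.integral (fun x => pev (normalDeriv ν g) x ^ 2) :=
      integral_add (hp.integrableOn (continuous_sum_sq_pev _))
        (hp.integrableOn ((continuous_pev _).pow 2))
    rw [← this]
    congr 1
    funext x
    rw [sum_sq_tangGrad hp.norm_eq, sub_add_cancel]
    exact Finset.sum_congr rfl fun i _ => by rw [hg, pderiv_normalDeriv]
  have hY2 := h₂ Ω ho hL 𝒯 ε α hε hα f hf u hu uh hN o F m ν _ hp hne
    (θ * (ε * kappa ε F.h)) (by positivity) hδρ
  have hY3 := h₃ Ω ho hL 𝒯 ε α hε hα f hf u hu uh hN o F m ν _ hp hne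
  have b2 := second_order_weights hε hκ hκ1 hεκ hθ hθ1 hα0 hα1 hh hP0 hE hO hC₀ hCt hCF hC₂ hX
    htang (hfull (normalDeriv ν g) ((totalDegree_normalDeriv_le _ _).trans hgN)) hY2 hP
  rw [← hYh] at b2
  have hdisc : ∫ x in Metric.ball m (θ * F.h) ∩ hyp m ν,
      ∑ i, pev (hessNormal ν J i) x ^ 2 ∂μHE[n]
      ≤ F.integral (fun x => ∑ i, pev (hessNormal ν J i) x ^ 2) :=
    setIntegral_mono_set (hp.integrableOn (continuous_sum_sq_pev _))
      (Eventually.of_forall fun _ => Finset.sum_nonneg fun _ _ => sq_nonneg _)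
      hp.disc_subset.eventuallyLE
  have hq3 : (thirdNormal ε α ν J).totalDegree ≤ N :=
    (MvPolynomial.totalDegree_sub _ _).trans (max_le
      ((totalDegree_C_mul_le _ _).trans hgN)
      ((totalDegree_C_mul_le _ _).trans ((totalDegree_divHessNormal_le _ _).trans hJN)))
  have b3 := third_order_weights hε hκ hκ1 hεκ hθ hθ1 hα0 hα1 hh hP0 hE hO hC₄0 hCF hC₃
    (hfull _ hq3) hdisc hY3 b2 hP
  calc _ ≤ _ := add_le_add b2 b3
    _ = _ := by ring

/-- All four estimates, in dimension `n + 1 ≥ 2`. -/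
theorem local_efficiency (n : ℕ) (hn : 1 ≤ n) (Ω : Set (Pt (n + 1)))
    (hΩ_open : IsOpen Ω) (hΩ_bdd : Bornology.IsBounded Ω) (hΩ_lip : IsLipschitzDomain Ω)
    (σ c : ℝ) (ℓ L : ℕ) (hℓ : 2 ≤ ℓ) :
    ∃ C : ℝ, 0 < C ∧
      ∀ 𝒯 : Triangulation Ω, ShapeRegular 𝒯 σ → ∀ o : Labelling 𝒯,
      ∀ ε α : ℝ, (ε = 1 ∧ α = 0) ∨ (0 < ε ∧ ε ≤ 1 ∧ α = 1) →
      ∀ Vh : Submodule ℝ (Cell 𝒯 → PolyD (n + 1)),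
        (∀ v ∈ Vh, ∀ T, (v T).totalDegree ≤ L) →
        WeakContinuity o c Vh → JumpConsistency o α ℓ Vh →
      ∀ f : Pt (n + 1) → ℝ, InL2 Ω f →
      ∀ u : Jet (n + 1), IsWeakSolution Ω ε α f u →
      ∀ uh : Cell 𝒯 → PolyD (n + 1), uh ∈ Vh →
        (∀ F, xiSq o ε uh F ≤ C * patchSum o (errSq ε α u uh) F) ∧
        (∀ T, mu0Sq ε α ℓ uh T ≤ C * (errSq ε α u uh T + bestApproxSq ε α ℓ u T)) ∧
        (∀ T, mu1Sq ε α f uh T ≤ C * (errSq ε α u uh T + oscSq ε f ℓ T)) ∧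
        (∀ F, mu2Sq o ε uh F + mu3Sq o ε α uh F ≤
          C * (patchSum o (errSq ε α u uh) F + patchSum o (oscSq ε f ℓ) F)) := by
  -- `exists_facePatch` shows `0 < σ` if there is a hyperface, so that the value `1` is immaterial
  set θ : ℝ := if 0 < σ then patchRatio n σ else 1 with hθdef
  have hθ : 0 < θ := by
    rw [hθdef]
    split_ifs with h
    · exact lt_min one_pos (by positivity)
    · exact one_pos
  have hθ1 : θ ≤ 1 := by
    rw [hθdef]
    split_ifs with h
    · exact min_le_left _ _
    · exact le_rfl
  set D := Metric.diam (closure Ω)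
  obtain ⟨C₁, hC₁, h₁⟩ := exists_xi_bound n L D c hθ hθ1
  obtain ⟨C₂, hC₂, h₂⟩ := exists_mu0_bound n L ℓ (by omega) σ
  obtain ⟨C₃, hC₃, h₃⟩ := exists_mu1_bound n L ℓ σ
  obtain ⟨C₄, hC₄, h₄⟩ := exists_mu23_bound n L ℓ σ D hθ hθ1
  refine ⟨C₁ + C₂ + C₃ + C₄, by positivity,
    fun 𝒯 hσ o ε α hreg Vh hdeg hweak hcons f hf u hu uh huh => ?_⟩
  have hε : 0 < ε := by rcases hreg with h | h <;> linarith [h.1]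
  have hα : α = 0 ∨ α = 1 := hreg.imp (fun h => h.2) fun h => h.2.2
  have hα0 : 0 ≤ α := by rcases hα with rfl | rfl <;> norm_num
  have hN := hdeg uh huh
  have patch : ∀ F : Face 𝒯, ∃ m ν, FacePatch o F m ν (θ * F.h) := by
    intro F
    obtain ⟨hσ0, m, ν, hp⟩ := exists_facePatch hn hΩ_open hΩ_lip hσ o F
    refine ⟨m, ν, ?_⟩
    rwa [hθdef, if_pos hσ0]
  have hdiam : ∀ F : Face 𝒯, F.h ≤ D := fun F =>
    (Face.h_le (o.subset_plus F)).trans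
      (Metric.diam_mono (o.plus F).set_subset_closure hΩ_bdd.closure)
  have hmean : ∀ (F : Face 𝒯) (i : Fin (n + 1)),
      F.integral (pev (MvPolynomial.pderiv i (jump o uh F))) = 0 := by
    intro F i
    have hG : GradJumpOrth o ℓ uh F := by
      rcases hα with h | h
      · exact (hcons.1 h uh huh F).2
      · exact (hcons.2 h uh huh).2 F
    exact hG.integral_eq_zero hℓ i
  have hosc : ∀ T : Cell 𝒯, 0 ≤ oscSq ε f ℓ T := fun T =>
    mul_nonneg (by positivity) (integral_nonneg fun _ => sq_nonneg _)
  have herr : ∀ T, 0 ≤ errSq ε α u uh T := errSq_nonneg hα0 u uh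
  have hbest : ∀ T : Cell 𝒯, 0 ≤ bestApproxSq ε α ℓ u T := fun T =>
    Real.iInf_nonneg fun p => energySq_nonneg hα0 _ _
  refine ⟨fun F => ?_, fun T => ?_, fun T => ?_, fun F => ?_⟩
  · obtain ⟨m, ν, hp⟩ := patch F
    refine (h₁ Ω hΩ_open hΩ_lip 𝒯 o F m ν hp (hdiam F) ε α hreg uh hN (hmean F)
      (hweak uh huh F) (fun h => (hcons.2 h uh huh).1) u hu.1).trans
      (mul_le_mul_of_nonneg_right (by linarith) (patchSum_nonneg o F herr))
  · exact (h₂ Ω hΩ_open hΩ_lip 𝒯 hσ ε α hα0 uh hN u hu.1 T).trans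
      (mul_le_mul_of_nonneg_right (by linarith) (add_nonneg (herr T) (hbest T)))
  · exact (h₃ Ω hΩ_open hΩ_lip 𝒯 hσ ε α hε hα f hf u hu uh hN T).trans
      (mul_le_mul_of_nonneg_right (by linarith) (add_nonneg (herr T) (hosc T)))
  · obtain ⟨m, ν, hp⟩ := patch F
    exact (h₄ Ω hΩ_open hΩ_lip 𝒯 hσ o F m ν hp (hdiam F) ε α hreg f hf uh hN (hmean F) u hu).trans
      (mul_le_mul_of_nonneg_right (by linarith)
        (add_nonneg (patchSum_nonneg o F herr) (patchSum_nonneg o F hosc)))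

end InteriorFaces


end

end BiharmonicFEM


theorem mainTheorem2 (d : ℕ) (hd : d = 2 ∨ d = 3) (Ω : Set (Pt d))
    (hΩ_open : IsOpen Ω) (hΩ_bdd : Bornology.IsBounded Ω) (hΩ_lip : IsLipschitzDomain Ω)
    (σ c : ℝ) (ℓ L : ℕ) (hℓ : 2 ≤ ℓ) :
    ∃ C : ℝ, 0 < C ∧
      ∀ 𝒯 : Triangulation Ω, ShapeRegular 𝒯 σ → ∀ o : Labelling 𝒯,
      ∀ ε α : ℝ, (ε = 1 ∧ α = 0) ∨ (0 < ε ∧ ε ≤ 1 ∧ α = 1) →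
      ∀ Vh : Submodule ℝ (Cell 𝒯 → PolyD d),
        (∀ v ∈ Vh, ∀ T, (v T).totalDegree ≤ L) →
        WeakContinuity o c Vh → JumpConsistency o α ℓ Vh →
      ∀ f : Pt d → ℝ, InL2 Ω f →
      ∀ u : Jet d, IsWeakSolution Ω ε α f u →
      ∀ uh : Cell 𝒯 → PolyD d, IsDiscreteSolution ε α f Vh uh →
        (∀ F, xiSq o ε uh F ≤ C * patchSum o (errSq ε α u uh) F) ∧
        (∀ T, mu0Sq ε α ℓ uh T ≤ C * (errSq ε α u uh T + bestApproxSq ε α ℓ u T)) ∧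
        (∀ T, mu1Sq ε α f uh T ≤ C * (errSq ε α u uh T + oscSq ε f ℓ T)) ∧
        (∀ F, mu2Sq o ε uh F + mu3Sq o ε α uh F ≤
          C * (patchSum o (errSq ε α u uh) F + patchSum o (oscSq ε f ℓ) F)) := by
  rcases hd with rfl | rfl
  · obtain ⟨C, hC, h⟩ := local_efficiency 1 (by norm_num) Ω hΩ_open hΩ_bdd hΩ_lip σ c ℓ L hℓ
    exact ⟨C, hC, fun 𝒯 hσ o ε α hreg Vh hdeg hw hc f hf u hu uh huh =>
      h 𝒯 hσ o ε α hreg Vh hdeg hw hc f hf u hu uh huh.1⟩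
  · obtain ⟨C, hC, h⟩ := local_efficiency 2 (by norm_num) Ω hΩ_open hΩ_bdd hΩ_lip σ c ℓ L hℓ
    exact ⟨C, hC, fun 𝒯 hσ o ε α hreg Vh hdeg hw hc f hf u hu uh huh =>
      h 𝒯 hσ o ε α hreg Vh hdeg hw hc f hf u hu uh huh.1⟩
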